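/- **Setting.** Let $\mathbb T$ be a rational Fermat theory: a Lawvere theory with a morphism $\mathrm{Com}_{\mathbb Q}\to\mathbb T$ from the theory of commutative $\mathbb Q$-algebras, such that for every $f\in\mathbb T[x,z_1,\dots,z_n]$ there is a unique $g\in\mathbb T[x,y,z_1,\dots,z_n]$ with $f(x,z)-f(y,z)=(x-y)g(x,y,z)$; here $\mathbb T[x_1,\dots,x_n]$ is the set of $n$-ary operations of $\mathbb T$, i.e. the free $\mathbb T$-algebra on $n$ generators. Every $\mathbb T$-algebra has an underlying commutative $\mathbb Q$-algebra, and its quotients by ideals are $\mathbb T$-algebras. A $\mathbb T$-algebra is finitely presented if it is isomorphic to a quotient of some $\mathbb T[x_1,\dots,x_n]$ by a finitely generated ideal, and a morphism is flat if the underlying ring homomorphism is. Write $\odot$ for pushouts of $\mathbb T$-algebras. Let $\mathcal E$ be a class of flat morphisms between finitely presented $\mathbb T$-algebras which contains the identities and is closed under composition, such that: 1. $\mathcal E$ is closed under pushouts along arbitrary maps of finitely presented $\mathbb T$-algebras; 2. (right cancellation) if $f$ and $g\circ f$ lie in $\mathcal E$, then so does $g$; 3. if $f\colon A\to B$ is in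 $\mathcal E$ and $i\colon B\to C$ is a map with $i\circ f\colon A\to C$ surjective, then $i$ factorises as $B\xrightarrow{j}B'\to C$ with $j$ in $\mathcal E$ and the induced map $B'\odot_AC\to C$ an isomorphism. An $\mathcal E$-morphism is a pushout, along any map of $\mathbb T$-algebras, of a morphism in $\mathcal E$. For a morphism $A\to B$ of $\mathbb T$-algebras, $(A/B)^{\mathrm{loc}_{\mathcal E}}$ is the colimit of the $\mathbb T$-algebras $C$ over the category of all factorisations $A\to C\to B$ for which $A\to C$ is an $\mathcal E$-morphism. A non-negatively graded $\mathbb T$-DGA is a chain complex $A_\bullet$ of $\mathbb Q$-vector spaces in degrees $\ge 0$ with an associative, unital, graded-commutative multiplication, for which the differential is a graded derivation, together with an enhancement of the $\mathbb Q$-algebra $A_0$ to a $\mathbb T$-algebra. Put $A_\bullet^{l\mathcal E}:=A_\bullet\otimes_{A_0}(A_0/\mathrm H_0A)^{\mathrm{loc}_{\mathcal E}}$. We write $A_\bullet\cong A_\bullet^{l\mathcal E}$ if the natural map $A_\bullet\to A_\bullet^{l\mathcal E}$ is an isomorphism. **Proposition.** (a) The category of all non-negatively graded $\mathbb T$-DGAs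 has a cofibrantly generated model structure (the standard one) in which weak equivalences are quasi-isomorphisms and fibrations are the maps surjective in strictly positive degrees. The category of those non-negatively graded $\mathbb T$-DGAs $A_\bullet$ with $A_\bullet\cong A_\bullet^{l\mathcal E}$ has a cofibrantly generated model structure (the $\mathcal E$-model structure) in which weak equivalences are quasi-isomorphisms and fibrations are the maps surjective in strictly positive degrees. The inclusion functor of the second category into the first is a right Quillen equivalence. (b) Every $\mathbb T$-algebra $B$, regarded as a $\mathbb T$-DGA concentrated in degree $0$, satisfies $B\cong B^{l\mathcal E}$, and every transfinite composition of $\mathcal E$-morphisms of $\mathbb T$-algebras is a cofibration in the $\mathcal E$-model structure. Every $\mathbb T$-algebra $B$ admitting, for some $n\ge 0$, an $\mathrm{ind}(\mathcal E)$-morphism $\mathbb T[x_1,\dots,x_n]\to B$ (that is, such that $B$ is a filtered colimit of $\mathbb T$-algebras $B_i$ under $\mathbb T[x_1,\dots,x_n]$ with each $\mathbb T[x_1,\dots,x_n]\to B_i$ an $\mathcal E$-morphism) is cofibrant in the $\mathcal E$-model structure. -/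

import Mathlib

open CategoryTheory Limits HomotopicalAlgebra MvPolynomial

universe u

noncomputable section

namespace FermatDG

/-! ### Lawvere theories and their algebras -/

/-- A Lawvere theory, presented by its sets `Op n = Hom(𝔸ⁿ, 𝔸¹)` of `n`-ary operations, the
coordinate projections `𝔸ⁿ ⟶ 𝔸¹`, and composition.  (As `𝔸ᵐ` is an `m`-fold product,
`Hom(𝔸ⁿ, 𝔸ᵐ) = Fin m → Op n`.) -/
structure LawvereTheory where
  /-- the operations `𝔸ⁿ ⟶ 𝔸¹` -/
  Op : ℕ → Type u
  /-- the coordinate projections -/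
  var : ∀ {n : ℕ}, Fin n → Op n
  /-- the composite `𝔸ⁿ ⟶ 𝔸ᵐ ⟶ 𝔸¹` -/
  comp : ∀ {m n : ℕ}, Op m → (Fin m → Op n) → Op n
  comp_var : ∀ {n : ℕ} (f : Op n), comp f var = f
  var_comp : ∀ {m n : ℕ} (i : Fin m) (g : Fin m → Op n), comp (var i) g = g i
  comp_assoc : ∀ {l m n : ℕ} (f : Op l) (g : Fin l → Op m) (h : Fin m → Op n),
    comp (comp f g) h = comp f (fun i => comp (g i) h)

/-- Morphisms of Lawvere theories. -/
structure LawvereTheory.Hom (L : LawvereTheory) (M : LawvereTheory.{u}) where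
  /-- the action on operations -/
  map : ∀ {n : ℕ}, L.Op n → M.Op n
  map_var : ∀ {n : ℕ} (i : Fin n), map (L.var i) = M.var i
  map_comp : ∀ {m n : ℕ} (f : L.Op m) (g : Fin m → L.Op n),
    map (L.comp f g) = M.comp (map f) (fun i => map (g i))

/-- The theory of commutative `ℚ`-algebras: polynomials over `ℚ` with substitution. -/
def comQ : LawvereTheory.{0} where
  Op n := MvPolynomial (Fin n) ℚ
  var i := X i
  comp f g := bind₁ g f
  comp_var f := aeval_X_left_apply f
  var_comp i g := by simp
  comp_assoc f g h := by rw [bind₁_bind₁]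

/-- The structure of an algebra over a Lawvere theory on a set `α`, i.e. a product-preserving
functor with `𝔸¹ ↦ α`. -/
structure AlgStr (L : LawvereTheory.{u}) (α : Type u) where
  /-- the action `Φ_f : αⁿ → α` of an operation -/
  op : ∀ {n : ℕ}, L.Op n → (Fin n → α) → α
  op_var : ∀ {n : ℕ} (i : Fin n) (a : Fin n → α), op (L.var i) a = a i
  op_comp : ∀ {m n : ℕ} (f : L.Op m) (g : Fin m → L.Op n) (a : Fin n → α),
    op (L.comp f g) a = op f (fun i => op (g i) a)

/-- A Lawvere theory equipped with a morphism from the theory of commutative `ℚ`-algebras. -/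
structure QTheory extends LawvereTheory.{u} where
  /-- the structure morphism from the theory of commutative `ℚ`-algebras -/
  fromComQ : LawvereTheory.Hom comQ toLawvereTheory

variable {T : QTheory.{u}}

/-- The operation given by a polynomial over `ℚ`. -/
def QTheory.poly (T : QTheory.{u}) {n : ℕ} (p : MvPolynomial (Fin n) ℚ) : T.Op n :=
  T.fromComQ.map (n := n) p

/-- Algebras over `T`. -/
structure TAlg (T : QTheory.{u}) where
  /-- the underlying set -/
  carrier : Type u
  /-- the operations -/
  str : AlgStr T.toLawvereTheory carrier

namespace TAlg

instance : CoeSort (TAlg T) (Type u) := ⟨TAlg.carrier⟩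

/-- The action of an operation on an algebra. -/
def op (A : TAlg T) {n : ℕ} (f : T.Op n) (a : Fin n → A) : A := A.str.op f a

lemma op_comp (A : TAlg T) {m n : ℕ} (f : T.Op m) (g : Fin m → T.Op n) (a : Fin n → A) :
    A.op (T.comp f g) a = A.op f (fun i => A.op (g i) a) := A.str.op_comp f g a

lemma op_var (A : TAlg T) {n : ℕ} (i : Fin n) (a : Fin n → A) :
    A.op (T.var i) a = a i := A.str.op_var i a

/-- Homomorphisms of `T`-algebras. -/
@[ext]
structure Hom (A B : TAlg T) where
  /-- the underlying map -/
  toFun : A → B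
  map_op : ∀ {n : ℕ} (f : T.Op n) (a : Fin n → A),
    toFun (A.op f a) = B.op f (fun i => toFun (a i))

instance : Category (TAlg T) where
  Hom := Hom
  id A := ⟨id, fun _ _ => rfl⟩
  comp f g := ⟨g.toFun ∘ f.toFun, fun h a => by simp [f.map_op, g.map_op]⟩

/-- The value of a polynomial over `ℚ` on elements of an algebra. -/
def ev (A : TAlg T) {n : ℕ} (p : MvPolynomial (Fin n) ℚ) (v : Fin n → A) : A :=
  A.op (T.poly p) v

lemma ev_X (A : TAlg T) {n : ℕ} (i : Fin n) (v : Fin n → A) : A.ev (X i) v = v i := by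
  have : T.poly (X i : MvPolynomial (Fin n) ℚ) = T.var i := T.fromComQ.map_var i
  rw [ev, this, op_var]

lemma ev_bind (A : TAlg T) {m n : ℕ} (p : MvPolynomial (Fin m) ℚ)
    (g : Fin m → MvPolynomial (Fin n) ℚ) (v : Fin n → A) :
    A.ev (bind₁ g p) v = A.ev p (fun i => A.ev (g i) v) := by
  have : T.poly (bind₁ g p) = T.comp (T.poly p) (fun i => T.poly (g i)) :=
    T.fromComQ.map_comp (m := m) (n := n) p g
  rw [ev, this, op_comp]
  rfl

/-! The commutative ring underlying an algebra. -/

instance (A : TAlg T) : Add A := ⟨fun a b => A.ev (X 0 + X 1) ![a, b]⟩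
instance (A : TAlg T) : Mul A := ⟨fun a b => A.ev (X 0 * X 1) ![a, b]⟩
instance (A : TAlg T) : Neg A := ⟨fun a => A.ev (-X 0) ![a]⟩
instance (A : TAlg T) : Zero A := ⟨A.ev (0 : MvPolynomial (Fin 0) ℚ) ![]⟩
instance (A : TAlg T) : One A := ⟨A.ev (1 : MvPolynomial (Fin 0) ℚ) ![]⟩

lemma add_def (A : TAlg T) (a b : A) : a + b = A.ev (X 0 + X 1) ![a, b] := rfl
lemma mul_def (A : TAlg T) (a b : A) : a * b = A.ev (X 0 * X 1) ![a, b] := rfl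
lemma neg_def (A : TAlg T) (a : A) : -a = A.ev (-X 0) ![a] := rfl
lemma zero_def (A : TAlg T) : (0 : A) = A.ev (0 : MvPolynomial (Fin 0) ℚ) ![] := rfl
lemma one_def (A : TAlg T) : (1 : A) = A.ev (1 : MvPolynomial (Fin 0) ℚ) ![] := rfl

lemma ev_const (A : TAlg T) {n : ℕ} (q : ℚ) (v : Fin n → A) :
    A.ev (C q) v = A.ev (C q : MvPolynomial (Fin 0) ℚ) ![] := by
  have := A.ev_bind (C q : MvPolynomial (Fin 0) ℚ) (n := n) Fin.elim0 v
  rw [algHom_C] at this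
  rw [show (C q : MvPolynomial (Fin n) ℚ) = algebraMap _ _ q from rfl, this]
  congr 1
  funext i
  exact i.elim0

lemma ev_pair (A : TAlg T) {n : ℕ} (P : MvPolynomial (Fin 2) ℚ) (p q : MvPolynomial (Fin n) ℚ)
    (v : Fin n → A) : A.ev P ![A.ev p v, A.ev q v] = A.ev (bind₁ ![p, q] P) v := by
  rw [ev_bind]
  congr 1
  funext i
  fin_cases i <;> rfl

lemma ev_add (A : TAlg T) {n : ℕ} (p q : MvPolynomial (Fin n) ℚ) (v : Fin n → A) :
    A.ev (p + q) v = A.ev p v + A.ev q v := by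
  rw [add_def, ev_pair]; simp

lemma ev_mul (A : TAlg T) {n : ℕ} (p q : MvPolynomial (Fin n) ℚ) (v : Fin n → A) :
    A.ev (p * q) v = A.ev p v * A.ev q v := by
  rw [mul_def, ev_pair]; simp

lemma ev_neg (A : TAlg T) {n : ℕ} (p : MvPolynomial (Fin n) ℚ) (v : Fin n → A) :
    A.ev (-p) v = -A.ev p v := by
  have h : (![A.ev p v] : Fin 1 → A) = fun i => A.ev (![p] i) v := by
    funext i; fin_cases i; rfl
  rw [neg_def, h, ← ev_bind]; simp

lemma ev_zero (A : TAlg T) {n : ℕ} (v : Fin n → A) :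
    A.ev (0 : MvPolynomial (Fin n) ℚ) v = 0 := by
  have := A.ev_const 0 v
  rwa [C_0, C_0] at this

lemma ev_one (A : TAlg T) {n : ℕ} (v : Fin n → A) :
    A.ev (1 : MvPolynomial (Fin n) ℚ) v = 1 := by
  have := A.ev_const 1 v
  rwa [C_1, C_1] at this

lemma exists_ev (A : TAlg T) (a b c : A) : ∃ (v : Fin 3 → A) (p q r : MvPolynomial (Fin 3) ℚ),
    A.ev p v = a ∧ A.ev q v = b ∧ A.ev r v = c :=
  ⟨![a, b, c], X 0, X 1, X 2, A.ev_X _ _, A.ev_X _ _, A.ev_X _ _⟩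

instance (A : TAlg T) : CommRing A where
  add_assoc a b c := by
    obtain ⟨v, p, q, r, rfl, rfl, rfl⟩ := A.exists_ev a b c
    simp only [← ev_add, add_assoc]
  zero_add a := by
    obtain ⟨v, p, -, -, rfl, -, -⟩ := A.exists_ev a a a
    rw [← A.ev_zero v, ← ev_add, zero_add]
  add_zero a := by
    obtain ⟨v, p, -, -, rfl, -, -⟩ := A.exists_ev a a a
    rw [← A.ev_zero v, ← ev_add, add_zero]
  add_comm a b := by
    obtain ⟨v, p, q, -, rfl, rfl, -⟩ := A.exists_ev a b b
    simp only [← ev_add, add_comm]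
  neg_add_cancel a := by
    obtain ⟨v, p, -, -, rfl, -, -⟩ := A.exists_ev a a a
    rw [← A.ev_neg, ← ev_add, neg_add_cancel, ev_zero]
  mul_assoc a b c := by
    obtain ⟨v, p, q, r, rfl, rfl, rfl⟩ := A.exists_ev a b c
    simp only [← ev_mul, mul_assoc]
  one_mul a := by
    obtain ⟨v, p, -, -, rfl, -, -⟩ := A.exists_ev a a a
    rw [← A.ev_one v, ← ev_mul, one_mul]
  mul_one a := by
    obtain ⟨v, p, -, -, rfl, -, -⟩ := A.exists_ev a a a
    rw [← A.ev_one v, ← ev_mul, mul_one]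
  mul_comm a b := by
    obtain ⟨v, p, q, -, rfl, rfl, -⟩ := A.exists_ev a b b
    simp only [← ev_mul, mul_comm]
  zero_mul a := by
    obtain ⟨v, p, -, -, rfl, -, -⟩ := A.exists_ev a a a
    rw [← A.ev_zero v, ← ev_mul, zero_mul]
  mul_zero a := by
    obtain ⟨v, p, -, -, rfl, -, -⟩ := A.exists_ev a a a
    rw [← A.ev_zero v, ← ev_mul, mul_zero]
  left_distrib a b c := by
    obtain ⟨v, p, q, r, rfl, rfl, rfl⟩ := A.exists_ev a b c
    simp only [← ev_mul, ← ev_add, mul_add]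
  right_distrib a b c := by
    obtain ⟨v, p, q, r, rfl, rfl, rfl⟩ := A.exists_ev a b c
    simp only [← ev_mul, ← ev_add, add_mul]
  nsmul := nsmulRec
  zsmul := zsmulRec

instance (A : TAlg T) : Algebra ℚ A :=
  RingHom.toAlgebra
    { toFun := fun q => A.ev (C q : MvPolynomial (Fin 0) ℚ) ![]
      map_one' := by rw [C_1, ev_one]
      map_zero' := by rw [C_0, ev_zero]
      map_mul' := fun p q => by rw [C_mul, ev_mul]
      map_add' := fun p q => by rw [C_add, ev_add] }

lemma ev_C_mul_X (A : TAlg T) (q : ℚ) (a : A) :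
    A.ev (C q * X 0 : MvPolynomial (Fin 1) ℚ) ![a] = q • a := by
  rw [ev_mul, ev_const, ev_X, Algebra.smul_def]
  rfl

lemma Hom.map_ev {A B : TAlg T} (φ : Hom A B) {n : ℕ} (p : MvPolynomial (Fin n) ℚ)
    (v : Fin n → A) : φ.toFun (A.ev p v) = B.ev p (fun i => φ.toFun (v i)) := φ.map_op _ _

/-- The ring homomorphism underlying a homomorphism of `T`-algebras. -/
def toRingHom {A B : TAlg T} (φ : A ⟶ B) : A →+* B where
  toFun := Hom.toFun φ
  map_one' := by
    rw [← A.ev_one ![], Hom.map_ev, ev_one]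
  map_zero' := by
    rw [← A.ev_zero ![], Hom.map_ev, ev_zero]
  map_mul' a b := by
    rw [mul_def, Hom.map_ev, ev_mul, ev_X, ev_X]; rfl
  map_add' a b := by
    rw [add_def, Hom.map_ev, ev_add, ev_X, ev_X]; rfl

/-- A morphism of `T`-algebras is flat if the underlying ring homomorphism is so. -/
def IsFlat {A B : TAlg T} (φ : A ⟶ B) : Prop := (toRingHom φ).Flat

end TAlg

/-- The free `T`-algebra `T[x₁, …, xₙ]`. -/
def QTheory.free (T : QTheory.{u}) (n : ℕ) : TAlg T where
  carrier := T.Op n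
  str :=
    { op := fun f a => T.comp f a
      op_var := fun i a => T.var_comp i a
      op_comp := fun f g a => T.comp_assoc f g a }

/-- The generators of `T[x₁, …, xₙ]`. -/
def QTheory.gen (T : QTheory.{u}) {n : ℕ} (i : Fin n) : T.free n := T.var i

/-- The condition for `T` to be a (rational) Fermat theory: for every `f(x, z₁, …, zₙ)` there is
a unique `g(x, y, z₁, …, zₙ)` with `f(x, z) - f(y, z) = (x - y) g(x, y, z)`. -/
class QTheory.IsFermat (T : QTheory.{u}) : Prop where
  existsUnique : ∀ (n : ℕ) (f : T.Op (n + 1)), ∃! g : T.free (n + 2),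
    (T.free (n + 2)).op f (Fin.cons (T.gen 0) fun i => T.gen i.succ.succ)
      - (T.free (n + 2)).op f (Fin.cons (T.gen 1) fun i => T.gen i.succ.succ)
      = (T.gen 0 - T.gen 1) * g

namespace TAlg

/-- The homomorphism out of a free algebra given by the images of the generators. -/
def freeDesc (A : TAlg T) {n : ℕ} (v : Fin n → A) : T.free n ⟶ A :=
  ⟨fun f => A.op f v, fun f a => A.op_comp f a v⟩

lemma op_update_sub_mem [T.IsFermat] (A : TAlg T) (I : Ideal A) {n : ℕ} (f : T.Op n)
    (a : Fin n → A) (i : Fin n) (x y : A) (h : x - y ∈ I) :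
    A.op f (Function.update a i x) - A.op f (Function.update a i y) ∈ I := by
  let σ : Fin n → T.Op (n + 1) := fun j => if j = i then T.var 0 else T.var j.succ
  have key : ∀ z : A, A.op (T.comp f σ) (Fin.cons z a) = A.op f (Function.update a i z) := by
    intro z
    rw [op_comp]
    congr 1
    funext j
    by_cases hj : j = i
    · subst hj; simp [σ, op_var]
    · simp [σ, op_var, hj]
  obtain ⟨g, hg, -⟩ := QTheory.IsFermat.existsUnique n (T.comp f σ)
  have e := congrArg (toRingHom (A.freeDesc (Fin.cons x (Fin.cons y a) : Fin (n + 2) → A))) hg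
  rw [map_sub, map_mul, map_sub] at e
  have h0 : ∀ k : Fin (n + 2), toRingHom (A.freeDesc (Fin.cons x (Fin.cons y a))) (T.gen k) =
      (Fin.cons x (Fin.cons y a) : Fin (n + 2) → A) k := fun k => A.op_var k _
  have h1 : ∀ w : Fin (n + 1) → T.free (n + 2),
      toRingHom (A.freeDesc (Fin.cons x (Fin.cons y a))) ((T.free (n + 2)).op (T.comp f σ) w) =
        A.op (T.comp f σ)
          (fun k => toRingHom (A.freeDesc (Fin.cons x (Fin.cons y a))) (w k)) :=
    fun w => Hom.map_op (A.freeDesc (Fin.cons x (Fin.cons y a))) _ w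
  have h2 : ∀ k : Fin (n + 2), (fun j : Fin (n + 1) =>
      toRingHom (A.freeDesc (Fin.cons x (Fin.cons y a)))
        ((Fin.cons (T.gen k) fun i => T.gen i.succ.succ : Fin (n + 1) → T.free (n + 2)) j)) =
      Fin.cons ((Fin.cons x (Fin.cons y a) : Fin (n + 2) → A) k) a := by
    intro k
    funext j
    refine Fin.cases ?_ (fun j => ?_) j
    · simp [h0]
    · simp [h0]
  rw [h1, h1, h2, h2, h0, h0] at e
  have e0 : (Fin.cons x (Fin.cons y a) : Fin (n + 2) → A) 0 = x := rfl
  have e1 : (Fin.cons x (Fin.cons y a) : Fin (n + 2) → A) 1 = y := rfl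
  rw [e0, e1, key, key] at e
  rw [e]
  exact I.mul_mem_right _ h

lemma op_sub_mem [T.IsFermat] (A : TAlg T) (I : Ideal A) {n : ℕ} (f : T.Op n)
    (a b : Fin n → A) (h : ∀ i, a i - b i ∈ I) : A.op f a - A.op f b ∈ I := by
  suffices H : ∀ (s : Finset (Fin n)) (a : Fin n → A), (∀ i, a i - b i ∈ I) →
      (∀ i, i ∉ s → a i = b i) → A.op f a - A.op f b ∈ I from
    H Finset.univ a h (fun i hi => absurd (Finset.mem_univ i) hi)
  intro s
  induction s using Finset.induction_on with
  | empty =>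
    intro a _ h'
    rw [show a = b from funext fun i => h' i (Finset.notMem_empty i), sub_self]
    exact I.zero_mem
  | insert i s _ ih =>
    intro a ha h'
    have h1 := A.op_update_sub_mem I f a i (a i) (b i) (ha i)
    rw [Function.update_eq_self] at h1
    have h2 := ih (Function.update a i (b i)) (fun j => by
      by_cases hj : j = i
      · subst hj; simp
      · simpa [hj] using ha j) (fun j hj => by
      by_cases hji : j = i
      · subst hji; simp
      · simpa [hji] using h' j (by simp [hji, hj]))
    simpa using I.add_mem h1 h2

/-- The quotient of a `T`-algebra by an ideal of the underlying ring. -/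
def quot [T.IsFermat] (A : TAlg T) (I : Ideal A) : TAlg T where
  carrier := A ⧸ I
  str :=
    { op := fun f a => Ideal.Quotient.mk I (A.op f fun i => (a i).out)
      op_var := fun i _ => by rw [op_var]; exact Quotient.out_eq' _
      op_comp := fun f g a => by
        rw [op_comp]
        refine Ideal.Quotient.eq.2 (A.op_sub_mem I f _ _ fun i => Ideal.Quotient.eq.1 ?_)
        exact (Quotient.out_eq' _).symm }

/-- The quotient map. -/
def quotMk [T.IsFermat] (A : TAlg T) (I : Ideal A) : A ⟶ A.quot I :=
  ⟨fun a => Ideal.Quotient.mk I a, fun f _ =>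
    Ideal.Quotient.eq.2 (A.op_sub_mem I f _ _ fun _ => Ideal.Quotient.eq.1
      (Quotient.out_eq' _).symm)⟩

/-- Finitely presented `T`-algebras: the quotients of some `T[x₁, …, xₙ]` by a finitely generated
ideal. -/
def IsFP [T.IsFermat] (A : TAlg T) : Prop :=
  ∃ (n : ℕ) (I : Ideal (T.free n)), I.FG ∧ Nonempty (A ≅ (T.free n).quot I)

end TAlg

/-! ### Differential graded algebras -/

/-- Non-negatively graded `T`-DGAs: a chain complex of `ℚ`-vector spaces in non-negative degrees,
with an associative unital graded-commutative multiplication for which the differential is a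
graded derivation, and with an enhancement of the `ℚ`-algebra structure on the degree `0` part
(which is the kernel of the differential out of degree `0`) to a `T`-algebra structure. -/
structure TDGA (T : QTheory.{u}) where
  /-- the underlying chain complex -/
  cx : ChainComplex (ModuleCat.{u} ℚ) ℕ
  /-- the product of elements of degrees `i` and `j` -/
  mul : ∀ {i j k : ℕ}, i + j = k → cx.X i → cx.X j → cx.X k
  /-- the unit -/
  one : cx.X 0
  mul_add : ∀ {i j k : ℕ} (h : i + j = k) (a : cx.X i) (b c : cx.X j),
    mul h a (b + c) = mul h a b + mul h a c
  add_mul : ∀ {i j k : ℕ} (h : i + j = k) (a b : cx.X i) (c : cx.X j),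
    mul h (a + b) c = mul h a c + mul h b c
  one_mul : ∀ {n : ℕ} (a : cx.X n), mul (zero_add n) one a = a
  mul_assoc : ∀ {i j k ij jk n : ℕ} (hij : i + j = ij) (hjk : j + k = jk) (h : ij + k = n)
    (h' : i + jk = n) (a : cx.X i) (b : cx.X j) (c : cx.X k),
    mul h (mul hij a b) c = mul h' a (mul hjk b c)
  mul_comm : ∀ {i j n : ℕ} (h : i + j = n) (h' : j + i = n) (a : cx.X i) (b : cx.X j),
    mul h a b = (-1 : ℚ) ^ (i * j) • mul h' b a
  leibniz : ∀ {i j n : ℕ} (h : i + 1 + (j + 1) = n + 1) (h₁ : i + (j + 1) = n)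
    (h₂ : i + 1 + j = n) (a : cx.X (i + 1)) (b : cx.X (j + 1)),
    cx.d (n + 1) n (mul h a b) =
      mul h₁ (cx.d (i + 1) i a) b + (-1 : ℚ) ^ (i + 1) • mul h₂ a (cx.d (j + 1) j b)
  leibniz_zero_left : ∀ {j : ℕ} (a : cx.X 0) (b : cx.X (j + 1)),
    cx.d (j + 1) j (mul (zero_add _) a b) = mul (zero_add _) a (cx.d (j + 1) j b)
  leibniz_zero_right : ∀ {i : ℕ} (a : cx.X (i + 1)) (b : cx.X 0),
    cx.d (i + 1) i (mul (add_zero _) a b) = mul (add_zero _) (cx.d (i + 1) i a) b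
  /-- the `T`-algebra structure in degree `0` -/
  str : AlgStr T.toLawvereTheory (cx.X 0)
  str_add : ∀ a b : cx.X 0, str.op (T.poly (X 0 + X 1)) ![a, b] = a + b
  str_mul : ∀ a b : cx.X 0, str.op (T.poly (X 0 * X 1)) ![a, b] = mul (zero_add 0) a b
  str_one : str.op (T.poly (1 : MvPolynomial (Fin 0) ℚ)) ![] = one
  str_smul : ∀ (q : ℚ) (a : cx.X 0), str.op (T.poly (C q * X 0)) ![a] = q • a

namespace TDGA

/-- Morphisms of `T`-DGAs: multiplicative chain maps which are `T`-algebra homomorphisms in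
degree `0`. -/
@[ext]
structure Hom (A B : TDGA T) where
  /-- the underlying chain map -/
  chain : A.cx ⟶ B.cx
  map_mul : ∀ {i j k : ℕ} (h : i + j = k) (a : A.cx.X i) (b : A.cx.X j),
    chain.f k (A.mul h a b) = B.mul h (chain.f i a) (chain.f j b)
  map_op : ∀ {n : ℕ} (f : T.Op n) (a : Fin n → A.cx.X 0),
    chain.f 0 (A.str.op f a) = B.str.op f (fun i => chain.f 0 (a i))

instance : Category (TDGA T) where
  Hom := Hom
  id A := ⟨𝟙 _, fun _ _ _ => rfl, fun _ _ => rfl⟩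
  comp f g := ⟨f.chain ≫ g.chain, fun h a b => by simp [f.map_mul, g.map_mul],
    fun h a => by simp [f.map_op, g.map_op]⟩

variable (A : TDGA T)

/-- The degree `n` part. -/
abbrev deg (n : ℕ) : Type u := A.cx.X n

/-- The degree `0` part, as a `T`-algebra. -/
def alg0 : TAlg T := ⟨A.deg 0, A.str⟩

lemma alg0_add (a b : A.deg 0) : (show A.alg0 from a) + (show A.alg0 from b) = a + b :=
  A.str_add a b

lemma alg0_mul (a b : A.deg 0) :
    (show A.alg0 from a) * (show A.alg0 from b) = A.mul (zero_add 0) a b := A.str_mul a b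

lemma alg0_one : (1 : A.alg0) = A.one := A.str_one

lemma mul_zero {i j k : ℕ} (h : i + j = k) (a : A.deg i) : A.mul h a 0 = 0 := by
  have := A.mul_add h a 0 0
  simpa using this

lemma zero_mul {i j k : ℕ} (h : i + j = k) (a : A.deg j) : A.mul h 0 a = 0 := by
  have := A.add_mul h 0 0 a
  simpa using this

lemma alg0_zero : (0 : A.alg0) = (0 : A.deg 0) := by
  have h := A.alg0_add 0 (0 : A.alg0)
  have h' : (show A.alg0 from (0 : A.deg 0)) + (0 : A.alg0) = (0 : A.deg 0) := add_zero _
  rw [h'] at h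
  have h2 : (0 : A.deg 0) = (0 : A.deg 0) + (show A.deg 0 from (0 : A.alg0)) := h
  rw [_root_.zero_add] at h2
  exact h2.symm

lemma smul_mul_left {i j k : ℕ} (h : i + j = k) (q : ℚ) (a : A.deg i) (b : A.deg j) :
    A.mul h (q • a) b = q • A.mul h a b :=
  map_rat_smul (AddMonoidHom.mk' (fun a => A.mul h a b) fun x y => A.add_mul h x y b) q a

lemma smul_mul_right {i j k : ℕ} (h : i + j = k) (q : ℚ) (a : A.deg i) (b : A.deg j) :
    A.mul h a (q • b) = q • A.mul h a b :=
  map_rat_smul (AddMonoidHom.mk' (fun b => A.mul h a b) fun x y => A.mul_add h a x y) q b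

/-- The boundaries in degree `0`, as an ideal. -/
def bdry : Ideal A.alg0 where
  carrier := {a | ∃ b : A.deg 1, A.cx.d 1 0 b = a}
  add_mem' := by
    rintro _ _ ⟨a, rfl⟩ ⟨b, rfl⟩
    exact ⟨a + b, by rw [map_add]; exact (A.alg0_add _ _).symm⟩
  zero_mem' := ⟨0, by rw [map_zero]; exact A.alg0_zero.symm⟩
  smul_mem' := by
    rintro c _ ⟨a, rfl⟩
    exact ⟨A.mul (zero_add 1) c a, (A.leibniz_zero_left _ _).trans (A.alg0_mul _ _).symm⟩

/-- The `T`-algebra `H₀A`. -/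
def H0 [T.IsFermat] : TAlg T := A.alg0.quot A.bdry

/-- The quotient map `A₀ ⟶ H₀A`. -/
def toH0 [T.IsFermat] : A.alg0 ⟶ A.H0 := A.alg0.quotMk A.bdry

/-! ### Base change along a morphism out of the degree `0` part -/

instance (n : ℕ) : Module A.alg0 (A.deg n) where
  smul r x := A.mul (zero_add n) r x
  one_smul x := by
    change A.mul (zero_add n) (1 : A.alg0) x = x
    rw [alg0_one]; exact A.one_mul x
  mul_smul r s x :=
    (congrArg (fun z => A.mul (zero_add n) z x) (A.alg0_mul r s)).trans
      (A.mul_assoc (zero_add 0) (zero_add n) (zero_add n) (zero_add n) r s x)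
  smul_zero r := A.mul_zero _ r
  smul_add r x y := A.mul_add _ r x y
  add_smul r s x :=
    (congrArg (fun z => A.mul (zero_add n) z x) (A.alg0_add r s)).trans (A.add_mul _ r s x)
  zero_smul x := by
    change A.mul (zero_add n) (0 : A.alg0) x = 0
    rw [alg0_zero, A.zero_mul]

lemma smul_def {n : ℕ} (r : A.alg0) (x : A.deg n) : r • x = A.mul (zero_add n) r x := rfl

instance (n : ℕ) : SMulCommClass A.alg0 ℚ (A.deg n) where
  smul_comm r q x := A.smul_mul_right _ q r x

/-- The differential, as an `A₀`-linear map. -/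
def dLin (i j : ℕ) : A.deg i →ₗ[A.alg0] A.deg j where
  toFun x := A.cx.d i j x
  map_add' := map_add _
  map_smul' r x := by
    by_cases h : j + 1 = i
    · subst h
      exact A.leibniz_zero_left r x
    · rw [A.cx.shape i j h]
      simp

lemma mul_left_comm0 {i j k : ℕ} (h : i + j = k) (r : A.deg 0) (a : A.deg i) (b : A.deg j) :
    A.mul h a (A.mul (zero_add j) r b) = A.mul (zero_add k) r (A.mul h a b) := by
  rw [← A.mul_assoc (add_zero i) (zero_add j) h h,
    A.mul_comm (add_zero i) (zero_add i) a r,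
    ← A.mul_assoc (zero_add i) h h (zero_add k)]
  simp

/-- The multiplication, as an `A₀`-bilinear map. -/
def mulLin {i j k : ℕ} (h : i + j = k) : A.deg i →ₗ[A.alg0] A.deg j →ₗ[A.alg0] A.deg k :=
  LinearMap.mk₂ A.alg0 (A.mul h) (A.add_mul h)
    (fun r a b => A.mul_assoc (zero_add i) h h (zero_add k) r a b)
    (A.mul_add h) (fun r a b => A.mul_left_comm0 h r a b)

variable {A} {L : TAlg T}

/-- The ring underlying `L`, regarded as an `A₀`-algebra through `φ : A₀ ⟶ L`. -/
def Along (_ : A.alg0 ⟶ L) : Type u := L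

instance (φ : A.alg0 ⟶ L) : CommRing (Along φ) := inferInstanceAs (CommRing L)
instance (φ : A.alg0 ⟶ L) : Algebra ℚ (Along φ) := inferInstanceAs (Algebra ℚ L)
instance (φ : A.alg0 ⟶ L) : Algebra A.alg0 (Along φ) := RingHom.toAlgebra (TAlg.toRingHom φ)

/-- The modules `Aₙ ⊗_{A₀} L`. -/
abbrev Tens (φ : A.alg0 ⟶ L) (n : ℕ) : Type u := TensorProduct A.alg0 (A.deg n) (Along φ)

open TensorProduct

/-- The differential `d ⊗ L`. -/
def tensD (φ : A.alg0 ⟶ L) (i j : ℕ) : Tens φ i →ₗ[A.alg0] Tens φ j :=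
  (A.dLin i j).rTensor (Along φ)

lemma tensD_tmul (φ : A.alg0 ⟶ L) (i j : ℕ) (a : A.deg i) (l : Along φ) :
    tensD φ i j (a ⊗ₜ[A.alg0] l) = (A.cx.d i j a : A.deg j) ⊗ₜ[A.alg0] l := rfl

/-- The chain complex `A ⊗_{A₀} L`. -/
def tensCx (φ : A.alg0 ⟶ L) : ChainComplex (ModuleCat.{u} ℚ) ℕ where
  X n := ModuleCat.of ℚ (Tens φ n)
  d i j := ModuleCat.ofHom (AddMonoidHom.toRatLinearMap (tensD φ i j).toAddMonoidHom)
  shape i j h := by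
    ext x
    change tensD φ i j x = 0
    have : A.dLin i j = 0 := by
      ext y
      change A.cx.d i j y = 0
      rw [A.cx.shape i j h]; rfl
    rw [tensD, this]; simp
  d_comp_d' i j k _ _ := by
    ext x
    change tensD φ j k (tensD φ i j x) = 0
    have : A.dLin j k ∘ₗ A.dLin i j = 0 := by
      ext y
      change A.cx.d j k (A.cx.d i j y) = 0
      rw [← ModuleCat.comp_apply, A.cx.d_comp_d]; rfl
    rw [tensD, tensD, ← LinearMap.rTensor_comp_apply, this]; simp

/-- The multiplication `(a ⊗ l)(b ⊗ m) = ab ⊗ lm`. -/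
def tensMul (φ : A.alg0 ⟶ L) {i j k : ℕ} (h : i + j = k) :
    Tens φ i →ₗ[A.alg0] Tens φ j →ₗ[A.alg0] Tens φ k :=
  TensorProduct.map₂ (A.mulLin h) (LinearMap.mul A.alg0 (Along φ))

lemma tensMul_tmul (φ : A.alg0 ⟶ L) {i j k : ℕ} (h : i + j = k) (a : A.deg i) (b : A.deg j)
    (l m : Along φ) : tensMul φ h (a ⊗ₜ l) (b ⊗ₜ m) = (A.mul h a b : A.deg k) ⊗ₜ (l * m) := rfl

/-- The identification `A₀ ⊗_{A₀} L = L`. -/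
def tensEquiv (φ : A.alg0 ⟶ L) : Tens φ 0 ≃ₗ[A.alg0] Along φ :=
  TensorProduct.congr
    { toFun := fun a : A.deg 0 => (show A.alg0 from a)
      invFun := fun a => a
      map_add' := fun a b => (A.alg0_add a b).symm
      map_smul' := fun a b => (A.alg0_mul a b).symm
      left_inv := fun _ => rfl
      right_inv := fun _ => rfl } (LinearEquiv.refl _ _) ≪≫ₗ TensorProduct.lid A.alg0 (Along φ)

lemma tensEquiv_tmul (φ : A.alg0 ⟶ L) (a : A.deg 0) (l : Along φ) :
    tensEquiv φ (a ⊗ₜ l) = (show Along φ from TAlg.Hom.toFun φ a) * l := rfl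

lemma tensEquiv_mul (φ : A.alg0 ⟶ L) (x y : Tens φ 0) :
    tensEquiv φ (tensMul φ (zero_add 0) x y) = tensEquiv φ x * tensEquiv φ y := by
  induction x using TensorProduct.induction_on with
  | zero => simp
  | add x x' hx hx' => simp only [map_add, LinearMap.add_apply, hx, hx', _root_.add_mul]
  | tmul a l =>
    induction y using TensorProduct.induction_on with
    | zero => simp
    | add y y' hy hy' => simp only [map_add, hy, hy', _root_.mul_add]
    | tmul b m =>
      rw [tensMul_tmul, tensEquiv_tmul, tensEquiv_tmul, tensEquiv_tmul]
      have : (show Along φ from TAlg.Hom.toFun φ (A.mul (zero_add 0) a b)) =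
          (show Along φ from TAlg.Hom.toFun φ a) * (show Along φ from TAlg.Hom.toFun φ b) := by
        rw [← A.alg0_mul]
        exact map_mul (TAlg.toRingHom φ) _ _
      exact (congrArg (fun z => z * (l * m)) this).trans (by ring)

lemma tensEquiv_one (φ : A.alg0 ⟶ L) :
    tensEquiv φ ((A.one : A.deg 0) ⊗ₜ[A.alg0] (1 : Along φ)) = 1 := by
  rw [tensEquiv_tmul, ← A.alg0_one, _root_.mul_one]
  exact map_one (TAlg.toRingHom φ)

lemma tens_one_mul (φ : A.alg0 ⟶ L) {n : ℕ} (a : Tens φ n) :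
    tensMul φ (zero_add n) ((A.one : A.deg 0) ⊗ₜ[A.alg0] (1 : Along φ)) a = a := by
  induction a using TensorProduct.induction_on with
  | zero => simp
  | add x y hx hy => rw [map_add, hx, hy]
  | tmul a l => rw [tensMul_tmul, A.one_mul, _root_.one_mul]

lemma tens_mul_assoc (φ : A.alg0 ⟶ L) {i j k ij jk n : ℕ} (hij : i + j = ij) (hjk : j + k = jk)
    (h : ij + k = n) (h' : i + jk = n) (a : Tens φ i) (b : Tens φ j) (c : Tens φ k) :
    tensMul φ h (tensMul φ hij a b) c = tensMul φ h' a (tensMul φ hjk b c) := by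
  induction a using TensorProduct.induction_on with
  | zero => simp
  | add x y hx hy => simp only [map_add, LinearMap.add_apply, hx, hy]
  | tmul a l =>
    induction b using TensorProduct.induction_on with
    | zero => simp
    | add x y hx hy => simp only [map_add, LinearMap.add_apply, hx, hy]
    | tmul b m =>
      induction c using TensorProduct.induction_on with
      | zero => simp
      | add x y hx hy => simp only [map_add, hx, hy]
      | tmul c p => simp only [tensMul_tmul, A.mul_assoc hij hjk h h', _root_.mul_assoc]

lemma tens_mul_comm (φ : A.alg0 ⟶ L) {i j n : ℕ} (h : i + j = n) (h' : j + i = n)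
    (a : Tens φ i) (b : Tens φ j) :
    tensMul φ h a b = (-1 : ℚ) ^ (i * j) • tensMul φ h' b a := by
  induction a using TensorProduct.induction_on with
  | zero => simp
  | add x y hx hy => simp only [map_add, LinearMap.add_apply, hx, hy, smul_add]
  | tmul a l =>
    induction b using TensorProduct.induction_on with
    | zero => simp
    | add x y hx hy => simp only [map_add, LinearMap.add_apply, hx, hy, smul_add]
    | tmul b m =>
      rw [tensMul_tmul, tensMul_tmul, A.mul_comm h h', _root_.mul_comm l m, smul_tmul']

lemma tens_leibniz (φ : A.alg0 ⟶ L) {i j n : ℕ} (h : i + 1 + (j + 1) = n + 1)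
    (h₁ : i + (j + 1) = n) (h₂ : i + 1 + j = n) (a : Tens φ (i + 1)) (b : Tens φ (j + 1)) :
    tensD φ (n + 1) n (tensMul φ h a b) = tensMul φ h₁ (tensD φ (i + 1) i a) b +
      (-1 : ℚ) ^ (i + 1) • tensMul φ h₂ a (tensD φ (j + 1) j b) := by
  induction a using TensorProduct.induction_on with
  | zero => simp
  | add x y hx hy =>
    simp only [map_add, LinearMap.add_apply, hx, hy, smul_add]
    abel
  | tmul a l =>
    induction b using TensorProduct.induction_on with
    | zero => simp
    | add x y hx hy =>
      simp only [map_add, hx, hy, smul_add]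
      abel
    | tmul b m =>
      simp only [tensMul_tmul, tensD_tmul]
      rw [A.leibniz h h₁ h₂, add_tmul, smul_tmul']

lemma tens_leibniz_zero_left (φ : A.alg0 ⟶ L) {j : ℕ} (a : Tens φ 0) (b : Tens φ (j + 1)) :
    tensD φ (j + 1) j (tensMul φ (zero_add _) a b) =
      tensMul φ (zero_add _) a (tensD φ (j + 1) j b) := by
  induction a using TensorProduct.induction_on with
  | zero => simp
  | add x y hx hy => simp only [map_add, LinearMap.add_apply, hx, hy]
  | tmul a l =>
    induction b using TensorProduct.induction_on with
    | zero => simp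
    | add x y hx hy => simp only [map_add, hx, hy]
    | tmul b m => simp only [tensMul_tmul, tensD_tmul, A.leibniz_zero_left]

lemma tens_leibniz_zero_right (φ : A.alg0 ⟶ L) {i : ℕ} (a : Tens φ (i + 1)) (b : Tens φ 0) :
    tensD φ (i + 1) i (tensMul φ (add_zero _) a b) =
      tensMul φ (add_zero _) (tensD φ (i + 1) i a) b := by
  induction a using TensorProduct.induction_on with
  | zero => simp
  | add x y hx hy => simp only [map_add, LinearMap.add_apply, hx, hy]
  | tmul a l =>
    induction b using TensorProduct.induction_on with
    | zero => simp
    | add x y hx hy => simp only [map_add, hx, hy]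
    | tmul b m => simp only [tensMul_tmul, tensD_tmul, A.leibniz_zero_right]

/-- The `T`-algebra structure on `A₀ ⊗_{A₀} L = L`. -/
def tensStr (φ : A.alg0 ⟶ L) : AlgStr T.toLawvereTheory (Tens φ 0) where
  op f v := (tensEquiv φ).symm (L.op f fun i => (tensEquiv φ (v i) : Along φ))
  op_var i a := (congrArg (tensEquiv φ).symm (L.op_var i _)).trans
    ((tensEquiv φ).symm_apply_apply _)
  op_comp f g a := by
    refine congrArg (tensEquiv φ).symm ((L.op_comp f g _).trans (congrArg (L.op f) ?_))
    funext i
    exact ((tensEquiv φ).apply_symm_apply _).symm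

/-- The `T`-DGA `A ⊗_{A₀} L`, for a morphism `φ : A₀ ⟶ L` of `T`-algebras; its degree `0` part is
the `T`-algebra `A₀ ⊗_{A₀} L = L`. -/
def baseChange (A : TDGA T) {L : TAlg T} (φ : A.alg0 ⟶ L) : TDGA T where
  cx := tensCx φ
  mul h x y := tensMul φ h x y
  one := ((A.one : A.deg 0) ⊗ₜ[A.alg0] (1 : Along φ) : Tens φ 0)
  mul_add h a b c := map_add (tensMul φ h a) b c
  add_mul h a b c := LinearMap.map_add₂ (tensMul φ h) a b c
  one_mul a := tens_one_mul φ a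
  mul_assoc hij hjk h h' a b c := tens_mul_assoc φ hij hjk h h' a b c
  mul_comm h h' a b := tens_mul_comm φ h h' a b
  leibniz h h₁ h₂ a b := tens_leibniz φ h h₁ h₂ a b
  leibniz_zero_left a b := tens_leibniz_zero_left φ a b
  leibniz_zero_right a b := tens_leibniz_zero_right φ a b
  str := tensStr φ
  str_add a b := by
    refine (tensEquiv φ).symm_apply_eq.2 (Eq.trans ?_ (map_add (tensEquiv φ) _ _).symm)
    refine Eq.trans (congrArg (L.ev (X 0 + X 1)) ?_) (L.add_def _ _).symm
    funext i; fin_cases i <;> rfl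
  str_mul a b := by
    refine (tensEquiv φ).symm_apply_eq.2 (Eq.trans ?_ (tensEquiv_mul φ _ _).symm)
    refine Eq.trans (congrArg (L.ev (X 0 * X 1)) ?_) (L.mul_def _ _).symm
    funext i; fin_cases i <;> rfl
  str_one :=
    (tensEquiv φ).symm_apply_eq.2 ((L.ev_one (n := 0) _).trans (tensEquiv_one φ).symm)
  str_smul q a := by
    refine (tensEquiv φ).symm_apply_eq.2 (Eq.trans ?_ (map_rat_smul (tensEquiv φ) q _).symm)
    refine Eq.trans (congrArg (L.ev (C q * X 0)) ?_) (L.ev_C_mul_X q _)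
    funext i; fin_cases i; rfl

/-- The natural map `A ⟶ A ⊗_{A₀} L`, `a ↦ a ⊗ 1`. -/
def toBaseChange (A : TDGA T) {L : TAlg T} (φ : A.alg0 ⟶ L) : A ⟶ A.baseChange φ where
  chain :=
    { f := fun n => ModuleCat.ofHom (AddMonoidHom.toRatLinearMap (AddMonoidHom.mk'
        (fun a : A.deg n => (a ⊗ₜ[A.alg0] (1 : Along φ) : Tens φ n))
        (fun a b => add_tmul a b (1 : Along φ))))
      comm' := fun i j _ => rfl }
  map_mul h a b := by
    refine Eq.trans ?_ (tensMul_tmul φ h a b 1 1).symm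
    rw [_root_.mul_one]
    rfl
  map_op f a := by
    refine ((tensEquiv φ).symm_apply_eq.2 ?_).symm
    refine Eq.trans ?_ (tensEquiv_tmul φ (A.str.op f a) 1).symm
    rw [_root_.mul_one]
    refine Eq.trans (congrArg (L.op f) ?_) (TAlg.Hom.map_op φ f a).symm
    funext i
    exact (tensEquiv_tmul φ (a i) 1).trans (_root_.mul_one _)

end TDGA

/-! ### `T`-algebras as `T`-DGAs concentrated in degree `0` -/

namespace TAlg

/-- The underlying graded vector space of `B`, placed in degree `0`. -/
def degX (B : TAlg T) : ℕ → ModuleCat.{u} ℚ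
  | 0 => ModuleCat.of ℚ B
  | _ + 1 => ModuleCat.of ℚ PUnit

/-- The multiplication on `B`, placed in degree `0`. -/
def degMul (B : TAlg T) : ∀ {i j k : ℕ}, i + j = k → B.degX i → B.degX j → B.degX k
  | 0, 0, 0, _, a, b => (show B from a) * (show B from b)
  | _, _, _ + 1, _, _, _ => PUnit.unit
  | i + 1, j, 0, h, _, _ => absurd h (by omega)
  | 0, j + 1, 0, h, _, _ => absurd h (by omega)

instance (B : TAlg T) (n : ℕ) : Subsingleton (B.degX (n + 1)) :=
  inferInstanceAs (Subsingleton PUnit)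

/-- A `T`-algebra, regarded as a `T`-DGA concentrated in degree `0`. -/
def toTDGA (B : TAlg T) : TDGA T where
  cx :=
    { X := B.degX
      d := fun _ _ => 0 }
  mul := B.degMul
  one := (1 : B)
  mul_add {i j k} h a b c := by
    obtain _ | k := k
    · obtain rfl : i = 0 := by omega
      obtain rfl : j = 0 := by omega
      exact mul_add (show B from a) b c
    · exact Subsingleton.elim (α := B.degX (k + 1)) _ _
  add_mul {i j k} h a b c := by
    obtain _ | k := k
    · obtain rfl : i = 0 := by omega
      obtain rfl : j = 0 := by omega
      exact add_mul (show B from a) b c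
    · exact Subsingleton.elim (α := B.degX (k + 1)) _ _
  one_mul {n} a := by
    obtain _ | n := n
    · exact one_mul (show B from a)
    · exact Subsingleton.elim (α := B.degX (n + 1)) _ _
  mul_assoc {i j k ij jk n} hij hjk h h' a b c := by
    obtain _ | n := n
    · obtain rfl : i = 0 := by omega
      obtain rfl : j = 0 := by omega
      obtain rfl : k = 0 := by omega
      obtain rfl : ij = 0 := by omega
      obtain rfl : jk = 0 := by omega
      exact mul_assoc (show B from a) b c
    · exact Subsingleton.elim (α := B.degX (n + 1)) _ _
  mul_comm {i j n} h h' a b := by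
    obtain _ | n := n
    · obtain rfl : i = 0 := by omega
      obtain rfl : j = 0 := by omega
      refine (mul_comm (show B from a) b).trans ?_
      exact (one_smul ℚ (show B.degX 0 from ((show B from b) * (show B from a)))).symm
    · exact Subsingleton.elim (α := B.degX (n + 1)) _ _
  leibniz {i j n} h h₁ h₂ a b := by
    obtain rfl : n = i + j + 1 := by omega
    exact Subsingleton.elim (α := B.degX (i + j + 1)) _ _
  leibniz_zero_left {j} a b := by
    obtain _ | j := j
    · exact (mul_zero (show B from a)).symm
    · exact Subsingleton.elim (α := B.degX (j + 1)) _ _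
  leibniz_zero_right {i} a b := by
    obtain _ | i := i
    · exact (zero_mul (show B from b)).symm
    · exact Subsingleton.elim (α := B.degX (i + 1)) _ _
  str := B.str
  str_add _ _ := rfl
  str_mul _ _ := rfl
  str_one := rfl
  str_smul q a := B.ev_C_mul_X q a

/-- The linear map underlying a homomorphism, placed in degree `0`. -/
def degMap {B C : TAlg T} (φ : B ⟶ C) : ∀ n : ℕ, B.degX n ⟶ C.degX n
  | 0 => ModuleCat.ofHom (AddMonoidHom.toRatLinearMap (toRingHom φ).toAddMonoidHom)
  | _ + 1 => 0

variable (T) in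
/-- The functor regarding `T`-algebras as `T`-DGAs concentrated in degree `0`. -/
def incl : TAlg T ⥤ TDGA T where
  obj := toTDGA
  map {B C} φ :=
    { chain :=
        { f := degMap φ
          comm' := fun i j _ => (comp_zero).trans (zero_comp).symm }
      map_mul := fun {i j k} h a b => by
        obtain _ | k := k
        · obtain rfl : i = 0 := by omega
          obtain rfl : j = 0 := by omega
          exact map_mul (toRingHom φ) (show B from a) b
        · exact Subsingleton.elim (α := C.degX (k + 1)) _ _
      map_op := fun f a => Hom.map_op φ f a }
  map_id B := by
    refine TDGA.Hom.ext (HomologicalComplex.hom_ext _ _ fun n => ?_)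
    obtain _ | n := n
    · rfl
    · ext x; exact Subsingleton.elim (α := B.degX (n + 1)) _ _
  map_comp {B C D} φ ψ := by
    refine TDGA.Hom.ext (HomologicalComplex.hom_ext _ _ fun n => ?_)
    obtain _ | n := n
    · rfl
    · ext x; exact Subsingleton.elim (α := D.degX (n + 1)) _ _

end TAlg

/-! ### Classes of morphisms behaving like open immersions or étale maps -/

/-- The standing assumptions on the class `E`: a class of flat morphisms between finitely presented
`T`-algebras, containing the identities and closed under composition, closed under pushouts along
arbitrary maps of finitely presented `T`-algebras, with right cancellation, and such that for
`f : A ⟶ B` in `E` and `i : B ⟶ C` with `A ⟶ C` surjective, there is a factorisation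
`B ⟶ B' ⟶ C` of `i` with `B ⟶ B'` in `E` and with `B' ⊙_A C ⟶ C` an isomorphism. -/
structure IsEtaleLike [T.IsFermat] (E : MorphismProperty (TAlg T)) : Prop where
  fp_source : ∀ {A B : TAlg T} (f : A ⟶ B), E f → A.IsFP
  fp_target : ∀ {A B : TAlg T} (f : A ⟶ B), E f → B.IsFP
  flat : ∀ {A B : TAlg T} (f : A ⟶ B), E f → TAlg.IsFlat f
  id_mem : ∀ A : TAlg T, A.IsFP → E (𝟙 A)
  comp_mem : ∀ {A B C : TAlg T} (f : A ⟶ B) (g : B ⟶ C), E f → E g → E (f ≫ g)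
  pushout_mem : ∀ {A B A' B' : TAlg T} (f : A ⟶ B) (g : A ⟶ A') (g' : B ⟶ B') (f' : A' ⟶ B'),
    IsPushout f g g' f' → A'.IsFP → E f → E f'
  right_cancel : ∀ {A B C : TAlg T} (f : A ⟶ B) (g : B ⟶ C), E f → E (f ≫ g) → E g
  factor : ∀ {A B C : TAlg T} (f : A ⟶ B) (i : B ⟶ C), E f →
    Function.Surjective (TAlg.Hom.toFun (f ≫ i)) →
    ∃ (B' : TAlg T) (j : B ⟶ B') (i' : B' ⟶ C), E j ∧ j ≫ i' = i ∧
      IsPushout (f ≫ j) (f ≫ i) i' (𝟙 C)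

section Localisation

variable (E : MorphismProperty (TAlg T))

/-- `E`-morphisms: the pushouts, along arbitrary maps of `T`-algebras, of morphisms in `E`. -/
abbrev EMor : MorphismProperty (TAlg T) := E.pushouts

/-- The category of factorisations `A ⟶ C ⟶ B` of `f` for which `A ⟶ C` is an `E`-morphism. -/
abbrev EFact {A B : TAlg T} (f : A ⟶ B) :=
  ObjectProperty.FullSubcategory fun F : Factorisation f => EMor E F.ι

/-- The diagram of the middle objects `C`. -/
def eDiagram {A B : TAlg T} (f : A ⟶ B) : EFact E f ⥤ TAlg T :=
  ObjectProperty.ι _ ⋙ Factorisation.forget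

/-- An `E`-localisation `(A/B)^{loc_E}` of `A` along `f : A ⟶ B`: a colimit of the middle objects `C`
of all factorisations `A ⟶ C ⟶ B` of `f` with `A ⟶ C` an `E`-morphism, together with the natural map
from `A`. -/
structure ELocalisation {A B : TAlg T} (f : A ⟶ B) where
  /-- the colimit -/
  cocone : Cocone (eDiagram E f)
  /-- the universal property -/
  isColimit : IsColimit cocone
  /-- the natural map from `A` to the localisation -/
  toLoc : A ⟶ cocone.pt
  fac : ∀ F : EFact E f, F.obj.ι ≫ cocone.ι.app F = toLoc

/-- The condition `A ≅ A^{lE}` on a `T`-DGA, where `A^{lE} = A ⊗_{A₀} (A₀/H₀A)^{loc_E}`: the natural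
map is an isomorphism. -/
def IsELocal [T.IsFermat] : ObjectProperty (TDGA T) := fun A =>
  ∃ L : ELocalisation E A.toH0, IsIso (A.toBaseChange L.toLoc)

/-- The category of those `T`-DGAs `A` with `A ≅ A^{lE}`. -/
abbrev LocTDGA [T.IsFermat] := (IsELocal E).FullSubcategory

/-- The inclusion into all `T`-DGAs. -/
abbrev locIncl [T.IsFermat] : LocTDGA E ⥤ TDGA T := (IsELocal E).ι

end Localisation

/-! ### Model structures -/

variable (T) in
/-- Quasi-isomorphisms of `T`-DGAs. -/
def quasiIsos : MorphismProperty (TDGA T) := fun _ _ f => QuasiIso (TDGA.Hom.chain f)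

variable (T) in
/-- Morphisms of `T`-DGAs which are surjective in strictly positive degrees. -/
def posSurj : MorphismProperty (TDGA T) := fun A B f =>
  ∀ n : ℕ, 0 < n → Function.Surjective (fun a : A.deg n => ((TDGA.Hom.chain f).f n a : B.deg n))

/-- A model category (with all small limits and colimits) is cofibrantly generated if there are
sets of maps `I`, `J`, permitting the small object argument, such that the trivial fibrations
(resp. the fibrations) are the maps with the right lifting property against `I` (resp. `J`). -/
structure IsCofibrantlyGenerated (C : Type (u + 1)) [Category.{u} C] [ModelCategory C] : Prop where
  hasLimits : HasLimitsOfSize.{u, u} C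
  hasColimits : HasColimitsOfSize.{u, u} C
  exists_generators : ∃ I J : MorphismProperty C,
    MorphismProperty.HasSmallObjectArgument.{u} I ∧
    MorphismProperty.HasSmallObjectArgument.{u} J ∧
    trivialFibrations C = I.rlp ∧ fibrations C = J.rlp

/-- A functor between model categories is a right Quillen equivalence if it has a left adjoint,
preserves fibrations and trivial fibrations, and if, for `X` cofibrant and `Y` fibrant, a map
`F X ⟶ Y` is a weak equivalence if and only if its adjunct `X ⟶ G Y` is. -/
def IsRightQuillenEquivalence {D C : Type (u + 1)} [Category.{u} D] [Category.{u} C]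
    [ModelCategory D] [ModelCategory C] (G : D ⥤ C) : Prop :=
  ∃ (F : C ⥤ D) (adj : F ⊣ G),
    (∀ {X Y : D} (p : X ⟶ Y), fibrations D p → fibrations C (G.map p)) ∧
    (∀ {X Y : D} (p : X ⟶ Y), trivialFibrations D p → trivialFibrations C (G.map p)) ∧
    ∀ (X : C) (Y : D), IsCofibrant X → IsFibrant Y → ∀ f : F.obj X ⟶ Y,
      (weakEquivalences D f ↔ weakEquivalences C (adj.homEquiv X Y f))

end FermatDG

end

noncomputable section

namespace FermatDG

variable {T : QTheory.{u}}

/-! Standard model structure. A cycle (an element) of degree n is a map out of a sphere (a disc), so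
lifting against `genI` and `genJ` describes the trivial fibrations and the fibrations. By a retract
argument (`llp_inf_weq_eq`) only one thing remains: every map factors as a quasi-isomorphism
followed by a map surjective in positive degrees. To factor A → B, adjoin to A a free variable, with
its differential, for each element of B of positive degree; the point is that this does not change
homology (`adj_contracts`). It is enough to adjoin one variable at a time. In degree at least 2, the
derivation counting variables and their differentials is nullhomotopic, and its positive eigenvalues
are invertible over ℚ. In degree 1 the differential of the variable is a new variable x of the
T-algebra A₀, and an element of A₀{x} need not be a sum of homogeneous parts. There the extension is
the Koszul complex on x, contracted by the difference quotient (c - c(0))/x. This is well defined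
because x is a nonzerodivisor (`poly_regular`), which comes from uniqueness in the Fermat property,
for free algebras first, then for their quotients, then for all algebras by filtered colimits.

Local objects. Right cancellation puts codiagonals of E in E, so lifts against E are automatically
unique, and the factorisations defining the localisation form a filtered, essentially small
category. The map from A₀ to the localisation is left orthogonal to every map right orthogonal to E,
and the map from the localisation to H₀A is itself right orthogonal to E. Hence A is local exactly
when A₀ → H₀A lifts against E (`isELocal_iff`), and base change to the localisation is a reflection.
Its unit is a quasi-isomorphism (`quasiIsos_toBaseChange`): the localisation is flat over A₀, the
third axiom on E makes it equal to H₀A modulo the boundaries (`locTo_ker`), and boundaries act by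
zero on homology.

The E-model structure is then transferred along the reflection: local objects are closed under
filtered colimits, so reflected generators stay small, and factorisations are obtained by reflecting
those of all T-DGAs. The Quillen equivalence is two-out-of-three for the unit.

Part (b). In degree 0, a quasi-isomorphism of local objects has the right lifting property against E
(`rlp_map0`), since H₀ is unchanged; this gives lifts for transfinite compositions. For an
ind(E)-morphism out of T[x₁, …, xₙ], a lift on the free algebra comes from surjectivity in degree 0,
and the unique lifts over the stages glue. -/

/-- The components of a cocone. -/
def coLeg {J D : Type*} [Category* J] [Category* D] {F : J ⥤ D} (c : Cocone F) (j : J) :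
    F.obj j ⟶ c.pt := c.ι.app j

lemma map_coLeg {J D : Type*} [Category* J] [Category* D] {F : J ⥤ D} (c : Cocone F)
    {i j : J} (f : i ⟶ j) : F.map f ≫ coLeg c j = coLeg c i := c.w f

lemma map_coLeg_assoc {J D : Type*} [Category* J] [Category* D] {F : J ⥤ D} (c : Cocone F)
    {i j : J} (f : i ⟶ j) {X : D} (h : c.pt ⟶ X) :
    F.map f ≫ coLeg c j ≫ h = coLeg c i ≫ h := by
  rw [← Category.assoc, map_coLeg]

/-- The components of a cone. -/
def leg {J D : Type*} [Category* J] [Category* D] {F : J ⥤ D} (c : Cone F) (j : J) :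
    c.pt ⟶ F.obj j := c.π.app j

lemma leg_map {J D : Type*} [Category* J] [Category* D] {F : J ⥤ D} (c : Cone F)
    {i j : J} (f : i ⟶ j) : leg c i ≫ F.map f = leg c j := c.w f

/-- The cocone given by a compatible family of morphisms. -/
def mkCocone {J D : Type*} [Category* J] [Category* D] {F : J ⥤ D} {B : D}
    (s : ∀ j, F.obj j ⟶ B) (w : ∀ {i j} (f : i ⟶ j), F.map f ≫ s j = s i) : Cocone F where
  pt := B
  ι :=
    { app := s
      naturality := fun _ _ f => (w f).trans (Category.comp_id _).symm }

/-! ### Elementwise interface to `T`-algebras and `T`-DGAs -/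

namespace TAlg

@[simp] lemma id_toFun (A : TAlg T) (a : A) : Hom.toFun (𝟙 A) a = a := rfl

@[simp] lemma comp_toFun {A B D : TAlg T} (f : A ⟶ B) (g : B ⟶ D) (a : A) :
    Hom.toFun (f ≫ g) a = Hom.toFun g (Hom.toFun f a) := rfl

lemma hom_ext {A B : TAlg T} {f g : A ⟶ B} (h : ∀ a : A, Hom.toFun f a = Hom.toFun g a) : f = g :=
  Hom.ext (funext h)

lemma congr_toFun {A B : TAlg T} {f g : A ⟶ B} (h : f = g) (a : A) :
    Hom.toFun f a = Hom.toFun g a := by rw [h]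

lemma toFun_op {A B : TAlg T} (f : A ⟶ B) {n : ℕ} (p : T.Op n) (a : Fin n → A) :
    Hom.toFun f (A.op p a) = B.op p fun i => Hom.toFun f (a i) := Hom.map_op f p a

@[simp] lemma toRingHom_apply {A B : TAlg T} (f : A ⟶ B) (a : A) :
    toRingHom f a = Hom.toFun f a := rfl

lemma toFun_add {A B : TAlg T} (f : A ⟶ B) (a b : A) :
    Hom.toFun f (a + b) = Hom.toFun f a + Hom.toFun f b := map_add (toRingHom f) a b

lemma toFun_sub {A B : TAlg T} (f : A ⟶ B) (a b : A) :
    Hom.toFun f (a - b) = Hom.toFun f a - Hom.toFun f b := map_sub (toRingHom f) a b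

lemma toFun_mul {A B : TAlg T} (f : A ⟶ B) (a b : A) :
    Hom.toFun f (a * b) = Hom.toFun f a * Hom.toFun f b := map_mul (toRingHom f) a b

lemma toFun_zero {A B : TAlg T} (f : A ⟶ B) : Hom.toFun f (0 : A) = 0 := map_zero (toRingHom f)

lemma toFun_one {A B : TAlg T} (f : A ⟶ B) : Hom.toFun f (1 : A) = 1 := map_one (toRingHom f)

/-- The isomorphism given by a bijective homomorphism. -/
def isoOfBijective {A B : TAlg T} (f : A ⟶ B) (h : Function.Bijective (Hom.toFun f)) : A ≅ B where
  hom := f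
  inv := ⟨(Equiv.ofBijective _ h).symm, fun p a => by
    apply h.1
    rw [toFun_op]
    exact ((Equiv.ofBijective _ h).apply_symm_apply _).trans
      (congrArg (B.op p) (funext fun i => ((Equiv.ofBijective _ h).apply_symm_apply (a i)).symm))⟩
  hom_inv_id := hom_ext fun a => (Equiv.ofBijective _ h).symm_apply_apply a
  inv_hom_id := hom_ext fun a => (Equiv.ofBijective _ h).apply_symm_apply a

lemma isIso_of_bijective {A B : TAlg T} (f : A ⟶ B) (h : Function.Bijective (Hom.toFun f)) :
    IsIso f := (isoOfBijective f h).isIso_hom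

@[simp] lemma freeDesc_gen (A : TAlg T) {n : ℕ} (v : Fin n → A) (i : Fin n) :
    Hom.toFun (A.freeDesc v) (T.gen i) = v i := A.op_var i v

lemma free_op_gen {n : ℕ} (p : T.Op n) : (T.free n).op p T.gen = p := T.comp_var p

lemma free_hom_ext {A : TAlg T} {n : ℕ} {f g : T.free n ⟶ A}
    (h : ∀ i, Hom.toFun f (T.gen i) = Hom.toFun g (T.gen i)) : f = g :=
  hom_ext fun p => by
    have e : ∀ k : T.free n ⟶ A, Hom.toFun k p = A.op p fun i => Hom.toFun k (T.gen i) :=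
      fun k => (congrArg (Hom.toFun k) (free_op_gen p).symm).trans
        (toFun_op k (show T.Op n from p) T.gen)
    rw [e, e]
    exact congrArg (A.op p) (funext h)

/-- The homomorphism out of a target of a surjection. -/
def descOfSurjective {A B D : TAlg T} (p : A ⟶ B) (hp : Function.Surjective (Hom.toFun p))
    (f : A ⟶ D) (h : ∀ a, Hom.toFun p a = 0 → Hom.toFun f a = 0) : B ⟶ D :=
  have key : ∀ a b, Hom.toFun p a = Hom.toFun p b → Hom.toFun f a = Hom.toFun f b := by
    intro a b hab
    rw [← sub_eq_zero, ← toFun_sub]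
    exact h _ (by rw [toFun_sub, hab, sub_self])
  ⟨fun b => Hom.toFun f (hp b).choose, fun q a => by
    rw [← toFun_op f]
    apply key
    rw [(hp _).choose_spec, toFun_op]
    exact congrArg (B.op q) (funext fun i => (hp (a i)).choose_spec.symm)⟩

lemma descOfSurjective_apply {A B D : TAlg T} (p : A ⟶ B)
    (hp : Function.Surjective (Hom.toFun p)) (f : A ⟶ D)
    (h : ∀ a, Hom.toFun p a = 0 → Hom.toFun f a = 0) (a : A) :
    Hom.toFun (descOfSurjective p hp f h) (Hom.toFun p a) = Hom.toFun f a := by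
  rw [← sub_eq_zero]
  change Hom.toFun f _ - Hom.toFun f a = 0
  rw [← toFun_sub]
  refine h _ ?_
  rw [toFun_sub, (hp (Hom.toFun p a)).choose_spec, sub_self]

lemma comp_descOfSurjective {A B D : TAlg T} (p : A ⟶ B)
    (hp : Function.Surjective (Hom.toFun p)) (f : A ⟶ D)
    (h : ∀ a, Hom.toFun p a = 0 → Hom.toFun f a = 0) : p ≫ descOfSurjective p hp f h = f :=
  hom_ext fun a => descOfSurjective_apply p hp f h a

section Quot

variable [T.IsFermat]

lemma quotMk_surjective (A : TAlg T) (I : Ideal A) :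
    Function.Surjective (Hom.toFun (A.quotMk I)) := Ideal.Quotient.mk_surjective

lemma quotMk_eq_iff (A : TAlg T) (I : Ideal A) (a b : A) :
    Hom.toFun (A.quotMk I) a = Hom.toFun (A.quotMk I) b ↔ a - b ∈ I := Ideal.Quotient.eq

lemma quotMk_eq_zero (A : TAlg T) (I : Ideal A) {a : A} :
    Hom.toFun (A.quotMk I) a = 0 ↔ a ∈ I := by
  rw [← toFun_zero (A.quotMk I), quotMk_eq_iff, sub_zero]

/-- The homomorphism out of a quotient. -/
def quotDesc {A D : TAlg T} (I : Ideal A) (f : A ⟶ D) (h : ∀ a ∈ I, Hom.toFun f a = 0) :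
    A.quot I ⟶ D :=
  descOfSurjective (A.quotMk I) (A.quotMk_surjective I) f
    fun a ha => h a ((A.quotMk_eq_zero I).1 ha)

@[simp] lemma quotMk_desc {A D : TAlg T} (I : Ideal A) (f : A ⟶ D)
    (h : ∀ a ∈ I, Hom.toFun f a = 0) : A.quotMk I ≫ quotDesc I f h = f :=
  comp_descOfSurjective _ _ _ _

end Quot

lemma epi_of_surjective {A B D : TAlg T} {p : A ⟶ B} (hp : Function.Surjective (Hom.toFun p))
    {f g : B ⟶ D} (h : p ≫ f = p ≫ g) : f = g :=
  hom_ext fun b => by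
    obtain ⟨a, rfl⟩ := hp b
    exact congr_toFun h a

end TAlg

namespace TDGA

/-- The degree `n` component of a morphism. -/
def app {A B : TDGA T} (f : A ⟶ B) (n : ℕ) : A.deg n →ₗ[ℚ] B.deg n := ((Hom.chain f).f n).hom

/-- The differential. -/
def dif (A : TDGA T) (n : ℕ) : A.deg (n + 1) →ₗ[ℚ] A.deg n := (A.cx.d (n + 1) n).hom

@[simp] lemma dif_dif (A : TDGA T) (n : ℕ) (a : A.deg (n + 1 + 1)) :
    A.dif n (A.dif (n + 1) a) = 0 := by
  change A.cx.d (n + 1) n (A.cx.d (n + 1 + 1) (n + 1) a) = 0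
  rw [← ModuleCat.comp_apply, A.cx.d_comp_d]; rfl

@[simp] lemma id_app (A : TDGA T) (n : ℕ) (a : A.deg n) : app (𝟙 A) n a = a := rfl

@[simp] lemma comp_app {A B D : TDGA T} (f : A ⟶ B) (g : B ⟶ D) (n : ℕ) (a : A.deg n) :
    app (f ≫ g) n a = app g n (app f n a) := rfl

lemma app_dif {A B : TDGA T} (f : A ⟶ B) (n : ℕ) (a : A.deg (n + 1)) :
    app f n (A.dif n a) = B.dif n (app f (n + 1) a) := by
  have := (Hom.chain f).comm (n + 1) n
  exact (congrArg (fun φ => φ.hom a) this).symm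

lemma app_mul {A B : TDGA T} (f : A ⟶ B) {i j k : ℕ} (h : i + j = k) (a : A.deg i) (b : A.deg j) :
    app f k (A.mul h a b) = B.mul h (app f i a) (app f j b) := Hom.map_mul f h a b

lemma app_op {A B : TDGA T} (f : A ⟶ B) {n : ℕ} (p : T.Op n) (a : Fin n → A.deg 0) :
    app f 0 (A.str.op p a) = B.str.op p fun i => app f 0 (a i) := Hom.map_op f p a

lemma app_one {A B : TDGA T} (f : A ⟶ B) : app f 0 A.one = B.one := by
  rw [← A.str_one, app_op, ← B.str_one]
  exact congrArg _ (funext fun i => i.elim0)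

lemma hom_ext {A B : TDGA T} {f g : A ⟶ B} (h : ∀ n a, app f n a = app g n a) : f = g :=
  Hom.ext (HomologicalComplex.hom_ext _ _ fun n => ModuleCat.hom_ext (LinearMap.ext (h n)))

lemma congr_app {A B : TDGA T} {f g : A ⟶ B} (h : f = g) (n : ℕ) (a : A.deg n) :
    app f n a = app g n a := by rw [h]

/-- Constructor for morphisms of `T`-DGAs. -/
def homMk {A B : TDGA T} (f : ∀ n, A.deg n → B.deg n)
    (map_add : ∀ n a b, f n (a + b) = f n a + f n b)
    (map_dif : ∀ n a, f n (A.dif n a) = B.dif n (f (n + 1) a))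
    (map_mul : ∀ {i j k : ℕ} (h : i + j = k) (a : A.deg i) (b : A.deg j),
      f k (A.mul h a b) = B.mul h (f i a) (f j b))
    (map_op : ∀ {n : ℕ} (p : T.Op n) (a : Fin n → A.deg 0),
      f 0 (A.str.op p a) = B.str.op p fun i => f 0 (a i)) : A ⟶ B where
  chain :=
    { f := fun n => ModuleCat.ofHom (AddMonoidHom.toRatLinearMap (AddMonoidHom.mk' (f n) (map_add n)))
      comm' := by
        rintro i j (rfl : j + 1 = i)
        ext a
        exact (map_dif j a).symm }
  map_mul := map_mul
  map_op := map_op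

lemma bijective_of_isIso {A B : TDGA T} (f : A ⟶ B) [IsIso f] (n : ℕ) :
    Function.Bijective (app f n) :=
  ⟨fun a b h => by
    have h' := congrArg (app (inv f) n) h
    rwa [← comp_app, ← comp_app, IsIso.hom_inv_id] at h',
   fun b => ⟨app (inv f) n b, by rw [← comp_app, IsIso.inv_hom_id]; rfl⟩⟩

lemma leibniz' (A : TDGA T) {i j n : ℕ} (h : i + 1 + (j + 1) = n + 1) (h₁ : i + (j + 1) = n)
    (h₂ : i + 1 + j = n) (a : A.deg (i + 1)) (b : A.deg (j + 1)) :
    A.dif n (A.mul h a b) =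
      A.mul h₁ (A.dif i a) b + (-1 : ℚ) ^ (i + 1) • A.mul h₂ a (A.dif j b) := A.leibniz h h₁ h₂ a b

lemma leibniz_left (A : TDGA T) {j : ℕ} (a : A.deg 0) (b : A.deg (j + 1)) :
    A.dif j (A.mul (zero_add _) a b) = A.mul (zero_add _) a (A.dif j b) := A.leibniz_zero_left a b

lemma leibniz_right (A : TDGA T) {i : ℕ} (a : A.deg (i + 1)) (b : A.deg 0) :
    A.dif i (A.mul (add_zero _) a b) = A.mul (add_zero _) (A.dif i a) b := A.leibniz_zero_right a b

/-- The map on degree `0` parts. -/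
def map0 {A B : TDGA T} (f : A ⟶ B) : A.alg0 ⟶ B.alg0 := ⟨app f 0, fun p a => app_op f p a⟩

/-- Graded data from which a `T`-DGA can be built. -/
structure GradedData (T : QTheory.{u}) where
  /-- the graded pieces -/
  deg : ℕ → Type u
  [grp : ∀ n, AddCommGroup (deg n)]
  [mod : ∀ n, Module ℚ (deg n)]
  /-- the differential -/
  d : ∀ n, deg (n + 1) → deg n
  d_add : ∀ n a b, d n (a + b) = d n a + d n b
  d_d : ∀ n a, d n (d (n + 1) a) = 0
  /-- the product -/
  mul : ∀ {i j k : ℕ}, i + j = k → deg i → deg j → deg k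
  /-- the unit -/
  one : deg 0
  mul_add : ∀ {i j k : ℕ} (h : i + j = k) (a : deg i) (b c : deg j),
    mul h a (b + c) = mul h a b + mul h a c
  add_mul : ∀ {i j k : ℕ} (h : i + j = k) (a b : deg i) (c : deg j),
    mul h (a + b) c = mul h a c + mul h b c
  one_mul : ∀ {n : ℕ} (a : deg n), mul (zero_add n) one a = a
  mul_assoc : ∀ {i j k ij jk n : ℕ} (hij : i + j = ij) (hjk : j + k = jk) (h : ij + k = n)
    (h' : i + jk = n) (a : deg i) (b : deg j) (c : deg k),
    mul h (mul hij a b) c = mul h' a (mul hjk b c)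
  mul_comm : ∀ {i j n : ℕ} (h : i + j = n) (h' : j + i = n) (a : deg i) (b : deg j),
    mul h a b = (-1 : ℚ) ^ (i * j) • mul h' b a
  leibniz : ∀ {i j n : ℕ} (h : i + 1 + (j + 1) = n + 1) (h₁ : i + (j + 1) = n)
    (h₂ : i + 1 + j = n) (a : deg (i + 1)) (b : deg (j + 1)),
    d n (mul h a b) = mul h₁ (d i a) b + (-1 : ℚ) ^ (i + 1) • mul h₂ a (d j b)
  leibniz_zero_left : ∀ {j : ℕ} (a : deg 0) (b : deg (j + 1)),
    d j (mul (zero_add _) a b) = mul (zero_add _) a (d j b)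
  leibniz_zero_right : ∀ {i : ℕ} (a : deg (i + 1)) (b : deg 0),
    d i (mul (add_zero _) a b) = mul (add_zero _) (d i a) b
  /-- the `T`-algebra structure in degree `0` -/
  str : AlgStr T.toLawvereTheory (deg 0)
  str_add : ∀ a b : deg 0, str.op (T.poly (X 0 + X 1)) ![a, b] = a + b
  str_mul : ∀ a b : deg 0, str.op (T.poly (X 0 * X 1)) ![a, b] = mul (zero_add 0) a b
  str_one : str.op (T.poly (1 : MvPolynomial (Fin 0) ℚ)) ![] = one
  str_smul : ∀ (q : ℚ) (a : deg 0), str.op (T.poly (C q * X 0)) ![a] = q • a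

attribute [instance] GradedData.grp GradedData.mod

namespace GradedData

variable (D : GradedData T)

/-- The differential as a morphism of vector spaces. -/
def dHom (n : ℕ) : ModuleCat.of ℚ (D.deg (n + 1)) ⟶ ModuleCat.of ℚ (D.deg n) :=
  ModuleCat.ofHom (AddMonoidHom.toRatLinearMap (AddMonoidHom.mk' (D.d n) (D.d_add n)))

/-- The underlying chain complex. -/
def cx : ChainComplex (ModuleCat.{u} ℚ) ℕ :=
  ChainComplex.of (fun n => ModuleCat.of ℚ (D.deg n)) D.dHom (fun n => by
    ext a; exact D.d_d n a)

lemma cx_d_apply (n : ℕ) (a : D.deg (n + 1)) : D.cx.d (n + 1) n a = D.d n a :=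
  congrArg (fun φ : ModuleCat.of ℚ (D.deg (n + 1)) ⟶ ModuleCat.of ℚ (D.deg n) => φ.hom a)
    (ChainComplex.of_d (fun n => ModuleCat.of ℚ (D.deg n)) D.dHom n)

/-- The `T`-DGA defined by graded data. -/
def toTDGA : TDGA T where
  cx := D.cx
  mul := D.mul
  one := D.one
  mul_add := D.mul_add
  add_mul := D.add_mul
  one_mul := D.one_mul
  mul_assoc := D.mul_assoc
  mul_comm := D.mul_comm
  leibniz h h₁ h₂ a b := by
    refine (D.cx_d_apply _ _).trans ((D.leibniz h h₁ h₂ a b).trans ?_)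
    exact congrArg₂ (fun x y => D.mul h₁ x b + (-1 : ℚ) ^ _ • D.mul h₂ a y)
      (D.cx_d_apply _ _).symm (D.cx_d_apply _ _).symm
  leibniz_zero_left a b := by
    refine (D.cx_d_apply _ _).trans ((D.leibniz_zero_left a b).trans ?_)
    exact congrArg (fun x => D.mul _ a x) (D.cx_d_apply _ _).symm
  leibniz_zero_right a b := by
    refine (D.cx_d_apply _ _).trans ((D.leibniz_zero_right a b).trans ?_)
    exact congrArg (fun x => D.mul _ x b) (D.cx_d_apply _ _).symm
  str := D.str
  str_add := D.str_add
  str_mul := D.str_mul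
  str_one := D.str_one
  str_smul := D.str_smul

lemma dif_eq (n : ℕ) (a : D.deg (n + 1)) : D.toTDGA.dif n a = D.d n a := D.cx_d_apply n a

end GradedData

end TDGA

/-! ### `T`-DGAs presented by raw operations and evaluation maps -/

namespace TDGA

/-- A graded set with the operations of a `T`-DGA, not subject to any axioms. -/
structure Raw (T : QTheory.{u}) where
  /-- the graded pieces -/
  deg : ℕ → Type u
  /-- zero -/
  zero : ∀ n, deg n
  /-- addition -/
  add : ∀ {n}, deg n → deg n → deg n
  /-- scalar multiplication -/
  smul : ∀ {n}, ℚ → deg n → deg n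
  /-- differential -/
  d : ∀ {n}, deg (n + 1) → deg n
  /-- product -/
  mul : ∀ {i j k : ℕ}, i + j = k → deg i → deg j → deg k
  /-- unit -/
  one : deg 0
  /-- operations of the theory -/
  op : ∀ {n : ℕ}, T.Op n → (Fin n → deg 0) → deg 0

namespace Raw

/-- Maps from a raw structure to a `T`-DGA preserving all operations. -/
structure Eval (Y : Raw T) (B : TDGA T) where
  /-- the underlying map -/
  f : ∀ n, Y.deg n → B.deg n
  zero : ∀ n, f n (Y.zero n) = 0
  add : ∀ {n} (a b : Y.deg n), f n (Y.add a b) = f n a + f n b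
  smul : ∀ {n} (q : ℚ) (a : Y.deg n), f n (Y.smul q a) = q • f n a
  d : ∀ {n} (a : Y.deg (n + 1)), f n (Y.d a) = B.dif n (f (n + 1) a)
  mul : ∀ {i j k : ℕ} (h : i + j = k) (a : Y.deg i) (b : Y.deg j),
    f k (Y.mul h a b) = B.mul h (f i a) (f j b)
  one : f 0 Y.one = B.one
  op : ∀ {n : ℕ} (p : T.Op n) (a : Fin n → Y.deg 0),
    f 0 (Y.op p a) = B.str.op p fun i => f 0 (a i)

variable {Y : Raw T} {Ω : Type*} {B : Ω → TDGA T} (φ : ∀ ω, Eval Y (B ω)) (𝓕 : Filter Ω)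

/-- Two elements are identified if their values are eventually equal. -/
def setoid (n : ℕ) : Setoid (Y.deg n) where
  r a b := ∀ᶠ ω in 𝓕, (φ ω).f n a = (φ ω).f n b
  iseqv :=
    { refl := fun _ => Filter.Eventually.of_forall fun _ => rfl
      symm := fun h => h.mono fun _ e => e.symm
      trans := fun h h' => (h.and h').mono fun _ e => e.1.trans e.2 }

/-- The graded pieces of the quotient. -/
def QDeg (n : ℕ) : Type u := Quotient (setoid φ 𝓕 n)

/-- The quotient map. -/
def qmk {n : ℕ} (a : Y.deg n) : QDeg φ 𝓕 n := Quotient.mk (setoid φ 𝓕 n) a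

variable {φ 𝓕}

lemma qmk_eq {n : ℕ} {a b : Y.deg n} :
    qmk φ 𝓕 a = qmk φ 𝓕 b ↔ ∀ᶠ ω in 𝓕, (φ ω).f n a = (φ ω).f n b :=
  ⟨fun h => Quotient.exact h, fun h => Quotient.sound (s := setoid φ 𝓕 n) h⟩

/-- An identity valid in every `B ω` descends to the quotient, so all axioms of a T-DGA are verified
on values. With the filter `⊤` the same construction yields universal objects and limits; with a
proper filter it yields reduced products. -/
lemma qsound {n : ℕ} {a b : Y.deg n} (h : ∀ ω, (φ ω).f n a = (φ ω).f n b) :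
    qmk φ 𝓕 a = qmk φ 𝓕 b := qmk_eq.2 (Filter.Eventually.of_forall h)

lemma qmk_surj {n : ℕ} (x : QDeg φ 𝓕 n) : ∃ a, qmk φ 𝓕 a = x := Quotient.exists_rep x

lemma qmk_surj_pi {m n : ℕ} (x : Fin m → QDeg φ 𝓕 n) : ∃ a : Fin m → Y.deg n, (fun i => qmk φ 𝓕 (a i)) = x :=
  ⟨fun i => (qmk_surj (x i)).choose, funext fun i => (qmk_surj (x i)).choose_spec⟩

variable (φ 𝓕)

/-- Addition on the quotient. -/
def qadd {n : ℕ} : QDeg φ 𝓕 n → QDeg φ 𝓕 n → QDeg φ 𝓕 n :=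
  Quotient.map₂ Y.add fun a a' ha b b' hb => by
    filter_upwards [ha, hb] with ω h h'
    rw [(φ ω).add, (φ ω).add, h, h']

/-- Scalar multiplication on the quotient. -/
def qsmul {n : ℕ} (q : ℚ) : QDeg φ 𝓕 n → QDeg φ 𝓕 n :=
  Quotient.map (Y.smul q) fun a a' ha => by
    filter_upwards [ha] with ω h
    rw [(φ ω).smul, (φ ω).smul, h]

/-- The differential on the quotient. -/
def qd {n : ℕ} : QDeg φ 𝓕 (n + 1) → QDeg φ 𝓕 n :=
  Quotient.map Y.d fun a a' ha => by
    filter_upwards [ha] with ω h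
    rw [(φ ω).d, (φ ω).d, h]

/-- The product on the quotient. -/
def qmul {i j k : ℕ} (hk : i + j = k) : QDeg φ 𝓕 i → QDeg φ 𝓕 j → QDeg φ 𝓕 k :=
  Quotient.map₂ (Y.mul hk) fun a a' ha b b' hb => by
    filter_upwards [ha, hb] with ω h h'
    rw [(φ ω).mul, (φ ω).mul, h, h']

/-- The operations on the quotient. -/
def qop {n : ℕ} (p : T.Op n) (v : Fin n → QDeg φ 𝓕 0) : QDeg φ 𝓕 0 :=
  qmk φ 𝓕 (Y.op p fun i => (qmk_surj (v i)).choose)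

/-- The operation is defined through chosen representatives. Arities are finite, so the finitely
many eventual equalities between representatives hold simultaneously. -/
lemma qop_mk {n : ℕ} (p : T.Op n) (v : Fin n → Y.deg 0) :
    qop φ 𝓕 p (fun i => qmk φ 𝓕 (v i)) = qmk φ 𝓕 (Y.op p v) := by
  refine qmk_eq.2 ?_
  have h : ∀ i, ∀ᶠ ω in 𝓕, (φ ω).f 0 (qmk_surj (qmk φ 𝓕 (v i))).choose = (φ ω).f 0 (v i) :=
    fun i => qmk_eq.1 (qmk_surj (qmk φ 𝓕 (v i))).choose_spec
  filter_upwards [Filter.eventually_all.2 h] with ω hω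
  rw [(φ ω).op, (φ ω).op]
  exact congrArg _ (funext hω)

instance (n : ℕ) : Add (QDeg φ 𝓕 n) := ⟨qadd φ 𝓕⟩
instance (n : ℕ) : Zero (QDeg φ 𝓕 n) := ⟨qmk φ 𝓕 (Y.zero n)⟩
instance (n : ℕ) : Neg (QDeg φ 𝓕 n) := ⟨qsmul φ 𝓕 (-1)⟩

instance (n : ℕ) : AddCommGroup (QDeg φ 𝓕 n) where
  add_assoc x y z := by
    obtain ⟨a, rfl⟩ := qmk_surj x
    obtain ⟨b, rfl⟩ := qmk_surj y
    obtain ⟨c, rfl⟩ := qmk_surj z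
    exact qsound fun ω => by simp only [(φ ω).add, add_assoc]
  zero_add x := by
    obtain ⟨a, rfl⟩ := qmk_surj x
    exact qsound fun ω => by simp only [(φ ω).add, (φ ω).zero, zero_add]
  add_zero x := by
    obtain ⟨a, rfl⟩ := qmk_surj x
    exact qsound fun ω => by simp only [(φ ω).add, (φ ω).zero, add_zero]
  add_comm x y := by
    obtain ⟨a, rfl⟩ := qmk_surj x
    obtain ⟨b, rfl⟩ := qmk_surj y
    exact qsound fun ω => by simp only [(φ ω).add, add_comm]
  neg_add_cancel x := by
    obtain ⟨a, rfl⟩ := qmk_surj x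
    exact qsound fun ω => by
      simp only [(φ ω).add, (φ ω).smul, (φ ω).zero, neg_smul, one_smul, neg_add_cancel]
  nsmul := nsmulRec
  zsmul := zsmulRec

instance (n : ℕ) : Module ℚ (QDeg φ 𝓕 n) where
  smul := qsmul φ 𝓕
  one_smul x := by
    obtain ⟨a, rfl⟩ := qmk_surj x
    exact qsound fun ω => by simp only [(φ ω).smul, one_smul]
  mul_smul p q x := by
    obtain ⟨a, rfl⟩ := qmk_surj x
    exact qsound fun ω => by simp only [(φ ω).smul, mul_smul]
  smul_zero q := qsound fun ω => by simp only [(φ ω).smul, (φ ω).zero, smul_zero]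
  smul_add q x y := by
    obtain ⟨a, rfl⟩ := qmk_surj x
    obtain ⟨b, rfl⟩ := qmk_surj y
    exact qsound fun ω => by simp only [(φ ω).smul, (φ ω).add, smul_add]
  add_smul p q x := by
    obtain ⟨a, rfl⟩ := qmk_surj x
    exact qsound fun ω => by simp only [(φ ω).smul, (φ ω).add, add_smul]
  zero_smul x := by
    obtain ⟨a, rfl⟩ := qmk_surj x
    exact qsound fun ω => by simp only [(φ ω).smul, (φ ω).zero, zero_smul]

/-- The quotient, as graded data. -/
def quotData : GradedData T where
  deg := QDeg φ 𝓕
  d n := qd φ 𝓕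
  d_add n x y := by
    obtain ⟨a, rfl⟩ := qmk_surj x
    obtain ⟨b, rfl⟩ := qmk_surj y
    exact qsound fun ω => by simp only [(φ ω).d, (φ ω).add, map_add]
  d_d n x := by
    obtain ⟨a, rfl⟩ := qmk_surj x
    exact qsound fun ω => by simp only [(φ ω).d, (φ ω).zero, dif_dif]
  mul h := qmul φ 𝓕 h
  one := qmk φ 𝓕 Y.one
  mul_add h x y z := by
    obtain ⟨a, rfl⟩ := qmk_surj x
    obtain ⟨b, rfl⟩ := qmk_surj y
    obtain ⟨c, rfl⟩ := qmk_surj z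
    exact qsound fun ω => by simp only [(φ ω).mul, (φ ω).add, (B ω).mul_add]
  add_mul h x y z := by
    obtain ⟨a, rfl⟩ := qmk_surj x
    obtain ⟨b, rfl⟩ := qmk_surj y
    obtain ⟨c, rfl⟩ := qmk_surj z
    exact qsound fun ω => by simp only [(φ ω).mul, (φ ω).add, (B ω).add_mul]
  one_mul x := by
    obtain ⟨a, rfl⟩ := qmk_surj x
    exact qsound fun ω => by simp only [(φ ω).mul, (φ ω).one, (B ω).one_mul]
  mul_assoc hij hjk h h' x y z := by
    obtain ⟨a, rfl⟩ := qmk_surj x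
    obtain ⟨b, rfl⟩ := qmk_surj y
    obtain ⟨c, rfl⟩ := qmk_surj z
    exact qsound fun ω => by simp only [(φ ω).mul, (B ω).mul_assoc hij hjk h h']
  mul_comm h h' x y := by
    obtain ⟨a, rfl⟩ := qmk_surj x
    obtain ⟨b, rfl⟩ := qmk_surj y
    exact qsound fun ω => by
      rw [(φ ω).mul, (φ ω).smul, (φ ω).mul, (B ω).mul_comm h h']
  leibniz h h₁ h₂ x y := by
    obtain ⟨a, rfl⟩ := qmk_surj x
    obtain ⟨b, rfl⟩ := qmk_surj y
    exact qsound fun ω => by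
      rw [(φ ω).d, (φ ω).mul, (φ ω).add, (φ ω).smul, (φ ω).mul, (φ ω).mul, (φ ω).d, (φ ω).d]
      exact (B ω).leibniz' h h₁ h₂ _ _
  leibniz_zero_left x y := by
    obtain ⟨a, rfl⟩ := qmk_surj x
    obtain ⟨b, rfl⟩ := qmk_surj y
    exact qsound fun ω => by
      rw [(φ ω).d, (φ ω).mul, (φ ω).mul, (φ ω).d]
      exact (B ω).leibniz_left _ _
  leibniz_zero_right x y := by
    obtain ⟨a, rfl⟩ := qmk_surj x
    obtain ⟨b, rfl⟩ := qmk_surj y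
    exact qsound fun ω => by
      rw [(φ ω).d, (φ ω).mul, (φ ω).mul, (φ ω).d]
      exact (B ω).leibniz_right _ _
  str :=
    { op := qop φ 𝓕
      op_var := fun i v => by
        obtain ⟨v, rfl⟩ := qmk_surj_pi v
        rw [qop_mk]
        exact qsound fun ω => by rw [(φ ω).op]; exact (B ω).str.op_var _ _
      op_comp := fun p g v => by
        obtain ⟨v, rfl⟩ := qmk_surj_pi v
        simp only [qop_mk]
        exact qsound fun ω => by simp only [(φ ω).op]; exact (B ω).str.op_comp _ _ _ }
  str_add x y := by
    obtain ⟨a, rfl⟩ := qmk_surj x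
    obtain ⟨b, rfl⟩ := qmk_surj y
    have : ![qmk φ 𝓕 a, qmk φ 𝓕 b] = fun i => qmk φ 𝓕 (![a, b] i) := by
      funext i; fin_cases i <;> rfl
    rw [this]
    refine (qop_mk φ 𝓕 _ _).trans (qsound fun ω => ?_)
    rw [(φ ω).op, (φ ω).add, ← (B ω).str_add]
    congr 1
    funext i; fin_cases i <;> rfl
  str_mul x y := by
    obtain ⟨a, rfl⟩ := qmk_surj x
    obtain ⟨b, rfl⟩ := qmk_surj y
    have : ![qmk φ 𝓕 a, qmk φ 𝓕 b] = fun i => qmk φ 𝓕 (![a, b] i) := by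
      funext i; fin_cases i <;> rfl
    rw [this]
    refine (qop_mk φ 𝓕 _ _).trans (qsound fun ω => ?_)
    rw [(φ ω).op, (φ ω).mul, ← (B ω).str_mul]
    congr 1
    funext i; fin_cases i <;> rfl
  str_one := by
    have : (![] : Fin 0 → QDeg φ 𝓕 0) = fun i => qmk φ 𝓕 ((![] : Fin 0 → Y.deg 0) i) := by
      funext i; exact i.elim0
    rw [this]
    refine (qop_mk φ 𝓕 _ _).trans (qsound fun ω => ?_)
    rw [(φ ω).op, (φ ω).one, ← (B ω).str_one]
    congr 1
    funext i; exact i.elim0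
  str_smul q x := by
    obtain ⟨a, rfl⟩ := qmk_surj x
    have : ![qmk φ 𝓕 a] = fun i => qmk φ 𝓕 (![a] i) := by
      funext i; fin_cases i; rfl
    rw [this]
    refine (qop_mk φ 𝓕 _ _).trans (qsound fun ω => ?_)
    rw [(φ ω).op, (φ ω).smul, ← (B ω).str_smul]
    congr 1
    funext i; fin_cases i; rfl

/-- The `T`-DGA obtained from a raw structure by identifying elements whose values are eventually
equal. -/
def quot : TDGA T := (quotData φ 𝓕).toTDGA

/-- The quotient map to `Raw.quot`. -/
def toQuot (n : ℕ) (a : Y.deg n) : (quot φ 𝓕).deg n := qmk φ 𝓕 a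

variable {φ 𝓕}

lemma toQuot_eq {n : ℕ} {a b : Y.deg n} :
    toQuot φ 𝓕 n a = toQuot φ 𝓕 n b ↔ ∀ᶠ ω in 𝓕, (φ ω).f n a = (φ ω).f n b := qmk_eq

lemma toQuot_surj {n : ℕ} (x : (quot φ 𝓕).deg n) : ∃ a, toQuot φ 𝓕 n a = x := qmk_surj x

variable (φ 𝓕)

/-- The quotient map preserves all operations. -/
def toQuotEval : Eval Y (quot φ 𝓕) where
  f := toQuot φ 𝓕
  zero _ := rfl
  add _ _ := rfl
  smul _ _ := rfl
  d a := ((quotData φ 𝓕).dif_eq _ (qmk φ 𝓕 a)).symm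
  mul _ _ _ := rfl
  one := rfl
  op p a := (qop_mk φ 𝓕 p a).symm

/-- A map of raw structures which is compatible with the identifications induces a morphism. -/
def quotDesc {D : TDGA T} (ψ : Eval Y D)
    (h : ∀ n (a b : Y.deg n), (∀ᶠ ω in 𝓕, (φ ω).f n a = (φ ω).f n b) → ψ.f n a = ψ.f n b) :
    quot φ 𝓕 ⟶ D :=
  homMk (fun n => Quotient.lift (ψ.f n) (h n))
    (fun n x y => by
      obtain ⟨a, rfl⟩ := toQuot_surj x
      obtain ⟨b, rfl⟩ := toQuot_surj y
      exact ψ.add a b)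
    (fun n x => by
      obtain ⟨a, rfl⟩ := toQuot_surj x
      exact (congrArg (Quotient.lift (ψ.f n) (h n)) ((toQuotEval φ 𝓕).d a).symm).trans (ψ.d a))
    (fun hk x y => by
      obtain ⟨a, rfl⟩ := toQuot_surj x
      obtain ⟨b, rfl⟩ := toQuot_surj y
      exact ψ.mul hk a b)
    (fun p x => by
      obtain ⟨a, rfl⟩ := qmk_surj_pi x
      exact (congrArg (Quotient.lift (ψ.f 0) (h 0)) ((toQuotEval φ 𝓕).op p a).symm).trans (ψ.op p a))

end Raw

/-! ### Universal `T`-DGAs -/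

/-- Formal expressions in the operations of a `T`-DGA. -/
inductive Term (T : QTheory.{u}) (G : ℕ → Type u) : ℕ → Type u
  | gen {n : ℕ} : G n → Term T G n
  | zero (n : ℕ) : Term T G n
  | add {n : ℕ} : Term T G n → Term T G n → Term T G n
  | smul {n : ℕ} : ℚ → Term T G n → Term T G n
  | d {n : ℕ} : Term T G (n + 1) → Term T G n
  | mul {i j k : ℕ} : i + j = k → Term T G i → Term T G j → Term T G k
  | one : Term T G 0
  | op {n : ℕ} : T.Op n → (Fin n → Term T G 0) → Term T G 0

/-- The raw structure on formal expressions. -/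
def termRaw (T : QTheory.{u}) (G : ℕ → Type u) : Raw T where
  deg := Term T G
  zero := .zero
  add := .add
  smul := .smul
  d := .d
  mul := .mul
  one := .one
  op := .op

/-- The value of a formal expression. -/
def Term.eval {G : ℕ → Type u} {B : TDGA T} (v : ∀ n, G n → B.deg n) :
    ∀ {n : ℕ}, Term T G n → B.deg n
  | _, .gen g => v _ g
  | _, .zero _ => 0
  | _, .add a b => eval v a + eval v b
  | _, .smul q a => q • eval v a
  | _, .d a => B.dif _ (eval v a)
  | _, .mul h a b => B.mul h (eval v a) (eval v b)
  | _, .one => B.one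
  | _, .op p a => B.str.op p fun i => eval v (a i)

/-- Evaluation of formal expressions preserves all operations. -/
def termVal {G : ℕ → Type u} {B : TDGA T} (v : ∀ n, G n → B.deg n) : Raw.Eval (termRaw T G) B where
  f _ a := Term.eval v a
  zero _ := rfl
  add _ _ := rfl
  smul _ _ := rfl
  d _ := rfl
  mul _ _ _ := rfl
  one := rfl
  op _ _ := rfl

section Univ

variable {G : ℕ → Type u} (R : ∀ B : TDGA T, (∀ n, G n → B.deg n) → Prop)

/-- The models of a property `R` of families of elements in `T`-DGAs. -/
def Model : Type (u + 1) := Σ B : TDGA T, { v : ∀ n, G n → B.deg n // R B v }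

/-- The evaluation in a model. -/
def Model.eval (ω : Model R) : Raw.Eval (termRaw T G) ω.1 := termVal ω.2.1

/-- The `T`-DGA generated by `G` in which exactly those equations hold that hold in all models
of `R`. -/
def univ : TDGA T := Raw.quot (Model.eval R) ⊤

/-- The generators. -/
def univGen (n : ℕ) (g : G n) : (univ R).deg n := Raw.toQuot (Model.eval R) ⊤ n (Term.gen g)

variable {R}

/-- The universal property of `univ`. -/
def univDesc {B : TDGA T} (v : ∀ n, G n → B.deg n) (hv : R B v) : univ R ⟶ B :=
  Raw.quotDesc _ _ (termVal v) fun n a b h => by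
    rw [Filter.eventually_top] at h
    exact h ⟨B, v, hv⟩

/-- True by construction: to prove an identity in the universal object one evaluates it in each
model. The models form a large type, but the quotient is one of the small type of terms. -/
lemma univ_ext {n : ℕ} {x y : (univ R).deg n}
    (h : ∀ (B : TDGA T) (v : ∀ n, G n → B.deg n) (hv : R B v),
      app (univDesc v hv) n x = app (univDesc v hv) n y) : x = y := by
  obtain ⟨a, rfl⟩ := Raw.toQuot_surj x
  obtain ⟨b, rfl⟩ := Raw.toQuot_surj y
  exact Raw.toQuot_eq.2 (Filter.eventually_top.2 fun ω => h ω.1 ω.2.1 ω.2.2)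

/-- Graded subsets closed under all operations. -/
structure IsSub (B : TDGA T) (S : ∀ n, B.deg n → Prop) : Prop where
  zero : ∀ n, S n 0
  add : ∀ {n} {a b : B.deg n}, S n a → S n b → S n (a + b)
  smul : ∀ {n} (q : ℚ) {a : B.deg n}, S n a → S n (q • a)
  d : ∀ {n} {a : B.deg (n + 1)}, S (n + 1) a → S n (B.dif n a)
  mul : ∀ {i j k : ℕ} (h : i + j = k) {a : B.deg i} {b : B.deg j}, S i a → S j b →
    S k (B.mul h a b)
  one : S 0 B.one
  op : ∀ {n : ℕ} (p : T.Op n) {a : Fin n → B.deg 0}, (∀ i, S 0 (a i)) → S 0 (B.str.op p a)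

lemma univ_induction {S : ∀ n, (univ R).deg n → Prop} (hS : IsSub (univ R) S)
    (hgen : ∀ n g, S n (univGen R n g)) {n : ℕ} (x : (univ R).deg n) : S n x := by
  obtain ⟨a, rfl⟩ := Raw.toQuot_surj x
  change Term T G n at a
  induction a with
  | gen g => exact hgen _ g
  | zero n => exact hS.zero n
  | add a b ha hb => exact hS.add ha hb
  | smul q a ha => exact hS.smul q ha
  | d a ha =>
    -- The class of the term `d a` is the differential of the class of `a` only up to a
    -- propositional equality, hence the cast; likewise for operations below.
    have := (Raw.toQuotEval (Model.eval R) ⊤).d a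
    exact cast (congrArg _ this.symm) (hS.d ha)
  | mul h a b ha hb => exact hS.mul h ha hb
  | one => exact hS.one
  | op p a ha =>
    have := (Raw.toQuotEval (Model.eval R) ⊤).op p a
    exact cast (congrArg _ this.symm) (hS.op p ha)

lemma isSub_eq {A B : TDGA T} (f g : A ⟶ B) : IsSub A fun n a => app f n a = app g n a where
  zero n := by rw [map_zero, map_zero]
  add h h' := by rw [map_add, map_add, h, h']
  smul q a h := by rw [map_smul, map_smul, h]
  d h := by rw [app_dif, app_dif, h]
  mul hk a b h h' := by rw [app_mul, app_mul, h, h']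
  one := by rw [app_one, app_one]
  op p a h := by rw [app_op, app_op]; exact congrArg _ (funext h)

lemma isSub_range {A B : TDGA T} (f : A ⟶ B) : IsSub B fun n b => ∃ a, app f n a = b where
  zero n := ⟨0, map_zero _⟩
  add := by rintro n _ _ ⟨a, rfl⟩ ⟨b, rfl⟩; exact ⟨a + b, map_add _ _ _⟩
  smul := by rintro n q _ ⟨a, rfl⟩; exact ⟨q • a, map_smul _ _ _⟩
  d := by rintro n _ ⟨a, rfl⟩; exact ⟨_, app_dif _ _ _⟩
  mul := by rintro i j k h _ _ ⟨a, rfl⟩ ⟨b, rfl⟩; exact ⟨_, app_mul _ h _ _⟩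
  one := ⟨_, app_one f⟩
  op := by
    intro n p a h
    choose b hb using h
    exact ⟨A.str.op p b, by rw [app_op]; exact congrArg _ (funext hb)⟩

lemma univ_hom_ext {B : TDGA T} {f g : univ R ⟶ B}
    (h : ∀ n x, app f n (univGen R n x) = app g n (univGen R n x)) : f = g :=
  hom_ext fun _ => univ_induction (isSub_eq f g) h

end Univ

end TDGA

/-! ### Limits and colimits of `T`-DGAs -/

namespace TDGA

section Lim

variable {J : Type u} [SmallCategory J] (F : J ⥤ TDGA T)

/-- Compatible families of elements. -/
def limRaw : Raw T where
  deg n := { x : ∀ j, (F.obj j).deg n // ∀ {i j} (f : i ⟶ j), app (F.map f) n (x i) = x j }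
  zero n := ⟨fun _ => 0, fun _ => map_zero _⟩
  add a b := ⟨fun j => a.1 j + b.1 j, fun f => by rw [map_add, a.2, b.2]⟩
  smul q a := ⟨fun j => q • a.1 j, fun f => by rw [map_smul, a.2]⟩
  d a := ⟨fun j => (F.obj j).dif _ (a.1 j), fun f => by rw [app_dif, a.2]⟩
  mul h a b := ⟨fun j => (F.obj j).mul h (a.1 j) (b.1 j), fun f => by rw [app_mul, a.2, b.2]⟩
  one := ⟨fun j => (F.obj j).one, fun f => app_one _⟩
  op p a := ⟨fun j => (F.obj j).str.op p fun i => (a i).1 j, fun f => by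
    rw [app_op]; exact congrArg _ (funext fun i => (a i).2 f)⟩

/-- The components of a compatible family. -/
def limEval (j : J) : Raw.Eval (limRaw F) (F.obj j) where
  f _ x := x.1 j
  zero _ := rfl
  add _ _ := rfl
  smul _ _ := rfl
  d _ := rfl
  mul _ _ _ := rfl
  one := rfl
  op _ _ := rfl

/-- The limit of a diagram. -/
def lim : TDGA T := Raw.quot (limEval F) ⊤

/-- The projections of the limit. -/
def limπ (j : J) : lim F ⟶ F.obj j :=
  Raw.quotDesc _ _ (limEval F j) fun _ _ _ h => (Filter.eventually_top.1 h) j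

variable {F}

lemma lim_ext {n : ℕ} {x y : (lim F).deg n} (h : ∀ j, app (limπ F j) n x = app (limπ F j) n y) :
    x = y := by
  obtain ⟨a, rfl⟩ := Raw.toQuot_surj x
  obtain ⟨b, rfl⟩ := Raw.toQuot_surj y
  exact Raw.toQuot_eq.2 (Filter.eventually_top.2 h)

/-- The map into the limit, on elements. -/
def limLiftFun (s : Cone F) (n : ℕ) (a : s.pt.deg n) : (lim F).deg n :=
  Raw.toQuot (limEval F) ⊤ n (⟨fun j => app (leg s j) n a, fun f => by
    rw [← comp_app, leg_map]⟩ : (limRaw F).deg n)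

lemma limπ_limLiftFun (s : Cone F) (n : ℕ) (a : s.pt.deg n) (j : J) :
    app (limπ F j) n (limLiftFun s n a) = app (leg s j) n a := rfl

/-- The map into the limit. -/
def limLift (s : Cone F) : s.pt ⟶ lim F :=
  homMk (limLiftFun s)
    (fun n a b => lim_ext fun j => by simp only [map_add, limπ_limLiftFun])
    (fun n a => lim_ext fun j => by simp only [app_dif, limπ_limLiftFun])
    (fun h a b => lim_ext fun j => by simp only [app_mul, limπ_limLiftFun])
    (fun p a => lim_ext fun j => by
      rw [limπ_limLiftFun, app_op, app_op]; rfl)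

variable (F)

lemma limπ_map {i j : J} (f : i ⟶ j) : limπ F i ≫ F.map f = limπ F j :=
  hom_ext fun n x => by
    obtain ⟨a, rfl⟩ := Raw.toQuot_surj x
    exact a.2 f

/-- The limit cone. -/
def limCone : Cone F where
  pt := lim F
  π :=
    { app := limπ F
      naturality := fun i j f => (Category.id_comp (limπ F j)).trans (limπ_map F f).symm }

/-- The universal property of the limit. -/
def limIsLimit : IsLimit (limCone F) where
  lift := limLift
  fac _ _ := hom_ext fun _ _ => rfl
  uniq s m hm := hom_ext fun n a => lim_ext fun j => congr_app (hm j) n a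

instance : HasLimitsOfSize.{u, u} (TDGA T) where
  has_limits_of_shape _ _ := ⟨fun F => ⟨⟨⟨limCone F, limIsLimit F⟩⟩⟩⟩

/-- The property of a family of elements to come from a cocone. -/
def IsCoconeFamily (B : TDGA T) (v : ∀ n, (Σ j, (F.obj j).deg n) → B.deg n) : Prop :=
  ∃ s : ∀ j, F.obj j ⟶ B, (∀ {i j} (f : i ⟶ j), F.map f ≫ s j = s i) ∧
    ∀ n j (a : (F.obj j).deg n), v n ⟨j, a⟩ = app (s j) n a

/-- The colimit of a diagram. -/
def colim : TDGA T := univ (IsCoconeFamily F)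

/-- The maps into the colimit, on elements. -/
def colimιFun (j : J) (n : ℕ) (a : (F.obj j).deg n) : (colim F).deg n :=
  univGen (IsCoconeFamily F) n ⟨j, a⟩

/-- The maps out of the colimit. -/
def colimDesc {B : TDGA T} {v} (hv : IsCoconeFamily F B v) : colim F ⟶ B := univDesc v hv

lemma colimDesc_ι {B : TDGA T} {v} (hv : IsCoconeFamily F B v) (j : J) (n : ℕ)
    (a : (F.obj j).deg n) :
    app (colimDesc F hv) n (colimιFun F j n a) = app (hv.choose j) n a := hv.choose_spec.2 n j a

lemma colim_ext {n : ℕ} {x y : (colim F).deg n}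
    (h : ∀ (B : TDGA T) (v) (hv : IsCoconeFamily F B v),
      app (colimDesc F hv) n x = app (colimDesc F hv) n y) : x = y := univ_ext h

/-- The maps into the colimit. -/
def colimι (j : J) : F.obj j ⟶ colim F :=
  homMk (colimιFun F j)
    (fun n a b => colim_ext F fun B v hv => by simp only [map_add, colimDesc_ι])
    (fun n a => colim_ext F fun B v hv => by simp only [app_dif, colimDesc_ι])
    (fun h a b => colim_ext F fun B v hv => by simp only [app_mul, colimDesc_ι])
    (fun p a => colim_ext F fun B v hv => by
      rw [colimDesc_ι, app_op, app_op]
      exact congrArg _ (funext fun i => (colimDesc_ι F hv j 0 (a i)).symm))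

lemma map_colimι {i j : J} (f : i ⟶ j) : F.map f ≫ colimι F j = colimι F i :=
  hom_ext fun n a => colim_ext F fun B v hv => by
    refine (colimDesc_ι F hv j n _).trans (Eq.trans ?_ (colimDesc_ι F hv i n a).symm)
    exact congr_app (hv.choose_spec.1 f) n a

/-- The colimit cocone. -/
def colimCocone : Cocone F := mkCocone (colimι F) (map_colimι F)

/-- The universal property of the colimit. -/
def colimIsColimit : IsColimit (colimCocone F) where
  desc s := univDesc (B := s.pt) (fun n x => app (coLeg s x.1) n x.2)
    ⟨coLeg s, map_coLeg s, fun _ _ _ => rfl⟩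
  fac _ _ := hom_ext fun _ _ => rfl
  uniq s m hm := univ_hom_ext fun n x => congr_app (hm x.1) n x.2

instance : HasColimitsOfSize.{u, u} (TDGA T) where
  has_colimits_of_shape _ _ := ⟨fun F => ⟨⟨⟨colimCocone F, colimIsColimit F⟩⟩⟩⟩

variable {F}

/-! ### Elements of filtered colimits -/

section Filtered

variable [IsFiltered J]

/-- Finitely many elements of the members of a filtered diagram can be moved to a single one. -/
lemma exists_common_stage {V : J → Type*} (tr : ∀ {i j}, (i ⟶ j) → V i → V j) {W : Type*}
    (ev : ∀ j, V j → W) (hev : ∀ {i j} (f : i ⟶ j) (y : V i), ev j (tr f y) = ev i y)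
    {α : Type*} [Finite α] (x : α → W) (hx : ∀ a, ∃ j y, ev j y = x a) :
    ∃ (j : J) (y : α → V j), ∀ a, ev j (y a) = x a := by
  classical
  cases nonempty_fintype α
  choose j y hy using hx
  obtain ⟨k, hk⟩ := IsFiltered.sup_objs_exists (Finset.univ.image j)
  have f : ∀ a, j a ⟶ k := fun a =>
    (hk (Finset.mem_image_of_mem j (Finset.mem_univ a))).some
  exact ⟨k, fun a => tr (f a) (y a), fun a => by rw [hev, hy]⟩

/-- Every operation has finitely many arguments, and these can be moved to a common stage. Applied
to the universal colimit this shows that all its elements come from a stage. -/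
lemma isSub_stages (c : Cocone F) :
    IsSub c.pt fun n x => ∃ j y, app (coLeg c j) n y = x := by
  have tr : ∀ {i j} (f : i ⟶ j) (n : ℕ) (y : (F.obj i).deg n),
      app (coLeg c j) n (app (F.map f) n y) = app (coLeg c i) n y := fun f n y => by
    rw [← comp_app, map_coLeg]
  have two : ∀ {m n : ℕ} (a : c.pt.deg m) (b : c.pt.deg n), (∃ j y, app (coLeg c j) m y = a) →
      (∃ j y, app (coLeg c j) n y = b) →
      ∃ j y z, app (coLeg c j) m y = a ∧ app (coLeg c j) n z = b := by
    rintro m n _ _ ⟨i, y, rfl⟩ ⟨j, z, rfl⟩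
    exact ⟨IsFiltered.max i j, app (F.map (IsFiltered.leftToMax i j)) m y,
      app (F.map (IsFiltered.rightToMax i j)) n z, tr _ _ _, tr _ _ _⟩
  obtain ⟨j₀⟩ : Nonempty J := IsFiltered.nonempty
  refine ⟨fun n => ⟨j₀, 0, map_zero _⟩, fun h h' => ?_, fun q _ h => ?_, fun h => ?_,
    fun hk _ _ h h' => ?_, ⟨j₀, _, app_one _⟩, fun {m} p a h => ?_⟩
  · obtain ⟨j, y, z, rfl, rfl⟩ := two _ _ h h'
    exact ⟨j, _, map_add _ _ _⟩
  · obtain ⟨j, y, rfl⟩ := h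
    exact ⟨j, _, map_smul _ _ _⟩
  · obtain ⟨j, y, rfl⟩ := h
    exact ⟨j, _, app_dif _ _ _⟩
  · obtain ⟨j, y, z, rfl, rfl⟩ := two _ _ h h'
    exact ⟨j, _, app_mul _ hk _ _⟩
  · obtain ⟨j, y, hy⟩ := exists_common_stage (V := fun j => (F.obj j).deg 0)
      (fun f => app (F.map f) 0) (fun j => app (coLeg c j) 0) (fun f y => tr f 0 y) a h
    exact ⟨j, (F.obj j).str.op p y, by rw [app_op]; exact congrArg _ (funext hy)⟩

lemma exists_rep_of_isColimit {c : Cocone F} (hc : IsColimit c) {n : ℕ} (x : c.pt.deg n) :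
    ∃ j y, app (coLeg c j) n y = x := by
  let e := (colimIsColimit F).coconePointUniqueUpToIso hc
  have he : x = app e.hom n (app e.inv n x) := by
    rw [← comp_app, e.inv_hom_id]; rfl
  obtain ⟨j, y, hy⟩ : ∃ j y, app (colimι F j) n y = app e.inv n x :=
    univ_induction (isSub_stages (colimCocone F)) (fun n g => ⟨g.1, g.2, rfl⟩) _
  refine ⟨j, y, ?_⟩
  rw [he, ← hy]
  refine Eq.symm ?_
  exact congr_app ((colimIsColimit F).comp_coconePointUniqueUpToIso_hom hc j).symm n y

variable (J) in
/-- Cocones over finite parts of a category. -/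
structure FinCocone where
  /-- the apex -/
  pt : J
  /-- the objects -/
  objs : Finset J
  /-- the morphisms -/
  homs : Finset (Σ i j : J, i ⟶ j)
  /-- the legs -/
  leg : ∀ i, i ∈ objs → (i ⟶ pt)
  w : ∀ {i j : J} (f : i ⟶ j) (hi : i ∈ objs) (hj : j ∈ objs), ⟨i, j, f⟩ ∈ homs →
    f ≫ leg j hj = leg i hi

lemma FinCocone.exists (O : Finset J) (H : Finset (Σ i j : J, i ⟶ j)) :
    ∃ ω : FinCocone J, ω.objs = O ∧ ω.homs = H := by
  classical
  -- Filteredness applies to morphisms between listed objects, so the endpoints of the morphisms in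
  -- `H` are added first.
  let O' : Finset J := O ∪ H.image (fun h => h.1) ∪ H.image (fun h => h.2.1)
  have h1 : ∀ h ∈ H, h.1 ∈ O' := fun h hh =>
    Finset.mem_union_left _ (Finset.mem_union_right _ (Finset.mem_image_of_mem (fun h => h.1) hh))
  have h2 : ∀ h ∈ H, h.2.1 ∈ O' := fun h hh =>
    Finset.mem_union_right _ (Finset.mem_image_of_mem (fun h => h.2.1) hh)
  have h0 : ∀ i ∈ O, i ∈ O' := fun i hi =>
    Finset.mem_union_left _ (Finset.mem_union_left _ hi)
  let H' : Finset (Σ' (X Y : J) (_ : X ∈ O') (_ : Y ∈ O'), X ⟶ Y) :=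
    H.attach.image fun h => ⟨h.1.1, h.1.2.1, h1 _ h.2, h2 _ h.2, h.1.2.2⟩
  obtain ⟨k, leg, hk⟩ := IsFiltered.sup_exists O' H'
  exact ⟨⟨k, O, H, fun i hi => leg (h0 i hi), fun {i j} f hi hj hf => hk _ _
    (Finset.mem_image.2 ⟨⟨⟨i, j, f⟩, hf⟩, Finset.mem_attach _ _, rfl⟩)⟩, rfl, rfl⟩

variable (J) in
/-- The filter of cocones over sufficiently large finite parts. -/
def finFilter : Filter (FinCocone J) :=
  Filter.comap (fun ω => (ω.objs, ω.homs)) Filter.atTop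

/-- Properness is what allows an eventual equality in the reduced product to be observed at an
actual object of the diagram. -/
instance : (finFilter J).NeBot := by
  classical
  refine Filter.comap_neBot fun t ht => ?_
  obtain ⟨⟨O, H⟩, h⟩ := (Filter.atTop.nonempty_of_mem ht)
  obtain ⟨ω, rfl, rfl⟩ := FinCocone.exists O H
  exact ⟨ω, h⟩

lemma finFilter_objs (j : J) : ∀ᶠ ω in finFilter J, j ∈ ω.objs := by
  classical
  refine Filter.Eventually.comap (p := fun x : Finset J × Finset (Σ i j : J, i ⟶ j) => j ∈ x.1) ?_ _
  filter_upwards [Filter.eventually_ge_atTop (({j}, ∅) : Finset J × Finset (Σ i j : J, i ⟶ j))]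
    with x hx
  exact hx.1 (Finset.mem_singleton_self j)

lemma finFilter_homs {i j : J} (f : i ⟶ j) : ∀ᶠ ω in finFilter J, ⟨i, j, f⟩ ∈ ω.homs := by
  classical
  refine Filter.Eventually.comap
    (p := fun x : Finset J × Finset (Σ i j : J, i ⟶ j) => ⟨i, j, f⟩ ∈ x.2) ?_ _
  filter_upwards [Filter.eventually_ge_atTop
    ((∅, {⟨i, j, f⟩}) : Finset J × Finset (Σ i j : J, i ⟶ j))] with x hx
  exact hx.2 (Finset.mem_singleton_self _)

/-- Families of elements of the apexes. -/
def prodRaw {Ω : Type u} (B : Ω → TDGA T) : Raw T where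
  deg n := ∀ ω, (B ω).deg n
  zero n := 0
  add a b := a + b
  smul q a := q • a
  d a := fun ω => (B ω).dif _ (a ω)
  mul h a b := fun ω => (B ω).mul h (a ω) (b ω)
  one := fun ω => (B ω).one
  op p a := fun ω => (B ω).str.op p fun i => a i ω

/-- The components of a family. -/
def prodEval {Ω : Type u} (B : Ω → TDGA T) (ω : Ω) : Raw.Eval (prodRaw B) (B ω) where
  f _ x := x ω
  zero _ := rfl
  add _ _ := rfl
  smul _ _ := rfl
  d _ := rfl
  mul _ _ _ := rfl
  one := rfl
  op _ _ := rfl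

/-- The reduced product of `T`-DGAs along a filter. -/
def reducedProd {Ω : Type u} (B : Ω → TDGA T) (𝓕 : Filter Ω) : TDGA T := Raw.quot (prodEval B) 𝓕

variable (F) in
open Classical in
/-- The family of the images of an element at the apexes. -/
def germFam (j : J) (n : ℕ) (a : (F.obj j).deg n) :
    (prodRaw fun ω : FinCocone J => F.obj ω.pt).deg n :=
  fun ω => if h : j ∈ ω.objs then app (F.map (ω.leg j h)) n a else 0

variable (F) in
/-- The map into the reduced product, on elements. -/
def germFun (j : J) (n : ℕ) (a : (F.obj j).deg n) :
    (reducedProd (fun ω : FinCocone J => F.obj ω.pt) (finFilter J)).deg n :=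
  Raw.toQuot _ _ n (germFam F j n a)

lemma germFam_of_mem {j : J} {ω : FinCocone J} (h : j ∈ ω.objs) (n : ℕ) (a : (F.obj j).deg n) :
    germFam F j n a ω = app (F.map (ω.leg j h)) n a := dif_pos h

variable (F) in
/-- The map into the reduced product. -/
def germ (j : J) :
    F.obj j ⟶ reducedProd (fun ω : FinCocone J => F.obj ω.pt) (finFilter J) :=
  homMk (germFun F j)
    (fun n a b => by
      refine Raw.toQuot_eq.2 ((finFilter_objs j).mono fun ω h => ?_)
      change germFam F j n (a + b) ω = germFam F j n a ω + germFam F j n b ω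
      simp only [germFam_of_mem h, map_add])
    (fun n a => by
      refine (Raw.toQuot_eq.2 ((finFilter_objs j).mono fun ω h => ?_)).trans
        ((Raw.toQuotEval (prodEval fun ω : FinCocone J => F.obj ω.pt) (finFilter J)).d
          (germFam F j (n + 1) a))
      change germFam F j n _ ω = (F.obj ω.pt).dif n (germFam F j (n + 1) a ω)
      simp only [germFam_of_mem h, app_dif])
    (fun {i l k} hk a b => by
      refine Raw.toQuot_eq.2 ((finFilter_objs j).mono fun ω h => ?_)
      change germFam F j k _ ω =
        (F.obj ω.pt).mul hk (germFam F j i a ω) (germFam F j l b ω)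
      simp only [germFam_of_mem h, app_mul])
    (fun {m} p a => by
      refine (Raw.toQuot_eq.2 ((finFilter_objs j).mono fun ω h => ?_)).trans
        ((Raw.toQuotEval (prodEval fun ω : FinCocone J => F.obj ω.pt) (finFilter J)).op p
          (fun i => germFam F j 0 (a i)))
      change germFam F j 0 _ ω = (F.obj ω.pt).str.op p fun i => germFam F j 0 (a i) ω
      simp only [germFam_of_mem h, app_op])

lemma germ_comp {i j : J} (f : i ⟶ j) : F.map f ≫ germ F j = germ F i := by
  refine hom_ext fun n a => Raw.toQuot_eq.2 ?_
  filter_upwards [finFilter_objs i, finFilter_objs j, finFilter_homs f] with ω hi hj hf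
  change germFam F j n (app (F.map f) n a) ω = germFam F i n a ω
  rw [germFam_of_mem hi, germFam_of_mem hj, ← comp_app, ← F.map_comp, ω.w f hi hj hf]

/-- The colimit is known only by its universal property, so it is tested on a single cocone: `germ`
sends an element to the family of its images at the apexes of finite cocones, in the reduced product
over these. Elements equal in the colimit have equal germs, hence equal images at some apex whose
cocone involves `j`, and the leg from `j` is the transition map sought. -/
lemma eq_of_isColimit {c : Cocone F} (hc : IsColimit c) {n : ℕ} {j : J} {y z : (F.obj j).deg n}
    (h : app (coLeg c j) n y = app (coLeg c j) n z) :
    ∃ (k : J) (f : j ⟶ k), app (F.map f) n y = app (F.map f) n z := by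
  let s : Cocone F := mkCocone (germ F) germ_comp
  have h' : app (germ F j) n y = app (germ F j) n z := by
    have e : coLeg c j ≫ hc.desc s = germ F j := hc.fac s j
    rw [← e]
    exact congrArg (app (hc.desc s) n) h
  obtain ⟨ω, h1, h2⟩ := ((Raw.toQuot_eq.1 h').and (finFilter_objs j)).exists
  change germFam F j n y ω = germFam F j n z ω at h1
  rw [germFam_of_mem h2, germFam_of_mem h2] at h1
  exact ⟨_, _, h1⟩

end Filtered

end Lim

variable (T) in
/-- The functor taking the degree `0` part. -/
def degZero : TDGA T ⥤ TAlg T where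
  obj A := A.alg0
  map f := map0 f

end TDGA

/-! ### T-algebras as a coreflective subcategory of T-DGAs -/

namespace TAlg

open TDGA

/-- The component in degree `n` of the morphism from a `T`-algebra given by its degree `0` part. -/
def inclDescFun {B : TAlg T} {A : TDGA T} (g : B ⟶ A.alg0) : ∀ n, B.toTDGA.deg n → A.deg n
  | 0 => fun b => Hom.toFun g b
  | _ + 1 => fun _ => 0

/-- The morphism from a `T`-algebra given by its degree `0` part. -/
def inclDesc {B : TAlg T} {A : TDGA T} (g : B ⟶ A.alg0) : (incl T).obj B ⟶ A :=
  homMk (A := B.toTDGA) (inclDescFun g)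
    (fun n a b => by
      cases n
      · exact (toFun_add g a b).trans (A.alg0_add _ _)
      · exact (add_zero (0 : A.deg _)).symm)
    (fun n a => by
      refine Eq.trans ?_ (map_zero (A.dif n)).symm
      cases n
      · exact (toFun_zero g).trans A.alg0_zero
      · rfl)
    (fun {i j k} h a b => by
      obtain _ | k := k
      · obtain rfl : i = 0 := by omega
        obtain rfl : j = 0 := by omega
        exact (toFun_mul g a b).trans (A.alg0_mul _ _)
      · obtain _ | i := i
        · obtain rfl : j = k + 1 := by omega
          exact (A.mul_zero h _).symm
        · exact (A.zero_mul h _).symm)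
    (fun p a => toFun_op g p a)

instance (B : TAlg T) (n : ℕ) : Subsingleton (((incl T).obj B).deg (n + 1)) :=
  inferInstanceAs (Subsingleton PUnit)

lemma incl_hom_ext {B : TAlg T} {A : TDGA T} {f g : (incl T).obj B ⟶ A}
    (h : map0 f = map0 g) : f = g :=
  TDGA.hom_ext fun n b => by
    obtain _ | n := n
    · exact congr_toFun h b
    · rw [Subsingleton.elim b 0, map_zero, map_zero]

/-- The functor `incl` is left adjoint to taking the degree `0` part. -/
def inclAdj : incl T ⊣ degZero T :=
  Adjunction.mkOfHomEquiv
    { homEquiv := fun B A =>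
        { toFun := fun f => (map0 f : B ⟶ A.alg0)
          invFun := inclDesc
          left_inv := fun f => incl_hom_ext rfl
          right_inv := fun g => rfl }
      homEquiv_naturality_left_symm := fun f g => incl_hom_ext rfl
      homEquiv_naturality_right := fun f g => rfl }

instance : (incl T).Full where
  map_surjective {A B} f := ⟨map0 f, incl_hom_ext rfl⟩

instance : (incl T).Faithful where
  map_injective {A B} f g h := by
    have h1 : map0 ((incl T).map f) = map0 ((incl T).map g) := by rw [h]
    exact h1

instance : Coreflective (incl T) where
  R := degZero T
  adj := inclAdj

instance : HasColimitsOfSize.{u, u} (TAlg T) := hasColimits_of_coreflective (incl T)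

section Filtered

variable {J : Type u} [SmallCategory J] [IsFiltered J] {F : J ⥤ TAlg T} {c : Cocone F}

/-- As a left adjoint, `incl` preserves colimits, so this is the degree 0 case of the result for
T-DGAs. -/
lemma exists_rep_of_isColimit (hc : IsColimit c) (x : c.pt) :
    ∃ j y, Hom.toFun (coLeg c j) y = x :=
  have := (inclAdj (T := T)).isLeftAdjoint
  TDGA.exists_rep_of_isColimit (isColimitOfPreserves (incl T) hc) (n := 0) x

lemma eq_of_isColimit (hc : IsColimit c) {j : J} {y z : F.obj j}
    (h : Hom.toFun (coLeg c j) y = Hom.toFun (coLeg c j) z) :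
    ∃ (k : J) (f : j ⟶ k), Hom.toFun (F.map f) y = Hom.toFun (F.map f) z :=
  have := (inclAdj (T := T)).isLeftAdjoint
  TDGA.eq_of_isColimit (isColimitOfPreserves (incl T) hc) (n := 0) h

end Filtered

end TAlg

/-! ### Model structures from generating sets -/

section Generators

universe v w

open MorphismProperty

variable {D : Type w} [Category.{v} D] {W Fib I J : MorphismProperty D}

lemma hasLifting_of_llp {P : MorphismProperty D} {A B X Y : D} {i : A ⟶ B} {p : X ⟶ Y}
    (hi : P.llp i) (hp : P p) : HasLiftingProperty i p := hi p hp

/-- The factorisation `hfac` replaces the usual requirement that relative cell complexes on the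
generating trivial cofibrations be weak equivalences. A map lifting against `Fib` is a retract of
the first half of its own `hfac` factorisation, hence in `W`. Conversely, factor `f` as a map
lifting against `Fib` followed by a fibration; by two-out-of-three the fibration is trivial, so `f`
lifts against it and is a retract of the first half. -/
lemma llp_inf_weq_eq [W.HasTwoOutOfThreeProperty] [W.IsStableUnderRetracts]
    [HasFactorization Fib.llp Fib]
    (hfac : ∀ {A B : D} (f : A ⟶ B), ∃ (Z : D) (i : A ⟶ Z) (p : Z ⟶ B), W i ∧ Fib p ∧ i ≫ p = f) :
    (Fib ⊓ W).llp ⊓ W = Fib.llp := by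
  refine le_antisymm (fun A B f hf => ?_) (fun A B f hf => ⟨?_, ?_⟩)
  · have h := factorizationData Fib.llp Fib f
    have hW : W h.i := by
      obtain ⟨Z, i, p, hi, hp, e⟩ := hfac h.i
      have : HasLiftingProperty h.i p := hasLifting_of_llp h.hi hp
      exact of_retract (RetractArrow.ofLeftLiftingProperty e) hi
    have hp : W h.p := W.of_precomp h.i h.p hW (by rw [h.fac]; exact hf.2)
    have : HasLiftingProperty f h.p := hasLifting_of_llp hf.1 ⟨h.hp, hp⟩
    exact of_retract (RetractArrow.ofLeftLiftingProperty h.fac) h.hi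
  · exact fun X Y p hp => hf p hp.1
  · obtain ⟨Z, i, p, hi, hp, e⟩ := hfac f
    have : HasLiftingProperty f p := hasLifting_of_llp hf hp
    exact of_retract (RetractArrow.ofLeftLiftingProperty e) hi

variable (W Fib I J) in
/-- The model structure determined by weak equivalences, fibrations and generating sets of
cofibrations and of trivial cofibrations. -/
@[reducible]
def modelOfGenerators [HasFiniteLimits D] [HasFiniteColimits D]
    [W.HasTwoOutOfThreeProperty] [W.IsStableUnderRetracts]
    [HasSmallObjectArgument.{u} I] [HasSmallObjectArgument.{u} J]
    (hI : I.rlp = Fib ⊓ W) (hJ : J.rlp = Fib)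
    (hfac : ∀ {A B : D} (f : A ⟶ B),
      ∃ (Z : D) (i : A ⟶ Z) (p : Z ⟶ B), W i ∧ Fib p ∧ i ≫ p = f) : ModelCategory D :=
  letI : CategoryWithFibrations D := ⟨Fib⟩
  letI : CategoryWithCofibrations D := ⟨(Fib ⊓ W).llp⟩
  letI : CategoryWithWeakEquivalences D := ⟨W⟩
  haveI : (weakEquivalences D).HasTwoOutOfThreeProperty :=
    inferInstanceAs W.HasTwoOutOfThreeProperty
  haveI fI : HasFactorization (Fib ⊓ W).llp (Fib ⊓ W) := by
    rw [← hI]; infer_instance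
  haveI fJ : HasFactorization Fib.llp Fib := by
    rw [← hJ]; infer_instance
  haveI hc : IsWeakFactorizationSystem (cofibrations D) (trivialFibrations D) :=
    { rlp := by
        change (Fib ⊓ W).llp.rlp = Fib ⊓ W
        rw [← hI, rlp_llp_rlp]
      llp := rfl
      hasFactorization := fI }
  have key : trivialCofibrations D = Fib.llp := llp_inf_weq_eq hfac
  haveI ht : IsWeakFactorizationSystem (trivialCofibrations D) (fibrations D) :=
    { rlp := by
        rw [key]
        change Fib.llp.rlp = Fib
        rw [← hJ, rlp_llp_rlp]
      llp := key.symm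
      hasFactorization := by rw [key]; exact fJ }
  ModelCategory.mk' D

end Generators

/-! ### Quasi-isomorphisms in terms of elements -/

/-- With homology computed as ker g / im f, the two clauses are injectivity and surjectivity of the
induced map. -/
lemma moduleCat_quasiIso_iff {S₁ S₂ : ShortComplex (ModuleCat.{u} ℚ)} (φ : S₁ ⟶ S₂) :
    ShortComplex.QuasiIso φ ↔
      (∀ a : S₁.X₂, S₁.g a = 0 → (∃ b, S₂.f b = φ.τ₂ a) → ∃ b, S₁.f b = a) ∧
      (∀ b : S₂.X₂, S₂.g b = 0 → ∃ a, S₁.g a = 0 ∧ ∃ c, S₂.f c = φ.τ₂ a - b) := by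
  let γ : ShortComplex.LeftHomologyMapData φ S₁.moduleCatLeftHomologyData
    S₂.moduleCatLeftHomologyData := default
  rw [γ.quasiIso_iff, ConcreteCategory.isIso_iff_bijective]
  let π₁ : LinearMap.ker S₁.g.hom → S₁.moduleCatLeftHomologyData.H :=
    fun a => S₁.moduleCatLeftHomologyData.π a
  let π₂ : LinearMap.ker S₂.g.hom → S₂.moduleCatLeftHomologyData.H :=
    fun a => S₂.moduleCatLeftHomologyData.π a
  let κ : LinearMap.ker S₁.g.hom → LinearMap.ker S₂.g.hom := fun a => γ.φK a
  have s₁ : Function.Surjective π₁ := Submodule.mkQ_surjective _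
  have s₂ : Function.Surjective π₂ := Submodule.mkQ_surjective _
  have hκ : ∀ a, (κ a : S₂.X₂) = φ.τ₂ (a : S₁.X₂) := fun a =>
    congrArg (fun f : S₁.moduleCatLeftHomologyData.K ⟶ S₂.X₂ => f.hom a) γ.commi
  have hπ : ∀ a, γ.φH (π₁ a) = π₂ (κ a) := fun a =>
    congrArg (fun f : S₁.moduleCatLeftHomologyData.K ⟶ S₂.moduleCatLeftHomologyData.H => f.hom a)
      γ.commπ
  have e₁ : ∀ a, π₁ a = 0 ↔ ∃ b, S₁.f b = (a : S₁.X₂) := fun a =>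
    (Submodule.Quotient.mk_eq_zero _).trans
      ⟨fun ⟨b, hb⟩ => ⟨b, congrArg Subtype.val hb⟩, fun ⟨b, hb⟩ => ⟨b, Subtype.ext hb⟩⟩
  have e₂ : ∀ a b, π₂ a = π₂ b ↔ ∃ c, S₂.f c = (a : S₂.X₂) - b := fun a b =>
    (Submodule.Quotient.eq _).trans
      ⟨fun ⟨b, hb⟩ => ⟨b, congrArg Subtype.val hb⟩, fun ⟨b, hb⟩ => ⟨b, Subtype.ext hb⟩⟩
  refine and_congr ⟨fun h a ha ⟨b, hb⟩ => ?_, fun h => ?_⟩ ⟨fun h b hb => ?_, fun h y => ?_⟩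
  · refine (e₁ ⟨a, ha⟩).1 (h ?_)
    rw [hπ]
    have : γ.φH (0 : S₁.moduleCatLeftHomologyData.H) = π₂ 0 := by
      rw [map_zero]; exact (map_zero S₂.moduleCatLeftHomologyData.π.hom).symm
    rw [this, e₂]
    exact ⟨b, by rw [hb, hκ]; exact (sub_zero _).symm⟩
  · refine (injective_iff_map_eq_zero γ.φH.hom).2 fun x hx => ?_
    obtain ⟨a, rfl⟩ := s₁ x
    refine (e₁ a).2 (h a a.2 ?_)
    have h0 : π₂ (κ a) = π₂ 0 := by
      rw [← hπ]; exact hx.trans (map_zero S₂.moduleCatLeftHomologyData.π.hom).symm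
    obtain ⟨c, hc⟩ := (e₂ _ _).1 h0
    exact ⟨c, by rw [hc, hκ]; exact sub_zero _⟩
  · obtain ⟨x, hx⟩ := h (π₂ ⟨b, hb⟩)
    obtain ⟨a, rfl⟩ := s₁ x
    refine ⟨a, a.2, ?_⟩
    rw [← hκ]
    exact (e₂ _ _).1 ((hπ a).symm.trans hx)
  · obtain ⟨b, rfl⟩ := s₂ y
    obtain ⟨a, ha, h2⟩ := h b b.2
    refine ⟨π₁ ⟨a, ha⟩, (hπ _).trans ((e₂ _ _).2 ?_)⟩
    rw [hκ]; exact h2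

namespace TDGA

/-- The cycles. -/
def IsCyc (A : TDGA T) : ∀ n, A.deg n → Prop
  | 0, _ => True
  | n + 1, a => A.dif n a = 0

/-- The boundaries. -/
def IsBdry (A : TDGA T) (n : ℕ) (a : A.deg n) : Prop := ∃ b, A.dif n b = a

lemma IsCyc.sub {A : TDGA T} {n : ℕ} {a b : A.deg n} (ha : A.IsCyc n a) (hb : A.IsCyc n b) :
    A.IsCyc n (a - b) := by
  cases n
  · trivial
  · exact (map_sub _ _ _).trans (by rw [ha, hb, sub_zero])

lemma isCyc_zero (A : TDGA T) (n : ℕ) : A.IsCyc n 0 := by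
  cases n
  · trivial
  · exact map_zero _

lemma isCyc_dif (A : TDGA T) (n : ℕ) (a : A.deg (n + 1)) : A.IsCyc n (A.dif n a) := by
  cases n
  · trivial
  · exact A.dif_dif _ _

lemma IsCyc.app {A B : TDGA T} (f : A ⟶ B) {n : ℕ} {a : A.deg n} (ha : A.IsCyc n a) :
    B.IsCyc n (app f n a) := by
  cases n
  · trivial
  · exact (app_dif _ _ _).symm.trans (by rw [ha, map_zero])

lemma IsBdry.app {A B : TDGA T} (f : A ⟶ B) {n : ℕ} {a : A.deg n} (ha : A.IsBdry n a) :
    B.IsBdry n (app f n a) := by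
  obtain ⟨b, rfl⟩ := ha
  exact ⟨_, (app_dif f n b).symm⟩

lemma IsBdry.add {A : TDGA T} {n : ℕ} {a b : A.deg n} (ha : A.IsBdry n a) (hb : A.IsBdry n b) :
    A.IsBdry n (a + b) := by
  obtain ⟨a, rfl⟩ := ha
  obtain ⟨b, rfl⟩ := hb
  exact ⟨a + b, map_add _ _ _⟩

lemma IsBdry.smul {A : TDGA T} {n : ℕ} {a : A.deg n} (q : ℚ) (ha : A.IsBdry n a) :
    A.IsBdry n (q • a) := by
  obtain ⟨a, rfl⟩ := ha
  exact ⟨q • a, map_smul _ _ _⟩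

lemma isBdry_zero (A : TDGA T) (n : ℕ) : A.IsBdry n 0 := ⟨0, map_zero _⟩

lemma isCyc_iff (A : TDGA T) (n : ℕ) (a : A.deg n) :
    A.IsCyc n a ↔ A.cx.d n ((ComplexShape.down ℕ).next n) a = 0 := by
  cases n with
  | zero =>
    rw [A.cx.shape _ _ (by simp)]
    exact ⟨fun _ => rfl, fun _ => trivial⟩
  | succ n =>
    rw [ChainComplex.next_nat_succ]
    rfl

lemma quasiIsos_iff {A B : TDGA T} (f : A ⟶ B) : quasiIsos T f ↔
    ∀ n, (∀ a, A.IsCyc n a → B.IsBdry n (app f n a) → A.IsBdry n a) ∧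
      (∀ b, B.IsCyc n b → ∃ a, A.IsCyc n a ∧ B.IsBdry n (app f n a - b)) := by
  refine (quasiIso_iff (Hom.chain f)).trans (forall_congr' fun n => ?_)
  rw [quasiIsoAt_iff' _ (n + 1) n _ (by simp) rfl, moduleCat_quasiIso_iff]
  simp only [isCyc_iff]
  rfl

variable (T) in
/-- The functor taking the underlying chain complex. -/
def cxFunctor : TDGA T ⥤ ChainComplex (ModuleCat.{u} ℚ) ℕ where
  obj A := A.cx
  map f := Hom.chain f

instance : (quasiIsos T).HasTwoOutOfThreeProperty :=
  inferInstanceAs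
    ((HomologicalComplex.quasiIso (ModuleCat.{u} ℚ) (ComplexShape.down ℕ)).inverseImage
      (cxFunctor T)).HasTwoOutOfThreeProperty

instance : (quasiIsos T).IsStableUnderRetracts where
  of_retract h hg :=
    MorphismProperty.of_retract
      (P := HomologicalComplex.quasiIso (ModuleCat.{u} ℚ) (ComplexShape.down ℕ))
      (RetractArrow.map h (cxFunctor T)) hg

/-! ### Spheres and discs -/

/-- A single generator in degree `n`. -/
abbrev SingleGen (n m : ℕ) : Type u := ULift.{u} (PLift (m = n))

/-- The family consisting of a single element. -/
def singleFam {A : TDGA T} {n : ℕ} (a : A.deg n) (m : ℕ) (h : SingleGen.{u} n m) : A.deg m :=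
  h.down.down.symm ▸ a

/-- The unique index of a single generator. -/
def singleIdx (n : ℕ) : SingleGen.{u} n n := ⟨⟨rfl⟩⟩

variable (T) in
/-- The `T`-DGA freely generated by an element of degree `n` satisfying `P`. -/
def cell (n : ℕ) (P : ∀ A : TDGA T, A.deg n → Prop) : TDGA T :=
  univ (G := SingleGen.{u} n) fun A v => P A (v n (singleIdx n))

variable {n : ℕ} {P : ∀ A : TDGA T, A.deg n → Prop}

/-- The generator. -/
def cellGen (n : ℕ) (P : ∀ A : TDGA T, A.deg n → Prop) : (cell T n P).deg n :=
  univGen _ n (singleIdx n)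

/-- The map determined by an element. -/
def cellDesc {A : TDGA T} (a : A.deg n) (ha : P A a) : cell T n P ⟶ A := univDesc (singleFam a) ha

@[simp] lemma cellDesc_gen {A : TDGA T} (a : A.deg n) (ha : P A a) :
    app (cellDesc a ha) n (cellGen n P) = a := rfl

lemma cell_hom_ext {A : TDGA T} {f g : cell T n P ⟶ A}
    (h : app f n (cellGen n P) = app g n (cellGen n P)) : f = g :=
  univ_hom_ext fun m x => by
    obtain ⟨⟨rfl⟩⟩ := x
    exact h

variable (T) in
/-- The `T`-DGA freely generated by an element of degree `n`. -/
abbrev disc (n : ℕ) : TDGA T := cell T n fun _ _ => True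

variable (T) in
/-- The `T`-DGA freely generated by a cycle of degree `n`. -/
abbrev sphere (n : ℕ) : TDGA T := cell T n fun A a => A.IsCyc n a

lemma sphereGen_isCyc (n : ℕ) : (sphere T n).IsCyc n (cellGen n _) := by
  cases n with
  | zero => trivial
  | succ n =>
    refine univ_ext fun A v hv => ?_
    exact (app_dif _ _ _).trans (Eq.trans hv (map_zero _).symm)

lemma app_sphereGen_isCyc {A : TDGA T} {n : ℕ} (f : sphere T n ⟶ A) :
    A.IsCyc n (app f n (cellGen n _)) := (sphereGen_isCyc n).app f

variable (T) in
/-- The inclusion of the sphere of dimension `n` into the disc of dimension `n + 1`. -/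
def sphereToDisc (n : ℕ) : sphere T n ⟶ disc T (n + 1) :=
  cellDesc ((disc T (n + 1)).dif n (cellGen (n + 1) _)) (isCyc_dif _ _ _)

variable (T) in
/-- The generating trivial cofibrations. -/
def genJ : MorphismProperty (TDGA T) :=
  MorphismProperty.ofHoms fun n : ℕ => initial.to (disc T (n + 1))

variable (T) in
/-- The sources of the generating cofibrations. -/
def genISource : Option ℕ → TDGA T
  | none => ⊥_ _
  | some n => sphere T n

variable (T) in
/-- The targets of the generating cofibrations. -/
def genITarget : Option ℕ → TDGA T
  | none => sphere T 0
  | some n => disc T (n + 1)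

variable (T) in
/-- The generating cofibrations. -/
def genIHom : ∀ k : Option ℕ, genISource T k ⟶ genITarget T k
  | none => initial.to (sphere T 0)
  | some n => sphereToDisc T n

variable (T) in
/-- The class of generating cofibrations. -/
def genI : MorphismProperty (TDGA T) := MorphismProperty.ofHoms (genIHom T)

lemma rlp_ofHoms_iff {D : Type*} [Category* D] {ι : Type*} {A B : ι → D} (f : ∀ i, A i ⟶ B i)
    {X Y : D} (p : X ⟶ Y) :
    (MorphismProperty.ofHoms f).rlp p ↔ ∀ i, HasLiftingProperty (f i) p :=
  ⟨fun h i => h _ ⟨i⟩, fun h _ _ _ hf => by obtain ⟨i⟩ := hf; exact h i⟩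

lemma hasLiftingProperty_initial_iff {D : Type*} [Category* D] [HasInitial D] {A X Y : D}
    (p : X ⟶ Y) : HasLiftingProperty (initial.to A) p ↔ ∀ f : A ⟶ Y, ∃ g : A ⟶ X, g ≫ p = f := by
  constructor
  · intro h f
    have sq : CommSq (initial.to X) (initial.to A) p f := ⟨initial.hom_ext _ _⟩
    exact ⟨sq.lift, sq.fac_right⟩
  · intro h
    refine ⟨fun {u v} sq => ?_⟩
    obtain ⟨g, hg⟩ := h v
    exact ⟨⟨⟨g, initial.hom_ext _ _, hg⟩⟩⟩

lemma posSurj_iff {A B : TDGA T} (p : A ⟶ B) :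
    posSurj T p ↔ ∀ n, Function.Surjective (app p (n + 1)) :=
  ⟨fun h n => h (n + 1) n.succ_pos, fun h n hn => by
    obtain ⟨m, rfl⟩ : ∃ m, n = m + 1 := ⟨n - 1, by omega⟩
    exact h m⟩

/-- A map out of the disc of dimension n + 1 is an arbitrary element of degree n + 1, and lifting it
is finding a preimage. -/
lemma genJ_rlp : (genJ T).rlp = posSurj T := by
  ext A B p
  rw [genJ, rlp_ofHoms_iff, posSurj_iff]
  refine forall_congr' fun n => ?_
  rw [hasLiftingProperty_initial_iff]
  constructor
  · intro h b
    obtain ⟨g, hg⟩ := h (cellDesc b trivial)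
    exact ⟨app g (n + 1) (cellGen (n + 1) _), by rw [← comp_app, hg]; rfl⟩
  · intro h f
    obtain ⟨a, ha⟩ := h (app f (n + 1) (cellGen (n + 1) _))
    exact ⟨cellDesc a trivial, cell_hom_ext ha⟩

/-- A commutative square amounts to a cycle `a` of the source and an element `b` of the target
bounding its image; a diagonal is an element bounding `a` and lying over `b`. -/
lemma sphereToDisc_lift_iff {A B : TDGA T} (p : A ⟶ B) (n : ℕ) :
    HasLiftingProperty (sphereToDisc T n) p ↔
      ∀ (a : A.deg n) (b : B.deg (n + 1)), A.IsCyc n a → B.dif n b = app p n a →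
        ∃ a' : A.deg (n + 1), A.dif n a' = a ∧ app p (n + 1) a' = b := by
  constructor
  · intro h a b ha hb
    have sq : CommSq (cellDesc a ha) (sphereToDisc T n) p (cellDesc b trivial) :=
      ⟨cell_hom_ext (hb.symm.trans (app_dif (cellDesc b trivial) n (cellGen (n + 1) _)).symm)⟩
    refine ⟨app sq.lift (n + 1) (cellGen (n + 1) _), ?_, ?_⟩
    · exact (app_dif sq.lift n (cellGen (n + 1) _)).symm.trans
        (congr_app sq.fac_left n (cellGen n _))
    · exact congr_app sq.fac_right (n + 1) (cellGen (n + 1) _)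
  · intro h
    refine ⟨fun {f g} sq => ?_⟩
    obtain ⟨a', h1, h2⟩ := h (app f n (cellGen n _)) (app g (n + 1) (cellGen (n + 1) _))
      (app_sphereGen_isCyc f)
      ((app_dif g n _).symm.trans (congr_app sq.w n (cellGen n _)).symm)
    exact ⟨⟨⟨cellDesc a' trivial, cell_hom_ext
      ((app_dif (cellDesc a' trivial) n (cellGen (n + 1) _)).trans h1), cell_hom_ext h2⟩⟩⟩

/-- The generator indexed by `none` is needed because no disc inclusion controls surjectivity in
degree 0; in positive degrees surjectivity on cycles comes from lifting problems with zero boundary.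
-/
lemma genI_rlp : (genI T).rlp = posSurj T ⊓ quasiIsos T := by
  ext A B p
  rw [genI, rlp_ofHoms_iff]
  change _ ↔ posSurj T p ∧ quasiIsos T p
  rw [posSurj_iff, quasiIsos_iff]
  constructor
  · intro h
    have h0 := h none
    change HasLiftingProperty (initial.to (sphere T 0)) p at h0
    rw [hasLiftingProperty_initial_iff] at h0
    have h1 : ∀ n, HasLiftingProperty (sphereToDisc T n) p := fun n => h (some n)
    simp only [sphereToDisc_lift_iff] at h1
    have hZ : ∀ n (b : B.deg n), B.IsCyc n b → ∃ a, A.IsCyc n a ∧ app p n a = b := by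
      intro n b hb
      cases n with
      | zero =>
        obtain ⟨g, hg⟩ := h0 (cellDesc b hb)
        exact ⟨app g 0 (cellGen 0 _), trivial, congr_app hg 0 (cellGen 0 _)⟩
      | succ n => exact h1 n 0 b (isCyc_zero _ _) (by rw [map_zero]; exact hb)
    refine ⟨fun n b => ?_, fun n => ⟨fun a ha ⟨b, hb⟩ => ?_, fun b hb => ?_⟩⟩
    · obtain ⟨a, ha, e⟩ := hZ n _ (B.isCyc_dif n b)
      obtain ⟨a', -, h'⟩ := h1 n a b ha e.symm
      exact ⟨a', h'⟩
    · obtain ⟨a', h', -⟩ := h1 n a b ha hb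
      exact ⟨a', h'⟩
    · obtain ⟨a, ha, rfl⟩ := hZ n b hb
      exact ⟨a, ha, by rw [sub_self]; exact isBdry_zero _ _⟩
  · rintro ⟨hs, hq⟩ (_ | n)
    · change HasLiftingProperty (initial.to (sphere T 0)) p
      rw [hasLiftingProperty_initial_iff]
      intro f
      obtain ⟨a, -, c, hc⟩ := (hq 0).2 (app f 0 (cellGen 0 _)) trivial
      -- The element `a` lies over the target only up to a boundary; that boundary lifts because `p`
      -- is surjective in degree 1, and is subtracted.
      obtain ⟨c, rfl⟩ := hs 0 c
      refine ⟨cellDesc (a - A.dif 0 c) (show A.IsCyc 0 _ from trivial), cell_hom_ext ?_⟩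
      change app p 0 (a - A.dif 0 c) = _
      rw [map_sub, app_dif, hc, sub_sub_cancel]
    · change HasLiftingProperty (sphereToDisc T n) p
      rw [sphereToDisc_lift_iff]
      intro a b ha hb
      obtain ⟨a₁, rfl⟩ := (hq n).1 a ha ⟨b, hb⟩
      -- A primitive `a₁` of `a` need not lie over `b`. The defect `p a₁ - b` is a cycle, hence the
      -- image of a cycle `a₂` up to a boundary, and both can be removed from `a₁` without changing
      -- its differential.
      obtain ⟨a₂, h₂, c, hc⟩ := (hq (n + 1)).2 (app p (n + 1) a₁ - b) (by
        change B.dif n _ = 0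
        rw [map_sub, hb, app_dif, sub_self])
      obtain ⟨c, rfl⟩ := hs (n + 1) c
      refine ⟨a₁ - a₂ + A.dif (n + 1) c, ?_, ?_⟩
      · change A.dif n a₂ = 0 at h₂
        rw [map_add, map_sub, h₂, dif_dif, sub_zero, add_zero]
      · rw [map_add, map_sub, app_dif, hc]
        abel

/-! ### Smallness -/

end TDGA

/-- Objects out of which morphisms into filtered colimits factor essentially uniquely. -/
def IsFinitary {D : Type*} [Category* D] (S : D) : Prop :=
  ∀ {J : Type u} [SmallCategory J] [IsFiltered J] {F : J ⥤ D} {c : Cocone F},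
    IsColimit c → (∀ f : S ⟶ c.pt, ∃ (j : J) (g : S ⟶ F.obj j), g ≫ coLeg c j = f) ∧
      ∀ {j : J} (g h : S ⟶ F.obj j), g ≫ coLeg c j = h ≫ coLeg c j →
        ∃ (k : J) (f : j ⟶ k), g ≫ F.map f = h ≫ F.map f

lemma IsFinitary.preserves {D : Type*} [Category.{u} D] {S : D} (hS : IsFinitary.{u} S)
    {J : Type u} [SmallCategory J] [IsFiltered J] (F : J ⥤ D) :
    PreservesColimit F (coyoneda.obj (Opposite.op S)) where
  preserves {c} hc :=
    ⟨Types.FilteredColimit.isColimitOf' _ _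
      (fun f => by
        obtain ⟨j, g, hg⟩ := (hS hc).1 f
        exact ⟨j, g, hg.symm⟩)
      (fun j g h e => by
        obtain ⟨k, f, hf⟩ := (hS hc).2 g h e
        exact ⟨k, f, hf⟩)⟩

lemma isFinitary_initial {D : Type*} [Category* D] {S : D} (hS : IsInitial S) :
    IsFinitary.{u} S := fun {J} _ _ F c _ =>
  ⟨fun f => ⟨Classical.choice (IsFiltered.nonempty (C := J)), hS.to _, hS.hom_ext _ _⟩,
    fun {j} g h _ => ⟨j, 𝟙 j, hS.hom_ext _ _⟩⟩

/-- The cardinal ℵ₀ works: its ordinal is a filtered order, so maps out of a finitary source commute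
with the colimits of the corresponding chains. Only sources of the generators matter. -/
lemma hasSmallObjectArgument_of_isFinitary {D : Type (u + 1)} [Category.{u} D]
    [HasColimitsOfSize.{u, u} D] (I : MorphismProperty D) [MorphismProperty.IsSmall.{u} I]
    (hI : ∀ {A B : D} (i : A ⟶ B), I i → IsFinitary.{u} A) :
    MorphismProperty.HasSmallObjectArgument.{u} I := by
  have hκ : Fact (Cardinal.aleph0.{u}).IsRegular := ⟨Cardinal.isRegular_aleph0⟩
  let b : OrderBot (Cardinal.aleph0.{u}).ord.ToType := by
    have : Nonempty (Cardinal.aleph0.{u}).ord.ToType := by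
      rw [← Cardinal.mk_ne_zero_iff, Cardinal.mk_toType, Cardinal.card_ord]
      exact Cardinal.aleph0_ne_zero
    exact WellFoundedLT.toOrderBot _
  have hf : IsFiltered (Cardinal.aleph0.{u}).ord.ToType := by
    infer_instance
  refine ⟨Cardinal.aleph0.{u}, hκ, b, ?_⟩
  exact
    { preservesColimit := fun {A B X Y} i hi f hf' => IsFinitary.preserves (hI i hi) _ }

namespace TDGA

/-- A map out of a sphere is one element subject to one equation; the element is represented at some
stage and the equation holds at a later one. -/
lemma sphere_isFinitary (n : ℕ) : IsFinitary.{u} (sphere T n) := by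
  intro J _ _ F c hc
  constructor
  · intro f
    obtain ⟨j, y, hy⟩ := exists_rep_of_isColimit hc (app f n (cellGen n _))
    obtain ⟨k, g, hg⟩ : ∃ (k : J) (g : j ⟶ k), (F.obj k).IsCyc n (app (F.map g) n y) := by
      cases n with
      | zero => exact ⟨j, 𝟙 j, trivial⟩
      | succ n =>
        obtain ⟨k, g, hg⟩ := eq_of_isColimit hc (y := (F.obj j).dif n y) (z := 0) (by
          rw [app_dif, hy, map_zero]
          exact app_sphereGen_isCyc f)
        exact ⟨k, g, by rw [map_zero, app_dif] at hg; exact hg⟩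
    refine ⟨k, cellDesc _ hg, cell_hom_ext ?_⟩
    rw [comp_app, cellDesc_gen, ← comp_app, map_coLeg, hy]
  · intro j g h e
    obtain ⟨k, f, hf⟩ := eq_of_isColimit hc (congr_app e n (cellGen n _))
    exact ⟨k, f, cell_hom_ext hf⟩

instance : MorphismProperty.HasSmallObjectArgument.{u} (genJ T) := by
  have : MorphismProperty.IsSmall.{u} (genJ T) := MorphismProperty.isSmall_ofHoms _
  refine hasSmallObjectArgument_of_isFinitary _ fun i hi => ?_
  obtain ⟨n⟩ := hi
  exact isFinitary_initial initialIsInitial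

lemma genISource_isFinitary (k : Option ℕ) : IsFinitary.{u} (genISource T k) := by
  cases k with
  | none => exact isFinitary_initial initialIsInitial
  | some n => exact sphere_isFinitary n

instance : MorphismProperty.HasSmallObjectArgument.{u} (genI T) := by
  have : MorphismProperty.IsSmall.{u} (genI T) := MorphismProperty.isSmall_ofHoms _
  refine hasSmallObjectArgument_of_isFinitary _ fun i hi => ?_
  obtain ⟨k⟩ := hi
  exact genISource_isFinitary k

end TDGA

/-! ### Every `T`-algebra is a filtered colimit of finitely presented ones -/

namespace TAlg

section Presentation

variable (A : TAlg T)

/-- Relations between elements of an algebra. -/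
structure Rel where
  /-- the number of variables -/
  n : ℕ
  /-- the operation -/
  f : T.Op n
  /-- the elements -/
  v : Fin n → A
  eq : A.op f v = 0

/-- Finite sets of elements together with finite sets of relations. -/
structure PresIdx where
  /-- the generators -/
  gens : Finset A
  /-- the relations -/
  rels : Finset (Rel A)

instance (A : TAlg T) : Preorder (PresIdx A) where
  le k l := k.gens ⊆ l.gens ∧ k.rels ⊆ l.rels
  le_refl _ := ⟨subset_rfl, subset_rfl⟩
  le_trans _ _ _ h h' := ⟨h.1.trans h'.1, h.2.trans h'.2⟩

instance (A : TAlg T) : Nonempty (PresIdx A) := ⟨⟨∅, ∅⟩⟩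

/-- No compatibility between generators and relations is demanded, since `relIdeal` ignores a
relation that involves elements outside the generators. Unions therefore provide upper bounds. -/
instance (A : TAlg T) : IsDirectedOrder (PresIdx A) := by
  classical
  exact ⟨fun k l => ⟨⟨k.gens ∪ l.gens, k.rels ∪ l.rels⟩,
    ⟨Finset.subset_union_left, Finset.subset_union_left⟩,
    ⟨Finset.subset_union_right, Finset.subset_union_right⟩⟩⟩

variable {A}

open Classical in
/-- The variable attached to an element. -/
def preGen (k : PresIdx A) (a : A) : T.free k.1.card :=
  if h : a ∈ k.1 then T.gen (k.1.equivFin ⟨a, h⟩) else 0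

/-- The relations, as elements of the free algebra. -/
def preRel (k : PresIdx A) (r : Rel A) : T.free k.1.card :=
  (T.free k.1.card).op r.f fun i => preGen k (r.v i)

/-- The ideal of relations. -/
def relIdeal (k : PresIdx A) : Ideal (T.free k.1.card) :=
  Ideal.span (preRel k '' {r | r ∈ k.2 ∧ ∀ i, r.v i ∈ k.1})

lemma relIdeal_fg (k : PresIdx A) : (relIdeal k).FG :=
  Submodule.fg_span ((k.2.finite_toSet.subset fun _ h => h.1).image _)

variable [T.IsFermat]

/-- The finitely presented algebra given by finitely many elements and relations. -/
def pres (k : PresIdx A) : TAlg T := (T.free k.1.card).quot (relIdeal k)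

lemma pres_isFP (k : PresIdx A) : (pres k).IsFP := ⟨_, _, relIdeal_fg k, ⟨Iso.refl _⟩⟩

/-- The generators of `pres k`. -/
def presGen (k : PresIdx A) (a : A) : pres k := Hom.toFun (quotMk _ (relIdeal k)) (preGen k a)

/-- The homomorphism from a free algebra given by the values at elements of a finite set. -/
def preDesc (k : PresIdx A) {D : TAlg T} (v : A → D) : T.free k.1.card ⟶ D :=
  D.freeDesc fun i => v (k.1.equivFin.symm i)

lemma preDesc_gen (k : PresIdx A) {D : TAlg T} (v : A → D) {a : A} (h : a ∈ k.1) :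
    Hom.toFun (preDesc k v) (preGen k a) = v a := by
  rw [preGen, dif_pos h]
  refine (freeDesc_gen _ _ _).trans ?_
  rw [Equiv.symm_apply_apply]

lemma preDesc_relIdeal (k : PresIdx A) {D : TAlg T} (v : A → D)
    (hv : ∀ r ∈ k.2, (∀ i, r.v i ∈ k.1) → D.op r.f (fun i => v (r.v i)) = 0) :
    ∀ a ∈ relIdeal k, Hom.toFun (preDesc k v) a = 0 := by
  have : relIdeal k ≤ RingHom.ker (toRingHom (preDesc k v)) := by
    refine Ideal.span_le.2 ?_
    rintro _ ⟨r, ⟨h1, h2⟩, rfl⟩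
    refine (toFun_op (preDesc k v) r.f _).trans (Eq.trans ?_ (hv r h1 h2))
    exact congrArg (D.op r.f) (funext fun i => preDesc_gen k v (h2 i))
  exact fun a ha => this ha

/-- The homomorphism given by values at the generators. -/
def presDesc (k : PresIdx A) {D : TAlg T} (v : A → D)
    (hv : ∀ r ∈ k.2, (∀ i, r.v i ∈ k.1) → D.op r.f (fun i => v (r.v i)) = 0) : pres k ⟶ D :=
  quotDesc _ (preDesc k v) (preDesc_relIdeal k v hv)

lemma presDesc_gen (k : PresIdx A) {D : TAlg T} (v : A → D) (hv) {a : A} (h : a ∈ k.1) :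
    Hom.toFun (presDesc k v hv) (presGen k a) = v a :=
  (congr_toFun (quotMk_desc _ _ (preDesc_relIdeal k v hv)) _).trans (preDesc_gen k v h)

lemma pres_hom_ext {k : PresIdx A} {D : TAlg T} {f g : pres k ⟶ D}
    (h : ∀ a ∈ k.1, Hom.toFun f (presGen k a) = Hom.toFun g (presGen k a)) : f = g := by
  refine epi_of_surjective (quotMk_surjective _ (relIdeal k)) (free_hom_ext fun i => ?_)
  have e : T.gen i = preGen k (k.1.equivFin.symm i) := by
    rw [preGen, dif_pos (k.1.equivFin.symm i).2]
    exact congrArg T.gen (k.1.equivFin.apply_symm_apply i).symm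
  rw [e]
  exact h _ (k.1.equivFin.symm i).2

lemma presGen_rel (k : PresIdx A) {r : Rel A} (h : r ∈ k.2) (h' : ∀ i, r.v i ∈ k.1) :
    (pres k).op r.f (fun i => presGen k (r.v i)) = 0 :=
  (toFun_op (quotMk _ (relIdeal k)) r.f _).symm.trans
    ((quotMk_eq_zero _ _).2 (Ideal.subset_span ⟨r, ⟨h, h'⟩, rfl⟩))

/-- The transition maps. -/
def presMap {k l : PresIdx A} (h : k ≤ l) : pres k ⟶ pres l :=
  presDesc k (presGen l) fun _ hr hv => presGen_rel l (h.2 hr) fun i => h.1 (hv i)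

lemma presMap_gen {k l : PresIdx A} (h : k ≤ l) {a : A} (ha : a ∈ k.1) :
    Hom.toFun (presMap h) (presGen k a) = presGen l a := presDesc_gen k _ _ ha

variable (A) in
/-- The diagram of finitely presented algebras over `A`. -/
def presFunctor : PresIdx A ⥤ TAlg T where
  obj k := pres k
  map f := presMap (leOfHom f)
  map_id k := pres_hom_ext fun a ha => presMap_gen _ ha
  map_comp f g := pres_hom_ext fun a ha => by
    rw [presMap_gen _ ha, comp_toFun, presMap_gen _ ha, presMap_gen _ ((leOfHom f).1 ha)]

/-- The maps to `A`. -/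
def presTo (k : PresIdx A) : pres k ⟶ A := presDesc k id fun r _ _ => r.eq

lemma presTo_gen (k : PresIdx A) {a : A} (ha : a ∈ k.1) :
    Hom.toFun (presTo k) (presGen k a) = a := presDesc_gen k _ _ ha

variable (A) in
/-- The cocone of finitely presented algebras over `A`. -/
def presCocone : Cocone (presFunctor A) :=
  mkCocone (F := presFunctor A) (B := A) presTo fun {i j} f => pres_hom_ext fun a ha => by
    refine Eq.trans ?_ (presTo_gen i ha).symm
    exact (congrArg (Hom.toFun (presTo j)) (presMap_gen (leOfHom f) ha)).trans
      (presTo_gen j ((leOfHom f).1 ha))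

variable (s : Cocone (presFunctor A))

/-- The map to another cocone. -/
def presColimFun (a : A) : s.pt := Hom.toFun (show pres (⟨{a}, ∅⟩ : PresIdx A) ⟶ s.pt from s.ι.app ⟨{a}, ∅⟩)
  (presGen ⟨{a}, ∅⟩ a)

lemma presColimFun_eq {a : A} {k : PresIdx A} (ha : a ∈ k.1) :
    presColimFun s a = Hom.toFun (show pres k ⟶ s.pt from s.ι.app k) (presGen k a) := by
  -- The stage with the single generator `a` and no relation lies below every stage having `a` among
  -- its generators.
  have h : (⟨{a}, ∅⟩ : PresIdx A) ≤ k := ⟨by simpa using ha, by simp⟩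
  have h1 : (presMap h ≫ (show pres k ⟶ s.pt from s.ι.app k)) = s.ι.app ⟨{a}, ∅⟩ :=
    s.w (homOfLE h)
  refine (congr_toFun h1 (presGen ⟨{a}, ∅⟩ a)).symm.trans ?_
  exact congrArg (Hom.toFun (show pres k ⟶ s.pt from s.ι.app k)) (presMap_gen h (by simp))

/-- The relation expressing the value of an operation. -/
def opRel {n : ℕ} (p : T.Op n) (v : Fin n → A) : Rel A where
  n := n + 1
  f := (T.free (n + 1)).op p (fun i => T.gen i.succ) - T.gen 0
  v := Fin.cons (A.op p v) v
  eq := by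
    let d : T.free (n + 1) ⟶ A := A.freeDesc (Fin.cons (A.op p v) v)
    refine (toFun_sub d _ _).trans ?_
    rw [toFun_op]
    have h : ∀ i, Hom.toFun d (T.gen i) = (Fin.cons (A.op p v) v : Fin (n + 1) → A) i :=
      fun i => freeDesc_gen A _ i
    simp only [h, Fin.cons_succ, Fin.cons_zero, sub_self]

lemma op_eq_of_opRel {D : TAlg T} {n : ℕ} (p : T.Op n) (v : Fin n → A) (w : A → D)
    (h : D.op (opRel p v).f (fun i => w ((opRel p v).v i)) = 0) :
    D.op p (fun i => w (v i)) = w (A.op p v) := by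
  let d : T.free (n + 1) ⟶ D := D.freeDesc fun i => w ((Fin.cons (A.op p v) v : Fin (n + 1) → A) i)
  have h1 : Hom.toFun d ((T.free (n + 1)).op p (fun i => T.gen i.succ) - T.gen 0) = 0 := h
  rw [toFun_sub, toFun_op] at h1
  have h2 : ∀ i, Hom.toFun d (T.gen i) = w ((Fin.cons (A.op p v) v : Fin (n + 1) → A) i) :=
    fun i => freeDesc_gen D _ i
  simp only [h2, Fin.cons_succ, Fin.cons_zero] at h1
  exact sub_eq_zero.1 h1

/-- The induced homomorphism. -/
def presColimDesc : A ⟶ s.pt :=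
  ⟨presColimFun s, fun {n} p v => by
    classical
    -- A stage holding the arguments, the value and the relation expressing that the operation takes
    -- this value; the identity already holds there, hence in every cocone.
    let k : PresIdx A := ⟨insert (A.op p v) (Finset.univ.image v), {opRel p v}⟩
    have hk : ∀ i, (opRel p v).v i ∈ k.1 := by
      intro i
      refine Fin.cases ?_ (fun i => ?_) i
      · exact Finset.mem_insert_self _ _
      · exact Finset.mem_insert_of_mem (Finset.mem_image_of_mem v (Finset.mem_univ i))
    have hv : ∀ i, v i ∈ k.1 := fun i => hk (Fin.succ i)
    have h0 : A.op p v ∈ k.1 := hk (0 : Fin (n + 1))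
    rw [presColimFun_eq s h0]
    have h := op_eq_of_opRel p v (presGen k) (presGen_rel k (Finset.mem_singleton_self _) hk)
    refine (congrArg (Hom.toFun (show pres k ⟶ s.pt from s.ι.app k)) h.symm).trans ?_
    rw [toFun_op]
    exact congrArg _ (funext fun i => (presColimFun_eq s (hv i)).symm)⟩

variable (A) in
/-- Every algebra is the filtered colimit of its finitely presented approximations. -/
def presIsColimit : IsColimit (presCocone A) where
  desc s := presColimDesc s
  fac s k := pres_hom_ext fun a ha =>
    (congrArg (presColimFun s) (presTo_gen k ha)).trans (presColimFun_eq s ha)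
  uniq s m hm := hom_ext fun a => by
    have h := congr_toFun (hm ⟨{a}, ∅⟩) (presGen ⟨{a}, ∅⟩ a)
    refine Eq.trans (congrArg (Hom.toFun m) ?_) h
    exact (presTo_gen _ (Finset.mem_singleton_self a)).symm

end Presentation

end TAlg

/-! ### Adjoining a variable to a `T`-algebra -/

namespace TAlg

/-- The algebra `A{x}` obtained by adjoining a variable. -/
def poly (A : TAlg T) : TAlg T := A ⨿ T.free 1

/-- The inclusion of the constants. -/
def polyIncl (A : TAlg T) : A ⟶ poly A := coprod.inl

/-- The variable. -/
def polyVar (A : TAlg T) : poly A :=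
  Hom.toFun (show T.free 1 ⟶ poly A from coprod.inr) (T.gen 0)

/-- The homomorphism given by its restriction to the constants and the image of the variable. -/
def polyDesc {A D : TAlg T} (f : A ⟶ D) (d : D) : poly A ⟶ D :=
  coprod.desc f (D.freeDesc fun _ => d)

lemma polyIncl_desc {A D : TAlg T} (f : A ⟶ D) (d : D) : polyIncl A ≫ polyDesc f d = f :=
  coprod.inl_desc _ _

lemma polyDesc_incl {A D : TAlg T} (f : A ⟶ D) (d : D) (a : A) :
    Hom.toFun (polyDesc f d) (Hom.toFun (polyIncl A) a) = Hom.toFun f a :=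
  congr_toFun (polyIncl_desc f d) a

lemma polyDesc_var {A D : TAlg T} (f : A ⟶ D) (d : D) :
    Hom.toFun (polyDesc f d) (polyVar A) = d :=
  (congr_toFun (coprod.inr_desc f (D.freeDesc fun _ => d)) (T.gen 0)).trans (freeDesc_gen _ _ _)

lemma poly_hom_ext {A D : TAlg T} {f g : poly A ⟶ D} (h : polyIncl A ≫ f = polyIncl A ≫ g)
    (h' : Hom.toFun f (polyVar A) = Hom.toFun g (polyVar A)) : f = g :=
  coprod.hom_ext h (free_hom_ext fun i => by
    obtain rfl : i = 0 := Subsingleton.elim _ _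
    exact h')

/-- The evaluation at `0`. -/
def polyEval (A : TAlg T) : poly A ⟶ A := polyDesc (𝟙 A) 0

/-- Functoriality of adjoining a variable. -/
def polyMap {A D : TAlg T} (f : A ⟶ D) : poly A ⟶ poly D :=
  polyDesc (f ≫ polyIncl D) (polyVar D)

lemma polyMap_var {A D : TAlg T} (f : A ⟶ D) :
    Hom.toFun (polyMap f) (polyVar A) = polyVar D := polyDesc_var _ _

lemma polyIncl_map {A D : TAlg T} (f : A ⟶ D) : polyIncl A ≫ polyMap f = f ≫ polyIncl D :=
  polyIncl_desc _ _

variable (T) in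
/-- The functor adjoining a variable. -/
def polyFunctor : TAlg T ⥤ TAlg T where
  obj := poly
  map := polyMap
  map_id A := poly_hom_ext ((polyIncl_map _).trans (by simp)) (polyMap_var _)
  map_comp {A B C} f g := by
    refine poly_hom_ext ?_ ?_
    · rw [polyIncl_map, ← Category.assoc (polyIncl A), polyIncl_map, Category.assoc,
        Category.assoc, polyIncl_map]
    · rw [polyMap_var, comp_toFun, polyMap_var, polyMap_var]

/-! ### Adjoining a variable commutes with filtered colimits -/

section Colimit

variable {J : Type u} [SmallCategory J] [IsFiltered J] {F : J ⥤ TAlg T} {c : Cocone F}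

lemma polyVar_cocone (s : Cocone (F ⋙ polyFunctor T)) (i j : J) :
    Hom.toFun (show poly (F.obj i) ⟶ s.pt from s.ι.app i) (polyVar (F.obj i)) =
      Hom.toFun (show poly (F.obj j) ⟶ s.pt from s.ι.app j) (polyVar (F.obj j)) := by
  have key : ∀ {i j} (f : i ⟶ j),
      Hom.toFun (show poly (F.obj i) ⟶ s.pt from s.ι.app i) (polyVar (F.obj i)) =
      Hom.toFun (show poly (F.obj j) ⟶ s.pt from s.ι.app j) (polyVar (F.obj j)) := by
    intro i j f
    have h : polyMap (F.map f) ≫ (show poly (F.obj j) ⟶ s.pt from s.ι.app j) = s.ι.app i := s.w f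
    rw [← polyMap_var (F.map f), ← comp_toFun, h]
  exact (key (IsFiltered.leftToMax i j)).trans (key (IsFiltered.rightToMax i j)).symm

/-- The restriction of a cocone to the constants. -/
def constCocone (s : Cocone (F ⋙ polyFunctor T)) : Cocone F :=
  mkCocone (fun j => polyIncl (F.obj j) ≫ (show poly (F.obj j) ⟶ s.pt from s.ι.app j))
    fun {i j} f => by
      have h : polyMap (F.map f) ≫ (show poly (F.obj j) ⟶ s.pt from s.ι.app j) = s.ι.app i := s.w f
      rw [← Category.assoc, ← polyIncl_map, Category.assoc, h]

/-- The map out of the colimit of the constants. -/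
def constDesc (hc : IsColimit c) (s : Cocone (F ⋙ polyFunctor T)) : c.pt ⟶ s.pt :=
  hc.desc (constCocone s)

lemma coLeg_constDesc (hc : IsColimit c) (s : Cocone (F ⋙ polyFunctor T)) (j : J) :
    coLeg c j ≫ constDesc hc s =
      polyIncl (F.obj j) ≫ (show poly (F.obj j) ⟶ s.pt from s.ι.app j) :=
  hc.fac (constCocone s) j

lemma comp_eq_constDesc (hc : IsColimit c) (s : Cocone (F ⋙ polyFunctor T))
    (m : poly c.pt ⟶ s.pt) (hm : ∀ j, polyMap (coLeg c j) ≫ m = s.ι.app j) :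
    polyIncl c.pt ≫ m = constDesc hc s := by
  refine hc.hom_ext fun j => Eq.trans ?_ (coLeg_constDesc hc s j).symm
  change coLeg c j ≫ polyIncl c.pt ≫ m = _
  rw [← Category.assoc, ← polyIncl_map, Category.assoc, hm]

/-- The common image of the variables. -/
def varImage (s : Cocone (F ⋙ polyFunctor T)) : s.pt :=
  Hom.toFun (show poly (F.obj (Classical.choice IsFiltered.nonempty)) ⟶ s.pt from s.ι.app _)
    (polyVar _)

/-- Adjoining a variable commutes with filtered colimits. -/
def polyIsColimit (hc : IsColimit c) : IsColimit ((polyFunctor T).mapCocone c) where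
  desc s := polyDesc (constDesc hc s) (varImage s)
  fac s j := by
    refine poly_hom_ext ?_ ?_
    · refine (congrArg (fun g => g ≫ polyDesc (constDesc hc s) (varImage s))
        (polyIncl_map (coLeg c j))).trans ((Category.assoc _ _ _).trans ?_)
      rw [polyIncl_desc]
      exact coLeg_constDesc hc s j
    · refine Eq.trans (congrArg (Hom.toFun (polyDesc (constDesc hc s) (varImage s)))
        (polyMap_var (coLeg c j))) ?_
      exact (polyDesc_var _ _).trans (polyVar_cocone s _ j)
  uniq s m hm := by
    refine poly_hom_ext ((comp_eq_constDesc hc s m hm).trans (polyIncl_desc _ _).symm) ?_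
    refine Eq.trans ?_ (polyDesc_var _ _).symm
    have h := congr_toFun (hm (Classical.choice IsFiltered.nonempty)) (polyVar _)
    refine Eq.trans ?_ h
    exact congrArg (Hom.toFun (show poly c.pt ⟶ s.pt from m)) (polyMap_var (coLeg c _)).symm

end Colimit

/-! ### The variable is a nonzerodivisor; difference quotients -/

section Regular

variable [T.IsFermat]

/-- Since quotients by ideals are T-algebras, a congruence between every element and its image can
be checked on generators, as an equality of two homomorphisms to the quotient. -/
lemma sub_mem_of_quot_eq {A : TAlg T} (I : Ideal A) (f : A ⟶ A)
    (h : A.quotMk I = f ≫ A.quotMk I) (a : A) : a - Hom.toFun f a ∈ I :=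
  (A.quotMk_eq_iff I _ _).1 (congr_toFun h a)

lemma poly_sub_eval_mem (A : TAlg T) (c : poly A) :
    c - Hom.toFun (polyIncl A) (Hom.toFun (polyEval A) c) ∈ Ideal.span {polyVar A} := by
  refine sub_mem_of_quot_eq _ (polyEval A ≫ polyIncl A) (poly_hom_ext ?_ ?_) c
  · rw [Category.assoc, ← Category.assoc (polyIncl A), polyEval, polyIncl_desc, Category.id_comp]
  · rw [comp_toFun, comp_toFun, polyEval, polyDesc_var, toFun_zero, toFun_zero]
    exact (quotMk_eq_zero _ _).2 (Ideal.subset_span rfl)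

/-- Uniqueness in the Fermat property: adding to a difference quotient an element annihilated by x -
y gives another one. The operation whose quotient is taken is irrelevant, and the first projection
serves. -/
lemma free_diff_regular (n : ℕ) {g : T.free (n + 2)} (h : (T.gen 0 - T.gen 1) * g = 0) :
    g = 0 := by
  obtain ⟨g₀, h₀, hu⟩ := QTheory.IsFermat.existsUnique (T := T) n (T.var 0)
  have h1 := hu (g₀ + g) (by
    change _ = (T.gen 0 - T.gen 1) * (g₀ + g)
    rw [mul_add, h, add_zero]; exact h₀)
  exact left_eq_add.1 h1.symm

/-- The substitution x ↦ x - y turns the relation into one for the difference of two variables, and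
setting y = 0 afterwards recovers `g`. -/
lemma free_gen_regular (n : ℕ) {g : T.free (n + 1)} (h : T.gen 0 * g = 0) : g = 0 := by
  let α : T.free (n + 1) ⟶ T.free (n + 2) :=
    freeDesc _ (Fin.cons (T.gen 0 - T.gen 1) fun i => T.gen i.succ.succ)
  let β : T.free (n + 2) ⟶ T.free (n + 1) :=
    freeDesc _ (Fin.cons (T.gen 0) (Fin.cons 0 fun i => T.gen i.succ))
  have hα0 : Hom.toFun α (T.gen 0) = T.gen 0 - T.gen 1 := freeDesc_gen _ _ _
  have hαs : ∀ i : Fin n, Hom.toFun α (T.gen i.succ) = T.gen i.succ.succ :=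
    fun i => freeDesc_gen _ _ _
  have hβ0 : Hom.toFun β (T.gen 0) = T.gen 0 := freeDesc_gen _ _ _
  have hβ1 : Hom.toFun β (T.gen 1) = 0 := freeDesc_gen _ _ _
  have hβs : ∀ i : Fin n, Hom.toFun β (T.gen i.succ.succ) = T.gen i.succ :=
    fun i => freeDesc_gen _ _ _
  have hαβ : α ≫ β = 𝟙 _ := by
    refine free_hom_ext fun i => ?_
    refine Fin.cases ?_ (fun i => ?_) i
    · rw [comp_toFun, hα0, toFun_sub, hβ0, hβ1, sub_zero]; rfl
    · rw [comp_toFun, hαs, hβs]; rfl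
  have h1 := congrArg (Hom.toFun α) h
  rw [toFun_mul, toFun_zero, hα0] at h1
  have h2 := free_diff_regular n h1
  rw [← id_toFun _ g, ← hαβ, comp_toFun, h2, toFun_zero]

/-- The extended ideal is generated by elements independent of x, so for y in it the difference y -
y(0) is x times an element of the ideal itself. If x g lies in the ideal then x g = x z with z in
the ideal, since x g vanishes at x = 0, and x can be cancelled in the free algebra. -/
lemma free_quot_regular {n : ℕ} (I : Ideal (T.free n)) (e : T.free n ⟶ T.free (n + 1))
    (he : ∀ i, Hom.toFun e (T.gen i) = T.gen i.succ) {g : T.free (n + 1)}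
    (h : T.gen 0 * g ∈ I.map (toRingHom e)) : g ∈ I.map (toRingHom e) := by
  let s : T.free (n + 1) ⟶ T.free n := freeDesc _ (Fin.cons 0 T.gen)
  have hs0 : Hom.toFun s (T.gen 0) = 0 := freeDesc_gen _ _ _
  have hss : ∀ i : Fin n, Hom.toFun s (T.gen i.succ) = T.gen i := fun i => freeDesc_gen _ _ _
  have key : ∀ r : T.free (n + 1), ∃ q, r - Hom.toFun e (Hom.toFun s r) = T.gen 0 * q := by
    intro r
    have h := sub_mem_of_quot_eq (Ideal.span {T.gen (0 : Fin (n + 1))}) (s ≫ e) (by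
      refine free_hom_ext fun i => ?_
      refine Fin.cases ?_ (fun i => ?_) i
      · rw [comp_toFun, comp_toFun, hs0, toFun_zero, toFun_zero]
        exact (quotMk_eq_zero _ _).2 (Ideal.subset_span rfl)
      · rw [comp_toFun, comp_toFun, hss, he]) r
    obtain ⟨q, hq⟩ := Ideal.mem_span_singleton.1 h
    exact ⟨q, hq⟩
  have h1 : ∀ y ∈ I.map (toRingHom e), ∃ z ∈ I.map (toRingHom e),
      y - Hom.toFun e (Hom.toFun s y) = T.gen 0 * z := by
    intro y hy
    induction hy using Submodule.span_induction with
    | mem y hy =>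
      obtain ⟨a, -, rfl⟩ := hy
      refine ⟨0, zero_mem _, ?_⟩
      have hes : e ≫ s = 𝟙 _ := free_hom_ext fun i => by
        rw [comp_toFun, he, hss]; rfl
      rw [toRingHom_apply, ← comp_toFun e s, hes, id_toFun, sub_self, mul_zero]
    | zero => exact ⟨0, zero_mem _, by rw [toFun_zero, toFun_zero, sub_zero, mul_zero]⟩
    | add x y _ _ hx hy =>
      obtain ⟨z, hz, ez⟩ := hx
      obtain ⟨w, hw, ew⟩ := hy
      refine ⟨z + w, add_mem hz hw, ?_⟩
      rw [mul_add, ← ez, ← ew, toFun_add, toFun_add]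
      ring
    | smul r y hy' hy =>
      obtain ⟨z, hz, ez⟩ := hy
      obtain ⟨q, hq⟩ := key r
      -- From r y - r(0) y(0) = (r - r(0)) y + r(0) (y - y(0)).
      refine ⟨q * y + Hom.toFun e (Hom.toFun s r) * z, add_mem (Ideal.mul_mem_left _ _ hy')
        (Ideal.mul_mem_left _ _ hz), ?_⟩
      rw [smul_eq_mul, toFun_mul, toFun_mul, mul_add, ← mul_assoc, ← hq, mul_left_comm, ← ez]
      ring
  obtain ⟨z, hz, ez⟩ := h1 _ h
  rw [toFun_mul, toFun_mul, hs0, toFun_zero, zero_mul, sub_zero] at ez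
  have : T.gen 0 * (g - z) = 0 := by rw [mul_sub, ez, sub_self]
  rw [sub_eq_zero.1 (free_gen_regular n this)]
  exact hz

/-- Adjoining x to T[z]/I gives T[x, z] modulo the extended ideal. Only the one-sided inverse `ψ ≫ χ
= 𝟙` is needed to carry the cancellation over. -/
lemma poly_quot_regular {n : ℕ} (I : Ideal (T.free n)) {c : poly ((T.free n).quot I)}
    (h : polyVar _ * c = 0) : c = 0 := by
  let e : T.free n ⟶ T.free (n + 1) := freeDesc _ fun i => T.gen i.succ
  have he : ∀ i, Hom.toFun e (T.gen i) = T.gen i.succ := fun i => freeDesc_gen _ _ _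
  let J := I.map (toRingHom e)
  let q := (T.free (n + 1)).quotMk J
  have hq : ∀ a ∈ I, Hom.toFun (e ≫ q) a = 0 := fun a ha =>
    (quotMk_eq_zero _ _).2 (Ideal.mem_map_of_mem (toRingHom e) ha)
  let ψ : poly ((T.free n).quot I) ⟶ (T.free (n + 1)).quot J :=
    polyDesc (quotDesc I (e ≫ q) hq) (Hom.toFun q (T.gen 0))
  let χ₀ : T.free (n + 1) ⟶ poly ((T.free n).quot I) :=
    freeDesc _ (Fin.cons (polyVar _)
      fun i => Hom.toFun ((T.free n).quotMk I ≫ polyIncl _) (T.gen i))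
  have hχ0 : Hom.toFun χ₀ (T.gen 0) = polyVar _ := freeDesc_gen _ _ _
  have hχs : ∀ i : Fin n, Hom.toFun χ₀ (T.gen i.succ) =
    Hom.toFun ((T.free n).quotMk I ≫ polyIncl _) (T.gen i) := fun i => freeDesc_gen _ _ _
  have heχ : e ≫ χ₀ = (T.free n).quotMk I ≫ polyIncl _ :=
    free_hom_ext fun i => by rw [comp_toFun, he, hχs]
  have hJ : ∀ a ∈ J, Hom.toFun χ₀ a = 0 := by
    have : J ≤ RingHom.ker (toRingHom χ₀) := by
      refine Ideal.map_le_iff_le_comap.2 fun a ha => ?_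
      change Hom.toFun (e ≫ χ₀) a = 0
      rw [heχ, comp_toFun, (quotMk_eq_zero _ _).2 ha, toFun_zero]
    exact fun a ha => this ha
  let χ : (T.free (n + 1)).quot J ⟶ poly ((T.free n).quot I) := quotDesc J χ₀ hJ
  have hψχ : ψ ≫ χ = 𝟙 _ := by
    refine poly_hom_ext (epi_of_surjective (quotMk_surjective _ I) ?_) ?_
    · rw [← Category.assoc (polyIncl _), polyIncl_desc, ← Category.assoc, quotMk_desc,
        Category.assoc, quotMk_desc, heχ, Category.comp_id]
    · rw [comp_toFun, polyDesc_var]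
      exact (congr_toFun (quotMk_desc J χ₀ hJ) _).trans hχ0
  obtain ⟨g, hg⟩ := quotMk_surjective _ J (Hom.toFun ψ c)
  have h1 : Hom.toFun q (T.gen 0 * g) = 0 := by
    rw [toFun_mul]
    refine (congrArg (Hom.toFun q (T.gen 0) * ·) hg).trans ?_
    have h2 := congrArg (Hom.toFun ψ) h
    rw [toFun_mul, toFun_zero, polyDesc_var] at h2
    exact h2
  have h2 := free_quot_regular I e he ((quotMk_eq_zero _ _).1 h1)
  rw [← id_toFun _ c, ← hψχ, comp_toFun, ← hg, (quotMk_eq_zero _ _).2 h2, toFun_zero]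

/-- A{x} is the filtered colimit of the algebras obtained by adjoining x to finitely presented
approximations of A; the relation x c = 0 already holds at a finite stage, where c vanishes. -/
lemma poly_regular (A : TAlg T) {c : poly A} (h : polyVar A * c = 0) : c = 0 := by
  have hc := polyIsColimit (presIsColimit A)
  obtain ⟨j, y, rfl⟩ := exists_rep_of_isColimit hc c
  let μ : poly (pres j) ⟶ poly A := polyMap (presTo j)
  have h0 : Hom.toFun μ (polyVar (pres j) * (show poly (pres j) from y)) = Hom.toFun μ 0 := by
    rw [toFun_mul, toFun_zero, polyMap_var]
    exact h
  obtain ⟨k, f, hf⟩ := eq_of_isColimit hc (j := j)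
    (y := polyVar (pres j) * (show poly (pres j) from y)) (z := (0 : poly (pres j))) h0
  let ν : poly (pres j) ⟶ poly (pres k) := polyMap (presMap (leOfHom f))
  have h1 : Hom.toFun ν (polyVar (pres j) * (show poly (pres j) from y)) = Hom.toFun ν 0 := hf
  rw [toFun_mul, toFun_zero, polyMap_var] at h1
  have h2 := poly_quot_regular _ h1
  have h3 : ν ≫ polyMap (presTo k) = μ :=
    ((polyFunctor T).map_comp ((presFunctor A).map f) (presTo k)).symm.trans
      (congrArg polyMap ((presCocone A).w f))
  refine (congr_toFun h3 y).symm.trans ?_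
  exact (congrArg (Hom.toFun (polyMap (presTo k))) h2).trans (toFun_zero _)

lemma exists_quotient (A : TAlg T) (c : poly A) : ∃ q, polyVar A * q =
    c - Hom.toFun (polyIncl A) (Hom.toFun (polyEval A) c) := by
  obtain ⟨q, hq⟩ := Ideal.mem_span_singleton.1 (poly_sub_eval_mem A c)
  exact ⟨q, hq.symm⟩

/-- The difference quotient `(c(x) - c(0)) / x`. -/
def polyQuo (A : TAlg T) (c : poly A) : poly A := (exists_quotient A c).choose

lemma polyVar_mul_quo (A : TAlg T) (c : poly A) : polyVar A * polyQuo A c =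
    c - Hom.toFun (polyIncl A) (Hom.toFun (polyEval A) c) := (exists_quotient A c).choose_spec

/-- As x is a nonzerodivisor, the defining equation determines the quotient; additivity and
A-linearity below follow from this. -/
lemma polyQuo_eq {A : TAlg T} {c q : poly A} (h : polyVar A * q =
    c - Hom.toFun (polyIncl A) (Hom.toFun (polyEval A) c)) : polyQuo A c = q :=
  sub_eq_zero.1 (poly_regular A (by rw [mul_sub, h, polyVar_mul_quo, sub_self]))

lemma polyQuo_add (A : TAlg T) (c d : poly A) :
    polyQuo A (c + d) = polyQuo A c + polyQuo A d := polyQuo_eq (by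
  rw [mul_add, polyVar_mul_quo, polyVar_mul_quo, toFun_add, toFun_add]; ring)

lemma polyEval_incl (A : TAlg T) (a : A) : Hom.toFun (polyEval A) (Hom.toFun (polyIncl A) a) = a :=
  polyDesc_incl _ _ _

lemma polyQuo_incl_mul (A : TAlg T) (a : A) (c : poly A) :
    polyQuo A (Hom.toFun (polyIncl A) a * c) = Hom.toFun (polyIncl A) a * polyQuo A c :=
  polyQuo_eq (by
    rw [mul_left_comm, polyVar_mul_quo, toFun_mul, toFun_mul, polyEval_incl]; ring)

lemma polyQuo_var_mul (A : TAlg T) (c : poly A) : polyQuo A (polyVar A * c) = c :=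
  polyQuo_eq (by
    rw [toFun_mul, toFun_mul, polyEval, polyDesc_var, toFun_zero, zero_mul, sub_zero])

end Regular

end TAlg

/-! ### The universal property of base change in degree `0` -/

namespace TDGA

open TensorProduct

section BaseChange

variable {A : TDGA T} {L : TAlg T} (φ : A.alg0 ⟶ L)

/-- The isomorphism of `L` with the degree `0` part of `A ⊗_{A₀} L`. -/
def bcZero : L ⟶ (A.baseChange φ).alg0 :=
  ⟨fun l => (tensEquiv φ).symm (show Along φ from l), fun f a => by
    refine congrArg (tensEquiv φ).symm (congrArg (L.op f) (funext fun i => ?_))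
    exact ((tensEquiv φ).apply_symm_apply _).symm⟩

lemma bcZero_bijective : Function.Bijective (TAlg.Hom.toFun (bcZero φ)) :=
  (tensEquiv φ).symm.bijective

lemma bcZero_apply (l : L) : TAlg.Hom.toFun (bcZero φ) l =
    ((A.one : A.deg 0) ⊗ₜ[A.alg0] (show Along φ from l) : Tens φ 0) := by
  refine (tensEquiv φ).symm_apply_eq.2 ?_
  rw [tensEquiv_tmul, ← A.alg0_one]
  exact ((congrArg (fun z : Along φ => z * (show Along φ from l))
    (map_one (TAlg.toRingHom φ))).trans (_root_.one_mul _)).symm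

lemma toBaseChange_app (n : ℕ) (a : A.deg n) :
    app (A.toBaseChange φ) n a = (a ⊗ₜ[A.alg0] (1 : Along φ) : Tens φ n) := rfl

lemma map0_toBaseChange : map0 (A.toBaseChange φ) = φ ≫ bcZero φ := by
  refine TAlg.hom_ext fun a => ?_
  refine ((tensEquiv φ).symm_apply_eq.2 ?_).symm
  exact ((tensEquiv_tmul φ a 1).trans (_root_.mul_one _)).symm

/-- Induction on elements of a base change. -/
lemma baseChange_induction {n : ℕ} {S : (A.baseChange φ).deg n → Prop} (h0 : S 0)
    (hadd : ∀ x y, S x → S y → S (x + y))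
    (h : ∀ (a : A.deg n) (l : Along φ), S (a ⊗ₜ[A.alg0] l : Tens φ n))
    (x : (A.baseChange φ).deg n) : S x :=
  TensorProduct.induction_on (motive := fun x : Tens φ n => S x) x h0 h hadd

/-- The base change is generated by the images of L and of A, which is why its maps are determined
by their restrictions to these. -/
lemma tmul_eq_mul {n : ℕ} (a : A.deg n) (l : Along φ) :
    (a ⊗ₜ[A.alg0] l : Tens φ n) = (A.baseChange φ).mul (zero_add n)
      (show (A.baseChange φ).deg 0 from TAlg.Hom.toFun (bcZero φ) l)
      (app (A.toBaseChange φ) n a) := by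
  refine Eq.trans ?_ (congrArg (fun z : (A.baseChange φ).deg 0 =>
    (A.baseChange φ).mul (zero_add n) z (app (A.toBaseChange φ) n a)) (bcZero_apply φ l).symm)
  refine Eq.trans ?_ (tensMul_tmul φ (zero_add n) A.one a l 1).symm
  rw [A.one_mul, _root_.mul_one]

lemma baseChange_hom_ext {X : TDGA T} {f g : A.baseChange φ ⟶ X}
    (h : A.toBaseChange φ ≫ f = A.toBaseChange φ ≫ g)
    (h' : bcZero φ ≫ map0 f = bcZero φ ≫ map0 g) : f = g := by
  refine hom_ext fun n => baseChange_induction φ (by rw [map_zero, map_zero])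
    (fun x y hx hy => by rw [map_add, map_add, hx, hy]) fun a l => ?_
  rw [tmul_eq_mul, app_mul, app_mul]
  exact congrArg₂ (X.mul _) (TAlg.congr_toFun h' l) (congr_app h n a)

variable {φ}

/-- The underlying map of `bcDesc`. -/
def bcDescFun {X : TDGA T} (f : A ⟶ X) (g : L ⟶ X.alg0) (h : φ ≫ g = map0 f) (n : ℕ) :
    Tens φ n →+ X.deg n :=
  TensorProduct.liftAddHom
    (AddMonoidHom.mk' (fun a : A.deg n => AddMonoidHom.mk'
      (fun l : Along φ => (TAlg.toRingHom g l) • app f n a)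
      (fun l m => (congrArg (· • app f n a) (map_add (TAlg.toRingHom g) l m)).trans
        (add_smul _ _ _)))
      (fun a b => by
        ext l
        exact (congrArg (TAlg.toRingHom g l • ·) (map_add (app f n) a b)).trans (smul_add _ _ _)))
    (fun r a l => by
      have h1 : TAlg.toRingHom g (r • l : Along φ) =
          (show X.alg0 from app f 0 r) * TAlg.toRingHom g l :=
        (map_mul (TAlg.toRingHom g) (TAlg.toRingHom φ r) l).trans
          (congrArg (· * TAlg.toRingHom g l) (TAlg.congr_toFun h r))
      have h2 : app f n (r • a) = (show X.alg0 from app f 0 r) • app f n a :=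
        app_mul f (zero_add n) r a
      refine (congrArg (TAlg.toRingHom g l • ·) h2).trans ?_
      refine Eq.trans ?_ (congrArg (· • app f n a) h1).symm
      -- The tensor product is balanced because `g ∘ φ` is the degree 0 part of `f`.
      rw [smul_smul, _root_.mul_comm])

lemma bcDescFun_tmul {X : TDGA T} (f : A ⟶ X) (g : L ⟶ X.alg0) (h : φ ≫ g = map0 f) (n : ℕ)
    (a : A.deg n) (l : Along φ) : bcDescFun f g h n (a ⊗ₜ l) =
      X.mul (zero_add n) (TAlg.Hom.toFun g l : X.alg0) (app f n a) := rfl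

lemma bcDescFun_dif {X : TDGA T} (f : A ⟶ X) (g : L ⟶ X.alg0) (h : φ ≫ g = map0 f) (n : ℕ)
    (x : Tens φ (n + 1)) :
    bcDescFun f g h n (tensD φ (n + 1) n x) = X.dif n (bcDescFun f g h (n + 1) x) := by
  induction x using TensorProduct.induction_on with
  | zero => simp only [map_zero]
  | add x y hx hy => simp only [map_add, hx, hy]
  | tmul a l =>
    exact (bcDescFun_tmul f g h n (A.dif n a) l).trans
      ((congrArg (X.mul _ _) (app_dif f n a)).trans (X.leibniz_left _ _).symm)

lemma bcDescFun_mul {X : TDGA T} (f : A ⟶ X) (g : L ⟶ X.alg0) (h : φ ≫ g = map0 f)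
    {i j k : ℕ} (hk : i + j = k) (x : Tens φ i) (y : Tens φ j) :
    bcDescFun f g h k (tensMul φ hk x y) =
      X.mul hk (bcDescFun f g h i x) (bcDescFun f g h j y) := by
  induction x using TensorProduct.induction_on with
  | zero => simp only [map_zero, LinearMap.zero_apply, X.zero_mul]
  | add x x' hx hx' => simp only [map_add, LinearMap.add_apply, X.add_mul, hx, hx']
  | tmul a l =>
    induction y using TensorProduct.induction_on with
    | zero => simp only [map_zero, X.mul_zero]
    | add y y' hy hy' => simp only [map_add, X.mul_add, hy, hy']
    | tmul b m =>
      rw [tensMul_tmul, bcDescFun_tmul, bcDescFun_tmul, bcDescFun_tmul, app_mul]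
      have h1 : (TAlg.Hom.toFun g (show L from l * m) : X.alg0) =
        (TAlg.Hom.toFun g l : X.alg0) * (TAlg.Hom.toFun g m : X.alg0) := TAlg.toFun_mul g l m
      change (TAlg.Hom.toFun g (show L from l * m) : X.alg0) • X.mul hk (app f i a) (app f j b)
        = X.mulLin hk ((TAlg.Hom.toFun g l : X.alg0) • app f i a)
          ((TAlg.Hom.toFun g m : X.alg0) • app f j b)
      rw [h1, map_smul, LinearMap.map_smul₂, smul_smul, _root_.mul_comm]
      rfl

lemma bcDescFun_zero {X : TDGA T} (f : A ⟶ X) (g : L ⟶ X.alg0) (h : φ ≫ g = map0 f)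
    (x : Tens φ 0) : bcDescFun f g h 0 x = TAlg.Hom.toFun g (tensEquiv φ x) := by
  induction x using TensorProduct.induction_on with
  | zero =>
    refine (map_zero (bcDescFun f g h 0)).trans ?_
    refine Eq.trans ?_ (congrArg (TAlg.toRingHom g) (map_zero (tensEquiv φ))).symm
    exact X.alg0_zero.symm.trans (map_zero (TAlg.toRingHom g)).symm
  | add x y hx hy =>
    refine (map_add (bcDescFun f g h 0) _ _).trans ?_
    refine Eq.trans ?_ (congrArg (TAlg.toRingHom g) (map_add (tensEquiv φ) _ _)).symm
    refine Eq.trans ?_ (map_add (TAlg.toRingHom g) _ _).symm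
    exact (congrArg₂ (fun a b : X.deg 0 => a + b) hx hy).trans (X.alg0_add _ _).symm
  | tmul a l =>
    rw [bcDescFun_tmul, tensEquiv_tmul]
    refine Eq.trans ?_ (map_mul (TAlg.toRingHom g) _ _).symm
    refine (X.alg0_mul _ _).symm.trans ?_
    refine (_root_.mul_comm (show X.alg0 from TAlg.Hom.toFun g l)
      (show X.alg0 from app f 0 a)).trans ?_
    exact congrArg (· * TAlg.toRingHom g l) (TAlg.congr_toFun h a).symm

/-- The morphism out of a base change. -/
def bcDesc {X : TDGA T} (f : A ⟶ X) (g : L ⟶ X.alg0) (h : φ ≫ g = map0 f) :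
    A.baseChange φ ⟶ X :=
  homMk (A := A.baseChange φ) (fun n => bcDescFun f g h n) (fun n => map_add (bcDescFun f g h n))
    (bcDescFun_dif f g h) (bcDescFun_mul f g h)
    (fun {n} p x => by
      refine (bcDescFun_zero f g h _).trans ?_
      refine (congrArg (TAlg.Hom.toFun g) ((tensEquiv φ).apply_symm_apply _)).trans ?_
      refine (TAlg.Hom.map_op g p _).trans ?_
      exact congrArg (X.str.op p) (funext fun i => (bcDescFun_zero f g h (x i)).symm))

lemma bcDesc_tmul {X : TDGA T} (f : A ⟶ X) (g : L ⟶ X.alg0) (h : φ ≫ g = map0 f) (n : ℕ)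
    (a : A.deg n) (l : Along φ) : app (bcDesc f g h) n (a ⊗ₜ[A.alg0] l : Tens φ n) =
      X.mul (zero_add n) (TAlg.Hom.toFun g l : X.alg0) (app f n a) := rfl

lemma toBaseChange_desc {X : TDGA T} (f : A ⟶ X) (g : L ⟶ X.alg0) (h : φ ≫ g = map0 f) :
    A.toBaseChange φ ≫ bcDesc f g h = f := hom_ext fun n a => by
  rw [comp_app, toBaseChange_app, bcDesc_tmul]
  have : (TAlg.Hom.toFun g (show L from (1 : Along φ)) : X.alg0) = X.one :=
    (TAlg.toFun_one g).trans X.alg0_one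
  exact (congrArg (fun z => X.mul (zero_add n) z (app f n a)) this).trans (X.one_mul _)

lemma bcZero_desc {X : TDGA T} (f : A ⟶ X) (g : L ⟶ X.alg0) (h : φ ≫ g = map0 f) :
    bcZero φ ≫ map0 (bcDesc f g h) = g := TAlg.hom_ext fun l => by
  rw [TAlg.comp_toFun, bcZero_apply]
  refine (bcDesc_tmul f g h 0 A.one l).trans ?_
  rw [app_one]
  refine (X.mul_comm _ (zero_add 0) _ _).trans ?_
  rw [Nat.mul_zero, pow_zero, one_smul]
  exact X.one_mul _

end BaseChange

/-! ### Adjoining variables -/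

section Adjoin

variable (A : TDGA T) (S : ℕ → Type u)

/-- The family of elements extending a morphism. -/
def adjFam {A : TDGA T} {S : ℕ → Type u} {B : TDGA T} (f : A ⟶ B) (s : ∀ n, S n → B.deg n) (n : ℕ) :
    A.deg n ⊕ S n → B.deg n := Sum.elim (app f n) (s n)

/-- The property of extending a morphism. -/
def AdjRel (B : TDGA T) (v : ∀ n, A.deg n ⊕ S n → B.deg n) : Prop :=
  ∃ f : A ⟶ B, ∀ n a, v n (.inl a) = app f n a

/-- The `T`-DGA freely generated by `A` and variables indexed by `S`, together with the
differentials of the latter. -/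
def adj : TDGA T := univ (AdjRel A S)

/-- The variables. -/
def adjVar (n : ℕ) (s : S n) : (adj A S).deg n := univGen (AdjRel A S) n (.inr s)

variable {A S}

/-- The morphism out of `adj A S`. -/
def adjDesc {B : TDGA T} (f : A ⟶ B) (s : ∀ n, S n → B.deg n) : adj A S ⟶ B :=
  univDesc (adjFam f s) ⟨f, fun _ _ => rfl⟩

variable (A S) in
/-- The constants. -/
def adjIncl : A ⟶ adj A S :=
  homMk (B := adj A S) (fun n a => univGen (AdjRel A S) n (.inl a))
    (fun n a b => univ_ext fun B v hv => by
      obtain ⟨f, hf⟩ := hv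
      refine Eq.trans ?_ (map_add (app (univDesc v ⟨f, hf⟩) n) _ _).symm
      exact (hf _ _).trans ((map_add (app f n) a b).trans (congrArg₂ _ (hf _ _) (hf _ _)).symm))
    (fun n a => univ_ext fun B v hv => by
      obtain ⟨f, hf⟩ := hv
      refine Eq.trans ?_ (app_dif (univDesc v ⟨f, hf⟩) n _).symm
      exact (hf _ _).trans ((app_dif f n a).trans (congrArg (B.dif n) (hf _ _)).symm))
    (fun {i j k} h a b => univ_ext fun B v hv => by
      obtain ⟨f, hf⟩ := hv
      refine Eq.trans ?_ (app_mul (univDesc v ⟨f, hf⟩) h _ _).symm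
      exact (hf _ _).trans ((app_mul f h a b).trans
        (congrArg₂ (B.mul h) (hf _ _) (hf _ _)).symm))
    (fun {n} p a => univ_ext fun B v hv => by
      obtain ⟨f, hf⟩ := hv
      refine Eq.trans ?_ (app_op (univDesc v ⟨f, hf⟩) p _).symm
      exact (hf _ _).trans ((app_op f p a).trans
        (congrArg (B.str.op p) (funext fun i => hf _ _)).symm))

lemma adjIncl_desc {B : TDGA T} (f : A ⟶ B) (s : ∀ n, S n → B.deg n) :
    adjIncl A S ≫ adjDesc f s = f := rfl

@[simp] lemma adjDesc_incl {B : TDGA T} (f : A ⟶ B) (s : ∀ n, S n → B.deg n) (n : ℕ)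
    (a : A.deg n) : app (adjDesc f s) n (app (adjIncl A S) n a) = app f n a := rfl

@[simp] lemma adjDesc_var {B : TDGA T} (f : A ⟶ B) (s : ∀ n, S n → B.deg n) (n : ℕ) (x : S n) :
    app (adjDesc f s) n (adjVar A S n x) = s n x := rfl

lemma adj_hom_ext {B : TDGA T} {f g : adj A S ⟶ B} (h : adjIncl A S ≫ f = adjIncl A S ≫ g)
    (h' : ∀ n x, app f n (adjVar A S n x) = app g n (adjVar A S n x)) : f = g :=
  univ_hom_ext fun n x => by
    obtain a | s := x
    · exact congr_app h n a
    · exact h' n s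

lemma adj_induction {P : ∀ n, (adj A S).deg n → Prop} (hP : IsSub (adj A S) P)
    (h : ∀ n a, P n (app (adjIncl A S) n a)) (h' : ∀ n x, P n (adjVar A S n x)) {n : ℕ}
    (x : (adj A S).deg n) : P n x :=
  univ_induction hP (fun n g => by
    obtain a | s := g
    · exact h n a
    · exact h' n s) x

variable (A S) in
/-- The retraction sending all variables to `0`. -/
def adjRetr : adj A S ⟶ A := adjDesc (𝟙 A) fun _ _ => 0

@[simp] lemma adjIncl_retr : adjIncl A S ≫ adjRetr A S = 𝟙 A := adjIncl_desc _ _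

lemma adjRetr_incl (n : ℕ) (a : A.deg n) : app (adjRetr A S) n (app (adjIncl A S) n a) = a :=
  adjDesc_incl _ _ _ _

lemma adjRetr_var (n : ℕ) (x : S n) : app (adjRetr A S) n (adjVar A S n x) = 0 :=
  adjDesc_var _ _ _ _

/-- Every cycle is homologous to its image under the retraction followed by the inclusion. -/
def Contracts {A X : TDGA T} (j : A ⟶ X) (r : X ⟶ A) : Prop :=
  ∀ n (x : X.deg n), X.IsCyc n x → X.IsBdry n (x - app j n (app r n x))

lemma Contracts.quasiIsos {A X : TDGA T} {j : A ⟶ X} {r : X ⟶ A} (h : Contracts j r)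
    (hj : j ≫ r = 𝟙 A) : quasiIsos T j := by
  refine (quasiIsos_iff j).2 fun n => ⟨fun a ha hb => ?_, fun b hb => ⟨app r n b, hb.app r, ?_⟩⟩
  · have := hb.app r
    rwa [← comp_app, hj] at this
  · have := (h n b hb).smul (-1)
    rwa [neg_smul, one_smul, neg_sub] at this

/-- Only `φ ≫ ψ = 𝟙` is required, so extensions are compared with explicit models by maps that are
checked to be inverse on one side only. -/
lemma Contracts.of_retract {A X Y : TDGA T} {j : A ⟶ X} {r : X ⟶ A} {j' : A ⟶ Y} {r' : Y ⟶ A}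
    (h : Contracts j' r') (φ : X ⟶ Y) (ψ : Y ⟶ X) (h1 : φ ≫ ψ = 𝟙 X) (h2 : j' ≫ ψ = j)
    (h3 : φ ≫ r' = r) : Contracts j r := fun n x hx => by
  have := (h n _ (hx.app φ)).app ψ
  rw [map_sub, ← comp_app φ ψ, h1, ← comp_app j' ψ, h2, ← comp_app φ r', h3] at this
  exact this

lemma Contracts.comp {A X Y : TDGA T} {j : A ⟶ X} {r : X ⟶ A} {j' : X ⟶ Y} {r' : Y ⟶ X}
    (h : Contracts j r) (h' : Contracts j' r') : Contracts (j ≫ j') (r' ≫ r) := fun n y hy => by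
  have h1 := (h n _ (hy.app r')).app j'
  have h2 := (h' n y hy).add h1
  rw [map_sub, sub_add_sub_cancel] at h2
  exact h2

/-- The variables belonging to a finite set. -/
abbrev SubVar (S : ℕ → Type u) (F : Finset (Σ n, S n)) (n : ℕ) : Type u := {s : S n // ⟨n, s⟩ ∈ F}

/-- The inclusion of finitely many variables. -/
def adjSub (A : TDGA T) (F : Finset (Σ n, S n)) : adj A (SubVar S F) ⟶ adj A S :=
  adjDesc (adjIncl A S) fun n s => adjVar A S n s.1

open Classical in
/-- The retraction onto finitely many variables. -/
def adjProj (A : TDGA T) (F : Finset (Σ n, S n)) : adj A S ⟶ adj A (SubVar S F) :=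
  adjDesc (adjIncl _ _) fun n s => if h : ⟨n, s⟩ ∈ F then adjVar A (SubVar S F) n ⟨s, h⟩ else 0

lemma adjSub_proj (F : Finset (Σ n, S n)) : adjSub A F ≫ adjProj A F = 𝟙 _ :=
  adj_hom_ext rfl fun n s => by
    rw [comp_app, adjSub, adjProj, adjDesc_var, adjDesc_var, dif_pos s.2]; rfl

lemma adjSub_mono {F F' : Finset (Σ n, S n)} (h : F ⊆ F') :
    adjDesc (adjIncl A _) (fun n s => adjVar A (SubVar S F') n ⟨s.1, h s.2⟩) ≫ adjSub A F' =
      adjSub A F := adj_hom_ext rfl fun n s => rfl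

lemma adjSub_range_mono {F F' : Finset (Σ n, S n)} (h : F ⊆ F') {n : ℕ} {x : (adj A S).deg n}
    (hx : ∃ y, app (adjSub A F) n y = x) : ∃ y, app (adjSub A F') n y = x := by
  obtain ⟨y, rfl⟩ := hx
  exact ⟨_, congr_app (adjSub_mono h) n y⟩

/-- An element is built from constants and variables by finitely many finitary operations, so it
involves finitely many variables. -/
lemma exists_adjSub {n : ℕ} (x : (adj A S).deg n) :
    ∃ (F : Finset (Σ n, S n)) (y : (adj A (SubVar S F)).deg n), app (adjSub A F) n y = x := by
  classical
  have key : ∀ F, IsSub (adj A S) fun n x => ∃ y, app (adjSub A F) n y = x := fun F => isSub_range _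
  refine adj_induction (P := fun n x => ∃ (F : Finset (Σ n, S n)) (y : (adj A (SubVar S F)).deg n),
    app (adjSub A F) n y = x) ?_ ?_ ?_ x
  · refine ⟨fun n => ⟨∅, (key ∅).zero n⟩, ?_, ?_, ?_, ?_, ⟨∅, (key ∅).one⟩, ?_⟩
    · rintro n a b ⟨F, h⟩ ⟨F', h'⟩
      exact ⟨F ∪ F', (key _).add (adjSub_range_mono Finset.subset_union_left h)
        (adjSub_range_mono Finset.subset_union_right h')⟩
    · rintro n q a ⟨F, h⟩
      exact ⟨F, (key F).smul q h⟩
    · rintro n a ⟨F, h⟩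
      exact ⟨F, (key F).d h⟩
    · rintro i j k hk a b ⟨F, h⟩ ⟨F', h'⟩
      exact ⟨F ∪ F', (key _).mul hk (adjSub_range_mono Finset.subset_union_left h)
        (adjSub_range_mono Finset.subset_union_right h')⟩
    · intro n p a h
      choose F hF using h
      exact ⟨Finset.univ.biUnion F, (key _).op p fun i =>
        adjSub_range_mono (Finset.subset_biUnion_of_mem F (Finset.mem_univ i)) (hF i)⟩
  · exact fun n a => ⟨∅, app (adjIncl _ _) n a, rfl⟩
  · exact fun n s => ⟨{⟨n, s⟩}, adjVar _ _ n ⟨s, Finset.mem_singleton_self _⟩, rfl⟩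

/-! ### Adjoining finitely many variables one at a time -/

section Insert

variable [DecidableEq (Σ n, S n)] (A) (F : Finset (Σ n, S n)) {m : ℕ} (s : S m)

/-- The iterated extension by finitely many variables and one further variable. -/
abbrev adjTwice : TDGA T := adj (adj A (SubVar S F)) (SingleGen.{u} m)

/-- The comparison with an iterated extension. -/
def adjInsTo : adj A (SubVar S (insert ⟨m, s⟩ F)) ⟶ adjTwice A F (m := m) :=
  adjDesc (adjIncl A (SubVar S F) ≫ adjIncl _ _) fun n t =>
    if ht : ⟨n, t.1⟩ ∈ F then
      app (adjIncl (adj A (SubVar S F)) _) n (adjVar A (SubVar S F) n ⟨t.1, ht⟩)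
    -- A variable of the enlarged set outside `F` is the new one, of degree `m`; the final value `0`
    -- is never attained.
    else if e : n = m then adjVar (adj A (SubVar S F)) (SingleGen.{u} m) n ⟨⟨e⟩⟩ else 0

/-- The inclusion of the old variables. -/
def adjInsOld : adj A (SubVar S F) ⟶ adj A (SubVar S (insert ⟨m, s⟩ F)) :=
  adjDesc (adjIncl A _) fun n t => adjVar A _ n ⟨t.1, Finset.mem_insert_of_mem t.2⟩

/-- The new variable. -/
def adjInsNew : (adj A (SubVar S (insert ⟨m, s⟩ F))).deg m :=
  adjVar A _ m ⟨s, Finset.mem_insert_self _ _⟩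

/-- The comparison with an iterated extension. -/
def adjInsFrom : adjTwice A F (m := m) ⟶ adj A (SubVar S (insert ⟨m, s⟩ F)) :=
  adjDesc (S := SingleGen.{u} m) (adjInsOld A F s) (singleFam (n := m) (adjInsNew A F s))

lemma adjIncl_insTo : adjIncl A _ ≫ adjInsTo A F s = adjIncl A (SubVar S F) ≫ adjIncl _ _ :=
  adjIncl_desc _ _

lemma adjInsTo_old {n : ℕ} {t : S n} (h : ⟨n, t⟩ ∈ insert (⟨m, s⟩ : Σ n, S n) F)
    (ht : ⟨n, t⟩ ∈ F) : app (adjInsTo A F s) n (adjVar A _ n ⟨t, h⟩) =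
      app (adjIncl (adj A (SubVar S F)) _) n (adjVar A (SubVar S F) n ⟨t, ht⟩) :=
  (adjDesc_var _ _ _ _).trans (dif_pos ht)

lemma adjInsTo_new (h : ⟨m, s⟩ ∈ insert (⟨m, s⟩ : Σ n, S n) F) (hs : ⟨m, s⟩ ∉ F) :
    app (adjInsTo A F s) m (adjVar A _ m ⟨s, h⟩) =
      adjVar (adj A (SubVar S F)) (SingleGen.{u} m) m (singleIdx m) :=
  (adjDesc_var _ _ _ _).trans ((dif_neg hs).trans (dif_pos rfl))

lemma adjIncl_insFrom : (adjIncl A (SubVar S F) ≫ adjIncl _ _) ≫ adjInsFrom A F s =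
    adjIncl A _ := by
  rw [Category.assoc, adjInsFrom, adjIncl_desc, adjInsOld, adjIncl_desc]

lemma adjInsFrom_old {n : ℕ} {t : S n} (ht : ⟨n, t⟩ ∈ F) : app (adjInsFrom A F s) n
    (app (adjIncl (adj A (SubVar S F)) _) n (adjVar A (SubVar S F) n ⟨t, ht⟩)) =
      adjVar A _ n ⟨t, Finset.mem_insert_of_mem ht⟩ :=
  (adjDesc_incl _ _ _ _).trans (adjDesc_var _ _ _ _)

lemma adjInsFrom_new : app (adjInsFrom A F s) m
    (adjVar (adj A (SubVar S F)) (SingleGen.{u} m) m (singleIdx m)) =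
      adjVar A _ m ⟨s, Finset.mem_insert_self _ _⟩ := adjDesc_var _ _ _ _

lemma adjInsTo_from (hs : ⟨m, s⟩ ∉ F) : adjInsTo A F s ≫ adjInsFrom A F s = 𝟙 _ := by
  refine adj_hom_ext ?_ fun n t => ?_
  · rw [← Category.assoc, adjIncl_insTo, adjIncl_insFrom, Category.comp_id]
  · obtain ⟨t, ht⟩ := t
    obtain h | h := Finset.mem_insert.1 ht
    · cases h
      rw [comp_app, adjInsTo_new _ _ _ _ hs, adjInsFrom_new]; rfl
    · rw [comp_app, adjInsTo_old _ _ _ _ h, adjInsFrom_old]; rfl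

lemma adjInsTo_retr (hs : ⟨m, s⟩ ∉ F) : adjInsTo A F s ≫ adjRetr _ _ ≫ adjRetr _ _ =
    adjRetr A _ := by
  refine adj_hom_ext ?_ fun n t => ?_
  · rw [← Category.assoc, adjIncl_insTo, Category.assoc, ← Category.assoc (adjIncl _ _) (adjRetr _ _),
      adjIncl_retr, Category.id_comp, adjIncl_retr, adjIncl_retr]
  · obtain ⟨t, ht⟩ := t
    refine Eq.trans ?_ (adjDesc_var (𝟙 A) (fun _ _ => 0) n _).symm
    obtain h | h := Finset.mem_insert.1 ht
    · cases h
      rw [comp_app, adjInsTo_new _ _ _ _ hs, comp_app, adjRetr_var, map_zero]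
    · rw [comp_app, adjInsTo_old _ _ _ _ h, comp_app, adjRetr_incl, adjRetr_var]

end Insert

/-- Adjoining variables is a homotopy equivalence if this is so for single variables. -/
lemma adj_contracts_of_single
    (h : ∀ (A : TDGA T) (n : ℕ),
      Contracts (adjIncl A (SingleGen.{u} (n + 1))) (adjRetr A (SingleGen.{u} (n + 1))))
    [IsEmpty (S 0)] : Contracts (adjIncl A S) (adjRetr A S) := by
  classical
  have fin : ∀ F : Finset (Σ n, S n),
      Contracts (adjIncl A (SubVar S F)) (adjRetr A (SubVar S F)) := by
    intro F
    induction F using Finset.induction_on with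
    | empty =>
      intro n x _
      have e : adjRetr A (SubVar S ∅) ≫ adjIncl A (SubVar S ∅) = 𝟙 _ :=
        adj_hom_ext rfl fun n s => absurd s.2 (Finset.notMem_empty _)
      rw [← comp_app, e, id_app, sub_self]
      exact isBdry_zero _ _
    | insert s F hs ih =>
      obtain ⟨m, s⟩ := s
      obtain _ | m := m
      · exact isEmptyElim s
      -- The extension by the enlarged set is a retract of a two-step extension, and contractions
      -- compose.
      · exact (ih.comp (h (adj A (SubVar S F)) m)).of_retract (adjInsTo A F s) (adjInsFrom A F s)
          (adjInsTo_from A F s hs) (adjIncl_insFrom A F s) (adjInsTo_retr A F s hs)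
  intro n x hx
  obtain ⟨F, y, rfl⟩ := exists_adjSub x
  -- Sending the remaining variables to 0 retracts onto the finite extension, so the representative
  -- of a cycle is itself a cycle.
  have hy : (adj A (SubVar S F)).IsCyc n y := by
    have := hx.app (adjProj A F)
    rwa [← comp_app, adjSub_proj] at this
  have := (fin F n y hy).app (adjSub A F)
  have e1 : adjIncl A (SubVar S F) ≫ adjSub A F = adjIncl A S := adjIncl_desc _ _
  have e2 : adjSub A F ≫ adjRetr A S = adjRetr A (SubVar S F) := by
    refine adj_hom_ext ?_ fun n s => ?_
    · rw [← Category.assoc, e1, adjIncl_retr, adjIncl_retr]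
    · rw [comp_app, adjSub, adjDesc_var, adjRetr_var, adjRetr_var]
  rwa [map_sub, ← e2, ← comp_app, e1, comp_app] at this

end Adjoin

end TDGA

/-! ### Koszul extensions -/

namespace TDGA

section Koszul

variable (C : TDGA T)

/-- The shift of a `T`-DGA. -/
def Sh : ℕ → Type u
  | 0 => PUnit
  | n + 1 => C.deg n

instance : ∀ n, AddCommGroup (Sh C n)
  | 0 => inferInstanceAs (AddCommGroup PUnit)
  | n + 1 => inferInstanceAs (AddCommGroup (C.deg n))

instance : Subsingleton (Sh C 0) := inferInstanceAs (Subsingleton PUnit)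

instance : ∀ n, Module ℚ (Sh C n)
  | 0 =>
    { smul := fun _ x => x
      one_smul := fun _ => rfl
      mul_smul := fun _ _ _ => rfl
      smul_zero := fun _ => rfl
      smul_add := fun _ _ _ => rfl
      add_smul := fun _ _ _ => Subsingleton.elim (α := Sh C 0) _ _
      zero_smul := fun _ => Subsingleton.elim (α := Sh C 0) _ _ }
  | n + 1 => inferInstanceAs (Module ℚ (C.deg n))

/-- The identification in positive degrees. -/
def toSh (n : ℕ) : C.deg n →ₗ[ℚ] Sh C (n + 1) := LinearMap.id (M := C.deg n)

/-- The identification in positive degrees. -/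
def unSh (n : ℕ) : Sh C (n + 1) →ₗ[ℚ] C.deg n := LinearMap.id (M := C.deg n)

@[simp] lemma unSh_toSh (n : ℕ) (a : C.deg n) : unSh C n (toSh C n a) = a := rfl

@[simp] lemma toSh_unSh (n : ℕ) (a : Sh C (n + 1)) : toSh C n (unSh C n a) = a := rfl

/-- The differential, with values in the shift. -/
def shDif : ∀ n, C.deg n →ₗ[ℚ] Sh C n
  | 0 => 0
  | n + 1 => toSh C n ∘ₗ C.dif n

@[simp] lemma shDif_succ (n : ℕ) (a : C.deg (n + 1)) : shDif C (n + 1) a = toSh C n (C.dif n a) :=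
  rfl

@[simp] lemma shDif_dif (n : ℕ) (a : C.deg (n + 1)) : shDif C n (C.dif n a) = 0 := by
  cases n with
  | zero => rfl
  | succ n => rw [shDif_succ, dif_dif, map_zero]

/-- The action on the shift. -/
def shMul : ∀ {i j k : ℕ}, i + j = k → C.deg i → Sh C j → Sh C k
  | _, 0, _, _, _, _ => 0
  | _, _ + 1, 0, h, _, _ => absurd h (by omega)
  | _, j + 1, k + 1, h, a, b => toSh C k (C.mul (by omega) a (unSh C j b))

variable {C}

lemma shMul_succ {i j k : ℕ} (h : i + (j + 1) = k + 1) (h' : i + j = k) (a : C.deg i)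
    (b : Sh C (j + 1)) : C.shMul h a b = toSh C k (C.mul h' a (unSh C j b)) := rfl

lemma shMul_add {i j k : ℕ} (h : i + j = k) (a : C.deg i) (b c : Sh C j) :
    C.shMul h a (b + c) = C.shMul h a b + C.shMul h a c := by
  obtain _ | j := j
  · exact (add_zero (0 : Sh C k)).symm
  · obtain _ | k := k
    · omega
    · have h' : i + j = k := by omega
      simp only [shMul_succ h h', map_add, C.mul_add]

lemma shMul_zero {i j k : ℕ} (h : i + j = k) (a : C.deg i) : C.shMul h a (0 : Sh C j) = 0 := by
  have := C.shMul_add h a 0 0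
  simpa using this

lemma add_shMul {i j k : ℕ} (h : i + j = k) (a b : C.deg i) (c : Sh C j) :
    C.shMul h (a + b) c = C.shMul h a c + C.shMul h b c := by
  obtain _ | j := j
  · exact (add_zero (0 : Sh C k)).symm
  · obtain _ | k := k
    · omega
    · have h' : i + j = k := by omega
      simp only [shMul_succ h h', map_add, C.add_mul]

lemma shMul_smul {i j k : ℕ} (h : i + j = k) (q : ℚ) (a : C.deg i) (b : Sh C j) :
    C.shMul h a (q • b) = q • C.shMul h a b := by
  obtain _ | j := j
  · exact (smul_zero q).symm
  · obtain _ | k := k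
    · omega
    · have h' : i + j = k := by omega
      simp only [shMul_succ h h', map_smul, C.smul_mul_right]

lemma smul_shMul {i j k : ℕ} (h : i + j = k) (q : ℚ) (a : C.deg i) (b : Sh C j) :
    C.shMul h (q • a) b = q • C.shMul h a b := by
  obtain _ | j := j
  · exact (smul_zero q).symm
  · obtain _ | k := k
    · omega
    · have h' : i + j = k := by omega
      simp only [shMul_succ h h', map_smul, C.smul_mul_left]

lemma one_shMul {n : ℕ} (b : Sh C n) : C.shMul (zero_add n) C.one b = b := by
  obtain _ | n := n
  · exact Subsingleton.elim _ _
  · rw [shMul_succ _ (zero_add n), C.one_mul, toSh_unSh]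

lemma mul_shMul {i j k ij jk n : ℕ} (hij : i + j = ij) (hjk : j + k = jk) (h : ij + k = n)
    (h' : i + jk = n) (a : C.deg i) (b : C.deg j) (c : Sh C k) :
    C.shMul h (C.mul hij a b) c = C.shMul h' a (C.shMul hjk b c) := by
  obtain _ | k := k
  · exact (C.shMul_zero h' a).symm
  · obtain _ | jk := jk
    · omega
    obtain _ | n := n
    · omega
    rw [shMul_succ h (show ij + k = n by omega), shMul_succ hjk (show j + k = jk by omega),
      shMul_succ h' (show i + jk = n by omega), unSh_toSh,
      C.mul_assoc hij (show j + k = jk by omega) _ (show i + jk = n by omega)]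

lemma shMul_left_comm {i j k ik jk n : ℕ} (hjk : j + k = jk) (hik : i + k = ik) (h : i + jk = n)
    (h' : j + ik = n) (a : C.deg i) (b : C.deg j) (c : Sh C k) :
    C.shMul h a (C.shMul hjk b c) = (-1 : ℚ) ^ (i * j) • C.shMul h' b (C.shMul hik a c) := by
  rw [← C.mul_shMul rfl hjk (by omega) h a b c, ← C.mul_shMul rfl hik (by omega) h' b a c,
    ← smul_shMul]
  have : ∀ {p q : ℕ} (hp : i + j = p) (hq : j + i = q) (hpn : p + k = n) (hqn : q + k = n),
      C.shMul hpn (C.mul hp a b) c = C.shMul hqn ((-1 : ℚ) ^ (i * j) • C.mul hq b a) c := by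
    intro p q hp hq hpn hqn
    obtain rfl : p = q := by omega
    rw [C.mul_comm hp hq]
  exact this _ _ _ _

/-- The Leibniz rule, uniformly in all degrees. -/
lemma shDif_mul {i j k : ℕ} (h : i + j = k) (h' : j + i = k) (a : C.deg i) (b : C.deg j) :
    shDif C k (C.mul h a b) = (-1 : ℚ) ^ i • C.shMul h a (shDif C j b) +
      (-1 : ℚ) ^ ((i + 1) * j) • C.shMul h' b (shDif C i a) := by
  obtain _ | i := i <;> obtain _ | j := j
  · obtain rfl : k = 0 := by omega
    exact Subsingleton.elim _ _
  · obtain rfl : k = j + 1 := by omega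
    rw [shDif_succ, leibniz_left, shDif_succ, shMul_succ _ (zero_add j), unSh_toSh, pow_zero,
      one_smul, show shDif C 0 a = 0 from rfl, shMul_zero, smul_zero, add_zero]
  · obtain rfl : k = i + 1 := by omega
    rw [shDif_succ, leibniz_right, shDif_succ, shMul_succ _ (zero_add i), unSh_toSh,
      show shDif C 0 b = 0 from rfl, shMul_zero, smul_zero, zero_add, C.mul_comm _ (zero_add i)]
    simp
  · obtain _ | k := k
    · omega
    rw [shDif_succ, leibniz' _ h (by omega) (by omega), shDif_succ, shDif_succ,
      shMul_succ _ (show i + 1 + j = k by omega), shMul_succ _ (show j + 1 + i = k by omega),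
      unSh_toSh, unSh_toSh, map_add, map_smul]
    refine (add_comm _ _).trans (congrArg₂ _ rfl ?_)
    rw [C.mul_comm (show i + (j + 1) = k by omega) (show j + 1 + i = k by omega), map_smul]
    congr 1
    rw [show (i + 1 + 1) * (j + 1) = i * (j + 1) + 2 * (j + 1) by ring, pow_add, pow_mul _ 2]
    simp

variable (C)

/-- The graded pieces of the Koszul extension. -/
abbrev KDeg (n : ℕ) : Type u := C.deg n × Sh C n

/-- The differential of the Koszul extension. -/
def kDif (x : C.deg 0) (n : ℕ) (a : KDeg C (n + 1)) : KDeg C n :=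
  -- A pair (a, v) stands for a + v y with y of degree 1 and d y = x. The sign arises from moving d
  -- past v, which has degree n.
  (C.dif n a.1 + (-1 : ℚ) ^ n • C.mul (zero_add n) x (unSh C n a.2), shDif C n (unSh C n a.2))

/-- The product of the Koszul extension. -/
def kMul {i j k : ℕ} (h : i + j = k) (a : KDeg C i) (b : KDeg C j) : KDeg C k :=
  -- Moving y past b and then v, of degree i - 1, past b gives the total sign (-1)^(i j). There is
  -- no term v y w y because y² = 0.
  (C.mul h a.1 b.1, C.shMul h a.1 b.2 + (-1 : ℚ) ^ (i * j) • C.shMul ((add_comm j i).trans h) b.1 a.2)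

lemma neg_one_pow_cases (i : ℕ) : (-1 : ℚ) ^ i = 1 ∨ (-1 : ℚ) ^ i = -1 := neg_one_pow_eq_or ℚ i

lemma kMul_assoc {i j k ij jk n : ℕ} (hij : i + j = ij) (hjk : j + k = jk) (h : ij + k = n)
    (h' : i + jk = n) (a : KDeg C i) (b : KDeg C j) (c : KDeg C k) :
    kMul C h (kMul C hij a b) c = kMul C h' a (kMul C hjk b c) := by
  refine Prod.ext (C.mul_assoc hij hjk h h' _ _ _) ?_
  simp only [kMul, shMul_add, shMul_smul]
  rw [C.mul_shMul hij hjk h h', C.mul_shMul hjk (rfl : k + i = k + i) _ (show j + (k + i) = n by omega),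
    C.shMul_left_comm _ (show k + j = jk by omega) _ (show i + jk = n by omega),
    C.shMul_left_comm _ (show k + i = k + i from rfl) _ (show j + (k + i) = n by omega)]
  subst hij hjk
  -- Once each power of -1 is replaced by 1 or -1, only finitely many linear identities remain.
  rcases neg_one_pow_cases i with hi | hi <;> rcases neg_one_pow_cases j with hj | hj <;>
  rcases neg_one_pow_cases k with hk | hk <;>
  simp [pow_mul, pow_add, hi, hj, hk] <;> abel

lemma kMul_comm {i j n : ℕ} (h : i + j = n) (h' : j + i = n) (a : KDeg C i) (b : KDeg C j) :
    kMul C h a b = (-1 : ℚ) ^ (i * j) • kMul C h' b a := by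
  refine Prod.ext (C.mul_comm h h' _ _) ?_
  change _ + _ = (-1 : ℚ) ^ (i * j) • (_ + (-1 : ℚ) ^ (j * i) • _)
  rcases neg_one_pow_cases i with hi | hi <;> rcases neg_one_pow_cases j with hj | hj <;>
  simp [pow_mul, hi, hj] <;> abel

variable {C}

lemma kDif_leibniz (x : C.deg 0) {i j n : ℕ} (h : i + 1 + (j + 1) = n + 1) (h₁ : i + (j + 1) = n)
    (h₂ : i + 1 + j = n) (a : KDeg C (i + 1)) (b : KDeg C (j + 1)) :
    kDif C x n (kMul C h a b) =
      kMul C h₁ (kDif C x i a) b + (-1 : ℚ) ^ (i + 1) • kMul C h₂ a (kDif C x j b) := by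
  obtain ⟨a, v⟩ := a
  obtain ⟨b, w⟩ := b
  obtain ⟨v, rfl⟩ : ∃ v', toSh C i v' = v := ⟨unSh C i v, rfl⟩
  obtain ⟨w, rfl⟩ : ∃ w', toSh C j w' = w := ⟨unSh C j w, rfl⟩
  have hs : (-1 : ℚ) ^ n = (-1) ^ i * (-1) ^ j * (-1) := by
    rw [← h₁, pow_add, pow_succ, _root_.mul_assoc]
  refine Prod.ext ?_ ?_
  · change C.dif n (C.mul h a b) + (-1 : ℚ) ^ n • C.mul (zero_add n) x (unSh C n (C.shMul h a _ +
      (-1 : ℚ) ^ ((i + 1) * (j + 1)) • C.shMul _ b _)) = C.mul h₁ (C.dif i a +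
      (-1 : ℚ) ^ i • C.mul _ x v) b + (-1 : ℚ) ^ (i + 1) • C.mul h₂ a (C.dif j b +
      (-1 : ℚ) ^ j • C.mul _ x w)
    rw [leibniz' C h h₁ h₂, shMul_succ _ h₂, shMul_succ _ (show j + 1 + i = n by omega)]
    simp only [map_add, map_smul, unSh_toSh, C.mul_add, C.add_mul, C.smul_mul_left,
      C.smul_mul_right]
    rw [C.mul_left_comm0 h₂, C.mul_assoc (zero_add i) h₁ h₁ (zero_add n),
      C.mul_comm (show j + 1 + i = n by omega) h₁, C.smul_mul_right, hs]
    rcases neg_one_pow_cases i with hi | hi <;> rcases neg_one_pow_cases j with hj | hj <;>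
    simp [pow_mul, pow_add, hi, hj] <;> abel
  · change shDif C n (unSh C n (C.shMul h a _ +
      (-1 : ℚ) ^ ((i + 1) * (j + 1)) • C.shMul _ b _)) = C.shMul h₁ (C.dif i a +
      (-1 : ℚ) ^ i • C.mul _ x v) (toSh C j w) + (-1 : ℚ) ^ (i * (j + 1)) • C.shMul _ b
      (shDif C i v) +
      (-1 : ℚ) ^ (i + 1) • (C.shMul h₂ a (shDif C j w) + (-1 : ℚ) ^ ((i + 1) * j) • C.shMul _
        (C.dif j b + (-1 : ℚ) ^ j • C.mul _ x w) (toSh C i v))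
    -- Graded commutativity, transported to the shift, brings the mixed terms on both sides to the
    -- same order of factors; `e2` below does the same for terms carrying the degree 0 factor x.
    have e : ∀ (v' : C.deg i) (b' : C.deg j) (hp : i + (j + 1) = n) (hq : j + (i + 1) = n),
        C.shMul hp v' (toSh C j b') = (-1 : ℚ) ^ (i * j) • C.shMul hq b' (toSh C i v') := by
      intro v' b' hp hq
      obtain _ | n := n
      · omega
      rw [shMul_succ hp (by omega), shMul_succ hq (by omega), ← map_smul, unSh_toSh, unSh_toSh,
        ← C.mul_comm (show i + j = n by omega)]
    rw [shMul_succ _ h₂, shMul_succ _ (show j + 1 + i = n by omega)]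
    simp only [map_add, map_smul, unSh_toSh, add_shMul, smul_shMul]
    rw [shDif_mul h₂ (show j + (i + 1) = n by omega), shDif_mul (show j + 1 + i = n by omega)
      (show i + (j + 1) = n by omega), shDif_succ, shDif_succ,
      e v (C.dif j b) _ (by omega), e (C.dif i a) w _ (by omega)]
    have e2 : ∀ (hp : i + (j + 1) = n) (hq : j + (i + 1) = n),
        C.shMul hp (C.mul (zero_add i) x v) (toSh C j w) =
          (-1 : ℚ) ^ (i * j) • C.shMul hq (C.mul (zero_add j) x w) (toSh C i v) := by
      intro hp hq
      obtain _ | n := n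
      · omega
      rw [shMul_succ hp (by omega), shMul_succ hq (by omega), ← map_smul, unSh_toSh, unSh_toSh,
        C.mul_assoc _ (show i + j = n by omega) _ (zero_add n),
        C.mul_assoc _ (show j + i = n by omega) _ (zero_add n), ← C.smul_mul_right,
        ← C.mul_comm (show i + j = n by omega)]
    rw [e2 _ (by omega)]
    rcases neg_one_pow_cases i with hi | hi <;> rcases neg_one_pow_cases j with hj | hj <;>
    simp [pow_mul, pow_add, hi, hj] <;> abel

lemma kDif_leibniz_left (x : C.deg 0) {j : ℕ} (a : KDeg C 0) (b : KDeg C (j + 1)) :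
    kDif C x j (kMul C (zero_add _) a b) = kMul C (zero_add _) a (kDif C x j b) := by
  obtain ⟨a, v⟩ := a
  obtain ⟨b, w⟩ := b
  obtain ⟨w, rfl⟩ : ∃ w', toSh C j w' = w := ⟨unSh C j w, rfl⟩
  obtain rfl : v = 0 := Subsingleton.elim _ _
  refine Prod.ext ?_ ?_
  · change C.dif j (C.mul _ a b) + (-1 : ℚ) ^ j • C.mul (zero_add j) x (unSh C j (C.shMul _ a _ +
      (-1 : ℚ) ^ (0 * (j + 1)) • C.shMul _ b 0)) = C.mul _ a (C.dif j b +
      (-1 : ℚ) ^ j • C.mul _ x w)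
    rw [shMul_zero, smul_zero, add_zero, shMul_succ _ (zero_add j), leibniz_left, unSh_toSh,
      unSh_toSh, C.mul_add, C.smul_mul_right, ← C.mul_left_comm0]
  · change shDif C j (unSh C j (C.shMul _ a _ + (-1 : ℚ) ^ (0 * (j + 1)) • C.shMul _ b 0)) =
      C.shMul _ a (shDif C j w) + (-1 : ℚ) ^ (0 * j) • C.shMul _ _ 0
    rw [shMul_zero, shMul_zero, smul_zero, smul_zero, add_zero, add_zero,
      shMul_succ _ (zero_add j), unSh_toSh, unSh_toSh, shDif_mul _ (add_zero j),
      show shDif C 0 a = 0 from rfl, shMul_zero, smul_zero, add_zero, pow_zero, one_smul]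

lemma kMul_add {i j k : ℕ} (h : i + j = k) (a : KDeg C i) (b c : KDeg C j) :
    kMul C h a (b + c) = kMul C h a b + kMul C h a c := by
  refine Prod.ext (C.mul_add h _ _ _) ?_
  simp only [kMul, Prod.snd_add, Prod.fst_add, shMul_add, add_shMul, smul_add]
  abel

lemma kDif_add (x : C.deg 0) (n : ℕ) (a b : KDeg C (n + 1)) :
    kDif C x n (a + b) = kDif C x n a + kDif C x n b := by
  refine Prod.ext ?_ ?_
  · simp only [kDif, Prod.fst_add, Prod.snd_add, map_add, C.mul_add, smul_add]
    abel
  · simp only [kDif, Prod.snd_add, map_add]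

lemma kDif_smul (x : C.deg 0) (n : ℕ) (q : ℚ) (a : KDeg C (n + 1)) :
    kDif C x n (q • a) = q • kDif C x n a := by
  refine Prod.ext ?_ ?_
  · simp only [kDif, Prod.smul_fst, Prod.smul_snd, map_smul, C.smul_mul_right, smul_add]
    rw [smul_comm]
  · simp only [kDif, Prod.smul_snd, map_smul]

variable (C) in
/-- The Koszul extension, as graded data. -/
def kosData (x : C.deg 0) : GradedData T where
  deg := KDeg C
  d := kDif C x
  d_add := kDif_add x
  d_d n a := by
    obtain ⟨a, v⟩ := a
    refine Prod.ext ?_ ?_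
    · simp only [kDif, map_add, map_smul, dif_dif, leibniz_left, unSh_toSh, shDif_succ]
      rw [zero_add, ← add_smul, pow_succ]
      simp
    · simp [kDif]
  mul := kMul C
  one := (C.one, 0)
  mul_add := kMul_add
  add_mul {i j k} h a b c := by
    have h' : j + i = k := (add_comm j i).trans h
    rw [kMul_comm C h h', kMul_add, smul_add, ← kMul_comm, ← kMul_comm]
  one_mul {n} a := by
    refine Prod.ext (C.one_mul _) ?_
    change C.shMul _ C.one a.2 + (-1 : ℚ) ^ (0 * n) • C.shMul _ a.1 0 = a.2
    rw [shMul_zero, smul_zero, add_zero, one_shMul]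
  mul_assoc := kMul_assoc C
  mul_comm := kMul_comm C
  leibniz := kDif_leibniz x
  leibniz_zero_left := kDif_leibniz_left x
  leibniz_zero_right {i} a b := by
    rw [kMul_comm C _ (zero_add _), kMul_comm C _ (zero_add i), kDif_smul, kDif_leibniz_left]
    simp
  str :=
    { op := fun p v => (C.str.op p fun i => (v i).1, 0)
      op_var := fun i v => Prod.ext (C.str.op_var i _) (Subsingleton.elim (α := Sh C 0) _ _)
      op_comp := fun p g v => Prod.ext (C.str.op_comp p g _) rfl }
  str_add a b := Prod.ext (by
    refine Eq.trans (congrArg (C.str.op _) (funext fun i => ?_)) (C.str_add a.1 b.1)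
    fin_cases i <;> rfl) (Subsingleton.elim (α := Sh C 0) _ _)
  str_mul a b := Prod.ext (by
    refine Eq.trans (congrArg (C.str.op _) (funext fun i => ?_)) (C.str_mul a.1 b.1)
    fin_cases i <;> rfl) (Subsingleton.elim (α := Sh C 0) _ _)
  str_one := Prod.ext (Eq.trans (congrArg (C.str.op _) (funext fun i : Fin 0 => i.elim0)) C.str_one) rfl
  str_smul q a := Prod.ext (by
    refine Eq.trans (congrArg (C.str.op _) (funext fun i => ?_)) (C.str_smul q a.1)
    fin_cases i; rfl) (Subsingleton.elim (α := Sh C 0) _ _)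

variable (C) in
/-- The Koszul extension, freely adjoining a variable of degree `1` with differential `x`. -/
def kos (x : C.deg 0) : TDGA T := (kosData C x).toTDGA

lemma kos_dif (x : C.deg 0) (n : ℕ) (a : KDeg C (n + 1)) : (kos C x).dif n a = kDif C x n a :=
  (kosData C x).dif_eq n a

/-- The inclusion of the constants. -/
def kosIncl (x : C.deg 0) : C ⟶ kos C x :=
  homMk (B := kos C x) (fun n a => ((a, 0) : KDeg C n))
    (fun n a b => Prod.ext rfl (add_zero (0 : Sh C n)).symm)
    (fun n a => by
      refine Eq.trans ?_ (kos_dif x n (a, 0)).symm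
      refine Prod.ext ?_ ?_
      · simp [kDif, C.mul_zero]
      · simp [kDif])
    (fun {i j k} h a b => Prod.ext rfl (by
      change 0 = C.shMul _ a 0 + (-1 : ℚ) ^ (i * j) • C.shMul _ b 0
      rw [shMul_zero, shMul_zero, smul_zero, add_zero]))
    (fun p a => rfl)

/-- The variable of degree `1`. -/
def kosVar (x : C.deg 0) : (kos C x).deg 1 := ((0, toSh C 0 C.one) : KDeg C 1)

/-! ### Maps out of a Koszul extension -/

section Desc

variable {Z : TDGA T} (f : C ⟶ Z) (y : Z.deg 1)

/-- The map `v ↦ f(v) y` on the shift. -/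
def shTo : ∀ n, Sh C n →ₗ[ℚ] Z.deg n
  | 0 => 0
  | n + 1 =>
    { toFun := fun v => Z.mul rfl (app f n (unSh C n v)) y
      map_add' := fun v w => by rw [map_add, map_add, Z.add_mul]
      map_smul' := fun q v => by rw [map_smul, map_smul, Z.smul_mul_left]; rfl }

lemma shTo_succ (n : ℕ) (v : Sh C (n + 1)) :
    shTo f y (n + 1) v = Z.mul rfl (app f n (unSh C n v)) y := rfl

lemma shTo_shMul {i j k : ℕ} (h : i + j = k) (a : C.deg i) (v : Sh C j) :
    shTo f y k (C.shMul h a v) = Z.mul h (app f i a) (shTo f y j v) := by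
  obtain _ | j := j
  · refine (map_zero _).trans ?_
    exact (Z.mul_zero h _).symm
  · obtain _ | k := k
    · omega
    have h' : i + j = k := by omega
    rw [shMul_succ h h', shTo_succ, shTo_succ, unSh_toSh, app_mul, Z.mul_assoc h' rfl rfl h]

/-- Graded commutativity gives y² = -y², and 2 is invertible. -/
lemma odd_sq (y : Z.deg 1) : Z.mul (rfl : 1 + 1 = 2) y y = 0 := by
  have h := Z.mul_comm (rfl : 1 + 1 = 2) (rfl : 1 + 1 = 2) y y
  rw [mul_one, pow_one, neg_smul, one_smul] at h
  have h2 : (2 : ℚ) • Z.mul (rfl : 1 + 1 = 2) y y = 0 := by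
    rw [two_smul]
    exact eq_neg_iff_add_eq_zero.1 h
  exact (smul_eq_zero.1 h2).resolve_left two_ne_zero

lemma shTo_mul_shTo {i j k : ℕ} (h : i + j = k) (v : Sh C i) (w : Sh C j) :
    Z.mul h (shTo f y i v) (shTo f y j w) = 0 := by
  obtain _ | i := i
  · exact Z.zero_mul h _
  obtain _ | j := j
  · exact Z.mul_zero h _
  have hy : ∀ {m p q : ℕ} (hp : m + 1 = p) (hq : 1 + p = q) (b : Z.deg m),
      Z.mul hq y (Z.mul hp b y) = 0 := by
    intro m p q hp hq b
    rw [Z.mul_comm hp ((add_comm 1 m).trans hp), Z.smul_mul_right,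
      ← Z.mul_assoc rfl _ (show 2 + m = q by omega) hq, odd_sq, Z.zero_mul, smul_zero]
  rw [shTo_succ, shTo_succ, Z.mul_assoc rfl (rfl : 1 + (j + 1) = 1 + (j + 1)) h (by omega), hy,
    Z.mul_zero]

/-- This is d(v y) = (-1)^n v x + (d v) y: compatibility of v ↦ f(v) y with the Koszul differential.
-/
lemma dif_shTo {x : C.deg 0} (hy : Z.dif 0 y = app f 0 x) (n : ℕ) (v : C.deg n) :
    Z.dif n (shTo f y (n + 1) (toSh C n v)) =
      (-1 : ℚ) ^ n • app f n (C.mul (zero_add n) x v) + shTo f y n (shDif C n v) := by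
  rw [shTo_succ, unSh_toSh, app_mul]
  obtain _ | n := n
  · refine (Z.leibniz_left (app f 0 v) y).trans ?_
    rw [hy, Z.mul_comm _ (zero_add 0)]
    exact (add_zero _).symm
  · refine (Z.leibniz' (i := n) (j := 0) rfl rfl rfl (app f (n + 1) v) y).trans ?_
    rw [hy, shDif_succ, shTo_succ, unSh_toSh, app_dif]
    refine (add_comm _ _).trans (congrArg₂ _ ?_ rfl)
    rw [Z.mul_comm _ (zero_add (n + 1))]
    simp

/-- The morphism out of a Koszul extension. -/
def kosDesc {x : C.deg 0} (hy : Z.dif 0 y = app f 0 x) : kos C x ⟶ Z :=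
  homMk (A := kos C x) (fun n (a : KDeg C n) => app f n a.1 + shTo f y n a.2)
    (fun n (a b : KDeg C n) => by
      change app f n (a.1 + b.1) + shTo f y n (a.2 + b.2) = _
      rw [map_add, map_add]; abel)
    (fun n (a : KDeg C (n + 1)) => by
      refine (congrArg (fun a : KDeg C n => app f n a.1 + shTo f y n a.2) (kos_dif x n a)).trans ?_
      obtain ⟨a, v⟩ := a
      obtain ⟨v, rfl⟩ : ∃ v', toSh C n v' = v := ⟨unSh C n v, rfl⟩
      change app f n (C.dif n a + (-1 : ℚ) ^ n • C.mul _ x v) + shTo f y n (shDif C n v) = _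
      rw [map_add (Z.dif n), dif_shTo f y hy, map_add, app_dif, map_smul]
      abel)
    (fun {i j k} h (a : KDeg C i) (b : KDeg C j) => by
      change app f k (C.mul h a.1 b.1) + shTo f y k (C.shMul h a.1 b.2 +
        (-1 : ℚ) ^ (i * j) • C.shMul _ b.1 a.2) = _
      rw [Z.mul_add, Z.add_mul, Z.add_mul, shTo_mul_shTo, map_add, map_smul, shTo_shMul, shTo_shMul,
        app_mul, Z.mul_comm h ((add_comm j i).trans h) (shTo f y i a.2)]
      abel)
    (fun {n} p a => by
      refine (add_zero _).trans ?_
      refine (app_op f p _).trans (congrArg (Z.str.op p) (funext fun i => ?_))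
      exact (add_zero _).symm)

lemma kosDesc_app {x : C.deg 0} (hy : Z.dif 0 y = app f 0 x) (n : ℕ) (a : KDeg C n) :
    app (kosDesc f y hy) n a = app f n a.1 + shTo f y n a.2 := rfl

lemma kosIncl_desc {x : C.deg 0} (hy : Z.dif 0 y = app f 0 x) :
    kosIncl x ≫ kosDesc f y hy = f := hom_ext fun n a => by
  refine (kosDesc_app f y hy n (a, 0)).trans ?_
  rw [map_zero, add_zero]

lemma kosDesc_var {x : C.deg 0} (hy : Z.dif 0 y = app f 0 x) :
    app (kosDesc f y hy) 1 (kosVar x) = y := by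
  refine (kosDesc_app f y hy 1 (0, toSh C 0 C.one)).trans ?_
  rw [map_zero, zero_add, shTo_succ, unSh_toSh, app_one, Z.one_mul]

end Desc

/-- Here `gam` is an inverse of multiplication by x up to `j ∘ r`, compatible with the differential,
and `hx` says r(x) = 0. For a cycle a + v y the element (-1)^n γ(a) y bounds the required
difference: its first component contributes x γ(a) = a - j r(a), and the cycle condition d a =
-(-1)^n x v gives the coefficient (-1)^n d γ(a) = v of y. -/
lemma kos_contracts {A : TDGA T} {x : C.deg 0} (j : A ⟶ C) (r : C ⟶ A)
    (gam : ∀ n, C.deg n →ₗ[ℚ] C.deg n) (hdif : ∀ n a, gam n (C.dif n a) = C.dif n (gam (n + 1) a))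
    (hmul : ∀ n a, gam n (C.mul (zero_add n) x a) = a)
    (hgam : ∀ n a, C.mul (zero_add n) x (gam n a) = a - app j n (app r n a))
    (hx : A.dif 0 0 = app r 0 x) :
    Contracts (j ≫ kosIncl x) (kosDesc r 0 hx) := by
  intro n z hz
  change KDeg C n at z
  refine ⟨((0, toSh C n ((-1 : ℚ) ^ n • gam n z.1)) : KDeg C (n + 1)), ?_⟩
  refine (kos_dif x n _).trans ?_
  have e : app (kosDesc r 0 hx) n z = app r n z.1 := by
    refine (kosDesc_app r 0 hx n z).trans ?_
    obtain _ | n := n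
    · exact add_zero _
    · rw [shTo_succ, A.mul_zero, add_zero]
  rw [e]
  refine Prod.ext ?_ ?_
  · change C.dif n 0 + (-1 : ℚ) ^ n • C.mul _ x ((-1 : ℚ) ^ n • gam n z.1) =
      z.1 - app j n (app r n z.1)
    rw [map_zero, zero_add, C.smul_mul_right, smul_smul, hgam, ← pow_add, ← two_mul, pow_mul]
    simp
  · change shDif C n ((-1 : ℚ) ^ n • gam n z.1) = z.2 - 0
    rw [sub_zero]
    obtain _ | n := n
    · exact Subsingleton.elim _ _
    · have h0 : kDif C x n z = 0 := (kos_dif x n z).symm.trans hz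
      have h1 : C.dif n z.1 + (-1 : ℚ) ^ n • C.mul _ x (unSh C n z.2) = 0 := congrArg Prod.fst h0
      have h2 := congrArg (gam n) h1
      rw [map_add, map_zero, map_smul, hmul, hdif] at h2
      rw [map_smul, shDif_succ, eq_neg_of_add_eq_zero_left h2, map_neg, map_smul, smul_neg,
        smul_smul, toSh_unSh, ← neg_smul, pow_succ]
      rcases neg_one_pow_cases n with h | h <;> simp [h]

end Koszul

/-! ### Adjoining a variable of degree 1 -/

section DegreeOne

open TensorProduct

variable [T.IsFermat] (A : TDGA T)

/-- Adjoining a variable of degree `0`, annihilated by the differential. -/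
abbrev adjPoly : TDGA T := A.baseChange (TAlg.polyIncl A.alg0)

/-- The variable of degree `0`. -/
def adjPolyVar : (adjPoly A).deg 0 :=
  TAlg.Hom.toFun (bcZero (TAlg.polyIncl A.alg0)) (TAlg.polyVar A.alg0)

/-- The difference quotient as a linear map. -/
def quoLin : Along (TAlg.polyIncl A.alg0) →ₗ[A.alg0] Along (TAlg.polyIncl A.alg0) where
  toFun := TAlg.polyQuo A.alg0
  map_add' := TAlg.polyQuo_add A.alg0
  map_smul' := TAlg.polyQuo_incl_mul A.alg0

/-- The difference quotient with coefficients. -/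
def quoTens (n : ℕ) : Tens (TAlg.polyIncl A.alg0) n →ₗ[A.alg0] Tens (TAlg.polyIncl A.alg0) n :=
  (quoLin A).lTensor (A.deg n)

/-- The difference quotient with coefficients, over the rational numbers. -/
def quoRat (n : ℕ) : (adjPoly A).deg n →ₗ[ℚ] (adjPoly A).deg n :=
  AddMonoidHom.toRatLinearMap (quoTens A n).toAddMonoidHom

lemma adjPolyVar_mul (n : ℕ) (a : A.deg n) (l : Along (TAlg.polyIncl A.alg0)) :
    (adjPoly A).mul (zero_add n) (adjPolyVar A) (a ⊗ₜ[A.alg0] l : Tens (TAlg.polyIncl A.alg0) n) =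
      (a ⊗ₜ[A.alg0] ((show Along (TAlg.polyIncl A.alg0) from TAlg.polyVar A.alg0) * l) :
        Tens (TAlg.polyIncl A.alg0) n) := by
  refine (congrArg (fun z : (adjPoly A).deg 0 => (adjPoly A).mul (zero_add n) z
    (a ⊗ₜ[A.alg0] l : Tens (TAlg.polyIncl A.alg0) n)) (bcZero_apply _ _)).trans ?_
  refine (tensMul_tmul _ (zero_add n) A.one a _ l).trans ?_
  rw [A.one_mul]

/-- The evaluation at `0`. -/
def adjPolyEval : adjPoly A ⟶ A :=
  bcDesc (𝟙 A) (TAlg.polyEval A.alg0) (TAlg.polyIncl_desc _ _)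

lemma toBaseChange_adjPolyEval : A.toBaseChange _ ≫ adjPolyEval A = 𝟙 A :=
  toBaseChange_desc _ _ _

lemma adjPolyEval_var : A.dif 0 0 = app (adjPolyEval A) 0 (adjPolyVar A) := by
  rw [map_zero]
  refine Eq.trans ?_ (TAlg.congr_toFun (bcZero_desc (𝟙 A) (TAlg.polyEval A.alg0)
    (TAlg.polyIncl_desc _ _)) (TAlg.polyVar A.alg0)).symm
  exact A.alg0_zero.symm.trans (TAlg.polyDesc_var _ _).symm

lemma quoRat_dif (n : ℕ) (a : (adjPoly A).deg (n + 1)) :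
    quoRat A n ((adjPoly A).dif n a) = (adjPoly A).dif n (quoRat A (n + 1) a) :=
  baseChange_induction (S := fun a => quoRat A n ((adjPoly A).dif n a) =
    (adjPoly A).dif n (quoRat A (n + 1) a)) _ (by simp only [map_zero])
    (fun x y hx hy => by simp only [map_add, hx, hy]) (fun a l => rfl) a

lemma quoRat_mul (n : ℕ) (a : (adjPoly A).deg n) :
    quoRat A n ((adjPoly A).mul (zero_add n) (adjPolyVar A) a) = a :=
  baseChange_induction (S := fun a => quoRat A n ((adjPoly A).mul (zero_add n) (adjPolyVar A) a) = a)
    _ (by rw [(adjPoly A).mul_zero, map_zero])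
    (fun x y hx hy => by rw [(adjPoly A).mul_add, map_add, hx, hy])
    (fun a l => (congrArg (quoRat A n) (adjPolyVar_mul A n a l)).trans
      (congrArg (fun l : Along (TAlg.polyIncl A.alg0) => a ⊗ₜ[A.alg0] l)
        (TAlg.polyQuo_var_mul A.alg0 l))) a

/-- The identity x q(c) = c - c(0) for difference quotients, extended A₀-linearly to coefficients in
A. -/
lemma mul_quoRat (n : ℕ) (a : (adjPoly A).deg n) :
    (adjPoly A).mul (zero_add n) (adjPolyVar A) (quoRat A n a) =
      a - app (A.toBaseChange _) n (app (adjPolyEval A) n a) := by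
  refine baseChange_induction (S := fun a => (adjPoly A).mul (zero_add n) (adjPolyVar A)
      (quoRat A n a) = a - app (A.toBaseChange _) n (app (adjPolyEval A) n a)) _ ?_ ?_ ?_ a
  · rw [map_zero, (adjPoly A).mul_zero, map_zero, map_zero, sub_zero]
  · intro x y hx hy
    rw [map_add, (adjPoly A).mul_add, map_add, map_add, hx, hy]
    abel
  · intro a l
    refine (adjPolyVar_mul A n a (quoLin A l)).trans ?_
    have h : (show Along (TAlg.polyIncl A.alg0) from TAlg.polyVar A.alg0) * quoLin A l =
        l - (show A.alg0 from TAlg.Hom.toFun (TAlg.polyEval A.alg0) l) •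
          (1 : Along (TAlg.polyIncl A.alg0)) := by
      rw [Algebra.smul_def, _root_.mul_one]
      exact TAlg.polyVar_mul_quo A.alg0 l
    rw [h, tmul_sub, ← smul_tmul]
    rfl

/-- The comparison of an extension by a variable of degree `1` with a Koszul extension. -/
def adjToKos : adj A (SingleGen.{u} 1) ⟶ kos (adjPoly A) (adjPolyVar A) :=
  adjDesc (A.toBaseChange _ ≫ kosIncl _) (singleFam (n := 1) (kosVar (adjPolyVar A)))

/-- The image of the variable of degree `0`. -/
def adjPolyTo : adjPoly A ⟶ adj A (SingleGen.{u} 1) :=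
  bcDesc (adjIncl A _) (TAlg.polyDesc (map0 (adjIncl A _))
    ((adj A (SingleGen.{u} 1)).dif 0 (adjVar A _ 1 (singleIdx 1)))) (TAlg.polyIncl_desc _ _)

lemma adjPolyTo_var : (adj A (SingleGen.{u} 1)).dif 0 (adjVar A _ 1 (singleIdx 1)) =
    app (adjPolyTo A) 0 (adjPolyVar A) := by
  refine Eq.trans ?_ (TAlg.congr_toFun (bcZero_desc (adjIncl A _) (TAlg.polyDesc
    (map0 (adjIncl A _)) ((adj A (SingleGen.{u} 1)).dif 0 (adjVar A _ 1 (singleIdx 1))))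
    (TAlg.polyIncl_desc _ _)) (TAlg.polyVar A.alg0)).symm
  exact (TAlg.polyDesc_var (map0 (adjIncl A _))
    ((adj A (SingleGen.{u} 1)).dif 0 (adjVar A _ 1 (singleIdx 1)))).symm

/-- The comparison of an extension by a variable of degree `1` with a Koszul extension. -/
def kosToAdj : kos (adjPoly A) (adjPolyVar A) ⟶ adj A (SingleGen.{u} 1) :=
  kosDesc (adjPolyTo A) (adjVar A _ 1 (singleIdx 1)) (adjPolyTo_var A)

lemma incl_kosToAdj : (A.toBaseChange _ ≫ kosIncl (adjPolyVar A)) ≫ kosToAdj A = adjIncl A _ := by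
  rw [Category.assoc, kosToAdj, kosIncl_desc]
  exact toBaseChange_desc _ _ _

/-- By the universal properties, the extension by a variable of degree 1 is a retract of the Koszul
extension of A{x}: the variable corresponds to y and its differential to x. -/
lemma adj_one_contracts :
    Contracts (adjIncl A (SingleGen.{u} 1)) (adjRetr A (SingleGen.{u} 1)) := by
  have h := kos_contracts (A.toBaseChange _) (adjPolyEval A) (quoRat A) (quoRat_dif A)
    (quoRat_mul A) (mul_quoRat A) (adjPolyEval_var A)
  refine h.of_retract (adjToKos A) (kosToAdj A) ?_ (incl_kosToAdj A) ?_
  · refine adj_hom_ext ?_ fun n s => ?_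
    · rw [← Category.assoc, adjToKos, adjIncl_desc, incl_kosToAdj, Category.comp_id]
    · obtain ⟨⟨rfl⟩⟩ := s
      exact kosDesc_var (adjPolyTo A) (adjVar A _ 1 (singleIdx 1)) (adjPolyTo_var A)
  · refine adj_hom_ext ?_ fun n s => ?_
    · rw [← Category.assoc, adjToKos, adjIncl_desc, Category.assoc, kosIncl_desc,
        toBaseChange_adjPolyEval, adjIncl_retr]
    · obtain ⟨⟨rfl⟩⟩ := s
      refine (kosDesc_var _ _ (adjPolyEval_var A)).trans ?_
      exact (adjRetr_var 1 (singleIdx 1)).symm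

end DegreeOne

end TDGA

/-! ### Adjoining variables of degree at least `2` -/

namespace TDGA

section Euler

variable (B : TDGA T)

/-- The graded pieces of the algebra representing a derivation with a nullhomotopy. -/
def evSub : ∀ m, Submodule ℚ (B.deg m × B.deg m × B.deg (m + 1))
  -- A triple (b, D b, h b) records a derivation D commuting with d and a derivation h of degree 1
  -- with D = d h + h d. In degree 0 both are required to vanish, so the operations of T need not be
  -- differentiated; in degree 1 the term h d passes through degree 0, which leaves D = d h.
  | 0 => LinearMap.ker (LinearMap.snd ℚ (B.deg 0) (B.deg 0 × B.deg 1))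
  | 1 => LinearMap.ker ((LinearMap.fst ℚ (B.deg 1) (B.deg 2) - B.dif 1 ∘ₗ LinearMap.snd ℚ _ _) ∘ₗ
      LinearMap.snd ℚ (B.deg 1) (B.deg 1 × B.deg 2))
  | _ + 2 => ⊤

variable {B}

lemma mem_evSub_zero (t : B.deg 0 × B.deg 0 × B.deg 1) :
    t ∈ evSub B 0 ↔ t.2.1 = 0 ∧ t.2.2 = 0 := by
  refine LinearMap.mem_ker.trans ?_
  exact Prod.ext_iff

lemma mem_evSub_one (t : B.deg 1 × B.deg 1 × B.deg 2) :
    t ∈ evSub B 1 ↔ t.2.1 = B.dif 1 t.2.2 := by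
  refine LinearMap.mem_ker.trans ?_
  exact sub_eq_zero

lemma mem_evSub_add_two (m : ℕ) (t : B.deg (m + 2) × B.deg (m + 2) × B.deg (m + 2 + 1)) :
    t ∈ evSub B (m + 2) := Submodule.mem_top

variable (B) in
/-- The differential on triples. -/
def evDif (m : ℕ) (t : B.deg (m + 1) × B.deg (m + 1) × B.deg (m + 1 + 1)) :
    B.deg m × B.deg m × B.deg (m + 1) :=
  -- The last entry is h(d b) = D b - d(h b).
  (B.dif m t.1, B.dif m t.2.1, t.2.1 - B.dif (m + 1) t.2.2)

variable (B) in
/-- The product of triples. -/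
def evMul {i j k : ℕ} (h : i + j = k) (s : B.deg i × B.deg i × B.deg (i + 1))
    (t : B.deg j × B.deg j × B.deg (j + 1)) : B.deg k × B.deg k × B.deg (k + 1) :=
  (B.mul h s.1 t.1, B.mul h s.1 t.2.1 + B.mul h s.2.1 t.1,
    B.mul (show i + 1 + j = k + 1 by omega) s.2.2 t.1 +
      (-1 : ℚ) ^ i • B.mul (show i + (j + 1) = k + 1 by omega) s.1 t.2.2)

lemma evDif_mem (m : ℕ) {t : B.deg (m + 1) × B.deg (m + 1) × B.deg (m + 1 + 1)}
    (ht : t ∈ evSub B (m + 1)) : evDif B m t ∈ evSub B m := by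
  obtain _ | _ | m := m
  · have h := (mem_evSub_one t).1 ht
    refine (mem_evSub_zero _).2 ⟨?_, ?_⟩
    · change B.dif 0 t.2.1 = 0
      rw [h, dif_dif]
    · exact sub_eq_zero.2 h
  · refine (mem_evSub_one _).2 ?_
    change B.dif 1 t.2.1 = B.dif 1 (t.2.1 - B.dif 2 t.2.2)
    rw [map_sub, dif_dif, sub_zero]
  · exact mem_evSub_add_two _ _

lemma evMul_mem {i j k : ℕ} (h : i + j = k) {s : B.deg i × B.deg i × B.deg (i + 1)}
    {t : B.deg j × B.deg j × B.deg (j + 1)} (hs : s ∈ evSub B i) (ht : t ∈ evSub B j) :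
    evMul B h s t ∈ evSub B k := by
  obtain _ | _ | k := k
  · obtain rfl : i = 0 := by omega
    obtain rfl : j = 0 := by omega
    obtain ⟨h1, h2⟩ := (mem_evSub_zero _).1 hs
    obtain ⟨h3, h4⟩ := (mem_evSub_zero _).1 ht
    refine (mem_evSub_zero _).2 ⟨?_, ?_⟩
    · simp only [evMul, h1, h3, B.mul_zero, B.zero_mul, add_zero]
    · simp only [evMul, h2, h4, B.mul_zero, B.zero_mul, smul_zero, add_zero]
  · refine (mem_evSub_one _).2 ?_
    obtain _ | i := i
    · obtain rfl : j = 1 := by omega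
      obtain ⟨h1, h2⟩ := (mem_evSub_zero _).1 hs
      have h3 := (mem_evSub_one _).1 ht
      simp only [evMul, h1, h2, h3, B.zero_mul, add_zero, zero_add, pow_zero, one_smul]
      exact (leibniz_left B _ _).symm
    · obtain rfl : i = 0 := by omega
      obtain rfl : j = 0 := by omega
      obtain ⟨h1, h2⟩ := (mem_evSub_zero _).1 ht
      have h3 := (mem_evSub_one _).1 hs
      simp only [evMul, h1, h2, h3, B.mul_zero, add_zero, zero_add, smul_zero]
      exact (leibniz_right B _ _).symm
  · exact mem_evSub_add_two _ _

lemma evMul_assoc {i j k ij jk n : ℕ} (hij : i + j = ij) (hjk : j + k = jk) (h : ij + k = n)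
    (h' : i + jk = n) (a : B.deg i × B.deg i × B.deg (i + 1))
    (b : B.deg j × B.deg j × B.deg (j + 1)) (c : B.deg k × B.deg k × B.deg (k + 1)) :
    evMul B h (evMul B hij a b) c = evMul B h' a (evMul B hjk b c) := by
  refine Prod.ext (B.mul_assoc hij hjk h h' _ _ _) (Prod.ext ?_ ?_)
  · simp only [evMul, B.mul_add, B.add_mul]
    rw [B.mul_assoc hij hjk h h', B.mul_assoc hij hjk h h', B.mul_assoc hij hjk h h']
    abel
  · simp only [evMul, B.mul_add, B.add_mul, B.smul_mul_left, B.smul_mul_right]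
    rw [B.mul_assoc _ hjk _ (show i + 1 + jk = n + 1 by omega),
      B.mul_assoc _ (show j + 1 + k = jk + 1 by omega) _ (show i + (jk + 1) = n + 1 by omega),
      B.mul_assoc hij (show j + (k + 1) = jk + 1 by omega) _ (show i + (jk + 1) = n + 1 by omega),
      show (-1 : ℚ) ^ ij = (-1) ^ i * (-1) ^ j by rw [← hij, pow_add], mul_smul, smul_add,
      add_assoc]

lemma evMul_comm {i j n : ℕ} (h : i + j = n) (h' : j + i = n)
    (a : B.deg i × B.deg i × B.deg (i + 1)) (b : B.deg j × B.deg j × B.deg (j + 1)) :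
    evMul B h a b = (-1 : ℚ) ^ (i * j) • evMul B h' b a := by
  refine Prod.ext (B.mul_comm h h' _ _) (Prod.ext ?_ ?_)
  · change _ = (-1 : ℚ) ^ (i * j) • (B.mul h' b.1 a.2.1 + B.mul h' b.2.1 a.1)
    rw [smul_add, ← B.mul_comm h h', ← B.mul_comm h h']
    exact add_comm _ _
  · change B.mul _ a.2.2 b.1 + (-1 : ℚ) ^ i • B.mul _ a.1 b.2.2 = (-1 : ℚ) ^ (i * j) •
      (B.mul _ b.2.2 a.1 + (-1 : ℚ) ^ j • B.mul _ b.1 a.2.2)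
    rw [B.mul_comm (show i + 1 + j = n + 1 by omega) (show j + (i + 1) = n + 1 by omega),
      B.mul_comm (show i + (j + 1) = n + 1 by omega) (show j + 1 + i = n + 1 by omega)]
    rcases neg_one_pow_cases i with hi | hi <;> rcases neg_one_pow_cases j with hj | hj <;>
    simp [pow_mul, pow_add, hi, hj] <;> abel

lemma evMul_add {i j k : ℕ} (h : i + j = k) (a : B.deg i × B.deg i × B.deg (i + 1))
    (b c : B.deg j × B.deg j × B.deg (j + 1)) :
    evMul B h a (b + c) = evMul B h a b + evMul B h a c := by
  refine Prod.ext (B.mul_add h _ _ _) (Prod.ext ?_ ?_)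
  · simp only [evMul, Prod.fst_add, Prod.snd_add, B.mul_add]
    abel
  · simp only [evMul, Prod.fst_add, Prod.snd_add, B.mul_add, smul_add]
    abel

lemma evDif_leibniz {i j n : ℕ} (h : i + 1 + (j + 1) = n + 1) (h₁ : i + (j + 1) = n)
    (h₂ : i + 1 + j = n) (a : B.deg (i + 1) × B.deg (i + 1) × B.deg (i + 1 + 1))
    (b : B.deg (j + 1) × B.deg (j + 1) × B.deg (j + 1 + 1)) :
    evDif B n (evMul B h a b) =
      evMul B h₁ (evDif B i a) b + (-1 : ℚ) ^ (i + 1) • evMul B h₂ a (evDif B j b) := by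
  refine Prod.ext (B.leibniz' h h₁ h₂ _ _) (Prod.ext ?_ ?_)
  · change B.dif n (B.mul h a.1 b.2.1 + B.mul h a.2.1 b.1) =
      B.mul h₁ (B.dif i a.1) b.2.1 + B.mul h₁ (B.dif i a.2.1) b.1 + (-1 : ℚ) ^ (i + 1) •
        (B.mul h₂ a.1 (B.dif j b.2.1) + B.mul h₂ a.2.1 (B.dif j b.1))
    rw [map_add, B.leibniz' h h₁ h₂, B.leibniz' h h₁ h₂, smul_add]
    abel
  · change B.mul h a.1 b.2.1 + B.mul h a.2.1 b.1 - B.dif (n + 1) (B.mul _ a.2.2 b.1 +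
      (-1 : ℚ) ^ (i + 1) • B.mul _ a.1 b.2.2) =
      B.mul _ (a.2.1 - B.dif (i + 1) a.2.2) b.1 + (-1 : ℚ) ^ i • B.mul _ (B.dif i a.1) b.2.2 +
      (-1 : ℚ) ^ (i + 1) • (B.mul _ a.2.2 (B.dif j b.1) + (-1 : ℚ) ^ (i + 1) •
        B.mul _ a.1 (b.2.1 - B.dif (j + 1) b.2.2))
    have hs : ∀ {i j k : ℕ} (h : i + j = k) (x : B.deg i) (y z : B.deg j),
        B.mul h x (y - z) = B.mul h x y - B.mul h x z := fun h x y z => by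
      rw [sub_eq_add_neg, B.mul_add, ← neg_one_smul ℚ z, B.smul_mul_right, neg_one_smul,
        sub_eq_add_neg]
    have hs' : ∀ {i j k : ℕ} (h : i + j = k) (x y : B.deg i) (z : B.deg j),
        B.mul h (x - y) z = B.mul h x z - B.mul h y z := fun h x y z => by
      rw [sub_eq_add_neg, B.add_mul, ← neg_one_smul ℚ y, B.smul_mul_left, neg_one_smul,
        sub_eq_add_neg]
    rw [map_add, map_smul, B.leibniz' (i := i + 1) (j := j) _ h (show i + 1 + 1 + j = n + 1 by omega),
      B.leibniz' (i := i) (j := j + 1) _ (show i + (j + 1 + 1) = n + 1 by omega) h, hs, hs']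
    rcases neg_one_pow_cases i with hi | hi <;>
    simp [pow_succ, hi] <;> abel

lemma evDif_leibniz_left {j : ℕ} {a : B.deg 0 × B.deg 0 × B.deg (0 + 1)} (ha : a ∈ evSub B 0)
    (b : B.deg (j + 1) × B.deg (j + 1) × B.deg (j + 1 + 1)) :
    evDif B j (evMul B (zero_add _) a b) = evMul B (zero_add _) a (evDif B j b) := by
  obtain ⟨h1, h2⟩ := (mem_evSub_zero _).1 ha
  refine Prod.ext (B.leibniz_left _ _) (Prod.ext ?_ ?_)
  · simp only [evDif, evMul, h1, B.zero_mul, add_zero]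
    exact B.leibniz_left _ _
  · simp only [evDif, evMul, h1, h2, B.zero_mul, add_zero, zero_add, pow_zero, one_smul]
    have e := B.leibniz_left a.1 b.2.2
    have e2 := B.mul_add (zero_add (j + 1)) a.1 (b.2.1 - B.dif (j + 1) b.2.2) (B.dif (j + 1) b.2.2)
    rw [sub_add_cancel] at e2
    rw [e, e2, add_sub_cancel_right]

lemma evDif_smul (m : ℕ) (q : ℚ) (a : B.deg (m + 1) × B.deg (m + 1) × B.deg (m + 1 + 1)) :
    evDif B m (q • a) = q • evDif B m a := by
  refine Prod.ext (map_smul _ _ _) (Prod.ext (map_smul _ _ _) ?_)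
  simp only [evDif, Prod.smul_snd, Prod.smul_fst, map_smul, smul_sub]

lemma evDif_add (m : ℕ) (a b : B.deg (m + 1) × B.deg (m + 1) × B.deg (m + 1 + 1)) :
    evDif B m (a + b) = evDif B m a + evDif B m b := by
  refine Prod.ext (map_add _ _ _) (Prod.ext (map_add _ _ _) ?_)
  simp only [evDif, Prod.snd_add, Prod.fst_add, map_add]
  abel

lemma evMul_comm_left {i j k : ℕ} (h : i + j = k) (a : B.deg i × B.deg i × B.deg (i + 1))
    (b : B.deg j × B.deg j × B.deg (j + 1)) : evMul B h a b =
      (-1 : ℚ) ^ (i * j) • evMul B ((add_comm j i).trans h) b a := evMul_comm h _ a b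

variable (B) in
/-- The algebra representing a derivation with a nullhomotopy, as graded data. -/
def evData : GradedData T where
  deg m := evSub B m
  d m t := ⟨evDif B m t.1, evDif_mem m t.2⟩
  d_add m a b := Subtype.ext (evDif_add m a.1 b.1)
  d_d n a := Subtype.ext (by
    refine Prod.ext (B.dif_dif n _) (Prod.ext (B.dif_dif n _) ?_)
    change B.dif (n + 1) a.1.2.1 - B.dif (n + 1) (a.1.2.1 - B.dif (n + 2) a.1.2.2) = 0
    rw [map_sub, dif_dif, sub_zero, sub_self])
  mul h a b := ⟨evMul B h a.1 b.1, evMul_mem h a.2 b.2⟩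
  one := ⟨(B.one, 0, 0), (mem_evSub_zero _).2 ⟨rfl, rfl⟩⟩
  mul_add h a b c := Subtype.ext (evMul_add h a.1 b.1 c.1)
  add_mul h a b c := Subtype.ext (by
    change evMul B h (a.1 + b.1) c.1 = evMul B h a.1 c.1 + evMul B h b.1 c.1
    rw [evMul_comm_left, evMul_add, smul_add, ← evMul_comm_left, ← evMul_comm_left])
  one_mul {n} a := Subtype.ext (by
    refine Prod.ext (B.one_mul _) (Prod.ext ?_ ?_)
    · change B.mul _ B.one a.1.2.1 + B.mul _ 0 a.1.1 = a.1.2.1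
      rw [B.zero_mul, add_zero, B.one_mul]
    · change B.mul _ 0 a.1.1 + (-1 : ℚ) ^ 0 • B.mul _ B.one a.1.2.2 = a.1.2.2
      rw [B.zero_mul, zero_add, pow_zero, one_smul, B.one_mul])
  mul_assoc hij hjk h h' a b c := Subtype.ext (evMul_assoc hij hjk h h' a.1 b.1 c.1)
  mul_comm h h' a b := Subtype.ext (evMul_comm h h' a.1 b.1)
  leibniz h h₁ h₂ a b := Subtype.ext (evDif_leibniz h h₁ h₂ a.1 b.1)
  leibniz_zero_left a b := Subtype.ext (evDif_leibniz_left a.2 b.1)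
  leibniz_zero_right {i} a b := Subtype.ext (by
    change evDif B i (evMul B _ a.1 b.1) = evMul B _ (evDif B i a.1) b.1
    rw [evMul_comm _ (zero_add _), evMul_comm _ (zero_add i), evDif_smul, evDif_leibniz_left b.2]
    simp)
  str :=
    { op := fun p v => ⟨(B.str.op p fun i => (v i).1.1, 0, 0), (mem_evSub_zero _).2 ⟨rfl, rfl⟩⟩
      op_var := fun i v => Subtype.ext (by
        obtain ⟨h1, h2⟩ := (mem_evSub_zero _).1 (v i).2
        exact Prod.ext (B.str.op_var i _) (Prod.ext h1.symm h2.symm))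
      op_comp := fun p g v => Subtype.ext (Prod.ext (B.str.op_comp p g _) rfl) }
  str_add a b := Subtype.ext (by
    obtain ⟨h1, h2⟩ := (mem_evSub_zero _).1 (a + b).2
    refine Prod.ext ?_ (Prod.ext h1.symm h2.symm)
    refine Eq.trans (congrArg (B.str.op _) (funext fun i => ?_)) (B.str_add a.1.1 b.1.1)
    fin_cases i <;> rfl)
  str_mul a b := Subtype.ext (by
    obtain ⟨h1, h2⟩ := (mem_evSub_zero _).1 (evMul_mem (zero_add 0) a.2 b.2)
    refine Prod.ext ?_ (Prod.ext h1.symm h2.symm)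
    refine Eq.trans (congrArg (B.str.op _) (funext fun i => ?_)) (B.str_mul a.1.1 b.1.1)
    fin_cases i <;> rfl)
  str_one := Subtype.ext (Prod.ext
    (Eq.trans (congrArg (B.str.op _) (funext fun i : Fin 0 => i.elim0)) B.str_one) rfl)
  str_smul q a := Subtype.ext (by
    obtain ⟨h1, h2⟩ := (mem_evSub_zero _).1 (q • a).2
    refine Prod.ext ?_ (Prod.ext h1.symm h2.symm)
    refine Eq.trans (congrArg (B.str.op _) (funext fun i => ?_)) (B.str_smul q a.1.1)
    fin_cases i; rfl)

variable (B) in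
/-- The algebra representing a derivation with a nullhomotopy. -/
def ev : TDGA T := (evData B).toTDGA

/-- The triple underlying an element. -/
def evVal (m : ℕ) : (ev B).deg m →ₗ[ℚ] B.deg m × B.deg m × B.deg (m + 1) := (evSub B m).subtype

lemma evVal_mem (m : ℕ) (x : (ev B).deg m) : evVal m x ∈ evSub B m := Subtype.property (p := (· ∈ evSub B m)) x

lemma evVal_dif (m : ℕ) (x : (ev B).deg (m + 1)) :
    evVal m ((ev B).dif m x) = evDif B m (evVal (m + 1) x) :=
  congrArg (evVal m) ((evData B).dif_eq m x)

/-- An element with a given underlying triple. -/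
def evMk {m : ℕ} (t : B.deg m × B.deg m × B.deg (m + 1)) (ht : t ∈ evSub B m) : (ev B).deg m :=
  (⟨t, ht⟩ : evSub B m)

@[simp] lemma evVal_mk {m : ℕ} (t : B.deg m × B.deg m × B.deg (m + 1)) (ht : t ∈ evSub B m) :
    evVal m (evMk t ht) = t := rfl

lemma ev_ext {m : ℕ} {x y : (ev B).deg m} (h : evVal m x = evVal m y) : x = y := Subtype.ext h

lemma evVal_mul {i j k : ℕ} (h : i + j = k) (x : (ev B).deg i) (y : (ev B).deg j) :
    evVal k ((ev B).mul h x y) = evMul B h (evVal i x) (evVal j y) := rfl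

variable (B) in
/-- The projection forgetting the derivation. -/
def evFst : ev B ⟶ B :=
  homMk (fun n x => (evVal n x).1) (fun _ _ _ => rfl)
    (fun n a => congrArg Prod.fst (evVal_dif n a)) (fun _ _ _ => rfl) (fun _ _ => rfl)

lemma mk_zero_mem (m : ℕ) (b : B.deg m) : ((b, 0, 0) : B.deg m × B.deg m × B.deg (m + 1)) ∈ evSub B m := by
  obtain _ | _ | m := m
  · exact (mem_evSub_zero _).2 ⟨rfl, rfl⟩
  · exact (mem_evSub_one _).2 (map_zero _).symm
  · exact mem_evSub_add_two _ _

variable (B) in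
/-- The zero derivation. -/
def evZero : B ⟶ ev B :=
  homMk (fun n b => evMk (b, 0, 0) (mk_zero_mem n b))
    (fun n a b => ev_ext (Prod.ext rfl (Prod.ext (add_zero 0).symm (add_zero 0).symm)))
    (fun n b => ev_ext (Eq.trans (b := ((B.dif n b, 0, 0) : _ × _ × _))
      rfl (Eq.trans (by simp [evDif]) (evVal_dif n _).symm)))
    (fun {i j k} h a b => ev_ext (Prod.ext rfl (Prod.ext (by
      simp [evVal_mul, evMul, B.mul_zero, B.zero_mul]) (by
      simp [evVal_mul, evMul, B.mul_zero, B.zero_mul]))))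
    (fun p a => rfl)

lemma evVal_evZero (n : ℕ) (b : B.deg n) :
    evVal n (app (evZero B) n b) = ((b, 0, 0) : B.deg n × B.deg n × B.deg (n + 1)) := rfl

/-- A section of `evFst` is exactly a derivation with its nullhomotopy; this one is zero. -/
lemma evZero_fst : evZero B ≫ evFst B = 𝟙 B := hom_ext fun _ _ => rfl

end Euler

/-! ### The Euler derivation and its weights -/

section HighDegree

variable {A : TDGA T} {S : ℕ → Type u} [IsEmpty (S 0)] [IsEmpty (S 1)]

variable (A S) in
-- The triple prescribes D s = s and h s = 0 on a variable s, which forces D(d s) = d s and h(d s) =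
-- s. In degree at least 2 triples are unconstrained, and there are no variables in degrees 0 and 1.
lemma eulerVar_mem (n : ℕ) (s : S n) :
    ((adjVar A S n s, adjVar A S n s, 0) : _ × _ × (adj A S).deg (n + 1)) ∈ evSub (adj A S) n := by
  obtain _ | _ | n := n
  · exact isEmptyElim s
  · exact isEmptyElim s
  · exact mem_evSub_add_two _ _

variable (A S) in
/-- The derivation counting the variables and their differentials, with its nullhomotopy. -/
def euler : adj A S ⟶ ev (adj A S) :=
  adjDesc (adjIncl A S ≫ evZero _) fun n s => evMk _ (eulerVar_mem A S n s)

lemma euler_fst : euler A S ≫ evFst _ = 𝟙 _ := by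
  refine adj_hom_ext ?_ fun n x => ?_
  · rw [← Category.assoc, euler, adjIncl_desc, Category.assoc, evZero_fst]
  · rfl

variable (A S) in
/-- The derivation counting the variables and their differentials. -/
def cnt (n : ℕ) : (adj A S).deg n →ₗ[ℚ] (adj A S).deg n :=
  LinearMap.fst ℚ _ _ ∘ₗ LinearMap.snd ℚ _ _ ∘ₗ evVal n ∘ₗ app (euler A S) n

variable (A S) in
/-- The nullhomotopy of the derivation counting the variables and their differentials. -/
def cntHtpy (n : ℕ) : (adj A S).deg n →ₗ[ℚ] (adj A S).deg (n + 1) :=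
  LinearMap.snd ℚ _ _ ∘ₗ LinearMap.snd ℚ _ _ ∘ₗ evVal n ∘ₗ app (euler A S) n

lemma euler_val (n : ℕ) (x : (adj A S).deg n) :
    evVal n (app (euler A S) n x) = (x, cnt A S n x, cntHtpy A S n x) :=
  Prod.ext (congr_app (euler_fst (A := A) (S := S)) n x) rfl

lemma cnt_zero (x : (adj A S).deg 0) : cnt A S 0 x = 0 :=
  ((mem_evSub_zero _).1 (evVal_mem 0 (app (euler A S) 0 x))).1

lemma cnt_dif (n : ℕ) (x : (adj A S).deg (n + 1)) :
    cnt A S n ((adj A S).dif n x) = (adj A S).dif n (cnt A S (n + 1) x) := by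
  have h := evVal_dif n (app (euler A S) (n + 1) x)
  rw [← app_dif, euler_val, euler_val] at h
  exact congrArg (fun t => t.2.1) h

lemma cntHtpy_dif (n : ℕ) (x : (adj A S).deg (n + 1)) :
    cntHtpy A S n ((adj A S).dif n x) =
      cnt A S (n + 1) x - (adj A S).dif (n + 1) (cntHtpy A S (n + 1) x) := by
  have h := evVal_dif n (app (euler A S) (n + 1) x)
  rw [← app_dif, euler_val, euler_val] at h
  exact congrArg (fun t => t.2.2) h

lemma cnt_mul {i j k : ℕ} (h : i + j = k) (x : (adj A S).deg i) (y : (adj A S).deg j) :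
    cnt A S k ((adj A S).mul h x y) =
      (adj A S).mul h x (cnt A S j y) + (adj A S).mul h (cnt A S i x) y := by
  have h := evVal_mul h (app (euler A S) i x) (app (euler A S) j y)
  rw [← app_mul, euler_val, euler_val, euler_val] at h
  exact congrArg (fun t => t.2.1) h

lemma cnt_incl (n : ℕ) (a : A.deg n) : cnt A S n (app (adjIncl A S) n a) = 0 :=
  congrArg (fun t => t.2.1) (evVal_evZero n (app (adjIncl A S) n a))

lemma cnt_var (n : ℕ) (s : S n) : cnt A S n (adjVar A S n s) = adjVar A S n s := rfl

variable (A S) in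
/-- The part of positive weight. -/
def posWt (n : ℕ) : Submodule ℚ ((adj A S).deg n) :=
  ⨆ k : ℕ, Module.End.eigenspace (cnt A S n) ((k : ℚ) + 1)

lemma mem_posWt {n : ℕ} {k : ℕ} {x : (adj A S).deg n} (h : cnt A S n x = ((k : ℚ) + 1) • x) :
    x ∈ posWt A S n :=
  Submodule.mem_iSup_of_mem k (Module.End.mem_eigenspace_iff.2 h)

lemma posWt_induction {n : ℕ} (P : (adj A S).deg n → Prop) {x : (adj A S).deg n}
    (hx : x ∈ posWt A S n) (h : ∀ (k : ℕ) x, cnt A S n x = ((k : ℚ) + 1) • x → P x) (h0 : P 0)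
    (hadd : ∀ x y, P x → P y → P (x + y)) : P x :=
  Submodule.iSup_induction _ (motive := P) hx (fun k x hx => h k x (Module.End.mem_eigenspace_iff.1 hx)) h0 hadd

/-- The counting derivation is zero in degree 0, whereas positive weights are nonzero eigenvalues.
-/
lemma posWt_zero {x : (adj A S).deg 0} (hx : x ∈ posWt A S 0) : x = 0 := by
  refine posWt_induction (fun x => x = 0) hx (fun k x hx => ?_) rfl fun x y hx hy => by rw [hx, hy, add_zero]
  rw [cnt_zero] at hx
  exact (smul_eq_zero.1 hx.symm).resolve_left (by positivity)

lemma dif_mem_posWt {n : ℕ} {x : (adj A S).deg (n + 1)} (hx : x ∈ posWt A S (n + 1)) :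
    (adj A S).dif n x ∈ posWt A S n := by
  refine posWt_induction (fun x => (adj A S).dif n x ∈ posWt A S n) hx
    (fun k x hx => mem_posWt (k := k) ?_) ?_ fun x y hx hy => ?_
  · rw [cnt_dif, hx, map_smul]
  · rw [map_zero]; exact zero_mem _
  · rw [map_add]; exact add_mem hx hy

lemma mul_mem_posWt {i j k : ℕ} (h : i + j = k) {x : (adj A S).deg i} {y : (adj A S).deg j}
    (hx : x ∈ posWt A S i) (hy : y ∈ posWt A S j ∨ cnt A S j y = 0) :
    (adj A S).mul h x y ∈ posWt A S k := by
  refine posWt_induction (fun x => (adj A S).mul h x y ∈ posWt A S k) hx (fun m x hx => ?_) ?_ fun x y hx hy => ?_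
  · obtain hy | hy := hy
    · refine posWt_induction (fun y => (adj A S).mul h x y ∈ posWt A S k) hy
        -- The index k stands for the weight k + 1, and (m + 1) + (m' + 1) = (m + m' + 1) + 1.
        (fun m' y hy => mem_posWt (k := m + m' + 1) ?_) ?_
        fun x y hx hy => ?_
      · rw [cnt_mul, hx, hy, smul_mul_left, smul_mul_right, ← add_smul]
        push_cast
        congr 1
        ring
      · rw [TDGA.mul_zero]; exact zero_mem _
      · rw [TDGA.mul_add]; exact add_mem hx hy
    · refine mem_posWt (k := m) ?_
      rw [cnt_mul, hx, hy, smul_mul_left, TDGA.mul_zero, zero_add]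
  · rw [TDGA.zero_mul]; exact zero_mem _
  · rw [TDGA.add_mul]; exact add_mem hx hy

lemma mul_mem_posWt' {i j k : ℕ} (h : i + j = k) {x : (adj A S).deg i} {y : (adj A S).deg j}
    (hx : cnt A S i x = 0) (hy : y ∈ posWt A S j) : (adj A S).mul h x y ∈ posWt A S k := by
  rw [TDGA.mul_comm _ h ((add_comm j i).trans h)]
  exact Submodule.smul_mem _ _ (mul_mem_posWt _ hy (Or.inr hx))

lemma cnt_surj {n : ℕ} {x : (adj A S).deg n} (hx : x ∈ posWt A S n) :
    ∃ y ∈ posWt A S n, cnt A S n y = x := by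
  refine posWt_induction (fun x => ∃ y ∈ posWt A S n, cnt A S n y = x) hx
    (fun k x hx => ⟨((k : ℚ) + 1)⁻¹ • x, ?_, ?_⟩) ⟨0, zero_mem _, map_zero _⟩ ?_
  · exact Submodule.smul_mem _ _ (mem_posWt hx)
  · rw [map_smul, hx, smul_smul, inv_mul_cancel₀ (by positivity), one_smul]
  · rintro x y ⟨x', hx, rfl⟩ ⟨y', hy, rfl⟩
    exact ⟨x' + y', add_mem hx hy, map_add _ _ _⟩

/-- Eigenspaces for distinct eigenvalues are independent, so a sum of vectors of positive weight
that also has weight 0 vanishes. -/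
lemma eq_zero_of_cnt {n : ℕ} {x : (adj A S).deg n} (hx : x ∈ posWt A S n)
    (h : cnt A S n x = 0) : x = 0 := by
  have hi := Module.End.eigenspaces_iSupIndep (cnt A S n) 0
  refine Submodule.disjoint_def.1 hi x ?_ ?_
  · rw [Module.End.mem_eigenspace_iff, h, zero_smul]
  · refine (iSup_le fun k => ?_ : posWt A S n ≤ _) hx
    exact le_iSup₂_of_le ((k : ℚ) + 1) (by positivity) le_rfl

/-- The elements whose difference from their constant part has positive weight are closed under all
operations. For products one expands both factors into constant and positive parts and adds weights.
For operations of T, positive weight in degree 0 means zero, so the arguments are already constant.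
-/
lemma sub_mem_posWt {n : ℕ} (x : (adj A S).deg n) :
    x - app (adjIncl A S) n (app (adjRetr A S) n x) ∈ posWt A S n := by
  refine adj_induction (P := fun n x => x - app (adjIncl A S) n (app (adjRetr A S) n x) ∈
    posWt A S n) ⟨?_, ?_, ?_, ?_, ?_, ?_, ?_⟩ ?_ ?_ x
  · intro n; rw [map_zero, map_zero, sub_zero]; exact zero_mem _
  · intro n a b ha hb
    rw [map_add, map_add, add_sub_add_comm]
    exact add_mem ha hb
  · intro n q a ha
    rw [map_smul, map_smul, ← smul_sub]
    exact Submodule.smul_mem _ _ ha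
  · intro n a ha
    rw [app_dif, app_dif, ← map_sub]
    exact dif_mem_posWt ha
  · intro i j k h a b ha hb
    have h1 := add_mem (mul_mem_posWt h ha (Or.inl hb)) (add_mem
      (mul_mem_posWt h ha (Or.inr (cnt_incl j (app (adjRetr A S) j b))))
      (mul_mem_posWt' h (cnt_incl i (app (adjRetr A S) i a)) hb))
    obtain ⟨a', ha'⟩ : ∃ a', a - app (adjIncl A S) i (app (adjRetr A S) i a) = a' := ⟨_, rfl⟩
    obtain ⟨b', hb'⟩ : ∃ b', b - app (adjIncl A S) j (app (adjRetr A S) j b) = b' := ⟨_, rfl⟩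
    rw [ha', hb'] at h1
    have : (adj A S).mul h a b - app (adjIncl A S) k (app (adjRetr A S) k ((adj A S).mul h a b)) =
        (adj A S).mul h a' b' + ((adj A S).mul h a' (app (adjIncl A S) j (app (adjRetr A S) j b)) +
          (adj A S).mul h (app (adjIncl A S) i (app (adjRetr A S) i a)) b') := by
      rw [app_mul, app_mul]
      conv_lhs => enter [1]; rw [← sub_add_cancel a (app (adjIncl A S) i (app (adjRetr A S) i a)),
        ← sub_add_cancel b (app (adjIncl A S) j (app (adjRetr A S) j b)), ha', hb']
      rw [TDGA.mul_add, TDGA.add_mul, TDGA.add_mul]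
      abel
    rw [this]
    exact h1
  · rw [app_one, app_one, sub_self]; exact zero_mem _
  · intro n p a ha
    rw [app_op, app_op, sub_eq_zero.2]
    · exact zero_mem _
    · refine congrArg ((adj A S).str.op p) (funext fun i => ?_)
      exact sub_eq_zero.1 (posWt_zero (ha i))
  · intro n a
    rw [adjRetr_incl, sub_self]; exact zero_mem _
  · intro n s
    rw [adjRetr_var, map_zero, sub_zero]
    exact mem_posWt (k := 0) (by rw [cnt_var]; simp)

/-- Let w be the positive-weight part of a cycle, again a cycle. Write w = D y with y of positive
weight. Then D(d y) = d w = 0, so d y = 0 by injectivity of D in positive weight, and w = D y = d(h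
y). -/
lemma adj_contracts_of_isEmpty : Contracts (adjIncl A S) (adjRetr A S) := fun n x hx => by
  have hw := sub_mem_posWt x
  obtain _ | n := n
  · rw [posWt_zero hw]
    exact isBdry_zero _ _
  · have hc := IsCyc.sub hx ((hx.app (adjRetr A S)).app (adjIncl A S))
    obtain ⟨y, hy, e⟩ := cnt_surj hw
    have hd : (adj A S).dif n y = 0 := eq_zero_of_cnt (dif_mem_posWt hy) (by
      rw [cnt_dif, e]; exact hc)
    have h := cntHtpy_dif n y
    rw [hd, map_zero, e] at h
    exact ⟨_, (sub_eq_zero.1 h.symm).symm⟩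

end HighDegree

lemma adj_contracts [T.IsFermat] (A : TDGA T) (S : ℕ → Type u) [IsEmpty (S 0)] :
    Contracts (adjIncl A S) (adjRetr A S) := by
  refine adj_contracts_of_single fun A n => ?_
  obtain _ | n := n
  · exact adj_one_contracts A
  · have h0 : IsEmpty (SingleGen.{u} (n + 1 + 1) 0) := ⟨fun h => by obtain ⟨⟨h⟩⟩ := h; omega⟩
    have h1 : IsEmpty (SingleGen.{u} (n + 1 + 1) 1) := ⟨fun h => by obtain ⟨⟨h⟩⟩ := h; omega⟩
    exact adj_contracts_of_isEmpty

/-- The elements of positive degree, as variables. -/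
def posVar (B : TDGA T) : ℕ → Type u
  | 0 => PEmpty
  | n + 1 => B.deg (n + 1)

instance (B : TDGA T) : IsEmpty (posVar B 0) := inferInstanceAs (IsEmpty PEmpty)

/-- The values of the variables. -/
def posVarVal (B : TDGA T) : ∀ n, posVar B n → B.deg n
  | 0, x => PEmpty.elim x
  | _ + 1, x => x

/-- One variable is adjoined for every element of B of positive degree and sent to it, which makes
the second map surjective there. -/
lemma exists_fac_quasiIsos [T.IsFermat] {A B : TDGA T} (f : A ⟶ B) :
    ∃ (Z : TDGA T) (i : A ⟶ Z) (p : Z ⟶ B), quasiIsos T i ∧ posSurj T p ∧ i ≫ p = f := by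
  refine ⟨adj A (posVar B), adjIncl A _, adjDesc f (posVarVal B),
    (adj_contracts A _).quasiIsos adjIncl_retr, ?_, adjIncl_desc _ _⟩
  refine (posSurj_iff _).2 fun n b => ⟨adjVar A (posVar B) (n + 1) b, ?_⟩
  exact adjDesc_var f (posVarVal B) (n + 1) (show posVar B (n + 1) from b)

variable (T) in
/-- The standard model structure. -/
@[reducible]
def model [T.IsFermat] : ModelCategory (TDGA T) :=
  modelOfGenerators.{u} (quasiIsos T) (posSurj T) (genI T) (genJ T) genI_rlp genJ_rlp
    exists_fac_quasiIsos

end TDGA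

/-! ### Pushouts of filtered diagrams -/

section PushDiagram

variable {D : Type*} [Category* D] [HasPushouts D] {J : Type*} [Category* J] {F : J ⥤ D} {P Q : D}
  (α : ∀ j, P ⟶ F.obj j)

lemma pushMap_comm (hα : ∀ {i j : J} (u : i ⟶ j), α i ≫ F.map u = α j) (f : P ⟶ Q) {i j : J}
    (u : i ⟶ j) : α i ≫ F.map u ≫ pushout.inl (α j) f = f ≫ pushout.inr (α j) f := by
  rw [← Category.assoc, hα, pushout.condition]

variable (hα : ∀ {i j : J} (u : i ⟶ j), α i ≫ F.map u = α j) (f : P ⟶ Q)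

/-- The pushout of a diagram under an object. -/
def pushDiagram : J ⥤ D where
  obj j := pushout (α j) f
  map {i j} u := pushout.desc (F.map u ≫ pushout.inl (α j) f) (pushout.inr (α j) f)
    (pushMap_comm α hα f u)
  map_id j := by
    apply pushout.hom_ext <;> simp
  map_comp u v := by
    refine pushout.hom_ext ?_ ?_
    · rw [pushout.inl_desc, ← Category.assoc, pushout.inl_desc, Category.assoc, pushout.inl_desc,
        F.map_comp, Category.assoc]
    · rw [pushout.inr_desc, ← Category.assoc, pushout.inr_desc, pushout.inr_desc]

/-- The coprojection of the diagram. -/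
def pushInl (j : J) : F.obj j ⟶ (pushDiagram α hα f).obj j := pushout.inl (α j) f

/-- The coprojection of the object. -/
def pushInr (j : J) : Q ⟶ (pushDiagram α hα f).obj j := pushout.inr (α j) f

lemma push_isPushout (j : J) : IsPushout (α j) f (pushInl α hα f j) (pushInr α hα f j) :=
  IsPushout.of_hasPushout (α j) f

lemma pushInl_map {i j : J} (u : i ⟶ j) :
    pushInl α hα f i ≫ (pushDiagram α hα f).map u = F.map u ≫ pushInl α hα f j :=
  pushout.inl_desc _ _ _

lemma pushInr_map {i j : J} (u : i ⟶ j) :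
    pushInr α hα f i ≫ (pushDiagram α hα f).map u = pushInr α hα f j :=
  pushout.inr_desc _ _ _

lemma pushInl_map_assoc {i j : J} (u : i ⟶ j) {X : D} (h : (pushDiagram α hα f).obj j ⟶ X) :
    pushInl α hα f i ≫ (pushDiagram α hα f).map u ≫ h = F.map u ≫ pushInl α hα f j ≫ h := by
  rw [← Category.assoc, pushInl_map, Category.assoc]

lemma pushInr_map_assoc {i j : J} (u : i ⟶ j) {X : D} (h : (pushDiagram α hα f).obj j ⟶ X) :
    pushInr α hα f i ≫ (pushDiagram α hα f).map u ≫ h = pushInr α hα f j ≫ h := by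
  rw [← Category.assoc, pushInr_map]

variable {c : Cocone F} {a : P ⟶ c.pt} {C : D} {q : Q ⟶ C} {g : c.pt ⟶ C}

lemma pushLeg_comm (ha : ∀ j, α j ≫ coLeg c j = a) (sq : IsPushout a f g q) (j : J) :
    α j ≫ coLeg c j ≫ g = f ≫ q := by
  rw [← Category.assoc, ha, sq.w]

variable (ha : ∀ j, α j ≫ coLeg c j = a) (sq : IsPushout a f g q)

/-- The comparison of the pushouts with the pushout of the colimit. -/
def pushLeg (j : J) : (pushDiagram α hα f).obj j ⟶ C :=
  (push_isPushout α hα f j).desc (coLeg c j ≫ g) q (pushLeg_comm α f ha sq j)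

lemma pushInl_leg (j : J) : pushInl α hα f j ≫ pushLeg α hα f ha sq j = coLeg c j ≫ g :=
  IsPushout.inl_desc _ _ _ _

lemma pushInr_leg (j : J) : pushInr α hα f j ≫ pushLeg α hα f ha sq j = q :=
  IsPushout.inr_desc _ _ _ _

lemma pushInl_leg_assoc (j : J) {X : D} (h : C ⟶ X) :
    pushInl α hα f j ≫ pushLeg α hα f ha sq j ≫ h = coLeg c j ≫ g ≫ h := by
  rw [← Category.assoc, pushInl_leg, Category.assoc]

lemma pushInr_leg_assoc (j : J) {X : D} (h : C ⟶ X) :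
    pushInr α hα f j ≫ pushLeg α hα f ha sq j ≫ h = q ≫ h := by
  rw [← Category.assoc, pushInr_leg]

/-- Cancellation for pasted pushout squares. -/
lemma pushLeg_isPushout (j : J) :
    IsPushout (coLeg c j) (pushInl α hα f j) g (pushLeg α hα f ha sq j) := by
  refine IsPushout.of_left (h₁₁ := α j) (v₁₁ := f) (h₂₁ := pushInr α hα f j) ?_
    (pushInl_leg α hα f ha sq j).symm (push_isPushout α hα f j)
  rw [ha, pushInr_leg]
  exact sq

/-- The pushouts as a cocone over the pushout of the colimit. -/
def pushCocone : Cocone (pushDiagram α hα f) :=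
  mkCocone (F := pushDiagram α hα f) (pushLeg α hα f ha sq) fun {i j} u => by
    refine (push_isPushout α hα f i).hom_ext ?_ ?_
    · rw [pushInl_map_assoc, pushInl_leg, pushInl_leg, map_coLeg_assoc]
    · rw [pushInr_map_assoc, pushInr_leg, pushInr_leg]

variable {α hα f}

/-- Filtered categories are connected, so the map out of `Q` does not depend on the stage. -/
lemma pushInr_coLeg [IsFilteredOrEmpty J] (s : Cocone (pushDiagram α hα f)) (i j : J) :
    pushInr α hα f i ≫ coLeg s i = pushInr α hα f j ≫ coLeg s j := by
  have h : ∀ {i j : J} (u : i ⟶ j), pushInr α hα f i ≫ coLeg s i =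
      pushInr α hα f j ≫ coLeg s j := fun u => by
    rw [← map_coLeg s u, pushInr_map_assoc]
  exact (h (IsFiltered.leftToMax i j)).trans (h (IsFiltered.rightToMax i j)).symm

/-- The map from the colimit induced by a cocone on the pushouts. -/
def pushColimDesc (hc : IsColimit c) (s : Cocone (pushDiagram α hα f)) : c.pt ⟶ s.pt :=
  hc.desc (mkCocone (fun j => pushInl α hα f j ≫ coLeg s j) fun {i j} u => by
    rw [← map_coLeg s u, pushInl_map_assoc])

lemma coLeg_pushColimDesc (hc : IsColimit c) (s : Cocone (pushDiagram α hα f)) (j : J) :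
    coLeg c j ≫ pushColimDesc hc s = pushInl α hα f j ≫ coLeg s j := hc.fac _ j

lemma pushColimDesc_comm (ha : ∀ j, α j ≫ coLeg c j = a) (hc : IsColimit c)
    (s : Cocone (pushDiagram α hα f)) (j : J) :
    a ≫ pushColimDesc hc s = f ≫ pushInr α hα f j ≫ coLeg s j := by
  rw [← ha j, Category.assoc, coLeg_pushColimDesc, (push_isPushout α hα f j).w_assoc]

lemma push_hom_ext [IsFiltered J] (hc : IsColimit c) {X : D} {m m' : C ⟶ X}
    (h : ∀ j, pushLeg α hα f ha sq j ≫ m = pushLeg α hα f ha sq j ≫ m') : m = m' := by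
  refine sq.hom_ext (hc.hom_ext fun j => ?_) ?_
  · have := congrArg (fun k => pushInl α hα f j ≫ k) (h j)
    simp only [pushInl_leg_assoc] at this
    exact this
  · have j := (IsFiltered.nonempty (C := J)).some
    have := congrArg (fun k => pushInr α hα f j ≫ k) (h j)
    simpa only [pushInr_leg_assoc] using this

/-- The map from the pushout of the colimit induced by a cocone on the pushouts. -/
def pushDesc [IsFiltered J] (hc : IsColimit c) (s : Cocone (pushDiagram α hα f)) : C ⟶ s.pt :=
  sq.desc (pushColimDesc hc s)
    (pushInr α hα f (IsFiltered.nonempty (C := J)).some ≫ coLeg s _)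
    (pushColimDesc_comm ha hc s _)

lemma pushLeg_desc [IsFiltered J] (hc : IsColimit c) (s : Cocone (pushDiagram α hα f)) (j : J) :
    pushLeg α hα f ha sq j ≫ pushDesc ha sq hc s = coLeg s j := by
  refine (push_isPushout α hα f j).hom_ext ?_ ?_
  · rw [pushInl_leg_assoc, pushDesc, sq.inl_desc, coLeg_pushColimDesc]
  · rw [pushInr_leg_assoc, pushDesc, sq.inr_desc]
    exact pushInr_coLeg s _ _

/-- Pushouts commute with filtered colimits. -/
def pushIsColimit [IsFiltered J] (hc : IsColimit c) : IsColimit (pushCocone α hα f ha sq) where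
  desc s := pushDesc ha sq hc s
  fac s j := pushLeg_desc ha sq hc s j
  uniq s m hm := push_hom_ext ha sq hc fun j => (hm j).trans (pushLeg_desc ha sq hc s j).symm

end PushDiagram

/-! ### Finitely presented algebras -/

namespace TAlg

lemma free_factors {J : Type u} [SmallCategory J] [IsFiltered J] {F : J ⥤ TAlg T} {c : Cocone F}
    (hc : IsColimit c) {n : ℕ} (f : T.free n ⟶ c.pt) :
    ∃ (j : J) (g : T.free n ⟶ F.obj j), g ≫ coLeg c j = f := by
  obtain ⟨j, y, hy⟩ := TDGA.exists_common_stage (V := fun j => F.obj j)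
    (fun u => Hom.toFun (F.map u)) (fun j => Hom.toFun (coLeg c j))
    (fun u y => congr_toFun (map_coLeg c u) y) (fun i => Hom.toFun f (T.gen i))
    (fun i => exists_rep_of_isColimit hc _)
  refine ⟨j, (F.obj j).freeDesc y, free_hom_ext fun i => ?_⟩
  rw [comp_toFun, freeDesc_gen, hy]

lemma exists_map_eq {J : Type u} [SmallCategory J] [IsFiltered J] {F : J ⥤ TAlg T} {c : Cocone F}
    (hc : IsColimit c) {α : Type*} [Finite α] {j : J} (y z : α → F.obj j)
    (h : ∀ i, Hom.toFun (coLeg c j) (y i) = Hom.toFun (coLeg c j) (z i)) :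
    ∃ (k : J) (u : j ⟶ k), ∀ i, Hom.toFun (F.map u) (y i) = Hom.toFun (F.map u) (z i) := by
  classical
  cases nonempty_fintype α
  have key : ∀ s : Finset α, ∃ (k : J) (u : j ⟶ k),
      ∀ i ∈ s, Hom.toFun (F.map u) (y i) = Hom.toFun (F.map u) (z i) := by
    intro s
    induction s using Finset.induction_on with
    | empty => exact ⟨j, 𝟙 j, fun i hi => absurd hi (Finset.notMem_empty i)⟩
    | insert a s ha ih =>
      obtain ⟨k, u, hu⟩ := ih
      obtain ⟨l, v, hv⟩ := eq_of_isColimit hc (y := Hom.toFun (F.map u) (y a))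
        (z := Hom.toFun (F.map u) (z a)) (by
          rw [← comp_toFun, ← comp_toFun, map_coLeg]; exact h a)
      refine ⟨l, u ≫ v, fun i hi => ?_⟩
      rw [F.map_comp, comp_toFun, comp_toFun]
      rcases Finset.mem_insert.1 hi with rfl | hi
      · exact hv
      · rw [hu i hi]
  obtain ⟨k, u, hu⟩ := key Finset.univ
  exact ⟨k, u, fun i => hu i (Finset.mem_univ i)⟩

section

variable [T.IsFermat]

lemma hom_eq_zero_of_span {A B : TAlg T} (f : A ⟶ B) (s : Set A)
    (h : ∀ a ∈ s, Hom.toFun f a = 0) : ∀ a ∈ Ideal.span s, Hom.toFun f a = 0 := by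
  have : Ideal.span s ≤ RingHom.ker (toRingHom f) := Ideal.span_le.2 h
  exact fun a ha => this ha

/-- Images of the finitely many generators are represented at one stage, and the finitely many
relations hold at a later one; two maps agreeing in the colimit agree on generators at a later
stage. -/
lemma isFinitary_of_isFP {P : TAlg T} (hP : P.IsFP) : IsFinitary.{u} P := by
  obtain ⟨n, I, ⟨s, rfl⟩, ⟨e⟩⟩ := hP
  intro J _ _ F c hc
  have hq := quotMk_surjective (T.free n) (Ideal.span (s : Set (T.free n)))
  constructor
  · intro f
    obtain ⟨j, g, hg⟩ := free_factors hc (quotMk _ _ ≫ e.inv ≫ f)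
    obtain ⟨k, u, hu⟩ := exists_map_eq hc (α := s) (fun i => Hom.toFun g i.1) (fun _ => 0)
      (fun i => by
        rw [← comp_toFun, hg, comp_toFun, (quotMk_eq_zero _ _).2 (Ideal.subset_span i.2),
          toFun_zero, toFun_zero])
    refine ⟨k, e.hom ≫ quotDesc _ (g ≫ F.map u) (hom_eq_zero_of_span _ _ fun a ha => ?_), ?_⟩
    · rw [comp_toFun, hu ⟨a, ha⟩, toFun_zero]
    · rw [← cancel_epi e.inv, Category.assoc, e.inv_hom_id_assoc]
      refine epi_of_surjective hq ?_
      rw [← Category.assoc, quotMk_desc, Category.assoc, map_coLeg, hg]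
  · intro j g h hgh
    obtain ⟨k, u, hu⟩ := exists_map_eq hc (α := Fin n)
      (fun i => Hom.toFun (quotMk _ _ ≫ e.inv ≫ g) (T.gen i))
      (fun i => Hom.toFun (quotMk _ _ ≫ e.inv ≫ h) (T.gen i)) (fun i => by
        rw [← comp_toFun, ← comp_toFun, Category.assoc, Category.assoc, Category.assoc,
          Category.assoc, hgh])
    refine ⟨k, u, ?_⟩
    rw [← cancel_epi e.inv]
    refine epi_of_surjective hq (free_hom_ext fun i => ?_)
    have := hu i
    rw [← comp_toFun, ← comp_toFun] at this
    simpa only [Category.assoc] using this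

lemma isFP_of_iso {P Q : TAlg T} (e : P ≅ Q) (hP : P.IsFP) : Q.IsFP := by
  obtain ⟨n, I, hI, ⟨e'⟩⟩ := hP
  exact ⟨n, I, hI, ⟨e.symm ≪≫ e'⟩⟩

end

/-! ### Flatness -/

section Flat

/-- The equational criterion: a linear relation that comes from a flat morphism is trivial there,
and the trivialisation is carried along `α` and `β`. -/
lemma isFlat_of_stages {A B : TAlg T} (φ : A ⟶ B)
    (h : ∀ (l : ℕ) (f : Fin l → A) (x : Fin l → B), ∑ i, Hom.toFun φ (f i) * x i = 0 →
      ∃ (A' B' : TAlg T) (φ' : A' ⟶ B') (α : A' ⟶ A) (β : B' ⟶ B) (f' : Fin l → A')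
        (x' : Fin l → B'), IsFlat φ' ∧ φ' ≫ β = α ≫ φ ∧ (∀ i, Hom.toFun α (f' i) = f i) ∧
        (∀ i, Hom.toFun β (x' i) = x i) ∧ ∑ i, Hom.toFun φ' (f' i) * x' i = 0) : IsFlat φ := by
  let _ : Algebra A B := (toRingHom φ).toAlgebra
  refine Module.Flat.of_forall_isTrivialRelation fun {l f x} hfx => ?_
  obtain ⟨A', B', φ', α, β, f', x', hφ', hc, hf, hx, h0⟩ := h l f x hfx
  let _ : Algebra A' B' := (toRingHom φ').toAlgebra
  have : Module.Flat A' B' := hφ'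
  obtain ⟨k, a, y, hy, ha⟩ := Module.Flat.isTrivialRelation_of_sum_smul_eq_zero
    (R := A') (M := B') (f := f') (x := x') h0
  refine ⟨k, fun i j => Hom.toFun α (a i j), fun j => Hom.toFun β (y j), fun i => ?_, fun j => ?_⟩
  · rw [← hx, hy]
    refine (map_sum (toRingHom β) _ _).trans (Finset.sum_congr rfl fun j _ => ?_)
    refine (map_mul (toRingHom β) _ _).trans ?_
    exact congrArg (· * Hom.toFun β (y j)) (congr_toFun hc (a i j))
  · have := congrArg (toRingHom α) (ha j)
    rw [map_sum, map_zero] at this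
    refine Eq.trans (Finset.sum_congr rfl fun i _ => ?_) this
    rw [map_mul, toRingHom_apply, toRingHom_apply, hf]

lemma toFun_sum_mul {A B C D : TAlg T} (φ : A ⟶ B) (α : A ⟶ C) (β : B ⟶ D) (ψ : C ⟶ D)
    (hc : φ ≫ β = α ≫ ψ) {l : ℕ} (f : Fin l → A) (x : Fin l → B) :
    Hom.toFun β (∑ i, Hom.toFun φ (f i) * x i) =
      ∑ i, Hom.toFun ψ (Hom.toFun α (f i)) * Hom.toFun β (x i) := by
  refine (map_sum (toRingHom β) _ _).trans (Finset.sum_congr rfl fun j _ => ?_)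
  refine (map_mul (toRingHom β) _ _).trans ?_
  exact congrArg (· * Hom.toFun β (x j)) (congr_toFun hc (f j))

/-- Filtered colimits of flat morphisms are flat. -/
lemma isFlat_of_isColimit {J : Type u} [SmallCategory J] [IsFiltered J] {F G : J ⥤ TAlg T}
    {c : Cocone F} {d : Cocone G} (hc : ∀ x : c.pt, ∃ j y, Hom.toFun (coLeg c j) y = x)
    (hd : IsColimit d) (φ : ∀ j, F.obj j ⟶ G.obj j)
    (hφ : ∀ {i j : J} (u : i ⟶ j), φ i ≫ G.map u = F.map u ≫ φ j) (ψ : c.pt ⟶ d.pt)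
    (hψ : ∀ j, φ j ≫ coLeg d j = coLeg c j ≫ ψ) (h : ∀ j, IsFlat (φ j)) : IsFlat ψ := by
  refine isFlat_of_stages ψ fun l f x hfx => ?_
  obtain ⟨j, y, hy⟩ := TDGA.exists_common_stage (V := fun j => F.obj j × G.obj j)
    (fun u y => (Hom.toFun (F.map u) y.1, Hom.toFun (G.map u) y.2))
    (fun j y => (Hom.toFun (coLeg c j) y.1, Hom.toFun (coLeg d j) y.2))
    (fun u y => Prod.ext (congr_toFun (map_coLeg c u) y.1) (congr_toFun (map_coLeg d u) y.2))
    (fun i => (f i, x i)) (fun i => by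
      obtain ⟨j, y, hy⟩ := hc (f i)
      obtain ⟨k, z, hz⟩ := exists_rep_of_isColimit hd (x i)
      refine ⟨IsFiltered.max j k, (Hom.toFun (F.map (IsFiltered.leftToMax j k)) y,
        Hom.toFun (G.map (IsFiltered.rightToMax j k)) z), Prod.ext ?_ ?_⟩
      · exact (congr_toFun (map_coLeg c _) y).trans hy
      · exact (congr_toFun (map_coLeg d _) z).trans hz)
  have h1 : ∀ i, Hom.toFun (coLeg c j) (y i).1 = f i := fun i => congrArg Prod.fst (hy i)
  have h2 : ∀ i, Hom.toFun (coLeg d j) (y i).2 = x i := fun i => congrArg Prod.snd (hy i)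
  have h3 := toFun_sum_mul (φ j) (coLeg c j) (coLeg d j) ψ (hψ j) (fun i => (y i).1)
    (fun i => (y i).2)
  simp only [h1, h2] at h3
  rw [hfx, ← toFun_zero (coLeg d j)] at h3
  obtain ⟨k, u, hu⟩ := eq_of_isColimit hd h3
  refine ⟨F.obj k, G.obj k, φ k, coLeg c k, coLeg d k, fun i => Hom.toFun (F.map u) (y i).1,
    fun i => Hom.toFun (G.map u) (y i).2, h k, hψ k, fun i => ?_, fun i => ?_, ?_⟩
  · exact (congr_toFun (map_coLeg c u) _).trans (h1 i)
  · exact (congr_toFun (map_coLeg d u) _).trans (h2 i)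
  · rw [toFun_sum_mul (φ j) (F.map u) (G.map u) (φ k) (hφ u), toFun_zero] at hu
    exact hu

end Flat

end TAlg

/-! ### `E`-morphisms -/

namespace TAlg

section EMor

variable [T.IsFermat] {E : MorphismProperty (TAlg T)} {A C : TAlg T} {g : A ⟶ C}

variable (E g) in
/-- A presentation of a morphism as the pushout of a morphism in `E` along a morphism factoring
through a finitely presented approximation. -/
structure EStage where
  /-- the approximation -/
  k : PresIdx A
  /-- the source of the morphism in `E` -/
  P : TAlg T
  /-- the target of the morphism in `E` -/
  Q : TAlg T
  /-- the morphism in `E` -/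
  f : P ⟶ Q
  hf : E f
  /-- the morphism to the approximation -/
  a : P ⟶ pres k
  /-- the coprojection -/
  q : Q ⟶ C
  sq : IsPushout (a ≫ presTo k) f g q

/-- The source of the morphism in E is finitely presented, so its map to A factors through some
finitely presented approximation of A. -/
lemma exists_stage (hE : IsEtaleLike E) (hg : EMor E g) : Nonempty (EStage E g) := by
  obtain ⟨P, Q, f, a, q, hf, sq⟩ := hg
  obtain ⟨k, b, rfl⟩ := (isFinitary_of_isFP (hE.fp_source f hf) (presIsColimit A)).1 a
  exact ⟨⟨k, P, Q, f, hf, b, q, sq⟩⟩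

namespace EStage

variable (st : EStage E g)

/-- The approximations of the source. -/
def src : Under st.k ⥤ TAlg T := Under.forget st.k ⋙ presFunctor A

/-- The source as a cocone. -/
def srcCocone : Cocone st.src := (presCocone A).whisker (Under.forget st.k)

/-- The source is the colimit of its approximations. -/
def srcIsColimit : IsColimit st.srcCocone :=
  (Functor.Final.isColimitWhiskerEquiv (Under.forget st.k) (presCocone A)).symm (presIsColimit A)

/-- The maps to the approximations. -/
def base (j : Under st.k) : st.P ⟶ st.src.obj j := st.a ≫ (presFunctor A).map j.hom

lemma base_map {i j : Under st.k} (u : i ⟶ j) : st.base i ≫ st.src.map u = st.base j := by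
  have h : (presFunctor A).map i.hom ≫ (presFunctor A).map u.right = (presFunctor A).map j.hom := by
    rw [← Functor.map_comp]
    rfl
  exact (Category.assoc _ _ _).trans (congrArg (st.a ≫ ·) h)

lemma base_leg (j : Under st.k) : st.base j ≫ coLeg st.srcCocone j = st.a ≫ presTo st.k :=
  (Category.assoc _ _ _).trans (congrArg (st.a ≫ ·) (map_coLeg (presCocone A) j.hom))

/-- The approximations of the target. -/
def tgt : Under st.k ⥤ TAlg T := pushDiagram st.base st.base_map st.f

/-- The target as a cocone. -/
def tgtCocone : Cocone st.tgt :=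
  pushCocone (c := st.srcCocone) (g := g) st.base st.base_map st.f st.base_leg st.sq

/-- The target is the colimit of its approximations. -/
def tgtIsColimit : IsColimit st.tgtCocone :=
  pushIsColimit (c := st.srcCocone) (g := g) st.base_leg st.sq st.srcIsColimit

/-- The approximations of the morphism. -/
def hom (j : Under st.k) : st.src.obj j ⟶ st.tgt.obj j := pushInl st.base st.base_map st.f j

/-- The maps to the source. -/
def srcTo (j : Under st.k) : st.src.obj j ⟶ A := coLeg st.srcCocone j

/-- The maps to the target. -/
def tgtTo (j : Under st.k) : st.tgt.obj j ⟶ C := coLeg st.tgtCocone j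

lemma hom_map {i j : Under st.k} (u : i ⟶ j) : st.hom i ≫ st.tgt.map u = st.src.map u ≫ st.hom j :=
  pushInl_map _ _ _ u

lemma isPushout (j : Under st.k) : IsPushout (st.srcTo j) (st.hom j) g (st.tgtTo j) :=
  pushLeg_isPushout (c := st.srcCocone) (g := g) st.base st.base_map st.f st.base_leg st.sq j

lemma src_isFP (j : Under st.k) : (st.src.obj j).IsFP := pres_isFP _

/-- The approximations of an E-morphism are pushouts along maps of finitely presented algebras,
hence lie in E itself. -/
lemma hom_mem (hE : IsEtaleLike E) (j : Under st.k) : E (st.hom j) :=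
  hE.pushout_mem st.f (st.base j) _ _ (push_isPushout st.base st.base_map st.f j).flip
    (st.src_isFP j) st.hf

lemma tgt_factors {X : TAlg T} (hX : X.IsFP) (h : X ⟶ C) :
    ∃ (j : Under st.k) (y : X ⟶ st.tgt.obj j), y ≫ st.tgtTo j = h :=
  (isFinitary_of_isFP hX st.tgtIsColimit).1 h

lemma tgt_rep (x : C) : ∃ j y, Hom.toFun (st.tgtTo j) y = x :=
  exists_rep_of_isColimit st.tgtIsColimit x

lemma src_free_factors {n : ℕ} (h : T.free n ⟶ A) :
    ∃ (j : Under st.k) (y : T.free n ⟶ st.src.obj j), y ≫ st.srcTo j = h :=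
  free_factors st.srcIsColimit h

end EStage

/-- E is closed under composition only at finite presentation, so the composite is descended there.
C is the filtered colimit of the targets of finitely presented approximations of `g`, so the second
morphism is a pushout of one starting at such a target. The two compose in E, and the pushout
squares paste. -/
lemma eMor_comp (hE : IsEtaleLike E) (hg : EMor E g) {D : TAlg T} {h : C ⟶ D} (hh : EMor E h) :
    EMor E (g ≫ h) := by
  obtain ⟨st⟩ := exists_stage hE hg
  obtain ⟨P, Q, f, a, q, hf, sq⟩ := hh
  obtain ⟨j, y, rfl⟩ := st.tgt_factors (hE.fp_source f hf) a
  have s1 := IsPushout.of_hasPushout y f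
  have hw : (y ≫ st.tgtTo j) ≫ h = f ≫ q := sq.w
  have s2 : IsPushout (st.tgtTo j) (pushout.inl y f) h
      (pushout.desc (st.tgtTo j ≫ h) q (by rw [← hw, Category.assoc])) := by
    refine IsPushout.of_left (h₁₁ := y) (v₁₁ := f) (h₂₁ := pushout.inr y f) ?_
      (pushout.inl_desc _ _ _).symm s1
    rw [pushout.inr_desc]
    exact sq
  exact E.pushouts_mk ((st.isPushout j).paste_vert s2) (hE.comp_mem _ _ (st.hom_mem hE j)
    (hE.pushout_mem f y _ _ s1.flip (hE.fp_target _ (st.hom_mem hE j)) hf))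

lemma isFlat_of_eMor (hE : IsEtaleLike E) (hg : EMor E g) : IsFlat g := by
  obtain ⟨st⟩ := exists_stage hE hg
  exact isFlat_of_isColimit (c := st.srcCocone) (d := st.tgtCocone)
    (exists_rep_of_isColimit st.srcIsColimit) st.tgtIsColimit st.hom st.hom_map g
    (fun j => (st.isPushout j).w.symm) fun j => hE.flat _ (st.hom_mem hE j)

/-- Right cancellation: a coprojection Q → Q ⊙_P Q is in E, and its composite with the codiagonal is
the identity. -/
lemma codiag_mem (hE : IsEtaleLike E) {P Q : TAlg T} (f : P ⟶ Q) (hf : E f) :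
    E (pushout.desc (𝟙 Q) (𝟙 Q) rfl : pushout f f ⟶ Q) := by
  have hQ := hE.fp_target f hf
  refine hE.right_cancel (pushout.inl f f) _
    (hE.pushout_mem f f _ _ (IsPushout.of_hasPushout f f).flip hQ hf) ?_
  rw [pushout.inl_desc]
  exact hE.id_mem Q hQ

/-- Coequalizers of morphisms under an `E`-morphism are `E`-morphisms. -/
lemma exists_eMor_coeq (hE : IsEtaleLike E) (hg : EMor E g) {D : TAlg T} (u v : C ⟶ D)
    (h : g ≫ u = g ≫ v) : ∃ (D' : TAlg T) (w : D ⟶ D'), EMor E w ∧ u ≫ w = v ≫ w ∧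
      ∀ (X : TAlg T) (t : D ⟶ X), u ≫ t = v ≫ t → ∃ t' : D' ⟶ X, w ≫ t' = t := by
  obtain ⟨P, Q, f, a, q, hf, sq⟩ := hg
  have hq : f ≫ q ≫ u = f ≫ q ≫ v := by
    rw [← sq.w_assoc, ← sq.w_assoc, h]
  -- Pushing the codiagonal out along (q u, q v) identifies these two maps universally.
  have s := IsPushout.of_hasPushout (pushout.desc (q ≫ u) (q ≫ v) hq)
    (pushout.desc (𝟙 Q) (𝟙 Q) rfl : pushout f f ⟶ Q)
  refine ⟨_, pushout.inl _ _, E.pushouts_mk s (codiag_mem hE f hf), ?_, fun X t ht => ?_⟩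
  · refine sq.hom_ext (by rw [← Category.assoc, h, Category.assoc]) ?_
    have h1 := congrArg (fun k => pushout.inl f f ≫ k) s.w
    have h2 := congrArg (fun k => pushout.inr f f ≫ k) s.w
    simp only [pushout.inl_desc_assoc, pushout.inr_desc_assoc, Category.assoc] at h1 h2
    rw [h1, h2]
  · refine ⟨pushout.desc t (q ≫ u ≫ t) ?_, pushout.inl_desc _ _ _⟩
    refine pushout.hom_ext ?_ ?_
    · rw [pushout.inl_desc_assoc, pushout.inl_desc_assoc, Category.id_comp, Category.assoc]
    · rw [pushout.inr_desc_assoc, pushout.inr_desc_assoc, Category.id_comp, Category.assoc, ht]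

/-- Although A need not be finitely presented, its identity is a pushout of the identity of the
initial algebra T[]. -/
lemma eMor_id (hE : IsEtaleLike E) (A : TAlg T) : EMor E (𝟙 A) := by
  have hF : (T.free 0).IsFP := ⟨0, ⊥, Submodule.fg_bot, ⟨(isoOfBijective (quotMk _ ⊥)
    ⟨fun a b h => by
      have := (quotMk_eq_iff _ _ a b).1 h
      exact sub_eq_zero.1 this, quotMk_surjective _ _⟩)⟩⟩
  exact E.pushouts_mk (IsPushout.of_id_snd (f := A.freeDesc (Fin.elim0 : Fin 0 → A)))
    (hE.id_mem _ hF)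

lemma iso_mem (hE : IsEtaleLike E) {P Q : TAlg T} (e : P ≅ Q) (hP : P.IsFP) : E e.hom := by
  have : IsPushout (𝟙 P) e.hom e.hom (𝟙 Q) := IsPushout.of_horiz_isIso ⟨by simp⟩
  have s : IsPushout (𝟙 P) (𝟙 P) e.hom e.hom := IsPushout.of_horiz_isIso ⟨rfl⟩
  exact hE.pushout_mem (𝟙 P) (𝟙 P) e.hom e.hom s hP (hE.id_mem P hP)

end EMor

/-! ### The category of factorisations -/

section Fact

variable [T.IsFermat] {E : MorphismProperty (TAlg T)} {A B : TAlg T} {f : A ⟶ B}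

/-- Construction of factorisations. -/
def mkFact {C : TAlg T} (i : A ⟶ C) (p : C ⟶ B) (h : i ≫ p = f) (hi : EMor E i) : EFact E f :=
  ⟨{ mid := C, ι := i, π := p, ι_π := h }, hi⟩

/-- The middle object. -/
def EFactMid (X : EFact E f) : TAlg T := X.obj.mid

/-- The first morphism. -/
def EFactIn (X : EFact E f) : A ⟶ EFactMid X := X.obj.ι

/-- The second morphism. -/
def EFactOut (X : EFact E f) : EFactMid X ⟶ B := X.obj.π

lemma eFactIn_out (X : EFact E f) : EFactIn X ≫ EFactOut X = f := X.obj.ι_π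

lemma eFactIn_mem (X : EFact E f) : EMor E (EFactIn X) := X.property

/-- Construction of morphisms of factorisations. -/
def mkFactHom {X Y : EFact E f} (h : EFactMid X ⟶ EFactMid Y) (h1 : EFactIn X ≫ h = EFactIn Y)
    (h2 : h ≫ EFactOut Y = EFactOut X) : X ⟶ Y :=
  ObjectProperty.homMk ⟨h, h1, h2⟩

/-- The morphism of middle objects. -/
def eFactMap {X Y : EFact E f} (u : X ⟶ Y) : EFactMid X ⟶ EFactMid Y := u.hom.h

lemma eFactIn_map {X Y : EFact E f} (u : X ⟶ Y) : EFactIn X ≫ eFactMap u = EFactIn Y := u.hom.ι_h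

lemma eFactMap_out {X Y : EFact E f} (u : X ⟶ Y) : eFactMap u ≫ EFactOut Y = EFactOut X :=
  u.hom.h_π

lemma eFact_hom_ext {X Y : EFact E f} {u v : X ⟶ Y} (h : eFactMap u = eFactMap v) : u = v :=
  ObjectProperty.hom_ext _ (Factorisation.Hom.ext h)

/-- Pushouts over A give upper bounds. Parallel maps are coequalised by an E-morphism, through which
the map to B factors. -/
lemma eFact_isFiltered (hE : IsEtaleLike E) (f : A ⟶ B) : IsFiltered (EFact E f) where
  nonempty := ⟨mkFact (𝟙 A) f (Category.id_comp f) (eMor_id hE A)⟩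
  cocone_objs X Y := by
    have s := IsPushout.of_hasPushout (EFactIn X) (EFactIn Y)
    have hY : EMor E (pushout.inl (EFactIn X) (EFactIn Y)) :=
      E.pushouts.of_isPushout s (eFactIn_mem Y)
    have hw : EFactIn X ≫ EFactOut X = EFactIn Y ≫ EFactOut Y := by
      rw [eFactIn_out, eFactIn_out]
    refine ⟨mkFact (EFactIn X ≫ pushout.inl _ _) (pushout.desc (EFactOut X) (EFactOut Y) hw)
      (by rw [Category.assoc, pushout.inl_desc, eFactIn_out]) (eMor_comp hE (eFactIn_mem X) hY),
      mkFactHom (pushout.inl _ _) rfl (pushout.inl_desc _ _ _),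
      mkFactHom (pushout.inr _ _) pushout.condition.symm (pushout.inr_desc _ _ _), trivial⟩
  cocone_maps {X Y} u v := by
    obtain ⟨D, w, hw, h1, h2⟩ := exists_eMor_coeq hE (eFactIn_mem X) (eFactMap u) (eFactMap v)
      (by rw [eFactIn_map, eFactIn_map])
    obtain ⟨t, ht⟩ := h2 B (EFactOut Y) (by rw [eFactMap_out, eFactMap_out])
    refine ⟨mkFact (EFactIn Y ≫ w) t (by rw [Category.assoc, ht, eFactIn_out])
      (eMor_comp hE (eFactIn_mem Y) hw), mkFactHom w rfl ht, eFact_hom_ext h1⟩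

variable (E f) in
/-- Data for a factorisation. -/
structure FactData where
  /-- number of generators -/
  n : ℕ
  /-- relations -/
  I : Ideal (T.free n)
  /-- number of generators -/
  m : ℕ
  /-- relations -/
  J : Ideal (T.free m)
  /-- the morphism in `E` -/
  φ : (T.free n).quot I ⟶ (T.free m).quot J
  hφ : E φ
  /-- the map from the source -/
  a : (T.free n).quot I ⟶ A
  /-- the map from the target -/
  b : (T.free m).quot J ⟶ B
  comm : a ≫ f = φ ≫ b

/-- The factorisation defined by data. -/
def FactData.toFact (d : FactData E f) : EFact E f :=
  mkFact (pushout.inl d.a d.φ) (pushout.desc f d.b d.comm) (pushout.inl_desc _ _ _)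
    (E.pushouts_mk (IsPushout.of_hasPushout d.a d.φ) d.hφ)

/-- The morphism in E has finitely presented source and target, so up to isomorphism it joins
quotients of free algebras; such data form a small type. -/
lemma exists_factData (hE : IsEtaleLike E) (X : EFact E f) :
    ∃ d : FactData E f, Nonempty (d.toFact ≅ X) := by
  obtain ⟨P, Q, φ, a, q, hφ, sq⟩ := eFactIn_mem X
  obtain ⟨n, I, hI, ⟨eP⟩⟩ := hE.fp_source φ hφ
  obtain ⟨m, J, hJ, ⟨eQ⟩⟩ := hE.fp_target φ hφ
  have hP : E eP.inv := iso_mem hE eP.symm (isFP_of_iso eP (hE.fp_source φ hφ))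
  have hQ : E eQ.hom := iso_mem hE eQ (hE.fp_target φ hφ)
  have hw : (eP.inv ≫ a) ≫ f = (eP.inv ≫ φ ≫ eQ.hom) ≫ eQ.inv ≫ q ≫ EFactOut X := by
    simp only [Category.assoc, eQ.hom_inv_id_assoc]
    rw [← sq.w_assoc, eFactIn_out]
  let d : FactData E f := ⟨n, I, m, J, eP.inv ≫ φ ≫ eQ.hom,
    hE.comp_mem _ _ hP (hE.comp_mem _ _ hφ hQ), eP.inv ≫ a, eQ.inv ≫ q ≫ EFactOut X, hw⟩
  have s : IsPushout d.a d.φ (EFactIn X) (eQ.inv ≫ q) :=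
    sq.of_iso eP (Iso.refl _) eQ (Iso.refl _) (by simp [d]) (by simp [d]) (by simp) (by simp)
  let e : pushout d.a d.φ ≅ EFactMid X := (IsPushout.of_hasPushout d.a d.φ).isoIsPushout _ _ s
  have e1 : pushout.inl d.a d.φ ≫ e.hom = EFactIn X := IsPushout.inl_isoIsPushout_hom _ _ _ _
  have e2 : pushout.inr d.a d.φ ≫ e.hom = eQ.inv ≫ q := IsPushout.inr_isoIsPushout_hom _ _ _ _
  have e3 : e.hom ≫ EFactOut X = pushout.desc f d.b d.comm := by
    refine pushout.hom_ext ?_ ?_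
    · rw [← Category.assoc, e1, pushout.inl_desc, eFactIn_out]
    · rw [← Category.assoc, e2, pushout.inr_desc, Category.assoc]
  refine ⟨d, ⟨⟨mkFactHom e.hom e1 e3, mkFactHom e.inv ?_ ?_, eFact_hom_ext e.hom_inv_id,
    eFact_hom_ext e.inv_hom_id⟩⟩⟩
  · exact (Iso.comp_inv_eq e).2 e1.symm
  · exact (Iso.inv_comp_eq e).2 e3.symm

lemma eFact_essentiallySmall (hE : IsEtaleLike E) (f : A ⟶ B) :
    EssentiallySmall.{u} (EFact E f) := by
  have hF : (eDiagram E f).Faithful := ⟨fun h => eFact_hom_ext h⟩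
  refine (essentiallySmall_iff _).2 ⟨?_, locallySmall_of_faithful (eDiagram E f)⟩
  refine small_of_surjective (α := FactData E f) (f := fun d => toSkeleton d.toFact) fun s => ?_
  obtain ⟨d, ⟨e⟩⟩ := exists_factData hE ((fromSkeleton _).obj s)
  exact ⟨d, toSkeleton_eq_iff.2 ⟨e⟩⟩

end Fact

end TAlg

/-! ### Unique lifting -/

section UniqueLift

variable {D : Type*} [Category* D]

/-- The right lifting property together with uniqueness of the lifts. -/
def UniqueLift {A B X Y : D} (i : A ⟶ B) (p : X ⟶ Y) : Prop :=
  HasLiftingProperty i p ∧ ∀ u v : B ⟶ X, i ≫ u = i ≫ v → u ≫ p = v ≫ p → u = v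

lemma UniqueLift.exists_lift {A B X Y : D} {i : A ⟶ B} {p : X ⟶ Y} (h : UniqueLift i p)
    {a : A ⟶ X} {b : B ⟶ Y} (w : a ≫ p = i ≫ b) : ∃ l : B ⟶ X, i ≫ l = a ∧ l ≫ p = b := by
  have := h.1
  have sq : CommSq a i p b := ⟨w⟩
  exact ⟨sq.lift, sq.fac_left, sq.fac_right⟩

lemma UniqueLift.mk' {A B X Y : D} {i : A ⟶ B} {p : X ⟶ Y}
    (h : ∀ (a : A ⟶ X) (b : B ⟶ Y), a ≫ p = i ≫ b → ∃ l : B ⟶ X, i ≫ l = a ∧ l ≫ p = b)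
    (h' : ∀ u v : B ⟶ X, i ≫ u = i ≫ v → u ≫ p = v ≫ p → u = v) : UniqueLift i p := by
  refine ⟨⟨fun {a b} sq => ?_⟩, h'⟩
  obtain ⟨l, h1, h2⟩ := h a b sq.w
  exact ⟨⟨⟨l, h1, h2⟩⟩⟩

end UniqueLift

namespace TAlg

section

variable [T.IsFermat] {E : MorphismProperty (TAlg T)}

/-- Two lifts together give a map out of Q ⊙_P Q, and lifting it along the codiagonal, which lies in
E, shows that they coincide. -/
lemma uniqueLift_of_mem (hE : IsEtaleLike E) {P Q X Y : TAlg T} {f : P ⟶ Q} (hf : E f)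
    {p : X ⟶ Y} (hp : E.rlp p) : UniqueLift f p := by
  refine ⟨hp f hf, fun u v h h' => ?_⟩
  have := hp _ (codiag_mem hE f hf)
  have sq : CommSq (pushout.desc u v h) (pushout.desc (𝟙 Q) (𝟙 Q) rfl : pushout f f ⟶ Q) p
      (u ≫ p) := ⟨by
    refine pushout.hom_ext ?_ ?_
    · rw [pushout.inl_desc_assoc, pushout.inl_desc_assoc, Category.id_comp]
    · rw [pushout.inr_desc_assoc, pushout.inr_desc_assoc, Category.id_comp, h']⟩
  have h1 := congrArg (fun k => pushout.inl f f ≫ k) sq.fac_left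
  have h2 := congrArg (fun k => pushout.inr f f ≫ k) sq.fac_left
  simp only [pushout.inl_desc_assoc, pushout.inr_desc_assoc, pushout.inl_desc,
    pushout.inr_desc] at h1 h2
  exact h1.symm.trans h2

lemma uniqueLift_of_eMor (hE : IsEtaleLike E) {A C X Y : TAlg T} {g : A ⟶ C} (hg : EMor E g)
    {p : X ⟶ Y} (hp : E.rlp p) : UniqueLift g p := by
  refine ⟨E.pushouts_le_llp_rlp _ hg _ hp, fun u v h h' => ?_⟩
  obtain ⟨P, Q, f, a, q, hf, sq⟩ := hg
  refine sq.hom_ext h ((uniqueLift_of_mem hE hf hp).2 _ _ ?_ ?_)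
  · rw [← sq.w_assoc, ← sq.w_assoc, h]
  · rw [Category.assoc, Category.assoc, h']

end

/-! ### The `E`-localisation -/

section Loc

variable [T.IsFermat] {E : MorphismProperty (TAlg T)} {A B : TAlg T} {f : A ⟶ B}

/-- The legs of the localisation. -/
def locLeg (L : ELocalisation E f) (X : EFact E f) : EFactMid X ⟶ L.cocone.pt := coLeg L.cocone X

lemma eFactMap_locLeg (L : ELocalisation E f) {X Y : EFact E f} (u : X ⟶ Y) :
    eFactMap u ≫ locLeg L Y = locLeg L X := map_coLeg L.cocone u

lemma eFactIn_locLeg (L : ELocalisation E f) (X : EFact E f) : EFactIn X ≫ locLeg L X = L.toLoc :=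
  L.fac X

lemma loc_hom_ext (L : ELocalisation E f) {X : TAlg T} {u v : L.cocone.pt ⟶ X}
    (h : ∀ Y, locLeg L Y ≫ u = locLeg L Y ≫ v) : u = v := L.isColimit.hom_ext h

lemma exists_locDesc (L : ELocalisation E f) {X : TAlg T} (r : ∀ Y : EFact E f, EFactMid Y ⟶ X)
    (hr : ∀ {Y Z : EFact E f} (u : Y ⟶ Z), eFactMap u ≫ r Z = r Y) :
    ∃ t : L.cocone.pt ⟶ X, ∀ Y, locLeg L Y ≫ t = r Y :=
  ⟨L.isColimit.desc (mkCocone (F := eDiagram E f) r hr),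
    L.isColimit.fac (mkCocone (F := eDiagram E f) r hr)⟩

/-- The natural map from the localisation. -/
def locTo (L : ELocalisation E f) : L.cocone.pt ⟶ B :=
  L.isColimit.desc (mkCocone (F := eDiagram E f) (fun X => EFactOut X) eFactMap_out)

lemma locLeg_to (L : ELocalisation E f) (X : EFact E f) : locLeg L X ≫ locTo L = EFactOut X :=
  L.isColimit.fac (mkCocone (F := eDiagram E f) (fun X => EFactOut X) eFactMap_out) X

/-- The trivial factorisation. -/
def idFact (hE : IsEtaleLike E) (f : A ⟶ B) : EFact E f :=
  mkFact (𝟙 A) f (Category.id_comp f) (eMor_id hE A)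

/-- The factorisations have the trivial one as their initial object. -/
def fromIdFact (hE : IsEtaleLike E) (X : EFact E f) : idFact hE f ⟶ X :=
  mkFactHom (X := idFact hE f) (EFactIn X) (Category.id_comp _) (eFactIn_out X)

lemma toLoc_eq (hE : IsEtaleLike E) (L : ELocalisation E f) : L.toLoc = locLeg L (idFact hE f) :=
  (eFactIn_locLeg L (idFact hE f)).symm.trans (Category.id_comp _)

lemma toLoc_to (hE : IsEtaleLike E) (L : ELocalisation E f) : L.toLoc ≫ locTo L = f :=
  (congrArg (· ≫ locTo L) (toLoc_eq hE L)).trans (locLeg_to L (idFact hE f))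

section Small

variable [EssentiallySmall.{u} (EFact E f)]

variable (E f) in
/-- A small model for the category of factorisations. -/
def smallFact : SmallModel.{u} (EFact E f) ⥤ EFact E f := (equivSmallModel _).inverse

instance : (smallFact E f).IsEquivalence :=
  inferInstanceAs (equivSmallModel.{u} (EFact E f)).inverse.IsEquivalence

/-- The localisation as a colimit over the small model. -/
def smallIsColimit (L : ELocalisation E f) : IsColimit (L.cocone.whisker (smallFact E f)) :=
  (Functor.Final.isColimitWhiskerEquiv (smallFact E f) L.cocone).symm L.isColimit

end Small

lemma smallFact_isFiltered (hE : IsEtaleLike E) [EssentiallySmall.{u} (EFact E f)] :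
    IsFiltered (SmallModel.{u} (EFact E f)) := by
  have := eFact_isFiltered hE f
  exact IsFiltered.of_equivalence (equivSmallModel.{u} (EFact E f))

lemma exists_eLocalisation (hE : IsEtaleLike E) (f : A ⟶ B) : Nonempty (ELocalisation E f) := by
  have := eFact_essentiallySmall hE f
  have : HasColimitsOfShape (EFact E f) (TAlg T) :=
    hasColimitsOfShape_of_essentiallySmall.{u} _ _
  let c := colimit.cocone (eDiagram E f)
  refine ⟨⟨c, colimit.isColimit _, coLeg c (idFact hE f), fun X => ?_⟩⟩
  exact map_coLeg c (fromIdFact hE X)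

lemma loc_rep (hE : IsEtaleLike E) (L : ELocalisation E f) (x : L.cocone.pt) :
    ∃ (X : EFact E f) (y : EFactMid X), Hom.toFun (locLeg L X) y = x := by
  have := eFact_essentiallySmall hE f
  have := smallFact_isFiltered (f := f) hE
  obtain ⟨j, y, hy⟩ := exists_rep_of_isColimit (smallIsColimit L) x
  exact ⟨(smallFact E f).obj j, y, hy⟩

lemma loc_factors (hE : IsEtaleLike E) (L : ELocalisation E f) {P : TAlg T} (hP : P.IsFP)
    (h : P ⟶ L.cocone.pt) : ∃ (X : EFact E f) (g : P ⟶ EFactMid X), g ≫ locLeg L X = h := by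
  have := eFact_essentiallySmall hE f
  have := smallFact_isFiltered (f := f) hE
  obtain ⟨j, y, hy⟩ := (isFinitary_of_isFP hP (smallIsColimit L)).1 h
  exact ⟨(smallFact E f).obj j, y, hy⟩

lemma isFlat_toLoc (hE : IsEtaleLike E) (L : ELocalisation E f) : IsFlat L.toLoc := by
  have := eFact_essentiallySmall hE f
  have := smallFact_isFiltered (f := f) hE
  have : Nonempty (SmallModel.{u} (EFact E f)) := IsFiltered.nonempty
  let F : SmallModel.{u} (EFact E f) ⥤ TAlg T := (Functor.const _).obj A
  refine isFlat_of_isColimit (F := F) (c := mkCocone (F := F) (fun _ => 𝟙 A)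
      (fun _ => Category.id_comp _)) (fun x => ⟨Classical.arbitrary _, x, rfl⟩) (smallIsColimit L)
    (fun j => EFactIn ((smallFact E f).obj j)) (fun {i j} u => ?_) L.toLoc (fun j => ?_)
    (fun j => isFlat_of_eMor hE (eFactIn_mem _))
  · exact (eFactIn_map ((smallFact E f).map u)).trans (Category.id_comp _).symm
  · exact (eFactIn_locLeg L ((smallFact E f).obj j)).trans (Category.id_comp _).symm

/-- Because P is finitely presented, the map to the localisation factors through the middle object
of some factorisation X. Pushing `φ` out along it gives a further factorisation D, whose leg to the
localisation supplies the lift. -/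
lemma locTo_rlp (hE : IsEtaleLike E) (L : ELocalisation E f) : E.rlp (locTo L) := by
  intro P Q φ hφ
  refine ⟨fun {a b} sq => ?_⟩
  obtain ⟨X, a, rfl⟩ := loc_factors hE L (hE.fp_source φ hφ) a
  have hw : a ≫ EFactOut X = φ ≫ b := by
    rw [← locLeg_to L X, ← Category.assoc, sq.w]
  have s := IsPushout.of_hasPushout a φ
  let D : EFact E f := mkFact (EFactIn X ≫ pushout.inl a φ) (pushout.desc (EFactOut X) b hw)
    (by rw [Category.assoc, pushout.inl_desc, eFactIn_out])
    (eMor_comp hE (eFactIn_mem X) (E.pushouts_mk s hφ))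
  let u : X ⟶ D := mkFactHom (Y := D) (pushout.inl a φ) rfl (pushout.inl_desc _ _ _)
  have hu : pushout.inl a φ ≫ locLeg L D = locLeg L X := eFactMap_locLeg L u
  have ho : locLeg L D ≫ locTo L = pushout.desc (EFactOut X) b hw := locLeg_to L D
  refine ⟨⟨⟨pushout.inr a φ ≫ locLeg L D, ?_, ?_⟩⟩⟩
  · exact ((pushout.condition_assoc (f := a) (g := φ) (locLeg L D)).symm.trans
      (congrArg (a ≫ ·) hu))
  · exact (Category.assoc _ _ _).trans
      ((congrArg (pushout.inr a φ ≫ ·) ho).trans (pushout.inr_desc _ _ _))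

/-- Lifts exist on each middle object, and their uniqueness makes them compatible, so they glue on
the colimit. -/
lemma toLoc_uniqueLift (hE : IsEtaleLike E) (L : ELocalisation E f) {X Y : TAlg T} {p : X ⟶ Y}
    (hp : E.rlp p) : UniqueLift L.toLoc p := by
  have hu : ∀ Z : EFact E f, UniqueLift (EFactIn Z) p :=
    fun Z => uniqueLift_of_eMor hE (eFactIn_mem Z) hp
  refine UniqueLift.mk' (fun a b w => ?_) fun u v h h' => loc_hom_ext L fun Z => (hu Z).2 _ _ ?_ ?_
  · have key : ∀ Z : EFact E f, ∃ l : EFactMid Z ⟶ X, EFactIn Z ≫ l = a ∧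
        l ≫ p = locLeg L Z ≫ b := fun Z => (hu Z).exists_lift (by
      rw [← Category.assoc, eFactIn_locLeg, w])
    choose r hr hr' using key
    obtain ⟨t, ht⟩ := exists_locDesc L r fun {Y Z} u => (hu Y).2 _ _
      (by rw [← Category.assoc, eFactIn_map, hr, hr])
      (by rw [Category.assoc, hr', hr', ← Category.assoc, eFactMap_locLeg])
    refine ⟨t, ?_, loc_hom_ext L fun Z => ?_⟩
    · exact (congrArg (· ≫ t) (toLoc_eq hE L)).trans
        ((ht (idFact hE f)).trans ((Category.id_comp _).symm.trans (hr (idFact hE f))))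
    · rw [← Category.assoc, ht, hr']
  · rw [← Category.assoc, ← Category.assoc, eFactIn_locLeg, h]
  · rw [Category.assoc, Category.assoc, h']

/-- If `f` lifts against E, a lift of the identity of A is a retraction of `L.toLoc`, and uniqueness
of lifts against `locTo L` makes it a two-sided inverse. -/
lemma isIso_toLoc_iff (hE : IsEtaleLike E) (L : ELocalisation E f) : IsIso L.toLoc ↔ E.rlp f := by
  constructor
  · intro h
    rw [← toLoc_to hE L]
    exact E.rlp.comp_mem _ _ (MorphismProperty.of_isIso _ _) (locTo_rlp hE L)
  · intro h
    obtain ⟨r, h1, h2⟩ := (toLoc_uniqueLift hE L h).exists_lift (a := 𝟙 A) (b := locTo L)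
      (by rw [toLoc_to hE, Category.id_comp])
    refine ⟨r, h1, (toLoc_uniqueLift hE L (locTo_rlp hE L)).2 _ _ ?_ ?_⟩
    · rw [← Category.assoc, h1, Category.id_comp, Category.comp_id]
    · rw [Category.assoc, toLoc_to hE, h2, Category.id_comp]

/-! ### The kernel of the map from the localisation to its target -/

/-- The image of a homomorphism. -/
def image {A B : TAlg T} (f : A ⟶ B) : TAlg T := A.quot (RingHom.ker (toRingHom f))

/-- The projection to the image. -/
def toImage {A B : TAlg T} (f : A ⟶ B) : A ⟶ image f := quotMk A _

/-- The inclusion of the image. -/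
def imageTo {A B : TAlg T} (f : A ⟶ B) : image f ⟶ B := quotDesc _ f fun _ ha => ha

lemma toImage_to {A B : TAlg T} (f : A ⟶ B) : toImage f ≫ imageTo f = f := quotMk_desc _ f _

lemma toImage_surjective {A B : TAlg T} (f : A ⟶ B) :
    Function.Surjective (Hom.toFun (toImage f)) := quotMk_surjective _ _

lemma imageTo_eq_zero {A B : TAlg T} (f : A ⟶ B) {y : image f} (hy : Hom.toFun (imageTo f) y = 0) :
    y = 0 := by
  obtain ⟨x, rfl⟩ := toImage_surjective f y
  rw [← comp_toFun, toImage_to] at hy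
  exact (quotMk_eq_zero _ _).2 hy

lemma imageTo_cancel {A B X : TAlg T} (f : A ⟶ B) {u v : X ⟶ image f}
    (h : u ≫ imageTo f = v ≫ imageTo f) : u = v := hom_ext fun x => by
  refine sub_eq_zero.1 (imageTo_eq_zero f ?_)
  rw [toFun_sub, ← comp_toFun, ← comp_toFun, h, sub_self]

/-- A pushout along a surjection is the quotient by the extension of its kernel; mapping the pushout
to that quotient shows that z dies there. -/
lemma mem_map_of_quot {A C : TAlg T} (φ : A ⟶ C) {B : TAlg T} (p : A ⟶ B)
    (hp : Function.Surjective (Hom.toFun p)) {i : C ⟶ B} (s : IsPushout φ p i (𝟙 B)) {z : C}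
    (hz : Hom.toFun i z = 0) : z ∈ Ideal.map (toRingHom φ) (RingHom.ker (toRingHom p)) := by
  let K := Ideal.map (toRingHom φ) (RingHom.ker (toRingHom p))
  have h : ∀ a, Hom.toFun p a = 0 → Hom.toFun (φ ≫ quotMk C K) a = 0 := fun a ha =>
    (quotMk_eq_zero C K).2 (Ideal.mem_map_of_mem (toRingHom φ) ha)
  have e := s.inl_desc (quotMk C K) (descOfSurjective p hp _ h)
    (comp_descOfSurjective p hp _ h).symm
  refine (quotMk_eq_zero C K).1 ?_
  rw [← e, comp_toFun, hz, toFun_zero]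

/-- The third axiom on E is applied at a finitely presented stage, with the image of A' in B as the
quotient. After the further morphism `j` in E, the kernel of the map to this image is generated by
the kernel of A' → B. The pushout of `φ ≫ j` to A is the factorisation D. -/
lemma exists_ker_subset_of_stage (hE : IsEtaleLike E) (X : EFact E f) {A' C' : TAlg T}
    {α : A' ⟶ A} {φ : A' ⟶ C'} {γ : C' ⟶ EFactMid X} (s : IsPushout α φ (EFactIn X) γ)
    (hφ : E φ) (i : C' ⟶ image (α ≫ f)) (hi : φ ≫ i = toImage (α ≫ f))
    (hi' : i ≫ imageTo (α ≫ f) = γ ≫ EFactOut X) (z : C')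
    (hz : Hom.toFun (γ ≫ EFactOut X) z = 0) :
    ∃ (D : EFact E f) (u : X ⟶ D), Hom.toFun (eFactMap u) (Hom.toFun γ z) ∈
      Ideal.map (toRingHom (EFactIn D)) (RingHom.ker (toRingHom f)) := by
  obtain ⟨C₁, j, i₁, hj, hji, sq⟩ := hE.factor φ i hφ (by
    rw [hi]; exact toImage_surjective _)
  rw [hi] at sq
  have s' := IsPushout.of_hasPushout α (φ ≫ j)
  have hw : α ≫ f = (φ ≫ j) ≫ i₁ ≫ imageTo (α ≫ f) := by
    rw [Category.assoc, ← Category.assoc j, hji, ← Category.assoc, hi, toImage_to]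
  let D : EFact E f := mkFact (pushout.inl α (φ ≫ j)) (pushout.desc f (i₁ ≫ imageTo _) hw)
    (pushout.inl_desc _ _ _) (E.pushouts_mk s' (hE.comp_mem _ _ hφ hj))
  let k : EFactMid X ⟶ pushout α (φ ≫ j) := s.desc (pushout.inl α (φ ≫ j)) (j ≫ pushout.inr _ _)
    (by rw [pushout.condition, Category.assoc])
  have hk : EFactIn X ≫ k = pushout.inl α (φ ≫ j) := s.inl_desc _ _ _
  have hk' : γ ≫ k = j ≫ pushout.inr _ _ := s.inr_desc _ _ _
  let u : X ⟶ D := mkFactHom (Y := D) k hk (s.hom_ext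
    ((Category.assoc _ _ _).symm.trans ((congrArg (· ≫ EFactOut D) hk).trans
      ((pushout.inl_desc _ _ _).trans (eFactIn_out X).symm)))
    ((Category.assoc _ _ _).symm.trans ((congrArg (· ≫ EFactOut D) hk').trans
      ((Category.assoc _ _ _).trans ((congrArg (j ≫ ·) (pushout.inr_desc _ _ _)).trans (by
        rw [← Category.assoc, hji, hi']))))))
  refine ⟨D, u, ?_⟩
  have h0 : Hom.toFun i₁ (Hom.toFun j z) = 0 := by
    rw [← comp_toFun, hji]
    refine imageTo_eq_zero (α ≫ f) ?_
    rw [← comp_toFun, hi', hz]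
  have h1 := mem_map_of_quot (φ ≫ j) (toImage (α ≫ f)) (toImage_surjective _) sq h0
  have h2 := Ideal.mem_map_of_mem (toRingHom (pushout.inr α (φ ≫ j))) h1
  have h3 : Hom.toFun (eFactMap u) (Hom.toFun γ z) =
      toRingHom (pushout.inr α (φ ≫ j)) (Hom.toFun j z) := congr_toFun hk' z
  rw [h3]
  rw [Ideal.map_map] at h2
  have h4 : (toRingHom (pushout.inr α (φ ≫ j))).comp (toRingHom (φ ≫ j)) =
      (toRingHom (pushout.inl α (φ ≫ j))).comp (toRingHom α) :=
    RingHom.ext fun a => (congr_toFun (pushout.condition (f := α) (g := φ ≫ j)) a).symm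
  rw [h4, ← Ideal.map_map] at h2
  refine Ideal.map_mono (f := toRingHom (pushout.inl α (φ ≫ j)))
    (Ideal.map_le_iff_le_comap.2 fun a ha => ?_) h2
  have h5 : Hom.toFun (toImage (α ≫ f)) a = 0 := ha
  have h6 := congr_toFun (toImage_to (α ≫ f)) a
  rw [comp_toFun, h5, toFun_zero] at h6
  exact h6.symm

/-- The task is to reach a stage whose target maps into the image of its source in B. The target of
the morphism in E is finitely generated; by surjectivity of `f` the images of its generators lift to
A, hence to a stage. Relations take care of themselves because the image embeds in B. -/
lemma exists_ker_subset (hE : IsEtaleLike E) (hf : Function.Surjective (Hom.toFun f))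
    (X : EFact E f) (y : EFactMid X) (hy : Hom.toFun (EFactOut X) y = 0) :
    ∃ (D : EFact E f) (u : X ⟶ D), Hom.toFun (eFactMap u) y ∈
      Ideal.map (toRingHom (EFactIn D)) (RingHom.ker (toRingHom f)) := by
  obtain ⟨st⟩ := exists_stage hE (eFactIn_mem X)
  obtain ⟨j₀, y₀, rfl⟩ := st.tgt_rep y
  obtain ⟨m, J, -, ⟨e⟩⟩ := hE.fp_target st.f st.hf
  obtain ⟨v, hv⟩ : ∃ v : T.free m ⟶ A, v ≫ f = quotMk _ J ≫ e.inv ≫ st.q ≫ EFactOut X := by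
    choose s hs using fun i : Fin m =>
      hf (Hom.toFun (quotMk _ J ≫ e.inv ≫ st.q ≫ EFactOut X) (T.gen i))
    exact ⟨A.freeDesc s, free_hom_ext fun i => by rw [comp_toFun, freeDesc_gen, hs]⟩
  obtain ⟨j₁, w₁, rfl⟩ := st.src_free_factors v
  let j := IsFiltered.max j₀ j₁
  let w := w₁ ≫ st.src.map (IsFiltered.rightToMax j₀ j₁)
  have hw : w ≫ st.srcTo j = w₁ ≫ st.srcTo j₁ := by
    rw [Category.assoc]
    exact congrArg (w₁ ≫ ·) (map_coLeg st.srcCocone _)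
  let z := Hom.toFun (st.tgt.map (IsFiltered.leftToMax j₀ j₁)) y₀
  have hz : Hom.toFun (st.tgtTo j) z = Hom.toFun (st.tgtTo j₀) y₀ :=
    congr_toFun (map_coLeg st.tgtCocone _) y₀
  let ι := imageTo (st.srcTo j ≫ f)
  have h1 : (w ≫ toImage (st.srcTo j ≫ f)) ≫ ι = quotMk _ J ≫ e.inv ≫ st.q ≫ EFactOut X := by
    rw [Category.assoc, toImage_to, ← hv, ← Category.assoc, hw, Category.assoc]
  let θ : st.Q ⟶ image (st.srcTo j ≫ f) := e.hom ≫ quotDesc J (w ≫ toImage (st.srcTo j ≫ f))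
    (fun a ha => imageTo_eq_zero _ (by
      rw [← comp_toFun, h1, comp_toFun, (quotMk_eq_zero _ J).2 ha, toFun_zero]))
  have hθ : θ ≫ ι = st.q ≫ EFactOut X := by
    rw [← cancel_epi e.inv]
    refine epi_of_surjective (quotMk_surjective _ J) ?_
    rw [← h1, Category.assoc, e.inv_hom_id_assoc, ← Category.assoc, quotMk_desc]
  have sq := push_isPushout st.base st.base_map st.f j
  have hα : st.base j ≫ st.srcTo j = st.a ≫ presTo st.k := st.base_leg j
  have hc : st.base j ≫ toImage (st.srcTo j ≫ f) = st.f ≫ θ := by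
    refine imageTo_cancel _ ?_
    rw [Category.assoc, toImage_to, Category.assoc, hθ, ← Category.assoc, hα, ← st.sq.w_assoc,
      eFactIn_out]
  let i : st.tgt.obj j ⟶ image (st.srcTo j ≫ f) := sq.desc (toImage _) θ hc
  have hi : st.hom j ≫ i = toImage _ := sq.inl_desc _ _ hc
  have hi2 : pushInr st.base st.base_map st.f j ≫ i = θ := sq.inr_desc _ _ hc
  have hr : pushInr st.base st.base_map st.f j ≫ st.tgtTo j = st.q :=
    pushInr_leg (c := st.srcCocone) (g := EFactIn X) st.base st.base_map st.f st.base_leg st.sq j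
  rw [← hz]
  refine exists_ker_subset_of_stage hE X (st.isPushout j) (st.hom_mem hE j) i hi
    (sq.hom_ext ?_ ?_) z ?_
  · refine (Category.assoc _ _ _).symm.trans ((congrArg (· ≫ ι) hi).trans ?_)
    refine (toImage_to _).trans ?_
    refine Eq.trans ?_ (Category.assoc _ _ _)
    refine Eq.trans ?_ (congrArg (· ≫ EFactOut X) (st.isPushout j).w)
    rw [Category.assoc, eFactIn_out]
  · refine (Category.assoc _ _ _).symm.trans ((congrArg (· ≫ ι) hi2).trans (hθ.trans ?_))
    exact (congrArg (· ≫ EFactOut X) hr).symm.trans (Category.assoc _ _ _)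
  · rw [comp_toFun, hz, hy]

/-- Equivalently, the localisation tensored over A with B is B. This is the only consequence of the
third axiom that is used later. -/
lemma locTo_ker (hE : IsEtaleLike E) (L : ELocalisation E f)
    (hf : Function.Surjective (Hom.toFun f)) {x : L.cocone.pt} (hx : Hom.toFun (locTo L) x = 0) :
    x ∈ Ideal.map (toRingHom L.toLoc) (RingHom.ker (toRingHom f)) := by
  obtain ⟨X, y, rfl⟩ := loc_rep hE L x
  rw [← comp_toFun, locLeg_to] at hx
  obtain ⟨D, u, hu⟩ := exists_ker_subset hE hf X y hx
  have h := Ideal.mem_map_of_mem (toRingHom (locLeg L D)) hu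
  rw [Ideal.map_map] at h
  have e : (toRingHom (locLeg L D)).comp (toRingHom (EFactIn D)) = toRingHom L.toLoc :=
    RingHom.ext fun a => congr_toFun (eFactIn_locLeg L D) a
  rw [e] at h
  exact (congr_toFun (eFactMap_locLeg L u) y) ▸ h

end Loc

end TAlg

/-! ### Local `T`-DGAs -/

namespace TDGA

section Local

variable [T.IsFermat] {E : MorphismProperty (TAlg T)}

/-- The degree 0 part of A → A ⊗ L is φ, up to the identification of L with A₀ ⊗ L. -/
lemma isIso_toBaseChange_iff {A : TDGA T} {L : TAlg T} (φ : A.alg0 ⟶ L) :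
    IsIso (A.toBaseChange φ) ↔ IsIso φ := by
  constructor
  · intro h
    have h1 : Function.Bijective (TAlg.Hom.toFun (map0 (A.toBaseChange φ))) :=
      bijective_of_isIso (A.toBaseChange φ) 0
    rw [map0_toBaseChange] at h1
    exact TAlg.isIso_of_bijective _ ((Function.Bijective.of_comp_iff' (bcZero_bijective φ) _).1 h1)
  · intro h
    have hφ : φ ≫ inv φ = map0 (𝟙 A) := IsIso.hom_inv_id φ
    obtain ⟨t, h1, h2⟩ : ∃ t : A.baseChange φ ⟶ A,
        A.toBaseChange φ ≫ t = 𝟙 A ∧ bcZero φ ≫ map0 t = inv φ :=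
      ⟨bcDesc (𝟙 A) (inv φ) hφ, toBaseChange_desc _ _ _, bcZero_desc _ _ _⟩
    refine ⟨t, h1, baseChange_hom_ext φ ?_ ?_⟩
    · rw [← Category.assoc, h1, Category.id_comp, Category.comp_id]
    · have h3 : bcZero φ ≫ map0 (t ≫ A.toBaseChange φ) = inv φ ≫ φ ≫ bcZero φ := by
        rw [← map0_toBaseChange, ← h2, Category.assoc]
        rfl
      rw [h3, IsIso.inv_hom_id_assoc]
      rfl

/-- Locality becomes a lifting property of A₀ → H₀A, which no longer mentions the localisation and
does not depend on its choice. -/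
lemma isELocal_iff (hE : IsEtaleLike E) (A : TDGA T) : IsELocal E A ↔ E.rlp A.toH0 := by
  constructor
  · rintro ⟨L, hL⟩
    exact (TAlg.isIso_toLoc_iff hE L).1 ((isIso_toBaseChange_iff L.toLoc).1 hL)
  · intro h
    obtain ⟨L⟩ := TAlg.exists_eLocalisation hE A.toH0
    exact ⟨L, (isIso_toBaseChange_iff L.toLoc).2 ((TAlg.isIso_toLoc_iff hE L).2 h)⟩

end Local

end TDGA

/-! ### Flat base change and homology -/

section FlatQuot

open TensorProduct

universe v

variable {R : Type v} {S : Type v} [CommRing R] [CommRing S] [Algebra R S]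
  {P M M' : Type v} [AddCommGroup P] [AddCommGroup M] [AddCommGroup M'] [Module R P] [Module R M]
  [Module R M'] (I : Ideal R)

/-- Since I annihilates H, the map h ⊗ s ↦ π(s) h is well defined on H ⊗ S, and it retracts h ↦ h ⊗
1. -/
lemma eq_zero_of_tmul_one {H : Type v} [AddCommGroup H] [Module R H] (π : S →ₗ[R] R ⧸ I)
    (hπ : π 1 = 1) (hI : ∀ i ∈ I, ∀ h : H, i • h = 0) {h : H} (h0 : h ⊗ₜ[R] (1 : S) = 0) :
    h = 0 := by
  have hle : I ≤ LinearMap.ker (LinearMap.lsmul R H) := fun i hi =>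
    LinearMap.mem_ker.2 (LinearMap.ext fun y => hI i hi y)
  let act : R ⧸ I →ₗ[R] H →ₗ[R] H := Submodule.liftQ I (LinearMap.lsmul R H) hle
  have h2 : TensorProduct.lift (act ∘ₗ π).flip (h ⊗ₜ[R] (1 : S)) = 0 := by rw [h0, map_zero]
  rw [TensorProduct.lift.tmul, LinearMap.flip_apply, LinearMap.comp_apply, hπ] at h2
  have h3 : act 1 h = (1 : R) • h := rfl
  rwa [h3, one_smul] at h2

/-- Injectivity on homology. H is the module of classes of Z in the cokernel of d; flatness keeps it
a submodule after tensoring, so the class of a satisfies h ⊗ 1 = 0, and I annihilates H. -/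
lemma mem_range_of_tmul_one [Module.Flat R S] (π : S →ₗ[R] R ⧸ I) (hπ : π 1 = 1) (d : P →ₗ[R] M) (Z : Submodule R M)
    (hI : ∀ i ∈ I, ∀ z ∈ Z, i • z ∈ LinearMap.range d) {a : M} (ha : a ∈ Z) (x : P ⊗[R] S)
    (hx : d.rTensor S x = a ⊗ₜ 1) : a ∈ LinearMap.range d := by
  let H : Submodule R (M ⧸ LinearMap.range d) := Z.map (LinearMap.range d).mkQ
  let h : H := ⟨(LinearMap.range d).mkQ a, Submodule.mem_map_of_mem ha⟩
  have h0 : h ⊗ₜ[R] (1 : S) = 0 := by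
    refine Module.Flat.rTensor_preserves_injective_linearMap (M := S) H.subtype
      (Submodule.injective_subtype H) ?_
    rw [map_zero]
    have h1 : (LinearMap.range d).mkQ.rTensor S (d.rTensor S x) = 0 := by
      rw [← LinearMap.rTensor_comp_apply, LinearMap.range_mkQ_comp, LinearMap.rTensor_zero,
        LinearMap.zero_apply]
    rw [hx] at h1
    exact h1
  have h1 : h = 0 := eq_zero_of_tmul_one I π hπ (fun i hi y => Subtype.ext (by
    obtain ⟨_, ⟨z, hz, rfl⟩⟩ := y
    change i • (LinearMap.range d).mkQ z = 0
    rw [← map_smul]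
    exact (Submodule.Quotient.mk_eq_zero _).2 (hI i hi z hz))) h0
  exact (Submodule.Quotient.mk_eq_zero _).1 (congrArg Subtype.val h1)

variable {I}

/-- For i in I one has k ⊗ i s = i k ⊗ s, which is a boundary. -/
lemma exists_rTensor_eq_tmul (d : P →ₗ[R] M) {k : M} (hk : ∀ i ∈ I, i • k ∈ LinearMap.range d)
    {t : S} (ht : t ∈ Ideal.map (algebraMap R S) I) : ∃ x, d.rTensor S x = k ⊗ₜ t := by
  have key : ∀ s : S, k ⊗ₜ[R] (s * t) ∈ LinearMap.range (d.rTensor S) := by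
    refine Submodule.span_induction (p := fun t _ => ∀ s : S,
      k ⊗ₜ[R] (s * t) ∈ LinearMap.range (d.rTensor S)) ?_ ?_ ?_ ?_ ht
    · rintro _ ⟨i, hi, rfl⟩ s
      obtain ⟨p, hp⟩ := hk i hi
      refine ⟨p ⊗ₜ s, ?_⟩
      rw [LinearMap.rTensor_tmul, hp, mul_comm, ← Algebra.smul_def, TensorProduct.smul_tmul]
    · intro s
      rw [mul_zero, TensorProduct.tmul_zero]
      exact zero_mem _
    · intro t t' _ _ h h' s
      rw [mul_add, TensorProduct.tmul_add]
      exact add_mem (h s) (h' s)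
    · intro c t _ h s
      rw [smul_eq_mul, ← mul_assoc]
      exact h _
  have := key 1
  rw [one_mul] at this
  exact this

/-- Surjectivity on homology. By flatness the cycles of the tensor product are ker d' ⊗ S, and since
S = R + I S each k ⊗ s agrees with r k ⊗ 1 up to a boundary. -/
lemma exists_tmul_one_sub [Module.Flat R S]
    (hs : ∀ s : S, ∃ r : R, s - algebraMap R S r ∈ Ideal.map (algebraMap R S) I)
    (d : P →ₗ[R] M) (d' : M →ₗ[R] M')
    (hI : ∀ i ∈ I, ∀ z ∈ LinearMap.ker d', i • z ∈ LinearMap.range d) (z : M ⊗[R] S)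
    (hz : d'.rTensor S z = 0) :
    ∃ a ∈ LinearMap.ker d', ∃ x, d.rTensor S x = a ⊗ₜ 1 - z := by
  obtain ⟨w, rfl⟩ := (Module.Flat.rTensor_exact S (LinearMap.exact_subtype_ker_map d') z).1 hz
  clear hz
  induction w using TensorProduct.induction_on with
  | zero => exact ⟨0, zero_mem _, 0, by rw [map_zero, map_zero, TensorProduct.zero_tmul, sub_zero]⟩
  | add w w' h h' =>
    obtain ⟨a, ha, x, hx⟩ := h
    obtain ⟨a', ha', x', hx'⟩ := h'
    refine ⟨a + a', add_mem ha ha', x + x', ?_⟩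
    rw [map_add, map_add, hx, hx', TensorProduct.add_tmul]
    abel
  | tmul k s =>
    obtain ⟨r, hr⟩ := hs s
    obtain ⟨x, hx⟩ := exists_rTensor_eq_tmul (S := S) d (fun i hi => hI i hi k k.2) hr
    refine ⟨r • k, Submodule.smul_mem _ _ k.2, -x, ?_⟩
    rw [map_neg, hx, LinearMap.rTensor_tmul, Submodule.subtype_apply, TensorProduct.tmul_sub,
      Algebra.algebraMap_eq_smul_one, TensorProduct.smul_tmul]
    abel

end FlatQuot

namespace TDGA

section Reflection

variable [T.IsFermat] {E : MorphismProperty (TAlg T)} {A : TDGA T}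

/-- For a cycle z one has d(b z) = (d b) z; hence boundaries of degree 0 act by zero on homology. -/
lemma IsCyc.smul_isBdry {n : ℕ} {z : A.deg n} (hz : A.IsCyc n z) {i : A.alg0} (hi : i ∈ A.bdry) :
    A.IsBdry n (i • z) := by
  obtain ⟨b, rfl⟩ := hi
  obtain _ | n := n
  · exact ⟨A.mul (add_zero 1) b z, A.leibniz_zero_right b z⟩
  · refine ⟨A.mul (by omega : 0 + 1 + (n + 1) = n + 1 + 1) b z, ?_⟩
    refine (A.leibniz' (by omega) (by omega) (by omega) b z).trans ?_
    have hz' : A.dif n z = 0 := hz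
    rw [hz', A.mul_zero, smul_zero, add_zero]
    rfl

variable (A) in
/-- The outgoing differential. -/
def outDif : ∀ n, A.deg n →ₗ[A.alg0] A.deg (n - 1)
  -- Subtraction is truncated: degree 0 carries the zero endomorphism, for which everything is a
  -- cycle.
  | 0 => 0
  | n + 1 => A.dLin (n + 1) n

lemma isCyc_iff_mem_ker {n : ℕ} {z : A.deg n} : A.IsCyc n z ↔ z ∈ LinearMap.ker (A.outDif n) := by
  cases n with
  | zero => exact ⟨fun _ => LinearMap.zero_apply z, fun _ => trivial⟩
  | succ n => exact Iff.rfl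

variable (L : ELocalisation E A.toH0)

lemma toH0_surjective (A : TDGA T) : Function.Surjective (TAlg.Hom.toFun A.toH0) :=
  TAlg.quotMk_surjective _ _

lemma toH0_eq_zero {a : A.alg0} : TAlg.Hom.toFun A.toH0 a = 0 ↔ a ∈ A.bdry :=
  TAlg.quotMk_eq_zero _ _

lemma ker_toH0 (A : TDGA T) : RingHom.ker (TAlg.toRingHom A.toH0) = A.bdry :=
  Ideal.ext fun _ => toH0_eq_zero

lemma toLoc_to_apply (hE : IsEtaleLike E) (a : A.alg0) :
    TAlg.Hom.toFun (TAlg.locTo L) (TAlg.Hom.toFun L.toLoc a) = TAlg.Hom.toFun A.toH0 a :=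
  TAlg.congr_toFun (TAlg.toLoc_to hE L) a

lemma exists_sub_mem_map (hE : IsEtaleLike E) (l : L.cocone.pt) : ∃ a : A.alg0,
    l - TAlg.Hom.toFun L.toLoc a ∈ Ideal.map (TAlg.toRingHom L.toLoc) A.bdry := by
  obtain ⟨a, ha⟩ := toH0_surjective A (TAlg.Hom.toFun (TAlg.locTo L) l)
  refine ⟨a, ?_⟩
  rw [← ker_toH0]
  refine TAlg.locTo_ker hE L (toH0_surjective A) ?_
  rw [TAlg.toFun_sub, toLoc_to_apply L hE, ha, sub_self]

/-- The map from the localisation to `H₀`, as a linear map. -/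
def locLin (hE : IsEtaleLike E) : Along L.toLoc →ₗ[A.alg0] A.alg0 ⧸ A.bdry where
  toFun l := TAlg.Hom.toFun (TAlg.locTo L) l
  map_add' x y := by
    refine (TAlg.toFun_add (TAlg.locTo L) x y).trans ?_
    obtain ⟨a, ha⟩ := toH0_surjective A (TAlg.Hom.toFun (TAlg.locTo L) x)
    obtain ⟨b, hb⟩ := toH0_surjective A (TAlg.Hom.toFun (TAlg.locTo L) y)
    rw [← ha, ← hb]
    exact (TAlg.toFun_add A.toH0 a b).symm
  map_smul' r x := by
    refine (TAlg.toFun_mul (TAlg.locTo L) (TAlg.Hom.toFun L.toLoc r) x).trans ?_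
    rw [toLoc_to_apply L hE]
    obtain ⟨b, hb⟩ := toH0_surjective A (TAlg.Hom.toFun (TAlg.locTo L) x)
    rw [← hb]
    exact (TAlg.toFun_mul A.toH0 r b).symm

/-- Flatness of the localisation and its equality with H₀A modulo boundaries feed the two preceding
algebraic statements, applied in each degree to incoming and outgoing differentials. -/
lemma quasiIsos_toBaseChange (hE : IsEtaleLike E) : quasiIsos T (A.toBaseChange L.toLoc) := by
  have hflat : Module.Flat A.alg0 (Along L.toLoc) := TAlg.isFlat_toLoc hE L
  refine (quasiIsos_iff _).2 fun n => ⟨fun a ha ⟨x, hx⟩ => ?_, fun b hb => ?_⟩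
  · refine mem_range_of_tmul_one A.bdry (locLin L hE) ?_ (A.dLin (n + 1) n)
      (LinearMap.ker (A.outDif n)) (fun i hi z hz => ?_) (isCyc_iff_mem_ker.1 ha) x hx
    · exact (TAlg.toFun_one (TAlg.locTo L)).trans (TAlg.toFun_one A.toH0).symm
    · exact (isCyc_iff_mem_ker.2 hz).smul_isBdry hi
  · obtain ⟨a, ha, x, hx⟩ := exists_tmul_one_sub (S := Along L.toLoc) (exists_sub_mem_map L hE)
      (A.dLin (n + 1) n) (A.outDif n)
      (fun i hi z hz => (isCyc_iff_mem_ker.2 hz).smul_isBdry hi) b (by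
        cases n with
        | zero => exact LinearMap.congr_fun (LinearMap.rTensor_zero _) b
        | succ n => exact hb)
    exact ⟨a, isCyc_iff_mem_ker.2 ha, x, hx⟩

/-- Identifies H₀ of the base change with H₀A: the boundaries there form the ideal generated by the
boundaries of A, which is the kernel of the map from the localisation. -/
lemma bcZero_mem_bdry_iff (hE : IsEtaleLike E) (l : L.cocone.pt) :
    TAlg.Hom.toFun (bcZero L.toLoc) l ∈ (A.baseChange L.toLoc).bdry ↔
      TAlg.Hom.toFun (TAlg.locTo L) l = 0 := by
  constructor
  · rintro ⟨c, hc⟩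
    have key : ∀ c : Tens L.toLoc 1,
        locLin L hE (tensEquiv L.toLoc (tensD L.toLoc 1 0 c)) = 0 := by
      intro c
      induction c using TensorProduct.induction_on with
      | zero => simp only [map_zero]
      | add x y hx hy => simp only [map_add, hx, hy, add_zero]
      | tmul a m =>
        rw [tensD_tmul, tensEquiv_tmul]
        have e0 : TAlg.Hom.toFun (TAlg.locTo L) (TAlg.Hom.toFun L.toLoc (A.dif 0 a)) = 0 :=
          (toLoc_to_apply L hE _).trans (toH0_eq_zero.2 ⟨a, rfl⟩)
        refine (TAlg.toFun_mul (TAlg.locTo L) _ _).trans ((congrArg (· * _) e0).trans ?_)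
        exact (MulZeroClass.zero_mul _).trans (TAlg.toFun_zero A.toH0).symm
    have h1 : tensEquiv L.toLoc (tensD L.toLoc 1 0 c) = l :=
      (congrArg (tensEquiv L.toLoc) hc).trans ((tensEquiv L.toLoc).apply_symm_apply l)
    have h2 := key c
    rw [h1] at h2
    exact h2.trans (TAlg.toFun_zero A.toH0)
  · intro h
    have h1 := TAlg.locTo_ker hE L (toH0_surjective A) h
    rw [ker_toH0] at h1
    have h2 : Ideal.map (TAlg.toRingHom L.toLoc) A.bdry ≤
        (A.baseChange L.toLoc).bdry.comap (TAlg.toRingHom (bcZero L.toLoc)) := by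
      refine Ideal.map_le_iff_le_comap.2 ?_
      rintro _ ⟨b, rfl⟩
      refine ⟨app (A.toBaseChange L.toLoc) 1 b, ?_⟩
      exact (app_dif (A.toBaseChange L.toLoc) 0 b).symm.trans
        (TAlg.congr_toFun (map0_toBaseChange L.toLoc) (A.dif 0 b))
    exact h2 h1

end Reflection

end TDGA

namespace TAlg

/-- With equal kernels, q followed by an injection t is p up to the isomorphism e; a lift for p
solves the problem for q because t can be cancelled. -/
lemma rlp_of_ker {E : MorphismProperty (TAlg T)} {X Y X' Y' : TAlg T} {p : X ⟶ Y} (hp : E.rlp p)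
    (e : X ≅ X') (q : X' ⟶ Y') (hq : Function.Surjective (Hom.toFun q))
    (h : ∀ x, Hom.toFun q (Hom.toFun e.hom x) = 0 ↔ Hom.toFun p x = 0) : E.rlp q := by
  have hk : ∀ x, Hom.toFun q x = 0 ↔ Hom.toFun (e.inv ≫ p) x = 0 := fun x => by
    have := h (Hom.toFun e.inv x)
    rw [← comp_toFun e.inv e.hom, e.inv_hom_id, id_toFun] at this
    exact this
  let t := descOfSurjective q hq (e.inv ≫ p) fun a ha => (hk a).1 ha
  have ht : q ≫ t = e.inv ≫ p := comp_descOfSurjective q hq (e.inv ≫ p) _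
  have hi : Function.Injective (Hom.toFun t) := by
    intro x y hxy
    obtain ⟨x, rfl⟩ := hq x
    obtain ⟨y, rfl⟩ := hq y
    rw [← sub_eq_zero, ← toFun_sub, hk, ← ht, comp_toFun, toFun_sub, toFun_sub, hxy, sub_self]
  intro P Q f hf
  have := hp f hf
  refine ⟨fun {a b} sq => ?_⟩
  have sq' : CommSq (a ≫ e.inv) f p (b ≫ t) := ⟨by
    rw [Category.assoc, ← ht, ← Category.assoc, sq.w, Category.assoc]⟩
  refine ⟨⟨⟨sq'.lift ≫ e.hom, ?_, hom_ext fun x => hi ?_⟩⟩⟩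
  · rw [← Category.assoc, sq'.fac_left, Category.assoc, e.inv_hom_id, Category.comp_id]
  · rw [← comp_toFun, ← comp_toFun, Category.assoc, ht, Category.assoc, e.hom_inv_id_assoc,
      sq'.fac_right]

end TAlg

/-! ### The universal property of the base change to the localisation -/

namespace TDGA

section Reflection

variable [T.IsFermat] {E : MorphismProperty (TAlg T)} {A : TDGA T} (L : ELocalisation E A.toH0)

lemma isELocal_baseChange (hE : IsEtaleLike E) : IsELocal E (A.baseChange L.toLoc) := by
  rw [isELocal_iff hE]
  exact TAlg.rlp_of_ker (TAlg.locTo_rlp hE L)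
    (TAlg.isoOfBijective (bcZero L.toLoc) (bcZero_bijective L.toLoc)) _ (toH0_surjective _)
    fun l => toH0_eq_zero.trans (bcZero_mem_bdry_iff L hE l)

lemma map0_mem_bdry {X Y : TDGA T} (f : X ⟶ Y) {a : X.alg0} (ha : a ∈ X.bdry) :
    TAlg.Hom.toFun (map0 f) a ∈ Y.bdry := IsBdry.app f ha

/-- The map induced on `H₀`. -/
def mapH0 {X Y : TDGA T} (f : X ⟶ Y) : X.H0 ⟶ Y.H0 :=
  TAlg.quotDesc _ (map0 f ≫ Y.toH0) fun _ ha => toH0_eq_zero.2 (map0_mem_bdry f ha)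

lemma toH0_mapH0 {X Y : TDGA T} (f : X ⟶ Y) : X.toH0 ≫ mapH0 f = map0 f ≫ Y.toH0 :=
  TAlg.quotMk_desc _ _ _

lemma exists_baseChange_desc (hE : IsEtaleLike E) {X : TDGA T} (hX : IsELocal E X) (f : A ⟶ X) :
    ∃ t : A.baseChange L.toLoc ⟶ X, A.toBaseChange L.toLoc ≫ t = f := by
  obtain ⟨g, hg, -⟩ := (TAlg.toLoc_uniqueLift hE L ((isELocal_iff hE X).1 hX)).exists_lift
    (a := map0 f) (b := TAlg.locTo L ≫ mapH0 f) (by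
      rw [← Category.assoc, TAlg.toLoc_to hE, toH0_mapH0])
  exact ⟨bcDesc f g hg, toBaseChange_desc _ _ _⟩

/-- In degree 0, uniqueness of lifts against X₀ → H₀X reduces the claim to equality in H₀X. There it
holds because every element of the localisation is the image of an element of A₀ modulo the kernel
of the map to H₀A, and that kernel goes to boundaries. -/
lemma baseChange_local_hom_ext (hE : IsEtaleLike E) {X : TDGA T} (hX : IsELocal E X)
    {s t : A.baseChange L.toLoc ⟶ X} (h : A.toBaseChange L.toLoc ≫ s = A.toBaseChange L.toLoc ≫ t) :
    s = t := by
  have h0 : ∀ s : A.baseChange L.toLoc ⟶ X, L.toLoc ≫ bcZero L.toLoc ≫ map0 s =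
      map0 (A.toBaseChange L.toLoc ≫ s) := fun s => by
    rw [← Category.assoc, ← map0_toBaseChange]
    rfl
  have h1 : ∀ (s : A.baseChange L.toLoc ⟶ X) (l : L.cocone.pt), TAlg.Hom.toFun (TAlg.locTo L) l = 0 →
      TAlg.Hom.toFun ((bcZero L.toLoc ≫ map0 s) ≫ X.toH0) l = 0 := fun s l hl =>
    toH0_eq_zero.2 (map0_mem_bdry s ((bcZero_mem_bdry_iff L hE l).2 hl))
  refine baseChange_hom_ext L.toLoc h
    ((TAlg.toLoc_uniqueLift hE L ((isELocal_iff hE X).1 hX)).2 _ _ ?_ ?_)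
  · rw [h0, h0, h]
  · refine TAlg.hom_ext fun l => ?_
    obtain ⟨a, ha⟩ := toH0_surjective A (TAlg.Hom.toFun (TAlg.locTo L) l)
    have hl : TAlg.Hom.toFun (TAlg.locTo L) (l - TAlg.Hom.toFun L.toLoc a) = 0 := by
      rw [TAlg.toFun_sub, toLoc_to_apply L hE, ha, sub_self]
    have e : ∀ s : A.baseChange L.toLoc ⟶ X,
        TAlg.Hom.toFun ((bcZero L.toLoc ≫ map0 s) ≫ X.toH0) l =
          TAlg.Hom.toFun (map0 (A.toBaseChange L.toLoc ≫ s) ≫ X.toH0) a := fun s => by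
      have := h1 s _ hl
      rw [TAlg.toFun_sub, sub_eq_zero, ← TAlg.comp_toFun, ← Category.assoc, h0] at this
      exact this
    rw [e, e, h]

end Reflection

end TDGA

/-! ### The reflection to local `T`-DGAs -/

section

variable [T.IsFermat] {E : MorphismProperty (TAlg T)}

/-- A choice of localisations. -/
def chosenLoc (hE : IsEtaleLike E) (A : TDGA T) : ELocalisation E A.toH0 :=
  (TAlg.exists_eLocalisation hE A.toH0).some

/-- The reflection of a `T`-DGA. -/
def reflObj (hE : IsEtaleLike E) (A : TDGA T) : LocTDGA E :=
  ⟨A.baseChange (chosenLoc hE A).toLoc, TDGA.isELocal_baseChange _ hE⟩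

/-- The unit of the reflection. -/
def reflUnit (hE : IsEtaleLike E) (A : TDGA T) : A ⟶ (reflObj hE A).obj :=
  A.toBaseChange (chosenLoc hE A).toLoc

lemma reflUnit_quasiIsos (hE : IsEtaleLike E) (A : TDGA T) : quasiIsos T (reflUnit hE A) :=
  TDGA.quasiIsos_toBaseChange _ hE

lemma reflUnit_desc (hE : IsEtaleLike E) {A : TDGA T} {X : LocTDGA E} (f : A ⟶ X.obj) :
    ∃ t : (reflObj hE A).obj ⟶ X.obj, reflUnit hE A ≫ t = f :=
  TDGA.exists_baseChange_desc _ hE X.property f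

lemma refl_hom_ext (hE : IsEtaleLike E) {A : TDGA T} {X : LocTDGA E}
    {s t : (reflObj hE A).obj ⟶ X.obj} (h : reflUnit hE A ≫ s = reflUnit hE A ≫ t) : s = t :=
  TDGA.baseChange_local_hom_ext _ hE X.property h

/-- The universal property of the reflection. -/
def reflEquiv (hE : IsEtaleLike E) (A : TDGA T) (X : LocTDGA E) :
    (reflObj hE A ⟶ X) ≃ (A ⟶ (locIncl E).obj X) :=
  Equiv.ofBijective (fun t => reflUnit hE A ≫ t.hom)
    ⟨fun s t h => ObjectProperty.hom_ext _ (refl_hom_ext hE h), fun f => by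
      obtain ⟨t, ht⟩ := reflUnit_desc (X := X) hE f
      exact ⟨ObjectProperty.homMk t, ht⟩⟩

lemma reflEquiv_naturality (hE : IsEtaleLike E) (A : TDGA T) (X Y : LocTDGA E) (g : X ⟶ Y)
    (t : reflObj hE A ⟶ X) :
    reflEquiv hE A Y (t ≫ g) = reflEquiv hE A X t ≫ (locIncl E).map g :=
  (Category.assoc (reflUnit hE A) t.hom g.hom).symm

/-- The reflection functor. -/
@[reducible]
def refl (hE : IsEtaleLike E) : TDGA T ⥤ LocTDGA E :=
  Adjunction.leftAdjointOfEquiv (reflEquiv hE) (reflEquiv_naturality hE)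

/-- The reflection is left adjoint to the inclusion. -/
def reflAdj (hE : IsEtaleLike E) : refl hE ⊣ locIncl E :=
  Adjunction.adjunctionOfEquivLeft (reflEquiv hE) (reflEquiv_naturality hE)

lemma reflAdj_homEquiv (hE : IsEtaleLike E) {A : TDGA T} {X : LocTDGA E}
    (t : (refl hE).obj A ⟶ X) : (reflAdj hE).homEquiv A X t = reflUnit hE A ≫ t.hom := by
  rw [reflAdj, Adjunction.adjunctionOfEquivLeft, Adjunction.mkOfHomEquiv_homEquiv]
  rfl

/-- Local `T`-DGAs form a reflective subcategory. -/
@[reducible]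
def locReflective (hE : IsEtaleLike E) : Reflective (locIncl E) where
  L := refl hE
  adj := reflAdj hE

lemma loc_hasLimits (hE : IsEtaleLike E) : HasLimitsOfSize.{u, u} (LocTDGA E) :=
  have := locReflective hE
  hasLimits_of_reflective (locIncl E)

lemma loc_hasColimits (hE : IsEtaleLike E) : HasColimitsOfSize.{u, u} (LocTDGA E) :=
  have := locReflective hE
  hasColimits_of_reflective (locIncl E)

end

/-! ### Filtered colimits of local `T`-DGAs -/

section FilteredColimits

/-- Source and target of f are finitary, so both sides of a square descend to stages, and a later
stage makes the descended square commute. -/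
lemma rlp_of_isColimit {D : Type*} [Category* D] {E : MorphismProperty D}
    (hP : ∀ {P Q : D} (f : P ⟶ Q), E f → IsFinitary.{u} P)
    (hQ : ∀ {P Q : D} (f : P ⟶ Q), E f → IsFinitary.{u} Q)
    {J : Type u} [SmallCategory J] [IsFiltered J] {F G : J ⥤ D} {c : Cocone F} {d : Cocone G}
    (hc : IsColimit c) (hd : IsColimit d) (p : ∀ j, F.obj j ⟶ G.obj j)
    (hp : ∀ {i j : J} (u : i ⟶ j), p i ≫ G.map u = F.map u ≫ p j) (π : c.pt ⟶ d.pt)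
    (hπ : ∀ j, p j ≫ coLeg d j = coLeg c j ≫ π) (h : ∀ j, E.rlp (p j)) : E.rlp π := by
  intro P Q f hf
  refine ⟨fun {a b} sq => ?_⟩
  obtain ⟨i, a, rfl⟩ := (hP f hf hc).1 a
  obtain ⟨j, b, rfl⟩ := (hQ f hf hd).1 b
  obtain ⟨k, w, hw⟩ := (hP f hf hd).2 ((a ≫ F.map (IsFiltered.leftToMax i j)) ≫ p _)
    (f ≫ b ≫ G.map (IsFiltered.rightToMax i j)) (by
      rw [Category.assoc, hπ, Category.assoc, map_coLeg_assoc, Category.assoc, Category.assoc,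
        map_coLeg, ← sq.w, Category.assoc])
  have := h k f hf
  have sq' : CommSq (a ≫ F.map (IsFiltered.leftToMax i j) ≫ F.map w) f (p k)
      (b ≫ G.map (IsFiltered.rightToMax i j) ≫ G.map w) := ⟨by
    rw [Category.assoc, Category.assoc, ← hp]
    simpa only [Category.assoc] using hw⟩
  refine ⟨⟨⟨sq'.lift ≫ coLeg c k, ?_, ?_⟩⟩⟩
  · rw [← Category.assoc, sq'.fac_left, Category.assoc, Category.assoc, map_coLeg, map_coLeg]
  · rw [Category.assoc, ← hπ, ← Category.assoc, sq'.fac_right, Category.assoc, Category.assoc,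
      map_coLeg, map_coLeg]

lemma TAlg.isColimit_of_rep {J : Type u} [SmallCategory J] [IsFiltered J] {F : J ⥤ TAlg T}
    {c : Cocone F} (h : ∀ x : c.pt, ∃ j y, Hom.toFun (coLeg c j) y = x)
    (h' : ∀ (j : J) (y z : F.obj j), Hom.toFun (coLeg c j) y = Hom.toFun (coLeg c j) z →
      ∃ (k : J) (f : j ⟶ k), Hom.toFun (F.map f) y = Hom.toFun (F.map f) z) :
    Nonempty (IsColimit c) := by
  have hd := colimit.isColimit F
  have hl : ∀ j, coLeg (colimit.cocone F) j ≫ hd.desc c = coLeg c j := fun j => hd.fac c j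
  have : IsIso (hd.desc c) := isIso_of_bijective _ ⟨fun x y hxy => by
    obtain ⟨j, x, y, rfl, rfl⟩ : ∃ (j : J) (x' y' : F.obj j),
        Hom.toFun (coLeg (colimit.cocone F) j) x' = x ∧
          Hom.toFun (coLeg (colimit.cocone F) j) y' = y := by
      obtain ⟨i, x, rfl⟩ := exists_rep_of_isColimit hd x
      obtain ⟨j, y, rfl⟩ := exists_rep_of_isColimit hd y
      refine ⟨IsFiltered.max i j, Hom.toFun (F.map (IsFiltered.leftToMax i j)) x,
        Hom.toFun (F.map (IsFiltered.rightToMax i j)) y, ?_, ?_⟩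
      · rw [← comp_toFun, map_coLeg]
      · rw [← comp_toFun, map_coLeg]
    rw [← comp_toFun, ← comp_toFun, hl] at hxy
    obtain ⟨k, f, hf⟩ := h' j x y hxy
    rw [← map_coLeg (colimit.cocone F) f, comp_toFun, hf, comp_toFun], fun x => by
    obtain ⟨j, y, rfl⟩ := h x
    exact ⟨Hom.toFun (coLeg (colimit.cocone F) j) y, by rw [← comp_toFun, hl]⟩⟩
  exact ⟨hd.ofPointIso⟩

/-! ### Degree 0 and H₀ of filtered colimits -/

namespace TDGA

variable (T) in
/-- The functor `H₀`. -/
def hZero [T.IsFermat] : TDGA T ⥤ TAlg T where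
  obj A := A.H0
  map f := mapH0 f
  map_id A := TAlg.epi_of_surjective (toH0_surjective A) (toH0_mapH0 (𝟙 A))
  map_comp {A B D} f g := TAlg.epi_of_surjective (toH0_surjective A) (by
    rw [toH0_mapH0, ← Category.assoc, toH0_mapH0, Category.assoc, toH0_mapH0]
    rfl)

variable {J : Type u} [SmallCategory J] [IsFiltered J] {F : J ⥤ TDGA T} {c : Cocone F}

lemma isColimit_degZero (hc : IsColimit c) : Nonempty (IsColimit ((degZero T).mapCocone c)) :=
  TAlg.isColimit_of_rep (fun x => exists_rep_of_isColimit (n := 0) hc x)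
    fun _ _ _ h => eq_of_isColimit (n := 0) hc h

lemma toH0_apply_mapH0 [T.IsFermat] {A B : TDGA T} (f : A ⟶ B) (a : A.alg0) :
    TAlg.Hom.toFun (mapH0 f) (TAlg.Hom.toFun A.toH0 a) =
      TAlg.Hom.toFun B.toH0 (TAlg.Hom.toFun (map0 f) a) :=
  TAlg.congr_toFun (toH0_mapH0 f) a

lemma toH0_eq_iff [T.IsFermat] {A : TDGA T} {a b : A.alg0} :
    TAlg.Hom.toFun A.toH0 a = TAlg.Hom.toFun A.toH0 b ↔ a - b ∈ A.bdry :=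
  TAlg.quotMk_eq_iff _ _ _ _

lemma isColimit_hZero [T.IsFermat] (hc : IsColimit c) :
    Nonempty (IsColimit ((hZero T).mapCocone c)) := by
  refine TAlg.isColimit_of_rep (fun x => ?_) fun j y z h => ?_
  · obtain ⟨x, rfl⟩ := toH0_surjective c.pt x
    obtain ⟨j, y, rfl⟩ := exists_rep_of_isColimit (n := 0) hc x
    exact ⟨j, TAlg.Hom.toFun (F.obj j).toH0 y, toH0_apply_mapH0 (coLeg c j) y⟩
  · obtain ⟨y, rfl⟩ := toH0_surjective (F.obj j) y
    obtain ⟨z, rfl⟩ := toH0_surjective (F.obj j) z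
    have h1 : TAlg.Hom.toFun c.pt.toH0 (TAlg.Hom.toFun (map0 (coLeg c j)) y) =
        TAlg.Hom.toFun c.pt.toH0 (TAlg.Hom.toFun (map0 (coLeg c j)) z) :=
      (toH0_apply_mapH0 (coLeg c j) y).symm.trans (Eq.trans h (toH0_apply_mapH0 (coLeg c j) z))
    rw [toH0_eq_iff] at h1
    obtain ⟨b, hb⟩ := h1
    obtain ⟨k, b, rfl⟩ := exists_rep_of_isColimit hc b
    -- Subtraction in `alg0` comes from the T-structure; `v` is that difference regarded as an
    -- element of the complex, compatibly with all maps.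
    obtain ⟨v, hv⟩ : ∃ v : (F.obj j).deg 0, ∀ (B : TDGA T) (f : F.obj j ⟶ B),
        TAlg.Hom.toFun (map0 f) y - TAlg.Hom.toFun (map0 f) z = app f 0 v :=
      ⟨(y - z : (F.obj j).alg0), fun B f => (TAlg.toFun_sub (map0 f) y z).symm⟩
    have h2 : app (coLeg c (IsFiltered.max j k)) 0
        (app (F.map (IsFiltered.rightToMax j k)) 0 ((F.obj k).dif 0 b)) =
        app (coLeg c (IsFiltered.max j k)) 0
          (app (F.map (IsFiltered.leftToMax j k)) 0 v) := by
      rw [← comp_app, ← comp_app, map_coLeg, map_coLeg, app_dif]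
      exact hb.trans (hv _ _)
    obtain ⟨l, w, hw⟩ := eq_of_isColimit hc h2
    refine ⟨l, IsFiltered.leftToMax j k ≫ w, ?_⟩
    refine (toH0_apply_mapH0 _ y).trans (Eq.trans ?_ (toH0_apply_mapH0 _ z).symm)
    refine toH0_eq_iff.2 ⟨app (F.map w) 1 (app (F.map (IsFiltered.rightToMax j k)) 1 b), ?_⟩
    refine (app_dif _ _ _).symm.trans ((congrArg (app (F.map w) 0) (app_dif _ _ _).symm).trans
      (hw.trans ?_))
    rw [← comp_app, ← F.map_comp]
    exact (hv _ _).symm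

lemma isELocal_of_isColimit [T.IsFermat] {E : MorphismProperty (TAlg T)} (hE : IsEtaleLike E)
    (hc : IsColimit c) (h : ∀ j, IsELocal E (F.obj j)) : IsELocal E c.pt := by
  obtain ⟨h1⟩ := isColimit_degZero hc
  obtain ⟨h2⟩ := isColimit_hZero hc
  rw [isELocal_iff hE]
  exact rlp_of_isColimit (fun f hf => TAlg.isFinitary_of_isFP (hE.fp_source f hf))
    (fun f hf => TAlg.isFinitary_of_isFP (hE.fp_target f hf)) h1 h2 (fun j => (F.obj j).toH0)
    (fun u => toH0_mapH0 (F.map u)) c.pt.toH0 (fun j => toH0_mapH0 (coLeg c j))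
    fun j => (isELocal_iff hE _).1 (h j)

end TDGA

variable [T.IsFermat] {E : MorphismProperty (TAlg T)}

lemma locIncl_preserves (hE : IsEtaleLike E) {J : Type u} [SmallCategory J] [IsFiltered J]
    (F : J ⥤ LocTDGA E) : PreservesColimit F (locIncl E) := by
  have := createsColimitFullSubcategoryInclusion' F (colimit.isColimit (F ⋙ (IsELocal E).ι))
    (TDGA.isELocal_of_isColimit hE (colimit.isColimit (F ⋙ (IsELocal E).ι))
      fun j => (F.obj j).property)
  exact preservesColimit_of_createsColimit_and_hasColimit F (IsELocal E).ι

/-- Maps from the reflection of S to a local object are maps from S, and the inclusion of local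
objects preserves filtered colimits. -/
lemma isFinitary_refl (hE : IsEtaleLike E) {S : TDGA T} (hS : IsFinitary.{u} S) :
    IsFinitary.{u} ((refl hE).obj S) := by
  intro J _ _ F c hc
  have := locIncl_preserves hE F
  have hc' := hS (isColimitOfPreserves (locIncl E) hc)
  constructor
  · intro f
    obtain ⟨j, g, hg⟩ := hc'.1 (reflUnit hE S ≫ f.hom)
    obtain ⟨t, ht⟩ := reflUnit_desc (X := F.obj j) hE g
    refine ⟨j, ObjectProperty.homMk t, ObjectProperty.hom_ext _ (refl_hom_ext hE ?_)⟩
    refine Eq.trans ?_ hg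
    rw [← ht]
    exact (Category.assoc _ _ _).symm
  · intro j g h e
    obtain ⟨k, w, hw⟩ := hc'.2 (reflUnit hE S ≫ g.hom) (reflUnit hE S ≫ h.hom) (by
      refine (Category.assoc _ _ _).trans (Eq.trans ?_ (Category.assoc _ _ _).symm)
      exact congrArg (fun t => reflUnit hE S ≫ t.hom) e)
    refine ⟨k, w, ObjectProperty.hom_ext _ (refl_hom_ext hE ?_)⟩
    exact (Category.assoc _ _ _).symm.trans (hw.trans (Category.assoc _ _ _))

end FilteredColimits

/-! ### The `E`-model structure -/

section LocModel

variable [T.IsFermat] {E : MorphismProperty (TAlg T)}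

variable (E) in
/-- The weak equivalences. -/
abbrev locWeq : MorphismProperty (LocTDGA E) := (quasiIsos T).inverseImage (locIncl E)

variable (E) in
/-- The fibrations. -/
abbrev locFib : MorphismProperty (LocTDGA E) := (posSurj T).inverseImage (locIncl E)

/-- The generating cofibrations. -/
def locGenI (hE : IsEtaleLike E) : MorphismProperty (LocTDGA E) :=
  MorphismProperty.ofHoms fun k => (refl hE).map (TDGA.genIHom T k)

/-- The generating trivial cofibrations. -/
def locGenJ (hE : IsEtaleLike E) : MorphismProperty (LocTDGA E) :=
  MorphismProperty.ofHoms fun n : ℕ => (refl hE).map (initial.to (TDGA.disc T (n + 1)))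

lemma locGenI_rlp (hE : IsEtaleLike E) : (locGenI hE).rlp = locFib E ⊓ locWeq E := by
  ext X Y p
  rw [locGenI, TDGA.rlp_ofHoms_iff]
  simp only [(reflAdj hE).hasLiftingProperty_iff]
  rw [← TDGA.rlp_ofHoms_iff]
  change (TDGA.genI T).rlp _ ↔ _
  rw [TDGA.genI_rlp]
  rfl

lemma locGenJ_rlp (hE : IsEtaleLike E) : (locGenJ hE).rlp = locFib E := by
  ext X Y p
  rw [locGenJ, TDGA.rlp_ofHoms_iff]
  simp only [(reflAdj hE).hasLiftingProperty_iff]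
  rw [← TDGA.rlp_ofHoms_iff]
  change (TDGA.genJ T).rlp _ ↔ _
  rw [TDGA.genJ_rlp]
  rfl

lemma locGenI_small (hE : IsEtaleLike E) :
    MorphismProperty.HasSmallObjectArgument.{u} (locGenI hE) := by
  have := loc_hasColimits hE
  have : MorphismProperty.IsSmall.{u} (locGenI hE) := MorphismProperty.isSmall_ofHoms _
  refine hasSmallObjectArgument_of_isFinitary _ fun i hi => ?_
  obtain ⟨k⟩ := hi
  exact isFinitary_refl hE (TDGA.genISource_isFinitary k)

lemma locGenJ_small (hE : IsEtaleLike E) :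
    MorphismProperty.HasSmallObjectArgument.{u} (locGenJ hE) := by
  have := loc_hasColimits hE
  have : MorphismProperty.IsSmall.{u} (locGenJ hE) := MorphismProperty.isSmall_ofHoms _
  refine hasSmallObjectArgument_of_isFinitary _ fun i hi => ?_
  obtain ⟨n⟩ := hi
  exact isFinitary_refl hE (isFinitary_initial initialIsInitial)

/-- The factorisation through all T-DGAs may leave the local ones, so the middle object is
reflected. The unit is a quasi-isomorphism, and p extends over the reflection because B is local;
its surjectivity persists. -/
lemma exists_loc_fac (hE : IsEtaleLike E) {A B : LocTDGA E} (f : A ⟶ B) :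
    ∃ (Z : LocTDGA E) (i : A ⟶ Z) (p : Z ⟶ B), locWeq E i ∧ locFib E p ∧ i ≫ p = f := by
  obtain ⟨Z, i, p, hi, hp, e⟩ := TDGA.exists_fac_quasiIsos f.hom
  obtain ⟨t, ht⟩ := reflUnit_desc (X := B) hE p
  refine ⟨reflObj hE Z, ObjectProperty.homMk (i ≫ reflUnit hE Z), ObjectProperty.homMk t,
    ?_, ?_, ObjectProperty.hom_ext _ ?_⟩
  · exact (quasiIsos T).comp_mem _ _ hi (reflUnit_quasiIsos hE Z)
  · refine (TDGA.posSurj_iff t).2 fun n b => ?_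
    obtain ⟨z, hz⟩ := (TDGA.posSurj_iff p).1 hp n b
    exact ⟨TDGA.app (reflUnit hE Z) (n + 1) z, by rw [← TDGA.comp_app, ht, hz]⟩
  · exact (Category.assoc _ _ _).trans ((congrArg (i ≫ ·) ht).trans e)

/-- The `E`-model structure. -/
@[reducible]
def locModel (hE : IsEtaleLike E) : ModelCategory (LocTDGA E) :=
  have := loc_hasLimits hE
  have := loc_hasColimits hE
  have := locGenI_small hE
  have := locGenJ_small hE
  have : HasFiniteLimits (LocTDGA E) := hasFiniteLimits_of_hasLimitsOfSize.{u, u} _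
  have : HasFiniteColimits (LocTDGA E) := hasFiniteColimits_of_hasColimitsOfSize.{u, u} _
  modelOfGenerators.{u} (locWeq E) (locFib E) (locGenI hE) (locGenJ hE) (locGenI_rlp hE)
    (locGenJ_rlp hE) (exists_loc_fac hE)

end LocModel

/-! ### Cofibrancy -/

section Cofibrant

variable [T.IsFermat] {E : MorphismProperty (TAlg T)}

namespace TDGA

lemma alg0_sub (A : TDGA T) (a b : A.alg0) :
    a - b = ((show A.deg 0 from a) - (show A.deg 0 from b) : A.deg 0) := by
  refine sub_eq_iff_eq_add.2 ?_
  refine Eq.trans ?_ (A.alg0_add _ _).symm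
  exact (sub_add_cancel (show A.deg 0 from a) (show A.deg 0 from b)).symm

lemma surjective_of_trivFib {X Y : TDGA T} {p : X ⟶ Y} (hp : posSurj T p) (hq : quasiIsos T p) :
    Function.Surjective (TAlg.Hom.toFun (map0 p)) := fun y => by
  obtain ⟨x, -, c, hc⟩ := ((quasiIsos_iff p).1 hq 0).2 y trivial
  obtain ⟨c, rfl⟩ := (posSurj_iff p).1 hp 0 c
  refine ⟨(x - X.dif 0 c : X.deg 0), ?_⟩
  refine (map_sub (app p 0) x _).trans ?_
  rw [app_dif, hc]
  exact sub_sub_cancel (app p 0 x) (show Y.deg 0 from y)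

lemma mapH0_bijective {X Y : TDGA T} {p : X ⟶ Y} (hq : quasiIsos T p) :
    Function.Bijective (TAlg.Hom.toFun (mapH0 p)) := by
  have h := (quasiIsos_iff p).1 hq 0
  constructor
  · intro x y hxy
    obtain ⟨x, rfl⟩ := toH0_surjective X x
    obtain ⟨y, rfl⟩ := toH0_surjective X y
    rw [toH0_apply_mapH0, toH0_apply_mapH0, toH0_eq_iff, ← TAlg.toFun_sub] at hxy
    exact toH0_eq_iff.2 (h.1 _ trivial hxy)
  · intro y
    obtain ⟨y, rfl⟩ := toH0_surjective Y y
    obtain ⟨x, -, c, hc⟩ := h.2 y trivial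
    exact ⟨TAlg.Hom.toFun X.toH0 x, (toH0_apply_mapH0 p x).trans
      (toH0_eq_iff.2 ⟨c, hc.trans (Y.alg0_sub _ _).symm⟩)⟩

/-- Quasi-isomorphisms of local `T`-DGAs are right orthogonal to `E` in degree `0`. -/
lemma rlp_map0 (hE : IsEtaleLike E) {X Y : TDGA T} (hX : IsELocal E X) (hY : IsELocal E Y)
    {p : X ⟶ Y} (hq : quasiIsos T p) : E.rlp (map0 p) := by
  rw [isELocal_iff hE] at hX hY
  intro P Q f hf
  refine ⟨fun {a b} sq => ?_⟩
  have hi : IsIso (mapH0 p) := TAlg.isIso_of_bijective _ (mapH0_bijective hq)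
  -- The lift is produced against X₀ → H₀X using H₀X ≅ H₀Y; that it lies over the given map to Y₀
  -- follows from uniqueness of lifts against Y₀ → H₀Y.
  obtain ⟨l, h1, h2⟩ := (TAlg.uniqueLift_of_mem hE hf hX).exists_lift (a := a)
    (b := b ≫ Y.toH0 ≫ inv (mapH0 p)) (by
      rw [← cancel_mono (mapH0 p)]
      simp only [Category.assoc, IsIso.inv_hom_id, Category.comp_id]
      rw [toH0_mapH0, ← Category.assoc, sq.w, Category.assoc])
  refine ⟨⟨⟨l, h1, (TAlg.uniqueLift_of_mem hE hf hY).2 _ _ ?_ ?_⟩⟩⟩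
  · rw [← Category.assoc, h1, sq.w]
  · rw [Category.assoc, ← toH0_mapH0, ← Category.assoc, h2]
    simp only [Category.assoc, IsIso.inv_hom_id, Category.comp_id]

end TDGA

/-- In a complex concentrated in degree 0 there are no nonzero boundaries, so the map from degree 0
to H₀ is an isomorphism. -/
lemma isELocal_incl (hE : IsEtaleLike E) (B : TAlg T) : IsELocal E ((TAlg.incl T).obj B) := by
  rw [TDGA.isELocal_iff hE]
  have : IsIso ((TAlg.incl T).obj B).toH0 := by
    refine TAlg.isIso_of_bijective _ ⟨fun x y h => ?_, TDGA.toH0_surjective _⟩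
    obtain ⟨b, hb⟩ := TDGA.toH0_eq_iff.1 h
    rw [← sub_eq_zero, ← hb, Subsingleton.elim b 0, map_zero]
    exact TDGA.alg0_zero _ |>.symm
  exact MorphismProperty.of_isIso _ _

/-- The inclusion of `T`-algebras into local `T`-DGAs. -/
abbrev inclLoc (h : ∀ B : TAlg T, IsELocal E ((TAlg.incl T).obj B)) : TAlg T ⥤ LocTDGA E :=
  (IsELocal E).lift (TAlg.incl T) h

lemma hasLifting_inclLoc (h : ∀ B : TAlg T, IsELocal E ((TAlg.incl T).obj B)) {A B : TAlg T}
    (f : A ⟶ B) {X Y : LocTDGA E} (p : X ⟶ Y) (hp : HasLiftingProperty f (TDGA.map0 p.hom)) :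
    HasLiftingProperty ((inclLoc h).map f) p := by
  have h1 : HasLiftingProperty ((TAlg.incl T).map f) p.hom :=
    (TAlg.inclAdj.hasLiftingProperty_iff f p.hom).2 hp
  refine ⟨fun {a b} sq => ?_⟩
  have sq' : CommSq a.hom ((TAlg.incl T).map f) p.hom b.hom :=
    ⟨congrArg (fun t => t.hom) sq.w⟩
  exact ⟨⟨⟨ObjectProperty.homMk sq'.lift, ObjectProperty.hom_ext _ sq'.fac_left,
    ObjectProperty.hom_ext _ sq'.fac_right⟩⟩⟩

lemma transfiniteCompositions_llp (hE : IsEtaleLike E) {A B : TAlg T} {f : A ⟶ B}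
    (hf : MorphismProperty.transfiniteCompositions.{u} (EMor E) f) {X Y : LocTDGA E} {p : X ⟶ Y}
    (hp : quasiIsos T p.hom) : HasLiftingProperty f (TDGA.map0 p.hom) := by
  have h1 : MorphismProperty.transfiniteCompositions.{u} (EMor E) ≤ E.rlp.llp :=
    (MorphismProperty.transfiniteCompositions_monotone.{u} E.pushouts_le_llp_rlp).trans
      (MorphismProperty.transfiniteCompositions_le.{u} _)
  exact h1 f hf _ (TDGA.rlp_map0 hE X.property Y.property hp)

/-- Surjectivity of a trivial fibration in degree 0 lifts the free algebra. Over each stage the lift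
extending this one is unique; uniqueness is what makes the lifts compatible and lets them glue over
the colimit. -/
lemma exists_lift_of_ind (hE : IsEtaleLike E) {n : ℕ} {B : TAlg T} {g : T.free n ⟶ B}
    (hg : MorphismProperty.ind.{u} (EMor E) g) {X Y : LocTDGA E} {p : X ⟶ Y} (hp : posSurj T p.hom)
    (hq : quasiIsos T p.hom) (b : B ⟶ Y.obj.alg0) : ∃ l : B ⟶ X.obj.alg0, l ≫ TDGA.map0 p.hom = b := by
  obtain ⟨J, _, _, D, t, s, hs, h⟩ := hg
  have hr := TDGA.rlp_map0 hE X.property Y.property hq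
  obtain ⟨v, hv⟩ : ∃ v : T.free n ⟶ X.obj.alg0, v ≫ TDGA.map0 p.hom = g ≫ b := by
    choose x hx using fun i : Fin n =>
      TDGA.surjective_of_trivFib hp hq (TAlg.Hom.toFun (g ≫ b) (T.gen i))
    exact ⟨X.obj.alg0.freeDesc x, TAlg.free_hom_ext fun i => by
      rw [TAlg.comp_toFun, TAlg.freeDesc_gen, hx]⟩
  let c : Cocone D := ⟨B, s⟩
  let τ : ∀ j, T.free n ⟶ D.obj j := fun j => t.app j
  have hτ : ∀ {i j : J} (w : i ⟶ j), τ i ≫ D.map w = τ j := fun {i j} w =>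
    (t.naturality w).symm.trans (Category.id_comp _)
  have hu : ∀ j, UniqueLift (τ j) (TDGA.map0 p.hom) :=
    fun j => TAlg.uniqueLift_of_eMor hE (h j).1 hr
  have hc : ∀ j, τ j ≫ coLeg c j = g := fun j => (h j).2
  have key : ∀ j, ∃ l : D.obj j ⟶ X.obj.alg0, τ j ≫ l = v ∧
      l ≫ TDGA.map0 p.hom = coLeg c j ≫ b := fun j => (hu j).exists_lift (by
    rw [hv, ← Category.assoc, hc])
  choose r hr1 hr2 using key
  have hnat : ∀ {i j : J} (w : i ⟶ j), D.map w ≫ r j = r i := fun {i j} w =>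
    (hu i).2 _ _ (by rw [← Category.assoc, hτ, hr1, hr1])
      (by rw [Category.assoc, hr2, hr2, map_coLeg_assoc])
  obtain ⟨d, hd⟩ : ∃ d : B ⟶ X.obj.alg0, ∀ j, coLeg c j ≫ d = r j :=
    ⟨hs.desc (mkCocone r hnat), hs.fac (mkCocone r hnat)⟩
  refine ⟨d, hs.hom_ext fun j => ?_⟩
  change coLeg c j ≫ _ = coLeg c j ≫ _
  rw [← Category.assoc, hd, hr2]

/-- Fibrations and weak equivalences are created by the inclusion, and the adjunct of f is f
composed with the unit, a quasi-isomorphism; two-out-of-three concludes. -/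
lemma isRightQuillenEquivalence_locIncl (hE : IsEtaleLike E) :
    @IsRightQuillenEquivalence (LocTDGA E) (TDGA T) _ _ (locModel hE) (TDGA.model T)
      (locIncl E) := by
  let _ := locModel hE
  let _ := TDGA.model T
  refine ⟨refl hE, reflAdj hE, fun _ hp => hp, fun _ hp => hp, fun X Y _ _ f => ?_⟩
  rw [reflAdj_homEquiv]
  change quasiIsos T f.hom ↔ quasiIsos T (reflUnit hE X ≫ f.hom)
  exact ⟨fun h => (quasiIsos T).comp_mem _ _ (reflUnit_quasiIsos hE X) h,
    fun h => (quasiIsos T).of_precomp _ _ (reflUnit_quasiIsos hE X) h⟩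

lemma hasLifting_of_ind [HasInitial (LocTDGA E)] (hE : IsEtaleLike E)
    (h : ∀ B : TAlg T, IsELocal E ((TAlg.incl T).obj B)) {n : ℕ} {B : TAlg T} {g : T.free n ⟶ B}
    (hg : MorphismProperty.ind.{u} (EMor E) g) {X Y : LocTDGA E} {p : X ⟶ Y}
    (hp : posSurj T p.hom) (hq : quasiIsos T p.hom) :
    HasLiftingProperty (initial.to ((inclLoc h).obj B)) p := by
  rw [TDGA.hasLiftingProperty_initial_iff]
  intro f
  obtain ⟨l, hl⟩ := exists_lift_of_ind hE hg hp hq (TDGA.map0 f.hom)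
  exact ⟨ObjectProperty.homMk (TAlg.inclDesc l), ObjectProperty.hom_ext _ (TAlg.incl_hom_ext hl)⟩

end Cofibrant

lemma model_isCofibrantlyGenerated (T : QTheory.{u}) [T.IsFermat] :
    @IsCofibrantlyGenerated (TDGA T) _ (TDGA.model T) :=
  let _ := TDGA.model T
  { hasLimits := inferInstance
    hasColimits := inferInstance
    exists_generators := ⟨TDGA.genI T, TDGA.genJ T, inferInstance, inferInstance,
      TDGA.genI_rlp.symm, TDGA.genJ_rlp.symm⟩ }

lemma locModel_isCofibrantlyGenerated [T.IsFermat] {E : MorphismProperty (TAlg T)}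
    (hE : IsEtaleLike E) : @IsCofibrantlyGenerated (LocTDGA E) _ (locModel hE) :=
  let _ := locModel hE
  { hasLimits := loc_hasLimits hE
    hasColimits := loc_hasColimits hE
    exists_generators := ⟨locGenI hE, locGenJ hE, locGenI_small hE, locGenJ_small hE,
      (locGenI_rlp hE).symm, (locGenJ_rlp hE).symm⟩ }


end FermatDG

end

open FermatDG in
theorem proposition3 (T : QTheory.{u}) [T.IsFermat] (E : MorphismProperty (TAlg T))
    (hE : IsEtaleLike E) :
    ∃ (_ : ModelCategory (TDGA T)) (_ : ModelCategory (LocTDGA E)),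
      (weakEquivalences (TDGA T) = quasiIsos T ∧ fibrations (TDGA T) = posSurj T ∧
        IsCofibrantlyGenerated (TDGA T)) ∧
      (weakEquivalences (LocTDGA E) = (quasiIsos T).inverseImage (locIncl E) ∧
        fibrations (LocTDGA E) = (posSurj T).inverseImage (locIncl E) ∧
        IsCofibrantlyGenerated (LocTDGA E)) ∧
      IsRightQuillenEquivalence (locIncl E) ∧
      ∃ h : ∀ B : TAlg T, IsELocal E ((TAlg.incl T).obj B),
        (∀ {A B : TAlg T} (f : A ⟶ B),
          MorphismProperty.transfiniteCompositions.{u} (EMor E) f →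
            cofibrations (LocTDGA E) (((IsELocal E).lift (TAlg.incl T) h).map f)) ∧
        ∀ (n : ℕ) (B : TAlg T) (g : T.free n ⟶ B), MorphismProperty.ind.{u} (EMor E) g →
          IsCofibrant (((IsELocal E).lift (TAlg.incl T) h).obj B) := by
  refine ⟨TDGA.model T, locModel hE, ⟨rfl, rfl, model_isCofibrantlyGenerated T⟩,
    ⟨rfl, rfl, locModel_isCofibrantlyGenerated hE⟩, isRightQuillenEquivalence_locIncl hE,
    isELocal_incl hE, fun f hf X Y p hp => ?_, fun n B g hg => ?_⟩
  · exact hasLifting_inclLoc _ f p (transfiniteCompositions_llp hE hf hp.2)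
  · let _ := locModel hE
    exact (cofibration_iff _).2 fun X Y p hp => hasLifting_of_ind hE _ hg hp.1 hp.2
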